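/- Let $d\in\{2,3\}$, let $z_1,\dots,z_n\in\mathbb R^d$ be distinct and $\alpha_1,\dots,\alpha_n\in\mathbb R$. For $a,b\in\mathbb C^d$ write $ab=\sum_j a_jb_j$ and $a^2=aa$. Put $\Sigma_E=\{k\in\mathbb C^d: k^2=E\}$ for $E\in\mathbb R$ and $\Omega_{E,p}=\{k\in\Sigma_E: 2kp=p^2\}$ for $p\in\mathbb R^d$. **Green functions.** For $x\ne0$ let $$g(x,k)=-\frac1{(2\pi)^d}\lim_{N\to\infty}\int_{|\xi|\le N}\frac{e^{i\xi x}}{\xi^2+2k\xi}\,d\xi\quad(\operatorname{Im}k\neq0),$$ $$g_\gamma(x,k)=\lim_{\varepsilon\to0+}g(x,k+i\varepsilon\gamma),\qquad g^+(x,k)=\lim_{\varepsilon\to0+}g(x,k+i\varepsilon k)\quad(k\in\mathbb R^d\setminus0,\ \gamma\in S^{d-1},\ k\gamma=0).$$ **Coefficients.** For a number $D$ and a function $G$ on $\mathbb R^d\setminus 0$ let $A=A(D,G)$ be the $n\times n$ matrix with $A_{mm}=1-\alpha_mD$ and $A_{mj}=-\alpha_mG(z_m-z_j)$ for $m\ne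 j$, and let $c$ be the solution of $Ac=(\alpha_1,\dots,\alpha_n)^T$ (when $\det A\ne0$). This gives: * $A(k)$, $c(k)$ for $k\in\mathbb C^d\setminus\mathbb R^d$, from $G=g(\cdot,k)$ and $D=\frac{|\operatorname{Im}k|}{4\pi}$ if $d=3$, $D=\frac{\ln(|\operatorname{Re}k|+|\operatorname{Im}k|)}{2\pi}$ if $d=2$; * $A_\gamma(k)$, $c_\gamma(k)$ for $k\in\mathbb R^d\setminus0$, $\gamma\in S^{d-1}$, $k\gamma=0$, from $G=g_\gamma(\cdot,k)$ and $D=0$ if $d=3$, $D=\frac{\ln|k|}{2\pi}$ if $d=2$; * $A^+(k)$, $c^+(k)$ for $k\in\mathbb R^d\setminus0$, from $G=g^+(\cdot,k)$ and $D=-\frac{i|k|}{4\pi}$ if $d=3$, $D=-\frac{\pi i-2\ln|k|}{4\pi}$ if $d=2$. **Functions.** Let $$\mu(x,k)=1+\sum_jc_j(k)\,g(x-z_j,k),\qquad \psi=e^{ikx}\mu,$$ $$\psi_\gamma(x,k)=e^{ikx}\Big[1+\sum_jc_{\gamma,j}(k)\,g_\gamma(x-z_j,k)\Big],\qquad \psi^+(x,k)=e^{ikx}\Big[1+\sum_jc^+_j(k)\,g^+(x-z_j,k)\Big],$$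 $$h(k,l)=\frac1{(2\pi)^d}\sum_jc_j(k)e^{i(k-l)z_j},\qquad H(k,p)=h(k,k-p),$$ $$h_\gamma(k,l)=\frac1{(2\pi)^d}\sum_jc_{\gamma,j}(k)e^{i(k-l)z_j},\qquad f(k,l)=\frac1{(2\pi)^d}\sum_jc^+_j(k)e^{i(k-l)z_j}.$$ **Proposition.** The limits above that define $g(x,k)$ for $k\in\Sigma_E\setminus\mathbb R^d$, $E\in\mathbb R$, and $g_\gamma(x,k)$, $g^+(x,k)$ exist for $x\neq0$, with integrands absolutely integrable over balls, and $\det A^+(k)\neq0$ for $k\in\mathbb R^d\setminus0$. Moreover: 1. Let $E\in\mathbb R$, $k\in\Sigma_E\setminus\mathbb R^d$, $\det A(k)\ne0$, and $\operatorname{Re}k\ne0$ if $d=2$. If $x\ne z_j$ for all $j$, then $\psi(x,\cdot)$ and $\mu(x,\cdot)$ are real differentiable along $\Sigma_E$ at $k$, and as $(0,1)$-forms on $\Sigma_E$, at $k$, $$\bar\partial_k\psi(x,k)=-2\pi\int_{\mathbb R^d}\Big(\sum_s\xi_s\,d\bar k_s\Big)H(k,-\xi)\,\psi(x,k+\xi)\,\delta(\xi^2+2k\xi)\,d\xi,$$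 $$\bar\partial_k\mu(x,k)=-2\pi\int_{\mathbb R^d}\Big(\sum_s\xi_s\,d\bar k_s\Big)H(k,-\xi)\,e^{i\xi x}\mu(x,k+\xi)\,\delta(\xi^2+2k\xi)\,d\xi.$$ 2. Let $E\in\mathbb R$, $p\in\mathbb R^d$, $k\in\Omega_{E,p}\setminus\mathbb R^d$, $\det A(k)\neq0$, and $\operatorname{Re}k\neq0$ if $d=2$. Then $H(\cdot,p)$ is real differentiable along $\Omega_{E,p}$ at $k$, and as $(0,1)$-forms on $\Omega_{E,p}$, at $k$, $$\bar\partial_kH(k,p)=-2\pi\int_{\mathbb R^d}\Big(\sum_s\xi_s\,d\bar k_s\Big)H(k,-\xi)\,H(k+\xi,p+\xi)\,\delta(\xi^2+2k\xi)\,d\xi.$$ 3. Let $k\in\mathbb R^d\setminus0$, $\gamma\in S^{d-1}$, $k\gamma=0$, $\det A_\gamma(k)\ne0$. If $x\neq z_j$ for all $j$, then $$\psi_\gamma(x,k)=\psi^+(x,k)+2\pi i\int_{\mathbb R^d}h_\gamma(k,\xi)\,\theta((\xi-k)\gamma)\,\delta(\xi^2-k^2)\,\psi^+(x,\xi)\,d\xi,$$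 and for $l\in\mathbb R^d$, $l^2=k^2$, $$h_\gamma(k,l)=f(k,l)+2\pi i\int_{\mathbb R^d}h_\gamma(k,\xi)\,\theta((\xi-k)\gamma)\,\delta(\xi^2-k^2)\,f(\xi,l)\,d\xi.$$ 4. Let $E\in\mathbb R$. Then $\det A(k)\neq0$ for all $k\in\Sigma_E$ with $|\operatorname{Im}k|$ sufficiently large, and $\mu(x,k)\to1$ as $|\operatorname{Im}k|\to\infty$, $k\in\Sigma_E$, for every $x\notin\{z_1,\dots,z_n\}$. Here $\theta$ is the Heaviside step function, and the $\delta$-functions denote the following measures: $\delta(\xi^2-k^2)\,d\xi$ is $\frac1{2|k|}$ times the surface measure of the sphere $|\xi|=|k|$, and, with $\delta(w)=\delta(\operatorname{Re}w)\,\delta(\operatorname{Im}w)$, for $k\in\Sigma_E\setminus\mathbb R^d$ the measure $\delta(\xi^2+2k\xi)\,d\xi$ is $\frac1{4|\operatorname{Re}k||\operatorname{Im}k|}$ times the $(d-2)$-dimensional surface measure of $\{\xi:\xi^2+2k\xi=0\}$, which is the sphere with center $-\operatorname{Re}k$ and radius $|\operatorname{Re}k|$ in the hyperplane $\xi\operatorname{Im}k=0$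 (counting measure on two points if $d=2$, arc length on a circle if $d=3$). If $d=3$ and $\operatorname{Re}k=0$, the right-hand sides in 1 and 2 are $0$. -/

import Mathlib

open Filter Topology MeasureTheory

noncomputable section

namespace Faddeev

/-- Real vectors (positions, real momenta) with the Euclidean norm. -/
abbrev RV (d : ℕ) := EuclideanSpace ℝ (Fin d)

/-- Complex momenta. -/
abbrev CV (d : ℕ) := EuclideanSpace ℂ (Fin d)

variable {d n : ℕ}

/-- The complex bilinear (not sesquilinear) product `a₁ b₁ + ... + a_d b_d`. -/
def cdot (a b : CV d) : ℂ := ∑ j, a j * b j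

/-- The inclusion of real vectors into complex vectors. -/
def toC (x : RV d) : CV d := WithLp.toLp 2 fun j => (x j : ℂ)

/-- The real part of a complex vector. -/
def reV (k : CV d) : RV d := WithLp.toLp 2 fun j => (k j).re

/-- The imaginary part of a complex vector. -/
def imV (k : CV d) : RV d := WithLp.toLp 2 fun j => (k j).im

/-- `exp (i k x)` for a complex momentum `k` and a real position `x`. -/
def planeWave (k : CV d) (x : RV d) : ℂ := Complex.exp (Complex.I * cdot k (toC x))

/-! ### Green functions of `Δ + 2 i k ∇` -/

/-- The integrand `exp (i ξ x) / (ξ² + 2 k ξ)`. -/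
def greenIntegrand (x : RV d) (k : CV d) (ξ : RV d) : ℂ :=
  planeWave (toC ξ) x / (((‖ξ‖ ^ 2 : ℝ) : ℂ) + 2 * cdot k (toC ξ))

/-- The Green integral over the ball `|ξ| ≤ N`, with its prefactor. -/
def greenCutoff (x : RV d) (k : CV d) (N : ℝ) : ℂ :=
  -(1 / (2 * (Real.pi : ℂ)) ^ d) * ∫ ξ in Metric.closedBall (0 : RV d) N, greenIntegrand x k ξ

/-- The Faddeev Green function
`g(x,k) = -(2π)^{-d} ∫ exp (i ξ x) / (ξ² + 2 k ξ) dξ`. The integral is only conditionally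
convergent at infinity, and is the limit of the integrals over the balls `|ξ| ≤ N`. -/
def green (x : RV d) (k : CV d) : ℂ := limUnder atTop (greenCutoff x k)

/-- The integral that defines `g(x,k)` makes sense: it is absolutely convergent over balls
and converges as the radius tends to infinity. -/
def GreenConverges (x : RV d) (k : CV d) : Prop :=
  (∀ N : ℝ, IntegrableOn (greenIntegrand x k) (Metric.closedBall (0 : RV d) N)) ∧
    Tendsto (greenCutoff x k) atTop (𝓝 (green x k))

/-- The complex momentum `k + i ε η`. -/
def shiftIm (k η : RV d) (ε : ℝ) : CV d := toC k + (Complex.I * (ε : ℂ)) • toC η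

/-- `g_γ(x,k) = g(x, k + i 0 γ)`. -/
def greenGamma (γ x k : RV d) : ℂ :=
  limUnder (𝓝[>] (0 : ℝ)) fun ε => green x (shiftIm k γ ε)

/-- `g⁺(x,k) = g(x, k + i 0 k)`. -/
def greenPlus (x k : RV d) : ℂ :=
  limUnder (𝓝[>] (0 : ℝ)) fun ε => green x (shiftIm k k ε)

/-! ### The linear systems for the coefficients -/

/-- The matrix of the linear system for the coefficients `c_j`, for a Green function `G`
and a diagonal term `D`. The `m`-th equation is
`(1 - α_m D) c_m - α_m ∑_{j ≠ m} G(z_m - z_j) c_j = α_m`. Where `1 - α_m D ≠ 0`, division of it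
by `1 - α_m D` gives the system with `1` on the diagonal; where `α_m ≠ 0`, division by `α_m`
gives the system with `α_m⁻¹ - D` on the diagonal. -/
def pointMatrix (z : Fin n → RV d) (α : Fin n → ℝ) (D : ℂ) (G : RV d → ℂ) :
    Matrix (Fin n) (Fin n) ℂ :=
  Matrix.of fun m j => if m = j then 1 - (α m : ℂ) * D else -(α m : ℂ) * G (z m - z j)

/-- The solution `c` of the linear system with matrix `pointMatrix z α D G`
(meaningful when the determinant is not zero). -/
def pointCoeff (z : Fin n → RV d) (α : Fin n → ℝ) (D : ℂ) (G : RV d → ℂ) : Fin n → ℂ :=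
  (pointMatrix z α D G)⁻¹.mulVec fun m => (α m : ℂ)

/-- `|Im k| / (4π)` for `d = 3` and `ln (|Re k| + |Im k|) / (2π)` for `d = 2`. -/
def diagTerm (k : CV d) : ℂ :=
  if d = 3 then ((‖imV k‖ / (4 * Real.pi) : ℝ) : ℂ)
  else ((Real.log (‖reV k‖ + ‖imV k‖) / (2 * Real.pi) : ℝ) : ℂ)

/-- The limit of `diagTerm` at `k + i 0 γ`: `0` for `d = 3` and `ln |k| / (2π)` for `d = 2`. -/
def diagTermGamma (k : RV d) : ℂ :=
  if d = 3 then 0 else ((Real.log ‖k‖ / (2 * Real.pi) : ℝ) : ℂ)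

/-- `-i |k| / (4π)` for `d = 3` and `-(π i - 2 ln |k|) / (4π)` for `d = 2`. -/
def diagTermPlus (k : RV d) : ℂ :=
  if d = 3 then -(Complex.I * (‖k‖ : ℂ)) / (4 * (Real.pi : ℂ))
  else -((Real.pi : ℂ) * Complex.I - 2 * (Real.log ‖k‖ : ℂ)) / (4 * (Real.pi : ℂ))

/-- The matrix for complex momenta `k`; its determinant vanishes exactly at the
spectral singularities. -/
def matA (z : Fin n → RV d) (α : Fin n → ℝ) (k : CV d) : Matrix (Fin n) (Fin n) ℂ :=
  pointMatrix z α (diagTerm k) fun x => green x k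

/-- The matrix at `k + i 0 γ`. -/
def matAGamma (z : Fin n → RV d) (α : Fin n → ℝ) (γ k : RV d) : Matrix (Fin n) (Fin n) ℂ :=
  pointMatrix z α (diagTermGamma k) fun x => greenGamma γ x k

/-- The matrix of the classical scattering problem. -/
def matAPlus (z : Fin n → RV d) (α : Fin n → ℝ) (k : RV d) : Matrix (Fin n) (Fin n) ℂ :=
  pointMatrix z α (diagTermPlus k) fun x => greenPlus x k

def coeff (z : Fin n → RV d) (α : Fin n → ℝ) (k : CV d) : Fin n → ℂ :=
  pointCoeff z α (diagTerm k) fun x => green x k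

def coeffGamma (z : Fin n → RV d) (α : Fin n → ℝ) (γ k : RV d) : Fin n → ℂ :=
  pointCoeff z α (diagTermGamma k) fun x => greenGamma γ x k

def coeffPlus (z : Fin n → RV d) (α : Fin n → ℝ) (k : RV d) : Fin n → ℂ :=
  pointCoeff z α (diagTermPlus k) fun x => greenPlus x k

/-! ### Eigenfunctions and scattering data -/

/-- `μ(x,k) = 1 + ∑ c_j(k) g(x - z_j, k)`. -/
def mu (z : Fin n → RV d) (α : Fin n → ℝ) (x : RV d) (k : CV d) : ℂ :=
  1 + ∑ j, coeff z α k j * green (x - z j) k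

/-- `ψ = exp (i k x) μ`. -/
def psi (z : Fin n → RV d) (α : Fin n → ℝ) (x : RV d) (k : CV d) : ℂ :=
  planeWave k x * mu z α x k

/-- `ψ_γ(x,k)`. -/
def psiGamma (z : Fin n → RV d) (α : Fin n → ℝ) (γ x k : RV d) : ℂ :=
  planeWave (toC k) x * (1 + ∑ j, coeffGamma z α γ k j * greenGamma γ (x - z j) k)

/-- `ψ⁺(x,k)`. -/
def psiPlus (z : Fin n → RV d) (α : Fin n → ℝ) (x k : RV d) : ℂ :=
  planeWave (toC k) x * (1 + ∑ j, coeffPlus z α k j * greenPlus (x - z j) k)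

/-- `h(k,l) = (2π)^{-d} ∑ c_j(k) exp (i (k - l) z_j)`. -/
def hData (z : Fin n → RV d) (α : Fin n → ℝ) (k l : CV d) : ℂ :=
  1 / (2 * (Real.pi : ℂ)) ^ d * ∑ j, coeff z α k j * planeWave (k - l) (z j)

/-- `H(k,p)`, that is, `h(k, k - p)`. -/
def HData (z : Fin n → RV d) (α : Fin n → ℝ) (k : CV d) (p : RV d) : ℂ :=
  hData z α k (k - toC p)

/-- `h_γ(k,l)`. -/
def hGamma (z : Fin n → RV d) (α : Fin n → ℝ) (γ k l : RV d) : ℂ :=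
  1 / (2 * (Real.pi : ℂ)) ^ d * ∑ j, coeffGamma z α γ k j * planeWave (toC (k - l)) (z j)

/-- The classical scattering amplitude `f(k,l)`. -/
def fAmp (z : Fin n → RV d) (α : Fin n → ℝ) (k l : RV d) : ℂ :=
  1 / (2 * (Real.pi : ℂ)) ^ d * ∑ j, coeffPlus z α k j * planeWave (toC (k - l)) (z j)

/-! ### The varieties, the `∂̄`-operator on them, and the delta functions -/

/-- `Σ_E`, the set of `k` with `k² = E`. -/
def SigmaE (d : ℕ) (E : ℝ) : Set (CV d) := {k | cdot k k = (E : ℂ)}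

/-- `Ω_{E,p}`, the set of `k` in `Σ_E` with `2 k p = p²`. -/
def OmegaE (E : ℝ) (p : RV d) : Set (CV d) :=
  {k | k ∈ SigmaE d E ∧ 2 * cdot k (toC p) = ((‖p‖ ^ 2 : ℝ) : ℂ)}

/-- Let `S` be a complex submanifold of `ℂ^d` near `k` with (complex) tangent space `T` at `k`.
The function `u` is real differentiable along `S` at `k`, and its form `∂̄u` at `k` is the
restriction of `∑ ω_j d(conj k_j)` to `T`: the antilinear part `w ↦ (L w + i L (i w)) / 2` of the
differential `L` of `u` along `S` is `∑ ω_j conj w_j` for `w ∈ T`. -/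
def HasDbarWithinAt (u : CV d → ℂ) (ω : Fin d → ℂ) (S T : Set (CV d)) (k : CV d) : Prop :=
  ∃ L : CV d →L[ℝ] ℂ, HasFDerivWithinAt u L S k ∧
    ∀ w ∈ T, (L w + Complex.I * L (Complex.I • w)) / 2 = ∑ j, ω j * (starRingEnd ℂ) (w j)

/-- The tangent space of `Σ_E` at `k ≠ 0`. -/
def tangentSigma (k : CV d) : Set (CV d) := {w | cdot k w = 0}

/-- The tangent space of `Ω_{E,p}` at a non-real `k`. -/
def tangentOmega (p : RV d) (k : CV d) : Set (CV d) := {w | cdot k w = 0 ∧ cdot (toC p) w = 0}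

/-- `∫ F(ξ) δ(ξ² - r²) dξ` for `r > 0`: the integral over the sphere `|ξ| = r` with respect to
the surface measure divided by the length `2 r` of the gradient of `ξ²`. -/
def intDeltaSphere (r : ℝ) (F : RV d → ℂ) : ℂ :=
  ((r ^ (d - 1) / (2 * r) : ℝ) : ℂ) *
    ∫ ω : Metric.sphere (0 : RV d) 1, F (r • (ω : RV d)) ∂(volume : Measure (RV d)).toSphere

/-- The Lebesgue measure of the hyperplane orthogonal to `v` (for its Euclidean structure). -/
def orthVolume (v : RV d) : Measure ((Submodule.span ℝ {v})ᗮ : Submodule ℝ (RV d)) :=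
  (stdOrthonormalBasis ℝ ((Submodule.span ℝ {v})ᗮ : Submodule ℝ (RV d))).toBasis.addHaar

/-- `∫ F(ξ) δ(ξ² + 2 k ξ) dξ` for `k ∈ ℂ^d` with `k² ∈ ℝ` and `Im k ≠ 0` (and `Re k ≠ 0` if
`d = 2`), where `δ(w) = δ(Re w) δ(Im w)`.
As `Re k` is orthogonal to `Im k`, the zero set of `ξ² + 2 k ξ` is the sphere with center `-Re k`
and radius `|Re k|` in the hyperplane orthogonal to `Im k` (two points if `d = 2`, a circle if
`d = 3`), and on it the gradients `2 (ξ + Re k)` and `2 Im k` of the real and of the imaginary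
part are orthogonal, of lengths `2 |Re k|` and `2 |Im k|`. -/
def intDeltaFaddeev (k : CV d) (F : RV d → ℂ) : ℂ :=
  ((‖reV k‖ ^ (d - 2) / ((2 * ‖reV k‖) * (2 * ‖imV k‖)) : ℝ) : ℂ) *
    ∫ ω : Metric.sphere (0 : ((Submodule.span ℝ {imV k})ᗮ : Submodule ℝ (RV d))) 1,
      F (-reV k + ‖reV k‖ • ((ω : ((Submodule.span ℝ {imV k})ᗮ : Submodule ℝ (RV d))) : RV d))
      ∂(orthVolume (imV k)).toSphere

/-- The Heaviside step function. -/
def heaviside (t : ℝ) : ℂ := if 0 < t then 1 else 0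

end Faddeev

end

open Faddeev

noncomputable section

set_option linter.unusedSectionVars false

namespace Faddeev

section

section Slices

variable {F : Type*} [NormedAddCommGroup F] [InnerProductSpace ℝ F] [FiniteDimensional ℝ F]
  [MeasurableSpace F] [BorelSpace F]

/-- The hyperplane orthogonal to `b`. -/
abbrev Perp (b : F) : Type _ := ((Submodule.span ℝ {b})ᗮ : Submodule ℝ F)

/-- The point with coordinate `t` along the unit vector `n` and component `s` orthogonal to it. -/
def slicePt (n : F) (p : ℝ × Perp n) : F := p.1 • n + (p.2 : F)

/-- `slicePt` as a linear isometry. -/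
def sliceIso (n : F) (hn : ‖n‖ = 1) : WithLp 2 (ℝ × Perp n) ≃ₗᵢ[ℝ] F :=
  (LinearIsometryEquiv.withLpProdCongr 2 (LinearIsometryEquiv.toSpanUnitSingleton n hn)
    (LinearIsometryEquiv.refl ℝ (Perp n))).trans
    (Submodule.span ℝ {n}).orthogonalDecomposition.symm

theorem sliceIso_apply (n : F) (hn : ‖n‖ = 1) (p : ℝ × Perp n) :
    sliceIso n hn (WithLp.toLp 2 p) = slicePt n p := by
  simp [sliceIso, slicePt]

theorem slicePt_measurePreserving (n : F) (hn : ‖n‖ = 1) :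
    MeasurePreserving (slicePt n) := by
  have h := (sliceIso n hn).measurePreserving.comp (WithLp.volume_preserving_toLp ℝ (Perp n))
  convert h using 1
  ext p
  simp [sliceIso_apply]

theorem slicePt_measurableEmbedding (n : F) (hn : ‖n‖ = 1) :
    MeasurableEmbedding (slicePt n) := by
  have h := (sliceIso n hn).toMeasurableEquiv.measurableEmbedding.comp
    (MeasurableEquiv.toLp 2 (ℝ × Perp n)).measurableEmbedding
  convert h using 1
  ext p
  simp [sliceIso_apply]

theorem integral_slicePt {G : Type*} [NormedAddCommGroup G] [NormedSpace ℝ G]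
    (n : F) (hn : ‖n‖ = 1) (f : F → G) :
    ∫ x, f x = ∫ p : ℝ × Perp n, f (slicePt n p) :=
  ((slicePt_measurePreserving n hn).integral_comp (slicePt_measurableEmbedding n hn) f).symm

theorem integrable_slicePt {G : Type*} [NormedAddCommGroup G]
    (n : F) (hn : ‖n‖ = 1) (f : F → G) :
    Integrable f ↔ Integrable (fun p : ℝ × Perp n => f (slicePt n p)) :=
  ((slicePt_measurePreserving n hn).integrable_comp_emb (slicePt_measurableEmbedding n hn)).symm

theorem inner_perp (n : F) (s : Perp n) : inner ℝ n (s : F) = 0 :=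
  Submodule.mem_orthogonal_singleton_iff_inner_right.1 s.2

theorem inner_slicePt_left {n : F} (hn : ‖n‖ = 1) (p : ℝ × Perp n) :
    inner ℝ n (slicePt n p) = p.1 := by
  simp [slicePt, inner_add_right, inner_smul_right, inner_perp, hn]

theorem norm_sq_slicePt {n : F} (hn : ‖n‖ = 1) (p : ℝ × Perp n) :
    ‖slicePt n p‖ ^ 2 = p.1 ^ 2 + ‖p.2‖ ^ 2 := by
  rw [slicePt, norm_add_sq_real, norm_smul, hn, inner_smul_left, inner_perp]
  simp

theorem finrank_perp {n : F} (hn : n ≠ 0) :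
    Module.finrank ℝ (Perp n) + 1 = Module.finrank ℝ F := by
  have h := (Submodule.span ℝ {n}).finrank_add_finrank_orthogonal
  rw [finrank_span_singleton hn] at h
  rw [← h, add_comm]

theorem continuous_slicePt (n : F) : Continuous (slicePt n) := by
  unfold slicePt; fun_prop

end Slices

section Polar

variable {F : Type*} [NormedAddCommGroup F] [InnerProductSpace ℝ F] [FiniteDimensional ℝ F]
  [MeasurableSpace F] [BorelSpace F]

/-- The surface measure of the unit sphere. -/
abbrev sphereMeasure (F : Type*) [NormedAddCommGroup F] [InnerProductSpace ℝ F]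
    [FiniteDimensional ℝ F] [MeasurableSpace F] [BorelSpace F] :
    Measure (Metric.sphere (0 : F) 1) := (volume : Measure F).toSphere

theorem integral_polar {G : Type*} [NormedAddCommGroup G] [NormedSpace ℝ G] [Nontrivial F]
    {f : F → G} (hf : Integrable f) :
    ∫ x, f x = ∫ ω : Metric.sphere (0 : F) 1, (∫ r in Set.Ioi (0 : ℝ),
      r ^ (Module.finrank ℝ F - 1) • f (r • (ω : F))) ∂(sphereMeasure F) := by
  have hmp := (volume : Measure F).measurePreserving_homeomorphUnitSphereProd
  have hemb := (homeomorphUnitSphereProd F).measurableEmbedding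
  have hcomp : ∀ p : ({0}ᶜ : Set F), f p =
      (fun q : Metric.sphere (0 : F) 1 × Set.Ioi (0 : ℝ) => f ((q.2 : ℝ) • (q.1 : F)))
        (homeomorphUnitSphereProd F p) := by
    intro p
    have hp : ‖(p : F)‖ ≠ 0 := norm_ne_zero_iff.2 p.2
    simp [smul_smul, hp]
  have hint : Integrable
      (fun q : Metric.sphere (0 : F) 1 × Set.Ioi (0 : ℝ) => f ((q.2 : ℝ) • (q.1 : F)))
      ((sphereMeasure F).prod (Measure.volumeIoiPow (Module.finrank ℝ F - 1))) := by
    rw [← hmp.integrable_comp_emb hemb]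
    have h1 : IntegrableOn f ({0}ᶜ : Set F) := hf.integrableOn
    rw [integrableOn_iff_comap_subtypeVal (measurableSet_singleton _).compl] at h1
    refine h1.congr (Eventually.of_forall fun p => ?_)
    exact hcomp p
  calc ∫ x, f x = ∫ x in ({0}ᶜ : Set F), f x := by rw [restrict_compl_singleton]
    _ = ∫ p : ({0}ᶜ : Set F), f p ∂((volume : Measure F).comap (↑)) :=
        (integral_subtype_comap (measurableSet_singleton _).compl f).symm
    _ = ∫ q, f ((q.2 : ℝ) • (q.1 : F)) ∂((sphereMeasure F).prod
          (Measure.volumeIoiPow (Module.finrank ℝ F - 1))) := by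
        rw [← hmp.integral_comp hemb]
        exact integral_congr_ae (Eventually.of_forall hcomp)
    _ = _ := by
        rw [integral_prod _ hint]
        refine integral_congr_ae (Eventually.of_forall fun ω => ?_)
        simp only [Measure.volumeIoiPow, ENNReal.ofReal]
        rw [integral_withDensity_eq_integral_smul
          ((measurable_subtype_coe.pow_const _).real_toNNReal),
          integral_subtype_comap measurableSet_Ioi fun a : ℝ =>
            Real.toNNReal (a ^ (Module.finrank ℝ F - 1)) • f (a • (ω : F))]
        refine setIntegral_congr_fun measurableSet_Ioi fun x hx => ?_
        simp only [NNReal.smul_def, Real.coe_toNNReal _ (pow_nonneg (le_of_lt hx) _)]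

open scoped Pointwise in
theorem sphereMeasure_map_neg (s : Set (Metric.sphere (0 : F) 1)) (hs : MeasurableSet s) :
    sphereMeasure F (Neg.neg ⁻¹' s) = sphereMeasure F s := by
  have hneg : Measurable (Neg.neg : Metric.sphere (0 : F) 1 → Metric.sphere (0 : F) 1) :=
    continuous_neg.measurable
  rw [Measure.toSphere_apply' _ hs, Measure.toSphere_apply' _ (hneg hs),
    ← Measure.measure_neg (volume : Measure F) (Set.Ioo (0 : ℝ) 1 • (Subtype.val '' s))]
  congr 2
  ext x
  simp only [Set.mem_smul, Set.mem_neg, Set.mem_image, Set.mem_preimage]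
  constructor
  · rintro ⟨r, hr, y, ⟨w, hw, rfl⟩, rfl⟩
    exact ⟨r, hr, _, ⟨-w, hw, rfl⟩, by simp⟩
  · rintro ⟨r, hr, y, ⟨w, hw, rfl⟩, h⟩
    refine ⟨r, hr, _, ⟨-w, by simpa using hw, rfl⟩, ?_⟩
    rw [← neg_eq_iff_eq_neg.mpr h.symm.symm]
    simp

theorem sphereMeasure_measurePreserving_neg :
    MeasurePreserving (Neg.neg : Metric.sphere (0 : F) 1 → Metric.sphere (0 : F) 1)
      (sphereMeasure F) (sphereMeasure F) :=
  ⟨continuous_neg.measurable, by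
    ext s hs
    rw [Measure.map_apply continuous_neg.measurable hs, sphereMeasure_map_neg s hs]⟩

theorem integral_sphere_neg {G : Type*} [NormedAddCommGroup G] [NormedSpace ℝ G]
    (f : Metric.sphere (0 : F) 1 → G) :
    ∫ ω, f (-ω) ∂(sphereMeasure F) = ∫ ω, f ω ∂(sphereMeasure F) :=
  sphereMeasure_measurePreserving_neg.integral_comp
    (Homeomorph.neg (Metric.sphere (0 : F) 1)).measurableEmbedding f

open scoped Pointwise in
theorem sphereMeasure_hyperplane (v : F) (hv : v ≠ 0) :
    ∀ᵐ ω : Metric.sphere (0 : F) 1 ∂(sphereMeasure F), inner ℝ v (ω : F) ≠ 0 := by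
  rw [ae_iff]
  simp only [ne_eq, not_not]
  have hms : MeasurableSet {ω : Metric.sphere (0 : F) 1 | inner ℝ v (ω : F) = 0} :=
    (isClosed_eq (by fun_prop) continuous_const).measurableSet
  rw [Measure.toSphere_apply' _ hms]
  refine mul_eq_zero.2 (Or.inr ?_)
  refine measure_mono_null (t := ((Submodule.span ℝ {v})ᗮ : Submodule ℝ F)) ?_ ?_
  · rintro x ⟨r, hr, y, ⟨w, hw, rfl⟩, rfl⟩
    rw [SetLike.mem_coe, Submodule.mem_orthogonal_singleton_iff_inner_right]
    simp only [inner_smul_right]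
    rw [Set.mem_ofPred_eq] at hw
    rw [hw, mul_zero]
  · refine Measure.addHaar_submodule _ _ fun h => hv ?_
    have : v ∈ (Submodule.span ℝ {v})ᗮ := h ▸ Submodule.mem_top
    rw [Submodule.mem_orthogonal_singleton_iff_inner_right] at this
    exact inner_self_eq_zero.1 this

end Polar

end

section

theorem exists_pow_le_exp_sq (c : ℝ) (hc : 0 < c) (j : ℕ) :
    ∃ C : ℝ, 0 < C ∧ ∀ r : ℝ, |r| ^ j ≤ C * Real.exp (c * r ^ 2) := by
  refine ⟨1 + (j.factorial : ℝ) / c ^ j, by positivity, fun r => ?_⟩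
  have h1 : |r| ^ j ≤ 1 + (r ^ 2) ^ j := by
    have h0 : (r ^ 2) ^ j = (|r| ^ j) ^ 2 := by rw [← sq_abs, ← pow_mul, ← pow_mul, mul_comm]
    rw [h0]
    nlinarith [sq_nonneg (|r| ^ j - 1)]
  have h2 : (c * r ^ 2) ^ j / (j.factorial : ℝ) ≤ Real.exp (c * r ^ 2) :=
    Real.pow_div_factorial_le_exp _ (by positivity) j
  have h3 : (r ^ 2) ^ j ≤ (j.factorial : ℝ) / c ^ j * Real.exp (c * r ^ 2) := by
    rw [div_mul_eq_mul_div, le_div_iff₀ (by positivity)]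
    rw [div_le_iff₀ (by positivity), mul_pow] at h2
    linarith
  have h4 : 1 ≤ Real.exp (c * r ^ 2) := Real.one_le_exp (by positivity)
  linarith

theorem integrable_abs_rpow_mul_exp {c s : ℝ} (hc : 0 < c) (hs : -1 < s) :
    Integrable fun t : ℝ => |t| ^ s * Real.exp (-c * t ^ 2) := by
  have h := (integrable_fun_norm_addHaar (volume : Measure ℝ)
    (f := fun r => r ^ s * Real.exp (-c * r ^ 2))).2 (by
      simpa using integrableOn_rpow_mul_exp_neg_mul_sq hc hs)
  refine h.congr (Eventually.of_forall fun t => ?_)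
  simp

theorem integrable_abs_sub_rpow_mul_exp {c s : ℝ} (ρ : ℝ) (hc : 0 < c) (hs : -1 < s) :
    Integrable fun t : ℝ => |t - ρ| ^ s * Real.exp (-c * t ^ 2) := by
  have h := ((integrable_abs_rpow_mul_exp (half_pos hc) hs).comp_sub_right ρ).const_mul
    (Real.exp (c * ρ ^ 2))
  refine h.mono' (by fun_prop) (Eventually.of_forall fun t => ?_)
  rw [Real.norm_eq_abs, abs_of_nonneg (by positivity), mul_left_comm, ← Real.exp_add]
  gcongr
  nlinarith [mul_nonneg hc.le (sq_nonneg (t + ρ))]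

section

variable {F : Type*} [NormedAddCommGroup F] [InnerProductSpace ℝ F] [FiniteDimensional ℝ F]
  [MeasurableSpace F] [BorelSpace F]

theorem integrable_norm_sub_rpow_mul_exp [Nontrivial F] {c s : ℝ} (ρ : ℝ) (hc : 0 < c)
    (hs : -1 < s) : Integrable fun u : F => |‖u‖ - ρ| ^ s * Real.exp (-c * ‖u‖ ^ 2) := by
  rw [integrable_fun_norm_addHaar (volume : Measure F)
    (f := fun r => |r - ρ| ^ s * Real.exp (-c * r ^ 2))]
  obtain ⟨C, hC, hCb⟩ := exists_pow_le_exp_sq (c / 2) (half_pos hc) (Module.finrank ℝ F - 1)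
  have h := ((integrable_abs_sub_rpow_mul_exp ρ (half_pos hc) hs).const_mul C).integrableOn
    (s := Set.Ioi (0 : ℝ))
  refine h.mono' (by fun_prop) (Eventually.of_forall fun t => ?_)
  have h2 : Real.exp (-c * t ^ 2) =
      Real.exp (-(c / 2) * t ^ 2) * Real.exp (-(c / 2) * t ^ 2) := by
    rw [← Real.exp_add]; ring_nf
  have h3 : Real.exp (c / 2 * t ^ 2) * Real.exp (-(c / 2) * t ^ 2) = 1 := by
    rw [← Real.exp_add]; simp
  simp only [smul_eq_mul, norm_mul, norm_pow, Real.norm_eq_abs, Real.abs_exp,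
    abs_of_nonneg (Real.rpow_nonneg (abs_nonneg (t - ρ)) s)]
  calc |t| ^ (Module.finrank ℝ F - 1) * (|t - ρ| ^ s * Real.exp (-c * t ^ 2))
      ≤ (C * Real.exp (c / 2 * t ^ 2)) * (|t - ρ| ^ s * Real.exp (-c * t ^ 2)) := by
        gcongr; exact hCb t
    _ = C * (|t - ρ| ^ s * Real.exp (-(c / 2) * t ^ 2)) := by
        rw [h2]; linear_combination (C * |t - ρ| ^ s * Real.exp (-(c / 2) * t ^ 2)) * h3

theorem integrable_norm_add_sub_rpow_mul_exp [Nontrivial F] {c s : ℝ} (s₀ : F) (ρ : ℝ)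
    (hc : 0 < c) (hs : -1 < s) :
    Integrable fun u : F => |‖u + s₀‖ - ρ| ^ s * Real.exp (-c * ‖u‖ ^ 2) := by
  have h := ((integrable_norm_sub_rpow_mul_exp (F := F) ρ (half_pos hc) hs).comp_add_right
    s₀).const_mul (Real.exp (c * ‖s₀‖ ^ 2))
  refine h.mono' (by fun_prop) (Eventually.of_forall fun u => ?_)
  rw [Real.norm_eq_abs, abs_of_nonneg (by positivity), mul_left_comm, ← Real.exp_add]
  gcongr
  have h1 : ‖u + s₀‖ ^ 2 ≤ (‖u‖ + ‖s₀‖) ^ 2 := by gcongr; exact norm_add_le _ _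
  nlinarith [mul_nonneg hc.le (sq_nonneg (‖u‖ - ‖s₀‖)), mul_le_mul_of_nonneg_left h1 hc.le]

/-- The quadratic symbol `|ζ|² + pζ + c + i bζ`. -/
def qsym (p b : F) (c : ℝ) (ζ : F) : ℂ :=
  ((‖ζ‖ ^ 2 + inner ℝ p ζ + c : ℝ) : ℂ) + ((inner ℝ b ζ : ℝ) : ℂ) * Complex.I

theorem qsym_re (p b : F) (c : ℝ) (ζ : F) :
    (qsym p b c ζ).re = ‖ζ‖ ^ 2 + inner ℝ p ζ + c := by
  simp only [qsym, Complex.add_re, Complex.ofReal_re, Complex.mul_re, Complex.ofReal_im,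
    Complex.I_re, Complex.I_im]
  ring

theorem qsym_im (p b : F) (c : ℝ) (ζ : F) : (qsym p b c ζ).im = inner ℝ b ζ := by
  simp only [qsym, Complex.add_im, Complex.ofReal_im, Complex.mul_im, Complex.ofReal_re,
    Complex.I_re, Complex.I_im]
  ring

theorem continuous_qsym (p b : F) (c : ℝ) : Continuous (qsym p b c) := by
  unfold qsym; fun_prop

/-- Interpolated lower bound for a number controlled by two quantities. -/
theorem inv_le_of_two_bounds {h t W D : ℝ} (hh : 0 < h) (ht : 0 < t) (hD : 0 < D)
    (h1 : h ^ 2 ≤ W * D) (h2 : t ≤ W * D) :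
    W⁻¹ ≤ D * (h ^ (-(1 / 2) : ℝ) * t ^ (-(3 / 4) : ℝ)) := by
  have hWD : 0 < W * D := lt_of_lt_of_le ht h2
  have hW : 0 < W := by
    by_contra hcon
    nlinarith [mul_nonneg (le_of_lt hD) (sub_nonneg.2 (not_lt.1 hcon))]
  have e1 : h ^ (1 / 2 : ℝ) ≤ (W * D) ^ (1 / 4 : ℝ) := by
    have : h ^ (1 / 2 : ℝ) = (h ^ 2) ^ (1 / 4 : ℝ) := by
      rw [← Real.rpow_natCast, ← Real.rpow_mul hh.le]; norm_num
    rw [this]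
    exact Real.rpow_le_rpow (by positivity) h1 (by norm_num)
  have e2 : t ^ (3 / 4 : ℝ) ≤ (W * D) ^ (3 / 4 : ℝ) := Real.rpow_le_rpow ht.le h2 (by norm_num)
  have e3 : h ^ (1 / 2 : ℝ) * t ^ (3 / 4 : ℝ) ≤ W * D := by
    calc _ ≤ (W * D) ^ (1 / 4 : ℝ) * (W * D) ^ (3 / 4 : ℝ) := by gcongr
      _ = W * D := by rw [← Real.rpow_add hWD]; norm_num
  rw [Real.rpow_neg hh.le, Real.rpow_neg ht.le, ← mul_inv, ← div_eq_mul_inv, inv_eq_one_div,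
    div_le_div_iff₀ hW (by positivity)]
  linarith

/-- The distance that enters the lower bound for a shifted sphere. -/
theorem sq_sub_sqrt_le (r c : ℝ) (hr : 0 ≤ r) :
    |r - Real.sqrt (-c)| ^ 2 ≤ |r ^ 2 + c| := by
  rw [sq_abs]
  rcases le_total 0 c with hc | hc
  · rw [Real.sqrt_eq_zero_of_nonpos (by linarith)]
    rw [abs_of_nonneg (by positivity)]
    nlinarith
  · have h := Real.sq_sqrt (show 0 ≤ -c by linarith)
    have h0 := Real.sqrt_nonneg (-c)
    set q := Real.sqrt (-c)
    have : r ^ 2 + c = (r - q) * (r + q) := by linear_combination h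
    rw [this, abs_mul, abs_of_nonneg (show 0 ≤ r + q by positivity)]
    have h2 : |r - q| ≤ r + q := abs_le.2 ⟨by linarith, by linarith⟩
    calc (r - q) ^ 2 = |r - q| * |r - q| := by rw [← sq, sq_abs]
      _ ≤ _ := by gcongr

/-- A bound of the inverse of the symbol on slices by a product of integrable singularities. -/
theorem inv_qsym_slice_bound {n : F} (hn : ‖n‖ = 1) (p : F) (c : ℝ) {β : ℝ} (hβ : 0 < β) :
    ∃ (s₀ : Perp n) (ρ C : ℝ), 0 < C ∧ ∀ q : ℝ × Perp n, q.1 ≠ 0 → ‖q.2 + s₀‖ ≠ ρ →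
      ‖qsym p (β • n) c (slicePt n q)‖⁻¹ ≤
        C * (1 + |q.1|) * (|‖q.2 + s₀‖ - ρ| ^ (-(1 / 2) : ℝ) * |q.1| ^ (-(3 / 4) : ℝ)) := by
  set s₀ : Perp n := (1 / 2 : ℝ) • ((Submodule.span ℝ {n})ᗮ).orthogonalProjectionOnto p with hs₀
  have hps : ∀ s : Perp n, inner ℝ p (s : F) = 2 * inner ℝ s₀ s := by
    intro s
    rw [hs₀, inner_smul_left, real_inner_comm, real_inner_comm s,
      Submodule.inner_orthogonalProjectionOnto_eq_of_mem_left]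
    simp
  set pn : ℝ := inner ℝ p n
  set c₁ : ℝ := c - ‖s₀‖ ^ 2
  set C₀ : ℝ := 1 + (2 + |pn|) / β with hC₀
  have hC₀pos : 0 < C₀ := by positivity
  refine ⟨s₀, Real.sqrt (-c₁), C₀, hC₀pos, fun q hq1 hq2 => ?_⟩
  obtain ⟨t, s⟩ := q
  simp only at hq1 hq2 ⊢
  set W := ‖qsym p (β • n) c (slicePt n (t, s))‖ with hW
  have him : β * |t| ≤ W := by
    have := Complex.abs_im_le_norm (qsym p (β • n) c (slicePt n (t, s)))
    rw [qsym_im, inner_smul_left, inner_slicePt_left hn] at this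
    simpa [abs_mul, abs_of_pos hβ] using this
  have hre : |t ^ 2 + (‖s + s₀‖ ^ 2 + c₁) + pn * t| ≤ W := by
    have := Complex.abs_re_le_norm (qsym p (β • n) c (slicePt n (t, s)))
    rw [qsym_re, norm_sq_slicePt hn] at this
    convert this using 2
    have e : inner ℝ p (slicePt n (t, s)) = t * pn + 2 * inner ℝ s₀ s := by
      rw [slicePt, inner_add_right, inner_smul_right, hps]
    rw [e, norm_add_sq_real, real_inner_comm s₀ s]
    ring
  have htpos : 0 < |t| := abs_pos.2 hq1
  have hWt : |t| ≤ W / β := by rw [le_div_iff₀ hβ]; linarith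
  have hW0 : 0 ≤ W := norm_nonneg _
  refine inv_le_of_two_bounds (abs_pos.2 (sub_ne_zero.2 hq2)) htpos
    (by positivity) ?_ ?_
  · refine (sq_sub_sqrt_le _ _ (norm_nonneg _)).trans ?_
    have h1 : |‖s + s₀‖ ^ 2 + c₁| ≤ W + |t| * (|t| + |pn|) := by
      have := abs_sub (t ^ 2 + (‖s + s₀‖ ^ 2 + c₁) + pn * t) (t ^ 2 + pn * t)
      have e : t ^ 2 + (‖s + s₀‖ ^ 2 + c₁) + pn * t - (t ^ 2 + pn * t) = ‖s + s₀‖ ^ 2 + c₁ := by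
        ring
      rw [e] at this
      have h3 : |t ^ 2 + pn * t| ≤ |t| * (|t| + |pn|) := by
        rw [show t ^ 2 + pn * t = t * (t + pn) by ring, abs_mul]
        gcongr; exact abs_add_le _ _
      linarith
    have h2 : |t| * (|t| + |pn|) ≤ W / β * (|t| + |pn|) := by gcongr
    refine h1.trans ((add_le_add le_rfl h2).trans ?_)
    rw [hC₀]
    have : W * ((1 + (2 + |pn|) / β) * (1 + |t|)) - (W + W / β * (|t| + |pn|)) =
      W * |t| + W / β * (2 + |t| + |pn| * |t|) := by ring
    nlinarith [show 0 ≤ W * |t| + W / β * (2 + |t| + |pn| * |t|) by positivity]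
  · refine hWt.trans ?_
    rw [hC₀]
    have : W * ((1 + (2 + |pn|) / β) * (1 + |t|)) - W / β =
      W + W * |t| + W / β * (1 + |pn| + (2 + |pn|) * |t|) := by ring
    nlinarith [show 0 ≤ W + W * |t| + W / β * (1 + |pn| + (2 + |pn|) * |t|) by positivity]

theorem integrable_one_add_abs_mul_exp {c : ℝ} (hc : 0 < c) :
    Integrable fun t : ℝ => (1 + |t|) * |t| ^ (-(3 / 4) : ℝ) * Real.exp (-c * t ^ 2) := by
  have h1 := integrable_abs_rpow_mul_exp (c := c) (s := -(3 / 4)) hc (by norm_num)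
  have h2 := integrable_abs_rpow_mul_exp (c := c) (s := 1 / 4) hc (by norm_num)
  refine (h1.add h2).congr ?_
  have : ∀ᵐ t : ℝ, t ≠ 0 := by simp [ae_iff, measure_singleton]
  filter_upwards [this] with t ht
  have h3 : |t| ^ (1 / 4 : ℝ) = |t| * |t| ^ (-(3 / 4) : ℝ) := by
    rw [← Real.rpow_one_add' (abs_nonneg t) (by norm_num)]; norm_num
  simp only [Pi.add_apply]
  rw [h3]; ring

theorem nontrivial_perp (hF : 2 ≤ Module.finrank ℝ F) {n : F} (hn : n ≠ 0) :
    Nontrivial (Perp n) := by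
  apply Module.nontrivial_of_finrank_pos (R := ℝ)
  have := finrank_perp hn
  omega

theorem ae_norm_add_ne {G : Type*} [NormedAddCommGroup G] [InnerProductSpace ℝ G]
    [FiniteDimensional ℝ G] [MeasurableSpace G] [BorelSpace G] [Nontrivial G] (s₀ : G) (ρ : ℝ) :
    ∀ᵐ s : G, ‖s + s₀‖ ≠ ρ := by
  rw [ae_iff]
  have := Measure.addHaar_sphere (volume : Measure G) (-s₀) ρ
  convert this using 2
  ext s
  simp

/-- Gaussian weights make the inverse of the symbol integrable. -/
theorem integrable_exp_mul_inv_qsym (hF : 2 ≤ Module.finrank ℝ F) (p b : F) (hb : b ≠ 0) (c : ℝ)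
    {γ : ℝ} (hγ : 0 < γ) :
    Integrable fun ζ : F => Real.exp (-γ * ‖ζ‖ ^ 2) * ‖qsym p b c ζ‖⁻¹ := by
  have hb' : 0 < ‖b‖ := norm_pos_iff.2 hb
  set n : F := ‖b‖⁻¹ • b
  have hn : ‖n‖ = 1 := by simp [n, norm_smul, hb'.ne']
  have hn0 : n ≠ 0 := by rintro h; simp [h] at hn
  have hbn : b = ‖b‖ • n := by simp [n, smul_smul, hb'.ne']
  have := nontrivial_perp hF hn0
  obtain ⟨s₀, ρ, C, hC, hbound⟩ := inv_qsym_slice_bound hn p c hb'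
  rw [integrable_slicePt n hn]
  have hprod := ((integrable_one_add_abs_mul_exp hγ).mul_prod
    (integrable_norm_add_sub_rpow_mul_exp (F := Perp n) (s := -(1 / 2)) s₀ ρ hγ
      (by norm_num))).const_mul C
  refine hprod.mono' ?_ ?_
  · refine Measurable.aestronglyMeasurable ?_
    have h1 := (continuous_qsym p b c).comp (continuous_slicePt n)
    have h2 : Continuous fun p => ‖slicePt n p‖ := (continuous_slicePt n).norm
    exact (by fun_prop : Continuous fun p => Real.exp (-γ * ‖slicePt n p‖ ^ 2)).measurable.mul
      h1.norm.measurable.inv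
  · have ht : ∀ᵐ q : ℝ × Perp n, q.1 ≠ 0 :=
      Measure.quasiMeasurePreserving_fst.ae (p := fun t : ℝ => t ≠ 0)
        (by simp [ae_iff, measure_singleton])
    have hs : ∀ᵐ q : ℝ × Perp n, ‖q.2 + s₀‖ ≠ ρ :=
      Measure.quasiMeasurePreserving_snd.ae (ae_norm_add_ne s₀ ρ)
    filter_upwards [ht, hs] with q h1 h2
    rw [Real.norm_eq_abs, abs_of_nonneg (by positivity), norm_sq_slicePt hn]
    have := hbound q h1 h2
    rw [← hbn] at this
    calc _ ≤ Real.exp (-γ * (q.1 ^ 2 + ‖q.2‖ ^ 2)) * (C * (1 + |q.1|) *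
          (|‖q.2 + s₀‖ - ρ| ^ (-(1 / 2) : ℝ) * |q.1| ^ (-(3 / 4) : ℝ))) := by gcongr
      _ = _ := by rw [mul_add, Real.exp_add]; ring

end

end

section

variable {d : ℕ}

theorem cdot_toC (k : CV d) (ξ : RV d) :
    cdot k (toC ξ) = ((inner ℝ (reV k) ξ : ℝ) : ℂ) + ((inner ℝ (imV k) ξ : ℝ) : ℂ) * Complex.I := by
  simp only [cdot, toC, reV, imV, PiLp.inner_apply, RCLike.inner_apply, conj_trivial,
    Complex.ofReal_sum, Complex.ofReal_mul, Finset.sum_mul, ← Finset.sum_add_distrib]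
  refine Finset.sum_congr rfl fun j _ => ?_
  nth_rw 1 [← Complex.re_add_im (k j)]
  ring

theorem cdot_add_left (a b c : CV d) : cdot (a + b) c = cdot a c + cdot b c := by
  simp [cdot, add_mul, Finset.sum_add_distrib]

theorem cdot_add_right (a b c : CV d) : cdot a (b + c) = cdot a b + cdot a c := by
  simp [cdot, mul_add, Finset.sum_add_distrib]

theorem cdot_comm (a b : CV d) : cdot a b = cdot b a := by
  simp [cdot, mul_comm]

theorem cdot_smul_left (r : ℂ) (a b : CV d) : cdot (r • a) b = r * cdot a b := by
  simp [cdot, mul_assoc, Finset.mul_sum]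

theorem cdot_smul_right (r : ℂ) (a b : CV d) : cdot a (r • b) = r * cdot a b := by
  rw [cdot_comm, cdot_smul_left, cdot_comm]

theorem toC_add (a b : RV d) : toC (a + b) = toC a + toC b := by
  ext j; simp [toC]

theorem toC_smul (r : ℝ) (a : RV d) : toC (r • a) = (r : ℂ) • toC a := by
  ext j; simp [toC]

theorem toC_neg (a : RV d) : toC (-a) = -toC a := by
  ext j; simp [toC]

@[simp] theorem reV_toC (a : RV d) : reV (toC a) = a := by
  ext j; simp [reV, toC]

@[simp] theorem imV_toC (a : RV d) : imV (toC a) = 0 := by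
  ext j; simp [imV, toC]

theorem reV_add (a b : CV d) : reV (a + b) = reV a + reV b := by
  ext j; simp [reV]

theorem imV_add (a b : CV d) : imV (a + b) = imV a + imV b := by
  ext j; simp [imV]

theorem toC_reV_add_imV (k : CV d) : toC (reV k) + Complex.I • toC (imV k) = k := by
  ext j
  simp only [toC, reV, imV, PiLp.add_apply, PiLp.smul_apply, smul_eq_mul]
  rw [mul_comm, Complex.re_add_im]

theorem cdot_toC_toC (a b : RV d) : cdot (toC a) (toC b) = ((inner ℝ a b : ℝ) : ℂ) := by
  rw [cdot_toC]; simp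

theorem planeWave_toC (ξ x : RV d) :
    planeWave (toC ξ) x = Complex.exp (((inner ℝ ξ x : ℝ) : ℂ) * Complex.I) := by
  rw [planeWave, cdot_toC_toC, mul_comm]

theorem norm_planeWave_toC (ξ x : RV d) : ‖planeWave (toC ξ) x‖ = 1 := by
  rw [planeWave_toC, Complex.norm_exp_ofReal_mul_I]

theorem planeWave_add (k l : CV d) (x : RV d) :
    planeWave (k + l) x = planeWave k x * planeWave l x := by
  rw [planeWave, planeWave, planeWave, cdot_add_left, mul_add, Complex.exp_add]

theorem planeWave_add_right (k : CV d) (x y : RV d) :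
    planeWave k (x + y) = planeWave k x * planeWave k y := by
  rw [planeWave, planeWave, planeWave, toC_add, cdot_add_right, mul_add, Complex.exp_add]

theorem planeWave_ne_zero (k : CV d) (x : RV d) : planeWave k x ≠ 0 := Complex.exp_ne_zero _

theorem planeWave_zero (x : RV d) : planeWave (0 : CV d) x = 1 := by
  simp [planeWave, cdot]

theorem planeWave_zero_right (k : CV d) : planeWave k (0 : RV d) = 1 := by
  simp [planeWave, cdot, toC]

theorem planeWave_neg_mul (k : CV d) (x : RV d) : planeWave (-k) x * planeWave k x = 1 := by
  rw [← planeWave_add, neg_add_cancel, planeWave_zero]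

theorem planeWave_neg_right_mul (k : CV d) (x : RV d) : planeWave k (-x) * planeWave k x = 1 := by
  rw [← planeWave_add_right, neg_add_cancel, planeWave_zero_right]

theorem planeWave_neg (k : CV d) (x : RV d) : planeWave (-k) x = planeWave k (-x) := by
  rw [← mul_left_inj' (planeWave_ne_zero k x), planeWave_neg_mul, planeWave_neg_right_mul]

theorem continuous_planeWave_toC (x : RV d) : Continuous fun ξ : RV d => planeWave (toC ξ) x := by
  simp only [planeWave_toC]; fun_prop

/-- The symbol `ξ² + 2 k ξ`. -/
def symb (k : CV d) (ξ : RV d) : ℂ := ((‖ξ‖ ^ 2 : ℝ) : ℂ) + 2 * cdot k (toC ξ)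

theorem symb_eq_qsym (k : CV d) (ξ : RV d) :
    symb k ξ = qsym ((2 : ℝ) • reV k) ((2 : ℝ) • imV k) 0 ξ := by
  rw [symb, cdot_toC, qsym, inner_smul_left, inner_smul_left]
  push_cast
  simp only [conj_trivial]
  push_cast
  ring

theorem symb_re (k : CV d) (ξ : RV d) : (symb k ξ).re = ‖ξ‖ ^ 2 + 2 * inner ℝ (reV k) ξ := by
  rw [symb_eq_qsym, qsym_re, inner_smul_left]; simp

theorem symb_im (k : CV d) (ξ : RV d) : (symb k ξ).im = 2 * inner ℝ (imV k) ξ := by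
  rw [symb_eq_qsym, qsym_im, inner_smul_left]; simp

theorem continuous_symb (k : CV d) : Continuous (symb k) := by
  have : symb k = qsym ((2 : ℝ) • reV k) ((2 : ℝ) • imV k) 0 := funext (symb_eq_qsym k)
  rw [this]; exact continuous_qsym _ _ _

theorem ae_symb_ne_zero {k : CV d} (hk : imV k ≠ 0) : ∀ᵐ ξ : RV d, symb k ξ ≠ 0 := by
  have h : ∀ᵐ ξ : RV d, ξ ∉ ((Submodule.span ℝ {imV k})ᗮ : Submodule ℝ (RV d)) := by
    rw [ae_iff]
    simp only [not_not]
    refine Measure.addHaar_submodule (volume : Measure (RV d))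
      ((Submodule.span ℝ {imV k})ᗮ) fun h => hk ?_
    have : imV k ∈ (Submodule.span ℝ {imV k})ᗮ := h ▸ Submodule.mem_top
    rw [Submodule.mem_orthogonal_singleton_iff_inner_right] at this
    exact inner_self_eq_zero.1 this
  filter_upwards [h] with ξ hξ h0
  rw [Submodule.mem_orthogonal_singleton_iff_inner_right] at hξ
  have := symb_im k ξ
  rw [h0] at this
  simp at this
  exact hξ this

theorem greenIntegrand_eq (x : RV d) (k : CV d) (ξ : RV d) :
    greenIntegrand x k ξ = planeWave (toC ξ) x * (symb k ξ)⁻¹ := div_eq_mul_inv _ _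

theorem integrable_exp_mul_inv_symb (hd : 2 ≤ d) {k : CV d} (hk : imV k ≠ 0) {γ : ℝ}
    (hγ : 0 < γ) : Integrable fun ξ : RV d => Real.exp (-γ * ‖ξ‖ ^ 2) * ‖symb k ξ‖⁻¹ := by
  simp only [symb_eq_qsym]
  exact integrable_exp_mul_inv_qsym (by simpa using hd) _ _ (by simpa using hk) _ hγ

theorem integrableOn_greenIntegrand (hd : 2 ≤ d) {k : CV d} (hk : imV k ≠ 0) (x : RV d) (N : ℝ) :
    IntegrableOn (greenIntegrand x k) (Metric.closedBall (0 : RV d) N) := by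
  have h := ((integrable_exp_mul_inv_symb hd hk one_pos).const_mul
    (Real.exp (N ^ 2))).integrableOn (s := Metric.closedBall (0 : RV d) N)
  refine h.mono' ?_ ?_
  · simp only [funext (greenIntegrand_eq x k)]
    exact ((continuous_planeWave_toC x).measurable.mul
      (continuous_symb k).measurable.inv).aestronglyMeasurable
  · filter_upwards [ae_restrict_mem Metric.isClosed_closedBall.measurableSet] with ξ hξ
    rw [greenIntegrand_eq, norm_mul, norm_planeWave_toC, one_mul, norm_inv, ← mul_assoc,
      ← Real.exp_add]
    have h1 : ‖ξ‖ ^ 2 ≤ N ^ 2 := by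
      gcongr; simpa using hξ
    have h2 : 1 ≤ Real.exp (N ^ 2 + -1 * ‖ξ‖ ^ 2) := Real.one_le_exp (by linarith)
    exact le_mul_of_one_le_left (by positivity) h2

/-- A lower bound for the real part of the symbol. -/
theorem symb_re_ge (k : CV d) (ξ : RV d) :
    ‖ξ‖ ^ 2 / 2 - 2 * ‖reV k‖ ^ 2 ≤ (symb k ξ).re := by
  rw [symb_re]
  have h := abs_real_inner_le_norm (reV k) ξ
  have h2 := (abs_le.1 h).1
  nlinarith [sq_nonneg (‖ξ‖ - 2 * ‖reV k‖)]

/-- The regularised Green integral. -/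
def regInt (T : ℝ) (x : RV d) (k : CV d) : ℂ :=
  ∫ ξ : RV d, planeWave (toC ξ) x * (Complex.exp (-T * symb k ξ) * (symb k ξ)⁻¹)

theorem integrable_regInt (hd : 2 ≤ d) {k : CV d} (hk : imV k ≠ 0) (x : RV d) {T : ℝ}
    (hT : 0 < T) : Integrable fun ξ : RV d =>
      planeWave (toC ξ) x * (Complex.exp (-T * symb k ξ) * (symb k ξ)⁻¹) := by
  refine ((integrable_exp_mul_inv_symb hd hk (half_pos hT)).const_mul
    (Real.exp (T * (2 * ‖reV k‖ ^ 2)))).mono' ?_ (Eventually.of_forall fun ξ => ?_)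
  · have h1 := continuous_symb k
    exact ((continuous_planeWave_toC x).measurable.mul
      ((by fun_prop : Continuous fun ξ => Complex.exp (-T * symb k ξ)).measurable.mul
        h1.measurable.inv)).aestronglyMeasurable
  · rw [norm_mul, norm_planeWave_toC, one_mul, norm_mul, norm_inv, ← mul_assoc, Complex.norm_exp,
      ← Real.exp_add]
    gcongr
    have := symb_re_ge k ξ
    simp only [neg_mul, Complex.neg_re, Complex.re_ofReal_mul]
    nlinarith [mul_le_mul_of_nonneg_left this hT.le]

/-- The Gaussian kernel `exp (iξx - ε (ξ² + 2kξ))`. -/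
def heatKer (ε : ℝ) (x : RV d) (k : CV d) (ξ : RV d) : ℂ :=
  planeWave (toC ξ) x * Complex.exp (-ε * symb k ξ)

theorem continuous_heatKer (x : RV d) (k : CV d) :
    Continuous fun p : ℝ × RV d => heatKer p.1 x k p.2 := by
  have h1 := continuous_symb k
  have h2 := continuous_planeWave_toC x
  unfold heatKer
  exact (h2.comp continuous_snd).mul (Complex.continuous_exp.comp
    ((Complex.continuous_ofReal.comp continuous_fst).neg.mul (h1.comp continuous_snd)))

theorem norm_heatKer_le {ε : ℝ} (hε : 0 ≤ ε) (x : RV d) (k : CV d) (ξ : RV d) :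
    ‖heatKer ε x k ξ‖ ≤ Real.exp (2 * ε * ‖reV k‖ ^ 2) * Real.exp (-(ε / 2) * ‖ξ‖ ^ 2) := by
  rw [heatKer, norm_mul, norm_planeWave_toC, one_mul, Complex.norm_exp, ← Real.exp_add]
  gcongr
  have := symb_re_ge k ξ
  simp only [neg_mul, Complex.neg_re, Complex.re_ofReal_mul]
  nlinarith [mul_le_mul_of_nonneg_left this hε]

theorem integrable_exp_neg_mul_norm_sq {F : Type*} [NormedAddCommGroup F] [InnerProductSpace ℝ F]
    [FiniteDimensional ℝ F] [MeasurableSpace F] [BorelSpace F] {c : ℝ} (hc : 0 < c) :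
    Integrable fun v : F => Real.exp (-c * ‖v‖ ^ 2) := by
  have h := (GaussianFourier.integrable_cexp_neg_mul_sq_norm_add (b := (c : ℂ))
    (by simpa using hc) 0 (0 : F)).norm
  refine h.congr (Eventually.of_forall fun v => ?_)
  simp only [zero_mul, add_zero]
  rw [Complex.norm_exp]
  congr 1
  norm_cast

theorem integrable_heatKer {ε : ℝ} (hε : 0 < ε) (x : RV d) (k : CV d) :
    Integrable (heatKer ε x k) := by
  refine ((integrable_exp_neg_mul_norm_sq (F := RV d) (half_pos hε)).const_mul
    (Real.exp (2 * ε * ‖reV k‖ ^ 2))).mono' ?_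
    (Eventually.of_forall fun ξ => norm_heatKer_le hε.le x k ξ)
  exact ((continuous_heatKer x k).comp (Continuous.prodMk_right ε)).aestronglyMeasurable

/-- The Gaussian factor of the heat kernel. -/
def heatFun (d : ℕ) (E : ℂ) (r ε : ℝ) : ℂ :=
  (((Real.pi / ε) ^ ((d : ℝ) / 2) * Real.exp (-(r ^ 2 / (4 * ε))) : ℝ) : ℂ) *
    Complex.exp (ε * E)

theorem integral_heatKer {ε : ℝ} (hε : 0 < ε) (x : RV d) (k : CV d) :
    ∫ ξ, heatKer ε x k ξ = planeWave (-k) x * heatFun d (cdot k k) ‖x‖ ε := by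
  set c : Fin d → ℂ := fun j => Complex.I * x j - 2 * ε * k j with hc
  have h := GaussianFourier.integral_cexp_neg_mul_sum_add (b := (ε : ℂ)) (by simpa using hε) c
  rw [← (PiLp.volume_preserving_toLp (Fin d)).integral_comp
    (MeasurableEquiv.toLp 2 (Fin d → ℝ)).measurableEmbedding]
  have e1 : ∀ v : Fin d → ℝ, heatKer ε x k (WithLp.toLp 2 v) =
      Complex.exp (-ε * ∑ i, (v i : ℂ) ^ 2 + ∑ i, c i * v i) := by
    intro v
    rw [heatKer, planeWave, symb, ← Complex.exp_add, EuclideanSpace.real_norm_sq_eq]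
    congr 1
    simp only [cdot, toC, hc, Finset.mul_sum, ← Finset.sum_add_distrib, Complex.ofReal_sum,
      Complex.ofReal_pow]
    refine Finset.sum_congr rfl fun j _ => ?_
    ring
  have e2 : ∑ i, c i ^ 2 = -((‖x‖ ^ 2 : ℝ) : ℂ) - 4 * ε * (Complex.I * cdot k (toC x)) +
      4 * ε ^ 2 * cdot k k := by
    rw [EuclideanSpace.real_norm_sq_eq]
    simp only [cdot, toC, hc, Finset.mul_sum, ← Finset.sum_add_distrib, Complex.ofReal_sum,
      Complex.ofReal_pow, ← Finset.sum_neg_distrib, ← Finset.sum_sub_distrib]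
    refine Finset.sum_congr rfl fun j _ => ?_
    linear_combination ((x j : ℂ) ^ 2) * Complex.I_sq
  simp only [e1]
  rw [h, e2, heatFun, planeWave, Complex.ofReal_mul, Complex.ofReal_cpow (by positivity),
    Complex.ofReal_exp]
  have hε' : (ε : ℂ) ≠ 0 := by exact_mod_cast hε.ne'
  have e3 : (-((‖x‖ ^ 2 : ℝ) : ℂ) - 4 * ε * (Complex.I * cdot k (toC x)) +
      4 * ε ^ 2 * cdot k k) / (4 * ε) =
      Complex.I * cdot (-k) (toC x) + ((-(‖x‖ ^ 2 / (4 * ε)) : ℝ) : ℂ) + ε * cdot k k := by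
    have : cdot (-k) (toC x) = -cdot k (toC x) := by simp [cdot]
    rw [this]
    push_cast
    field_simp
    ring
  rw [e3, Complex.exp_add, Complex.exp_add]
  simp only [Fintype.card_fin]
  push_cast
  ring

end

section

section Oscillatory

theorem osc_identity {α : ℂ} (hα : α ≠ 0) (ε S : ℝ) (c₀ : ℂ) :
    ∫ t in (-S)..S, Complex.exp (α * t) * (Complex.exp (-ε * t ^ 2) - c₀) =
      (Complex.exp (α * S) * ((Complex.exp (-ε * S ^ 2) - c₀) / α
          + 2 * ε * S * Complex.exp (-ε * S ^ 2) / α ^ 2)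
        - Complex.exp (-(α * S)) * ((Complex.exp (-ε * S ^ 2) - c₀) / α
          - 2 * ε * S * Complex.exp (-ε * S ^ 2) / α ^ 2))
      + (α ^ 2)⁻¹ * ∫ t in (-S)..S,
          Complex.exp (α * t) * ((4 * ε ^ 2 * t ^ 2 - 2 * ε) * Complex.exp (-ε * t ^ 2)) := by
  set H : ℝ → ℂ := fun t => Complex.exp (α * t) * ((Complex.exp (-ε * t ^ 2) - c₀) / α
    + 2 * ε * t * Complex.exp (-ε * t ^ 2) / α ^ 2) with hH
  have hderiv : ∀ t : ℝ, HasDerivAt H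
      (Complex.exp (α * t) * (Complex.exp (-ε * t ^ 2) - c₀) -
        (α ^ 2)⁻¹ * (Complex.exp (α * t) *
          ((4 * ε ^ 2 * t ^ 2 - 2 * ε) * Complex.exp (-ε * t ^ 2)))) t := by
    intro t
    have h1 : HasDerivAt (fun z : ℂ => Complex.exp (α * z) *
        ((Complex.exp (-ε * z ^ 2) - c₀) / α + 2 * ε * z * Complex.exp (-ε * z ^ 2) / α ^ 2))
        _ (t : ℂ) :=
      (((hasDerivAt_id' (t : ℂ)).const_mul α).cexp).mul
        ((((((hasDerivAt_id' (t : ℂ)).pow 2).const_mul (-ε : ℂ)).cexp.sub_const c₀).div_const α).add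
        ((((hasDerivAt_id' (t : ℂ)).const_mul (2 * ε : ℂ)).mul
          (((hasDerivAt_id' (t : ℂ)).pow 2).const_mul (-ε : ℂ)).cexp).div_const (α ^ 2)))
    have h2 := h1.comp_ofReal
    refine h2.congr_deriv ?_
    simp only [Pi.pow_apply]
    field_simp
    push_cast
    ring
  have h3 := intervalIntegral.integral_eq_sub_of_hasDerivAt (a := -S) (b := S)
    (fun t _ => hderiv t) (Continuous.intervalIntegrable (by fun_prop) _ _)
  rw [intervalIntegral.integral_sub (Continuous.intervalIntegrable (by fun_prop) _ _)
    (Continuous.intervalIntegrable (by fun_prop) _ _),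
    intervalIntegral.integral_const_mul] at h3
  rw [sub_eq_iff_eq_add] at h3
  rw [h3]
  simp only [hH]
  push_cast
  ring_nf

theorem mul_exp_neg_sq_le (y : ℝ) : y * Real.exp (-(y ^ 2 / 2)) ≤ 1 := by
  have h := Real.add_one_le_exp (y ^ 2 / 2)
  rw [Real.exp_neg, ← div_eq_mul_inv, div_le_one (Real.exp_pos _)]
  nlinarith [sq_nonneg (y - 1)]

theorem norm_exp_mul_le {α : ℂ} {ε K T : ℝ} (hε : 0 < ε) (hεT : ε ≤ T)
    (hre : |α.re| ≤ 2 * ε * K) (t : ℝ) :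
    ‖Complex.exp (α * t)‖ ≤ Real.exp (2 * T * K ^ 2) * Real.exp (ε * t ^ 2 / 2) := by
  rw [Complex.norm_exp, ← Real.exp_add]
  gcongr
  rw [Complex.re_mul_ofReal]
  have h1 : α.re * t ≤ 2 * ε * K * |t| := by
    calc α.re * t ≤ |α.re * t| := le_abs_self _
      _ = |α.re| * |t| := abs_mul _ _
      _ ≤ _ := by gcongr
  have h2 : 2 * ε * K * |t| ≤ 2 * ε * K ^ 2 + ε * t ^ 2 / 2 := by
    rw [← sq_abs t]
    nlinarith [mul_nonneg hε.le (sq_nonneg (|t| - 2 * K))]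
  have h3 : 2 * ε * K ^ 2 ≤ 2 * T * K ^ 2 := by gcongr
  linarith

theorem integral_exp_neg_mul_sq_norm_eq {F : Type*} [NormedAddCommGroup F] [InnerProductSpace ℝ F]
    [FiniteDimensional ℝ F] [MeasurableSpace F] [BorelSpace F] {ε c : ℝ} (hε : 0 < ε)
    (hc : 0 < c) : ∫ v : F, Real.exp (-(c * ε) * ‖v‖ ^ 2) =
      (Real.pi / c) ^ ((Module.finrank ℝ F : ℝ) / 2) *
        (ε ^ ((Module.finrank ℝ F : ℝ) / 2))⁻¹ := by
  rw [GaussianFourier.integral_rexp_neg_mul_sq_norm (mul_pos hc hε), ← div_div,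
    Real.div_rpow (by positivity) hε.le, div_eq_mul_inv]

theorem integral_exp_neg_mul_sq_real_eq {ε c : ℝ}
    (hc : 0 < c) : ∫ t : ℝ, Real.exp (-(c * ε) * t ^ 2) =
      Real.sqrt (Real.pi / c) * (Real.sqrt ε)⁻¹ := by
  rw [integral_gaussian, ← div_div, Real.sqrt_div (by positivity), div_eq_mul_inv]

theorem osc_bound {α : ℂ} {ε K T A : ℝ} (hε : 0 < ε) (hεT : ε ≤ T)
    (hre : |α.re| ≤ 2 * ε * K) (hA : 0 < A) (hαA : A ≤ ‖α‖) (c₀ : ℂ) {S : ℝ} (hS : 0 ≤ S) :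
    ‖∫ t in (-S)..S, Complex.exp (α * t) * (Complex.exp (-ε * t ^ 2) - c₀)‖ ≤
      (‖Complex.exp (α * S)‖ + ‖Complex.exp (-(α * S))‖) * ‖Complex.exp (-ε * S ^ 2) - c₀‖ / A
      + Real.exp (2 * T * K ^ 2) * (4 + 18 * Real.sqrt (Real.pi / (1 / 4))) / A ^ 2 *
        Real.sqrt ε := by
  have hα0 : α ≠ 0 := norm_pos_iff.1 (lt_of_lt_of_le hA hαA)
  set M := Real.exp (2 * T * K ^ 2) with hM
  have hMpos : 0 < M := Real.exp_pos _
  have hn : ∀ t : ℝ, ‖Complex.exp (-ε * t ^ 2 : ℂ)‖ = Real.exp (-(ε * t ^ 2)) := by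
    intro t
    rw [Complex.norm_exp]
    congr 1
    norm_cast
    simp
  have hsq := Real.mul_self_sqrt hε.le
  have hsp : 0 < Real.sqrt ε := Real.sqrt_pos.2 hε
  have hbd : ∀ (α' : ℂ), |α'.re| ≤ 2 * ε * K →
      ‖Complex.exp (α' * S)‖ * ‖(2 * ε * S * Complex.exp (-ε * S ^ 2) : ℂ)‖ ≤
        2 * M * Real.sqrt ε := by
    intro α' h'
    have h1 := norm_exp_mul_le hε hεT h' S
    rw [norm_mul, hn]
    have h2 : ‖(2 * ε * S : ℂ)‖ = 2 * ε * S := by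
      rw [norm_mul, norm_mul]; simp [abs_of_pos hε, abs_of_nonneg hS]
    rw [h2]
    have h3 := mul_exp_neg_sq_le (Real.sqrt ε * S)
    have h4 : (Real.sqrt ε * S) ^ 2 / 2 = ε * S ^ 2 / 2 := by
      rw [mul_pow, Real.sq_sqrt hε.le]
    rw [h4] at h3
    have h5 : Real.exp (-(ε * S ^ 2)) =
        Real.exp (-(ε * S ^ 2 / 2)) * Real.exp (-(ε * S ^ 2 / 2)) := by
      rw [← Real.exp_add]; ring_nf
    have h6 : Real.exp (ε * S ^ 2 / 2) * Real.exp (-(ε * S ^ 2 / 2)) = 1 := by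
      rw [← Real.exp_add]; simp
    calc ‖Complex.exp (α' * S)‖ * (2 * ε * S * Real.exp (-(ε * S ^ 2)))
        ≤ (M * Real.exp (ε * S ^ 2 / 2)) * (2 * ε * S * Real.exp (-(ε * S ^ 2))) := by gcongr
      _ = 2 * M * Real.sqrt ε * (Real.sqrt ε * S * Real.exp (-(ε * S ^ 2 / 2))) *
          (Real.exp (ε * S ^ 2 / 2) * Real.exp (-(ε * S ^ 2 / 2))) := by
          rw [h5]
          linear_combination (-2 * M * S * Real.exp (ε * S ^ 2 / 2) *
            Real.exp (-(ε * S ^ 2 / 2)) ^ 2) * hsq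
      _ ≤ 2 * M * Real.sqrt ε * 1 * 1 := by rw [h6]; gcongr
      _ = _ := by ring
  have hb1 := hbd α hre
  have hb2 := hbd (-α) (by simpa using hre)
  have hint : ‖∫ t in (-S)..S,
      Complex.exp (α * t) * ((4 * ε ^ 2 * t ^ 2 - 2 * ε) * Complex.exp (-ε * t ^ 2))‖ ≤
      18 * M * Real.sqrt (Real.pi / (1 / 4)) * Real.sqrt ε := by
    have hpt : ∀ t : ℝ, ‖Complex.exp (α * t) *
        ((4 * ε ^ 2 * t ^ 2 - 2 * ε) * Complex.exp (-ε * t ^ 2))‖ ≤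
        18 * M * ε * Real.exp (-(1 / 4 * ε) * t ^ 2) := by
      intro t
      have h1 := norm_exp_mul_le hε hεT hre t
      rw [norm_mul, norm_mul, hn]
      have h2 : ‖(4 * ε ^ 2 * t ^ 2 - 2 * ε : ℂ)‖ ≤ 4 * ε ^ 2 * t ^ 2 + 2 * ε := by
        refine (norm_sub_le _ _).trans (le_of_eq ?_)
        simp [abs_of_pos hε]
      have h3 : 4 * ε ^ 2 * t ^ 2 + 2 * ε ≤ 18 * ε * Real.exp (ε * t ^ 2 / 4) := by
        have := Real.add_one_le_exp (ε * t ^ 2 / 4)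
        nlinarith [mul_le_mul_of_nonneg_left this hε.le, mul_nonneg hε.le (mul_nonneg hε.le
          (sq_nonneg t))]
      calc _ ≤ (M * Real.exp (ε * t ^ 2 / 2)) * ((18 * ε * Real.exp (ε * t ^ 2 / 4)) *
            Real.exp (-(ε * t ^ 2))) := by
              gcongr; exact h2.trans h3
        _ = 18 * M * ε * (Real.exp (ε * t ^ 2 / 2) * Real.exp (ε * t ^ 2 / 4) *
            Real.exp (-(ε * t ^ 2))) := by ring
        _ = _ := by
            rw [← Real.exp_add, ← Real.exp_add]; ring_nf
    have hI : Integrable fun t : ℝ => 18 * M * ε * Real.exp (-(1 / 4 * ε) * t ^ 2) :=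
      (integrable_exp_neg_mul_sq (by positivity)).const_mul _
    rw [intervalIntegral.integral_of_le (by linarith)]
    refine (norm_integral_le_integral_norm _).trans ?_
    calc _ ≤ ∫ t in Set.Ioc (-S) S, 18 * M * ε * Real.exp (-(1 / 4 * ε) * t ^ 2) :=
          integral_mono_of_nonneg (Eventually.of_forall fun t => norm_nonneg _)
            hI.integrableOn (Eventually.of_forall hpt)
      _ ≤ ∫ t, 18 * M * ε * Real.exp (-(1 / 4 * ε) * t ^ 2) :=
          setIntegral_le_integral hI (Eventually.of_forall fun t => by positivity)
      _ = 18 * M * Real.sqrt (Real.pi / (1 / 4)) * Real.sqrt ε := by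
          rw [integral_const_mul, integral_exp_neg_mul_sq_real_eq (by norm_num)]
          field_simp
          linear_combination (-1 : ℝ) * hsq
  rw [osc_identity hα0]
  have hA2 : A ^ 2 ≤ ‖α‖ ^ 2 := by gcongr
  have key : ∀ e : ℂ, ∀ sgn : ℂ, ‖sgn‖ = 1 → ‖e‖ *
      ‖(2 * ε * S * Complex.exp (-ε * S ^ 2) : ℂ)‖ ≤ 2 * M * Real.sqrt ε →
      ‖e * ((Complex.exp (-ε * S ^ 2) - c₀) / α +
        sgn * (2 * ε * S * Complex.exp (-ε * S ^ 2) / α ^ 2))‖ ≤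
      ‖e‖ * ‖Complex.exp (-ε * S ^ 2) - c₀‖ / A + 2 * M * Real.sqrt ε / A ^ 2 := by
    intro e sgn hs he
    rw [mul_add]
    refine (norm_add_le _ _).trans (add_le_add ?_ ?_)
    · rw [norm_mul, norm_div, ← mul_div_assoc]
      gcongr
    · rw [norm_mul, norm_mul, hs, one_mul, norm_div, ← mul_div_assoc, norm_pow]
      gcongr
  have k1 := key _ 1 (by simp) hb1
  have k2 := key (Complex.exp (-(α * S))) (-1) (by simp) (by simpa using hb2)
  rw [one_mul] at k1
  rw [neg_one_mul, ← sub_eq_add_neg] at k2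
  refine (norm_add_le _ _).trans ?_
  have k3 := (norm_sub_le (Complex.exp (α * S) * ((Complex.exp (-ε * S ^ 2) - c₀) / α
          + 2 * ε * S * Complex.exp (-ε * S ^ 2) / α ^ 2))
        (Complex.exp (-(α * S)) * ((Complex.exp (-ε * S ^ 2) - c₀) / α
          - 2 * ε * S * Complex.exp (-ε * S ^ 2) / α ^ 2))).trans (add_le_add k1 k2)
  have k4 : ‖(α ^ 2)⁻¹ * ∫ t in (-S)..S,
      Complex.exp (α * t) * ((4 * ε ^ 2 * t ^ 2 - 2 * ε) * Complex.exp (-ε * t ^ 2))‖ ≤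
      (18 * M * Real.sqrt (Real.pi / (1 / 4)) * Real.sqrt ε) / A ^ 2 := by
    rw [norm_mul, norm_inv, norm_pow, inv_mul_eq_div]
    gcongr
  refine (add_le_add k3 k4).trans (le_of_eq ?_)
  ring

end Oscillatory

end

section

section BallBound

variable {F : Type*} [NormedAddCommGroup F] [InnerProductSpace ℝ F] [FiniteDimensional ℝ F]
  [MeasurableSpace F] [BorelSpace F]

theorem integral_odd_eq_zero (f : F → ℂ) (hf : ∀ s, f (-s) = -f s) : ∫ s, f s = 0 := by
  have h1 := integral_neg_eq_self f (volume : Measure F)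
  simp only [hf, integral_neg] at h1
  exact self_eq_neg.1 h1.symm

/-- The Gaussian factor transversal to the direction of oscillation. -/
def transGauss (ε : ℝ) (L : F →L[ℝ] ℂ) (s : F) : ℂ :=
  Complex.exp (-ε * ((‖s‖ ^ 2 : ℝ) : ℂ) - 2 * ε * L s)

theorem continuous_transGauss (ε : ℝ) (L : F →L[ℝ] ℂ) : Continuous (transGauss ε L) := by
  unfold transGauss; fun_prop

theorem norm_transGauss_le {ε K T : ℝ} (hε : 0 < ε) (hεT : ε ≤ T) {L : F →L[ℝ] ℂ}
    (hL : ‖L‖ ≤ K) (s : F) :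
    ‖transGauss ε L s‖ ≤ Real.exp (2 * T * K ^ 2) * Real.exp (-(1 / 2 * ε) * ‖s‖ ^ 2) := by
  have hK : 0 ≤ K := (norm_nonneg _).trans hL
  rw [transGauss, Complex.norm_exp, ← Real.exp_add]
  gcongr
  have h1 : -(L s).re ≤ K * ‖s‖ :=
    ((neg_le_abs _).trans (Complex.abs_re_le_norm _)).trans ((L.le_opNorm s).trans (by gcongr))
  have h2 : (-ε * ((‖s‖ ^ 2 : ℝ) : ℂ) - 2 * ε * L s).re = -ε * ‖s‖ ^ 2 + 2 * ε * (-(L s).re) := by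
    rw [show (-ε * ((‖s‖ ^ 2 : ℝ) : ℂ) - 2 * ε * L s) =
      ((-ε * ‖s‖ ^ 2 : ℝ) : ℂ) - ((2 * ε : ℝ) : ℂ) * L s by push_cast; ring]
    rw [Complex.sub_re, Complex.ofReal_re, Complex.re_ofReal_mul]
    ring
  rw [h2]
  have h3 : 2 * T * K ^ 2 ≥ 2 * ε * K ^ 2 := by gcongr
  nlinarith [mul_le_mul_of_nonneg_left h1 hε.le, mul_nonneg hε.le (sq_nonneg (‖s‖ - 2 * K))]

theorem integral_ball_gauss (hF : Module.finrank ℝ F = 2) {ε R : ℝ} (hε : 0 < ε) (hR : 0 ≤ R) :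
    ∫ s in Metric.closedBall (0 : F) R, Real.exp (-ε * ‖s‖ ^ 2) =
      2 * (volume : Measure F).real (Metric.ball 0 1) *
        ((1 - Real.exp (-ε * R ^ 2)) / (2 * ε)) := by
  have : Nontrivial F := Module.nontrivial_of_finrank_pos (R := ℝ) (by omega)
  rw [← integral_indicator Metric.isClosed_closedBall.measurableSet]
  have h0 : (Metric.closedBall (0 : F) R).indicator (fun s => Real.exp (-ε * ‖s‖ ^ 2)) =
      fun s => (fun r => (Set.Iic R).indicator (fun r => Real.exp (-ε * r ^ 2)) r) ‖s‖ := by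
    ext s
    by_cases h : ‖s‖ ≤ R <;> simp [Set.indicator, h]
  rw [h0, integral_fun_norm_addHaar, hF]
  have h1 : ∫ y in Set.Ioi (0 : ℝ), y ^ (2 - 1) •
      (Set.Iic R).indicator (fun r => Real.exp (-ε * r ^ 2)) y =
      ∫ y in (0 : ℝ)..R, y * Real.exp (-ε * y ^ 2) := by
    rw [intervalIntegral.integral_of_le hR, ← Set.Ioi_inter_Iic, Set.inter_comm,
      ← Measure.restrict_restrict measurableSet_Iic, ← integral_indicator measurableSet_Iic]
    refine integral_congr_ae (Eventually.of_forall fun y => ?_)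
    by_cases h : y ≤ R <;> simp [Set.indicator, h]
  have h2 : ∫ y in (0 : ℝ)..R, y * Real.exp (-ε * y ^ 2) = (1 - Real.exp (-ε * R ^ 2)) / (2 * ε) := by
    have hd : ∀ y ∈ Set.uIcc (0 : ℝ) R,
        HasDerivAt (fun y => -(Real.exp (-ε * y ^ 2)) / (2 * ε)) (y * Real.exp (-ε * y ^ 2)) y := by
      intro y _
      have := (((hasDerivAt_pow 2 y).const_mul (-ε)).exp.neg).div_const (2 * ε)
      refine this.congr_deriv ?_
      field_simp
      norm_num
      ring
    rw [intervalIntegral.integral_eq_sub_of_hasDerivAt hd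
      (Continuous.intervalIntegrable (by fun_prop) _ _)]
    simp
    ring
  rw [h1, h2]
  simp only [nsmul_eq_mul, smul_eq_mul]
  push_cast
  ring

theorem norm_ball_transGauss_sub_le (hF : Module.finrank ℝ F = 2) {ε K T : ℝ} (hε : 0 < ε)
    (hεT : ε ≤ T) {L : F →L[ℝ] ℂ} (hL : ‖L‖ ≤ K) {R : ℝ} (hR : 0 ≤ R) :
    ‖(∫ s in Metric.closedBall (0 : F) R, transGauss ε L s) -
      ((2 * (volume : Measure F).real (Metric.ball 0 1) *
        ((1 - Real.exp (-ε * R ^ 2)) / (2 * ε)) : ℝ) : ℂ)‖ ≤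
      16 * Real.exp (2 * T * K ^ 2) * K ^ 2 * (Real.pi / (1 / 4)) := by
  have hK : 0 ≤ K := (norm_nonneg _).trans hL
  set B := Metric.closedBall (0 : F) R
  have hB : MeasurableSet B := Metric.isClosed_closedBall.measurableSet
  have hcB : IsCompact B := isCompact_closedBall _ _
  have hodd : ∫ s in B, (Real.exp (-ε * ‖s‖ ^ 2) : ℂ) * (-2 * ε * L s) = 0 := by
    rw [← integral_indicator hB]
    refine integral_odd_eq_zero _ fun s => ?_
    by_cases h : s ∈ B
    · have h' : -s ∈ B := by simpa [B] using h
      simp [h, h']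
    · have h' : -s ∉ B := by simpa [B] using h
      simp [h, h']
  have hc1 : Continuous fun s : F => (Real.exp (-ε * ‖s‖ ^ 2) : ℂ) := by fun_prop
  have hc2 : Continuous fun s : F => (Real.exp (-ε * ‖s‖ ^ 2) : ℂ) * (-2 * ε * L s) := by fun_prop
  have hc3 := continuous_transGauss ε L
  have hc4 : Continuous fun s => transGauss ε L s - (Real.exp (-ε * ‖s‖ ^ 2) : ℂ) := hc3.sub hc1
  rw [← integral_ball_gauss hF hε hR, ← integral_complex_ofReal,
    ← integral_sub (hc3.continuousOn.integrableOn_compact hcB)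
      (hc1.continuousOn.integrableOn_compact hcB), ← sub_zero (∫ s in B, _), ← hodd,
    ← integral_sub (hc4.continuousOn.integrableOn_compact hcB)
      (hc2.continuousOn.integrableOn_compact hcB)]
  set M := Real.exp (2 * T * K ^ 2) with hM
  have hpt : ∀ s : F, ‖transGauss ε L s - (Real.exp (-ε * ‖s‖ ^ 2) : ℂ) -
      (Real.exp (-ε * ‖s‖ ^ 2) : ℂ) * (-2 * ε * L s)‖ ≤
      16 * M * K ^ 2 * (ε * Real.exp (-(1 / 4 * ε) * ‖s‖ ^ 2)) := by
    intro s
    set z : ℂ := -2 * ε * L s with hz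
    have e1 : transGauss ε L s = (Real.exp (-ε * ‖s‖ ^ 2) : ℂ) * Complex.exp z := by
      rw [transGauss, Complex.ofReal_exp, ← Complex.exp_add, hz]
      congr 1; push_cast; ring
    have hzn : ‖z‖ ≤ 2 * ε * K * ‖s‖ := by
      rw [hz, norm_mul]
      have : ‖(-2 * ε : ℂ)‖ = 2 * ε := by simp [abs_of_pos hε]
      rw [this, mul_assoc (2 * ε)]
      exact mul_le_mul_of_nonneg_left ((L.le_opNorm s).trans (by gcongr)) (by positivity)
    have h2 := Complex.norm_exp_sub_sum_le_norm_mul_exp z 2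
    simp only [Finset.sum_range_succ, Finset.sum_range_zero, pow_zero, pow_one, Nat.factorial,
      Nat.cast_one, div_one, zero_add, mul_one] at h2
    rw [e1, show (Real.exp (-ε * ‖s‖ ^ 2) : ℂ) * Complex.exp z - (Real.exp (-ε * ‖s‖ ^ 2) : ℂ) -
      (Real.exp (-ε * ‖s‖ ^ 2) : ℂ) * z = (Real.exp (-ε * ‖s‖ ^ 2) : ℂ) *
        (Complex.exp z - (1 + z)) by ring, norm_mul, Complex.norm_real, Real.norm_eq_abs,
      Real.abs_exp]
    have h3 : Real.exp ‖z‖ ≤ M * Real.exp (1 / 2 * ε * ‖s‖ ^ 2) := by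
      rw [hM, ← Real.exp_add]
      gcongr
      have h3 : 2 * T * K ^ 2 ≥ 2 * ε * K ^ 2 := by gcongr
      nlinarith [mul_nonneg hε.le (sq_nonneg (‖s‖ - 2 * K))]
    have h4 : ‖z‖ ^ 2 ≤ 16 * K ^ 2 * ε * Real.exp (1 / 4 * ε * ‖s‖ ^ 2) := by
      have h5 : ‖z‖ ^ 2 ≤ (2 * ε * K * ‖s‖) ^ 2 := by gcongr
      have h6 := Real.add_one_le_exp (1 / 4 * ε * ‖s‖ ^ 2)
      have h7 : 1 / 4 * ε * ‖s‖ ^ 2 ≤ Real.exp (1 / 4 * ε * ‖s‖ ^ 2) := by linarith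
      have h8 := mul_le_mul_of_nonneg_left h7 (show 0 ≤ 16 * K ^ 2 * ε by positivity)
      refine h5.trans (le_trans (le_of_eq ?_) h8)
      ring
    calc Real.exp (-ε * ‖s‖ ^ 2) * ‖Complex.exp z - (1 + z)‖
        ≤ Real.exp (-ε * ‖s‖ ^ 2) * ((16 * K ^ 2 * ε * Real.exp (1 / 4 * ε * ‖s‖ ^ 2)) *
          (M * Real.exp (1 / 2 * ε * ‖s‖ ^ 2))) := by
          gcongr
          exact h2.trans (by gcongr)
      _ = 16 * M * K ^ 2 * (ε * (Real.exp (-ε * ‖s‖ ^ 2) * Real.exp (1 / 4 * ε * ‖s‖ ^ 2) *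
            Real.exp (1 / 2 * ε * ‖s‖ ^ 2))) := by ring
      _ = _ := by
          rw [← Real.exp_add, ← Real.exp_add]; ring_nf
  have hI : Integrable fun s : F => 16 * M * K ^ 2 * (ε * Real.exp (-(1 / 4 * ε) * ‖s‖ ^ 2)) :=
    ((integrable_exp_neg_mul_norm_sq (by positivity)).const_mul _).const_mul _
  refine (norm_integral_le_integral_norm _).trans ?_
  calc _ ≤ ∫ s in B, 16 * M * K ^ 2 * (ε * Real.exp (-(1 / 4 * ε) * ‖s‖ ^ 2)) :=
        integral_mono_of_nonneg (Eventually.of_forall fun t => norm_nonneg _)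
          hI.integrableOn (Eventually.of_forall hpt)
    _ ≤ ∫ s : F, 16 * M * K ^ 2 * (ε * Real.exp (-(1 / 4 * ε) * ‖s‖ ^ 2)) :=
        setIntegral_le_integral hI (Eventually.of_forall fun t => by positivity)
    _ = _ := by
        rw [integral_const_mul, integral_const_mul,
          integral_exp_neg_mul_sq_norm_eq hε (by norm_num), hF]
        norm_num
        rw [mul_comm _ (ε⁻¹), mul_inv_cancel_left₀ hε.ne']
        exact Or.inl rfl

end BallBound

end

section

variable {d : ℕ}

/-- `ξ ↦ k ξ` as a real-linear functional. -/
def cdotL (k : CV d) : RV d →L[ℝ] ℂ :=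
  Complex.ofRealCLM.comp (innerSL ℝ (reV k)) +
    Complex.I • Complex.ofRealCLM.comp (innerSL ℝ (imV k))

theorem cdotL_apply (k : CV d) (ξ : RV d) : cdotL k ξ = cdot k (toC ξ) := by
  rw [cdot_toC]
  simp [cdotL, mul_comm]

theorem norm_unit {x : RV d} (hx : x ≠ 0) : ‖‖x‖⁻¹ • x‖ = 1 := by
  have : ‖x‖ ≠ 0 := norm_ne_zero_iff.2 hx
  simp [norm_smul, this]

/-- The functional `cdotL k` on the hyperplane orthogonal to `n`. -/
def cdotPerp (k : CV d) (n : RV d) : Perp n →L[ℝ] ℂ :=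
  (cdotL k).comp ((Submodule.span ℝ {n})ᗮ).subtypeL

theorem norm_cdotPerp_le (k : CV d) (n : RV d) : ‖cdotPerp k n‖ ≤ ‖cdotL k‖ := by
  refine ((cdotL k).opNorm_comp_le _).trans ?_
  exact mul_le_of_le_one_right (norm_nonneg _) (Submodule.norm_subtypeL_le _)

theorem symb_slicePt {n : RV d} (hn : ‖n‖ = 1) (k : CV d) (p : ℝ × Perp n) :
    symb k (slicePt n p) = (p.1 : ℂ) ^ 2 + ((‖p.2‖ ^ 2 : ℝ) : ℂ) + 2 * (p.1 * cdotL k n +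
      cdotPerp k n p.2) := by
  rw [symb, norm_sq_slicePt hn, ← cdotL_apply]
  have : cdotL k (slicePt n p) = p.1 * cdotL k n + cdotPerp k n p.2 := by
    simp [slicePt, cdotPerp]
  rw [this]
  push_cast
  ring

/-- The heat kernel on slices in the direction of `x`. -/
theorem heatKer_slicePt {x n : RV d} (hn : ‖n‖ = 1) (hx : x = ‖x‖ • n) (ε : ℝ) (k : CV d)
    (p : ℝ × Perp n) :
    heatKer ε x k (slicePt n p) =
      Complex.exp ((Complex.I * (‖x‖ : ℂ) - 2 * ε * cdotL k n) * p.1) *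
        Complex.exp (-ε * (p.1 : ℂ) ^ 2) * transGauss ε (cdotPerp k n) p.2 := by
  have h1 : inner ℝ (slicePt n p) x = ‖x‖ * p.1 := by
    nth_rw 1 [hx]
    rw [inner_smul_right, real_inner_comm, inner_slicePt_left hn]
  rw [heatKer, planeWave_toC, h1, symb_slicePt hn, transGauss, ← Complex.exp_add,
    ← Complex.exp_add, ← Complex.exp_add]
  congr 1
  push_cast
  ring

theorem heatKer_ball_slice {x n : RV d} (hn : ‖n‖ = 1) {N : ℝ} (hN : 0 ≤ N) {ε : ℝ}
    (k : CV d) :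
    ∫ ξ in Metric.closedBall (0 : RV d) N, heatKer ε x k ξ =
      ∫ p : ℝ × Perp n, {p : ℝ × Perp n | p.1 ^ 2 + ‖p.2‖ ^ 2 ≤ N ^ 2}.indicator
        (fun p => heatKer ε x k (slicePt n p)) p := by
  rw [← integral_indicator Metric.isClosed_closedBall.measurableSet, integral_slicePt n hn]
  congr 1
  ext p
  have : slicePt n p ∈ Metric.closedBall (0 : RV d) N ↔ p.1 ^ 2 + ‖p.2‖ ^ 2 ≤ N ^ 2 := by
    rw [mem_closedBall_zero_iff, ← norm_sq_slicePt hn, pow_le_pow_iff_left₀ (norm_nonneg _) hN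
      two_ne_zero]
  by_cases h : p.1 ^ 2 + ‖p.2‖ ^ 2 ≤ N ^ 2
  · rw [Set.indicator_of_mem (this.2 h), Set.indicator_of_mem (by exact h)]
  · rw [Set.indicator_of_notMem (mt this.1 h), Set.indicator_of_notMem (by exact h)]

theorem integrable_heatKer_ball_slice {x n : RV d} (hn : ‖n‖ = 1) (N : ℝ) {ε : ℝ} (hε : 0 < ε)
    (k : CV d) :
    Integrable ({p : ℝ × Perp n | p.1 ^ 2 + ‖p.2‖ ^ 2 ≤ N ^ 2}.indicator
        (fun p => heatKer ε x k (slicePt n p))) := by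
  refine ((integrable_slicePt n hn _).1 (integrable_heatKer hε x k)).indicator ?_
  exact (isClosed_le (by fun_prop) continuous_const).measurableSet

theorem heat_ball_bound_two (hd : d = 2) {x : RV d} (hx : x ≠ 0) (k : CV d) {T ε₀ : ℝ}
    (hT : 0 < T) (hε₀ : 2 * ε₀ * ‖cdotL k‖ ≤ ‖x‖ / 2) :
    ∃ C : ℝ, ∀ ε : ℝ, 0 < ε → ε ≤ T → ε ≤ ε₀ → ∀ N : ℝ, 0 ≤ N →
      ‖∫ ξ in Metric.closedBall (0 : RV d) N, heatKer ε x k ξ‖ ≤ C * (Real.sqrt ε)⁻¹ := by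
  set n : RV d := ‖x‖⁻¹ • x with hn'
  have hX : 0 < ‖x‖ := norm_pos_iff.2 hx
  have hn : ‖n‖ = 1 := norm_unit hx
  have hn0 : n ≠ 0 := by rintro h; rw [h] at hn; simp at hn
  have hxn : x = ‖x‖ • n := by simp [hn', smul_smul, hX.ne']
  have hfr : Module.finrank ℝ (Perp n) = 1 := by
    have := finrank_perp hn0
    rw [finrank_euclideanSpace_fin] at this
    omega
  set K := ‖cdotL k‖ with hK
  have hK0 : 0 ≤ K := norm_nonneg _
  set M := Real.exp (2 * T * K ^ 2) with hM
  set A := ‖x‖ / 2 with hA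
  have hApos : 0 < A := by positivity
  set B := 2 * M / A + M * (4 + 18 * Real.sqrt (Real.pi / (1 / 4))) / A ^ 2 * Real.sqrt T with hB
  refine ⟨M * B * Real.sqrt (Real.pi / (1 / 2)), fun ε hε hεT hεε N hN => ?_⟩
  rw [heatKer_ball_slice hn hN, Measure.volume_eq_prod, integral_prod_symm _
    (by rw [← Measure.volume_eq_prod]; exact integrable_heatKer_ball_slice hn N hε k)]
  have hnκ : ‖cdotL k n‖ ≤ K := by
    simpa [hn] using (cdotL k).le_opNorm n
  set α : ℂ := Complex.I * (‖x‖ : ℂ) - 2 * ε * cdotL k n with hα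
  have hre : |α.re| ≤ 2 * ε * K := by
    have : α.re = -(2 * ε * (cdotL k n).re) := by
      rw [hα]
      simp [mul_assoc]
    rw [this, abs_neg, abs_mul, abs_of_pos (by positivity : 0 < 2 * ε)]
    gcongr
    exact (Complex.abs_re_le_norm _).trans hnκ
  have hε₀pos : 0 < ε₀ := hε.trans_le hεε
  have hαA : A ≤ ‖α‖ := by
    have h1 : ‖Complex.I * (‖x‖ : ℂ)‖ = ‖x‖ := by simp
    have h2 : ‖(2 * ε * cdotL k n : ℂ)‖ ≤ 2 * ε₀ * K := by
      rw [norm_mul]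
      have : ‖(2 * ε : ℂ)‖ = 2 * ε := by simp [abs_of_pos hε]
      rw [this]
      gcongr
    have h3 := norm_sub_norm_le (Complex.I * (‖x‖ : ℂ)) (2 * ε * cdotL k n)
    rw [h1] at h3
    linarith
  have hinner : ∀ s : Perp n, ‖∫ t : ℝ, {p : ℝ × Perp n | p.1 ^ 2 + ‖p.2‖ ^ 2 ≤ N ^ 2}.indicator
        (fun p => heatKer ε x k (slicePt n p)) (t, s)‖ ≤
      M * Real.exp (-(1 / 2 * ε) * ‖s‖ ^ 2) * B := by
    intro s
    have hB0 : 0 ≤ B := by positivity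
    by_cases hs : ‖s‖ ^ 2 ≤ N ^ 2
    · set S := Real.sqrt (N ^ 2 - ‖s‖ ^ 2) with hS
      have hS0 : 0 ≤ S := Real.sqrt_nonneg _
      have hSsq : S ^ 2 = N ^ 2 - ‖s‖ ^ 2 := Real.sq_sqrt (by linarith)
      have e1 : ∀ t : ℝ, {p : ℝ × Perp n | p.1 ^ 2 + ‖p.2‖ ^ 2 ≤ N ^ 2}.indicator
          (fun p => heatKer ε x k (slicePt n p)) (t, s) =
          (Set.Icc (-S) S).indicator (fun t : ℝ => (Complex.exp (α * t) *
            (Complex.exp (-ε * (t : ℂ) ^ 2) - 0)) * transGauss ε (cdotPerp k n) s) t := by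
        intro t
        have hiff : t ∈ Set.Icc (-S) S ↔ t ^ 2 + ‖s‖ ^ 2 ≤ N ^ 2 := by
          rw [Set.mem_Icc, ← abs_le, ← sq_le_sq₀ (abs_nonneg t) hS0, sq_abs, hSsq]
          constructor <;> intro h <;> linarith
        by_cases h : t ^ 2 + ‖s‖ ^ 2 ≤ N ^ 2
        · rw [Set.indicator_of_mem (hiff.2 h), Set.indicator_of_mem (by exact h),
            heatKer_slicePt hn hxn, sub_zero]
        · rw [Set.indicator_of_notMem (mt hiff.1 h), Set.indicator_of_notMem (by exact h)]
      simp only [e1]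
      rw [integral_indicator measurableSet_Icc, integral_Icc_eq_integral_Ioc,
        ← intervalIntegral.integral_of_le (by linarith), intervalIntegral.integral_mul_const,
        norm_mul, mul_comm]
      have hb := osc_bound hε hεT hre hApos hαA 0 hS0
      refine mul_le_mul (norm_transGauss_le hε hεT (norm_cdotPerp_le k n) s) (hb.trans ?_)
        (norm_nonneg _) (by positivity)
      rw [hB]
      have hg : ‖Complex.exp (-ε * (S : ℂ) ^ 2) - 0‖ = Real.exp (-(ε * S ^ 2)) := by
        rw [sub_zero, Complex.norm_exp]
        congr 1
        norm_cast
        simp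
      have h1 := norm_exp_mul_le hε hεT hre S
      have h2 := norm_exp_mul_le (α := -α) hε hεT (by simpa using hre) S
      rw [neg_mul] at h2
      have h3 : Real.exp (ε * S ^ 2 / 2) * Real.exp (-(ε * S ^ 2)) ≤ 1 := by
        rw [← Real.exp_add]
        exact Real.exp_le_one_iff.2 (by nlinarith [mul_nonneg hε.le (sq_nonneg S)])
      have h4 : (‖Complex.exp (α * S)‖ + ‖Complex.exp (-(α * S))‖) * Real.exp (-(ε * S ^ 2)) ≤
          2 * M := by
        calc _ ≤ (M * Real.exp (ε * S ^ 2 / 2) + M * Real.exp (ε * S ^ 2 / 2)) *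
              Real.exp (-(ε * S ^ 2)) := by gcongr
          _ = 2 * M * (Real.exp (ε * S ^ 2 / 2) * Real.exp (-(ε * S ^ 2))) := by ring
          _ ≤ 2 * M * 1 := by gcongr
          _ = _ := by ring
      rw [hg]
      gcongr
    · have e1 : ∀ t : ℝ, {p : ℝ × Perp n | p.1 ^ 2 + ‖p.2‖ ^ 2 ≤ N ^ 2}.indicator
          (fun p => heatKer ε x k (slicePt n p)) (t, s) = 0 := by
        intro t
        refine Set.indicator_of_notMem ?_ _
        intro h
        have h' : t ^ 2 + ‖s‖ ^ 2 ≤ N ^ 2 := h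
        nlinarith [sq_nonneg t]
      simp only [e1, integral_zero, norm_zero]
      positivity
  have hI : Integrable fun s : Perp n => M * Real.exp (-(1 / 2 * ε) * ‖s‖ ^ 2) * B :=
    ((integrable_exp_neg_mul_norm_sq (by positivity)).const_mul _).mul_const _
  refine (norm_integral_le_of_norm_le hI (Eventually.of_forall hinner)).trans (le_of_eq ?_)
  rw [integral_mul_const, integral_const_mul, integral_exp_neg_mul_sq_norm_eq hε (by norm_num),
    hfr]
  simp only [Nat.cast_one, Real.sqrt_eq_rpow]
  ring

theorem heat_ball_bound_three (hd : d = 3) {x : RV d} (hx : x ≠ 0) (k : CV d) {T ε₀ : ℝ}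
    (hε₀ : 2 * ε₀ * ‖cdotL k‖ ≤ ‖x‖ / 2) :
    ∃ C : ℝ, ∀ ε : ℝ, 0 < ε → ε ≤ T → ε ≤ ε₀ → ∀ N : ℝ, 0 ≤ N →
      ‖∫ ξ in Metric.closedBall (0 : RV d) N, heatKer ε x k ξ‖ ≤ C * (Real.sqrt ε)⁻¹ := by
  set n : RV d := ‖x‖⁻¹ • x with hn'
  have hX : 0 < ‖x‖ := norm_pos_iff.2 hx
  have hn : ‖n‖ = 1 := norm_unit hx
  have hn0 : n ≠ 0 := by rintro h; rw [h] at hn; simp at hn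
  have hxn : x = ‖x‖ • n := by simp [hn', smul_smul, hX.ne']
  have hfr : Module.finrank ℝ (Perp n) = 2 := by
    have := finrank_perp hn0
    rw [finrank_euclideanSpace_fin] at this
    omega
  set K := ‖cdotL k‖ with hK
  have hK0 : 0 ≤ K := norm_nonneg _
  set M := Real.exp (2 * T * K ^ 2) with hM
  set A := ‖x‖ / 2 with hA
  have hApos : 0 < A := by positivity
  set v := (volume : Measure (Perp n)).real (Metric.ball 0 1)
  have hv : 0 ≤ v := measureReal_nonneg
  set B := M * (4 + 18 * Real.sqrt (Real.pi / (1 / 4))) / A ^ 2 with hB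
  set R₀ := 16 * M * K ^ 2 * (Real.pi / (1 / 4)) with hR₀
  refine ⟨v * B + R₀ * (M * Real.sqrt (Real.pi / (1 / 2))), fun ε hε hεT hεε N hN => ?_⟩
  rw [heatKer_ball_slice hn hN, Measure.volume_eq_prod, integral_prod _
    (by rw [← Measure.volume_eq_prod]; exact integrable_heatKer_ball_slice hn N hε k)]
  have hnκ : ‖cdotL k n‖ ≤ K := by
    simpa [hn] using (cdotL k).le_opNorm n
  set α : ℂ := Complex.I * (‖x‖ : ℂ) - 2 * ε * cdotL k n with hα
  have hre : |α.re| ≤ 2 * ε * K := by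
    have : α.re = -(2 * ε * (cdotL k n).re) := by
      rw [hα]
      simp [mul_assoc]
    rw [this, abs_neg, abs_mul, abs_of_pos (by positivity : 0 < 2 * ε)]
    gcongr
    exact (Complex.abs_re_le_norm _).trans hnκ
  have hε₀pos : 0 < ε₀ := hε.trans_le hεε
  have hαA : A ≤ ‖α‖ := by
    have h1 : ‖Complex.I * (‖x‖ : ℂ)‖ = ‖x‖ := by simp
    have h2 : ‖(2 * ε * cdotL k n : ℂ)‖ ≤ 2 * ε₀ * K := by
      rw [norm_mul]
      have : ‖(2 * ε : ℂ)‖ = 2 * ε := by simp [abs_of_pos hε]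
      rw [this]
      gcongr
    have h3 := norm_sub_norm_le (Complex.I * (‖x‖ : ℂ)) (2 * ε * cdotL k n)
    rw [h1] at h3
    linarith
  set h := transGauss ε (cdotPerp k n) with hh
  set J : ℝ → ℂ := fun t => ∫ s : Perp n,
    {p : ℝ × Perp n | p.1 ^ 2 + ‖p.2‖ ^ 2 ≤ N ^ 2}.indicator
        (fun p => heatKer ε x k (slicePt n p)) (t, s) with hJ
  set main : ℝ → ℂ := fun t => Complex.exp (α * t) *
    (Complex.exp (-ε * (t : ℂ) ^ 2) - Complex.exp (-ε * (N : ℂ) ^ 2)) * ((v / ε : ℝ) : ℂ) with hmain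
  have hJm : ∀ t : ℝ, ‖J t - (Set.Icc (-N) N).indicator main t‖ ≤
      R₀ * (M * Real.exp (-(1 / 2 * ε) * t ^ 2)) := by
    intro t
    have hR0 : 0 ≤ R₀ := by positivity
    by_cases ht : t ∈ Set.Icc (-N) N
    · have ht2 : t ^ 2 ≤ N ^ 2 := by
        rw [← sq_abs t]
        have := abs_le.2 ht
        gcongr
      set R := Real.sqrt (N ^ 2 - t ^ 2) with hR
      have hR0' : 0 ≤ R := Real.sqrt_nonneg _
      have hRsq : R ^ 2 = N ^ 2 - t ^ 2 := Real.sq_sqrt (by linarith)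
      set g : ℂ := Complex.exp (α * t) * Complex.exp (-ε * (t : ℂ) ^ 2) with hg
      have eJ : J t = g * ∫ s in Metric.closedBall (0 : Perp n) R, h s := by
        rw [hJ, ← integral_const_mul, ← integral_indicator Metric.isClosed_closedBall.measurableSet]
        refine integral_congr_ae (Eventually.of_forall fun s => ?_)
        have hiff : s ∈ Metric.closedBall (0 : Perp n) R ↔ t ^ 2 + ‖s‖ ^ 2 ≤ N ^ 2 := by
          rw [mem_closedBall_zero_iff, ← sq_le_sq₀ (norm_nonneg s) hR0', hRsq]
          constructor <;> intro h <;> linarith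
        simp only
        by_cases hs : t ^ 2 + ‖s‖ ^ 2 ≤ N ^ 2
        · rw [Set.indicator_of_mem (hiff.2 hs), Set.indicator_of_mem (by exact hs),
            heatKer_slicePt hn hxn]
        · rw [Set.indicator_of_notMem (mt hiff.1 hs), Set.indicator_of_notMem (by exact hs)]
      have em : main t = g * ((2 * v * ((1 - Real.exp (-ε * R ^ 2)) / (2 * ε)) : ℝ) : ℂ) := by
        have e5 : Complex.exp (-ε * (N : ℂ) ^ 2) =
            Complex.exp (-ε * (t : ℂ) ^ 2) * Complex.exp (-ε * (R : ℂ) ^ 2) := by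
          rw [← Complex.exp_add]
          congr 1
          have : (R : ℂ) ^ 2 = (N : ℂ) ^ 2 - (t : ℂ) ^ 2 := by exact_mod_cast hRsq
          rw [this]; ring
        have hε' : (ε : ℂ) ≠ 0 := by exact_mod_cast hε.ne'
        rw [hmain, hg]
        simp only
        rw [e5]
        push_cast
        field_simp
      rw [Set.indicator_of_mem ht, eJ, em, ← mul_sub, norm_mul, mul_comm]
      refine mul_le_mul (norm_ball_transGauss_sub_le hfr hε hεT (norm_cdotPerp_le k n) hR0') ?_
        (norm_nonneg _) hR0
      have hgn : ‖Complex.exp (-ε * (t : ℂ) ^ 2)‖ = Real.exp (-(ε * t ^ 2)) := by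
        rw [Complex.norm_exp]
        congr 1
        norm_cast
        simp
      rw [hg, norm_mul, hgn]
      calc _ ≤ (M * Real.exp (ε * t ^ 2 / 2)) * Real.exp (-(ε * t ^ 2)) := by
            gcongr; exact norm_exp_mul_le hε hεT hre t
        _ = _ := by rw [mul_assoc, ← Real.exp_add]; ring_nf
    · have : J t = 0 := by
        rw [hJ]
        simp only
        rw [show (0 : ℂ) = ∫ s : Perp n, (0 : ℂ) by simp]
        refine integral_congr_ae (Eventually.of_forall fun s => ?_)
        refine Set.indicator_of_notMem ?_ _
        intro hmem
        have h' : t ^ 2 + ‖s‖ ^ 2 ≤ N ^ 2 := hmem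
        apply ht
        rw [Set.mem_Icc, ← abs_le, ← sq_le_sq₀ (abs_nonneg t) hN, sq_abs]
        nlinarith [sq_nonneg ‖s‖]
      rw [this, Set.indicator_of_notMem ht, sub_zero, norm_zero]
      positivity
  have hJint : Integrable J := by
    have := (integrable_heatKer_ball_slice (x := x) hn N hε k)
    rw [Measure.volume_eq_prod] at this
    exact this.integral_prod_left
  have hmc : Continuous main := by rw [hmain]; fun_prop
  have hmint : Integrable ((Set.Icc (-N) N).indicator main) :=
    (hmc.continuousOn.integrableOn_compact isCompact_Icc).integrable_indicator measurableSet_Icc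
  have hI : Integrable fun t : ℝ => R₀ * (M * Real.exp (-(1 / 2 * ε) * t ^ 2)) :=
    ((integrable_exp_neg_mul_sq (by positivity)).const_mul _).const_mul _
  have h1 : ‖∫ t, (J t - (Set.Icc (-N) N).indicator main t)‖ ≤
      R₀ * (M * Real.sqrt (Real.pi / (1 / 2))) * (Real.sqrt ε)⁻¹ := by
    refine (norm_integral_le_of_norm_le hI (Eventually.of_forall hJm)).trans (le_of_eq ?_)
    rw [integral_const_mul, integral_const_mul, integral_exp_neg_mul_sq_real_eq (by norm_num)]
    ring
  have h2 : ‖∫ t, (Set.Icc (-N) N).indicator main t‖ ≤ v * B * (Real.sqrt ε)⁻¹ := by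
    rw [integral_indicator measurableSet_Icc, integral_Icc_eq_integral_Ioc,
      ← intervalIntegral.integral_of_le (by linarith), hmain,
      intervalIntegral.integral_mul_const, norm_mul, Complex.norm_real, Real.norm_eq_abs,
      abs_of_nonneg (by positivity)]
    have hb := osc_bound hε hεT hre hApos hαA (Complex.exp (-ε * (N : ℂ) ^ 2)) hN
    rw [sub_self, norm_zero, mul_zero, zero_div, zero_add] at hb
    have hs := Real.mul_self_sqrt hε.le
    have hsp : 0 < Real.sqrt ε := Real.sqrt_pos.2 hε
    calc _ ≤ B * Real.sqrt ε * (v / ε) := by gcongr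
      _ = _ := by
        field_simp
        linear_combination (B * v) * hs
  rw [integral_sub hJint hmint] at h1
  calc ‖∫ t, J t‖ = ‖((∫ t, J t) - ∫ t, (Set.Icc (-N) N).indicator main t) +
        ∫ t, (Set.Icc (-N) N).indicator main t‖ := by rw [sub_add_cancel]
    _ ≤ _ := (norm_add_le _ _).trans (add_le_add h1 h2)
    _ = _ := by ring

theorem heat_ball_bound (hd : d = 2 ∨ d = 3) {x : RV d} (hx : x ≠ 0) (k : CV d) {T : ℝ}
    (hT : 0 < T) :
    ∃ C : ℝ, ∀ ε : ℝ, 0 < ε → ε ≤ T → ∀ N : ℝ, 0 ≤ N →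
      ‖∫ ξ in Metric.closedBall (0 : RV d) N, heatKer ε x k ξ‖ ≤ C * (Real.sqrt ε)⁻¹ := by
  have hX : 0 < ‖x‖ := norm_pos_iff.2 hx
  have hK0 : 0 ≤ ‖cdotL k‖ := norm_nonneg _
  set ε₀ := ‖x‖ / (4 * (‖cdotL k‖ + 1)) with hε₀
  have hε₀pos : 0 < ε₀ := by positivity
  have hcond : 2 * ε₀ * ‖cdotL k‖ ≤ ‖x‖ / 2 := by
    rw [hε₀, mul_div_assoc', div_mul_eq_mul_div, div_le_div_iff₀ (by positivity) (by norm_num)]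
    nlinarith
  obtain ⟨C₁, h1⟩ : ∃ C : ℝ, ∀ ε : ℝ, 0 < ε → ε ≤ T → ε ≤ ε₀ → ∀ N : ℝ, 0 ≤ N →
      ‖∫ ξ in Metric.closedBall (0 : RV d) N, heatKer ε x k ξ‖ ≤ C * (Real.sqrt ε)⁻¹ := by
    rcases hd with hd | hd
    · exact heat_ball_bound_two hd hx k hT hcond
    · exact heat_ball_bound_three hd hx k hcond
  set C₂ := ∫ ξ : RV d, Real.exp (2 * T * ‖reV k‖ ^ 2) * Real.exp (-(ε₀ / 2) * ‖ξ‖ ^ 2)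
  have hC₂ : 0 ≤ C₂ := integral_nonneg fun ξ => by positivity
  refine ⟨max C₁ (C₂ * Real.sqrt T), fun ε hε hεT N hN => ?_⟩
  by_cases hle : ε ≤ ε₀
  · exact (h1 ε hε hεT hle N hN).trans (by gcongr; exact le_max_left _ _)
  · have hI : Integrable fun ξ : RV d =>
        Real.exp (2 * T * ‖reV k‖ ^ 2) * Real.exp (-(ε₀ / 2) * ‖ξ‖ ^ 2) :=
      (integrable_exp_neg_mul_norm_sq (by positivity)).const_mul _
    have h2 : ‖∫ ξ in Metric.closedBall (0 : RV d) N, heatKer ε x k ξ‖ ≤ C₂ := by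
      refine (norm_integral_le_of_norm_le hI.integrableOn (Eventually.of_forall fun ξ => ?_)).trans
        (setIntegral_le_integral hI (Eventually.of_forall fun ξ => by positivity))
      refine (norm_heatKer_le hε.le x k ξ).trans ?_
      gcongr
      exact (not_le.1 hle).le
    refine h2.trans ?_
    have h3 : 1 ≤ Real.sqrt T * (Real.sqrt ε)⁻¹ := by
      rw [← div_eq_mul_inv, one_le_div (Real.sqrt_pos.2 hε)]
      exact Real.sqrt_le_sqrt hεT
    calc C₂ ≤ C₂ * (Real.sqrt T * (Real.sqrt ε)⁻¹) := le_mul_of_one_le_right hC₂ h3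
      _ = C₂ * Real.sqrt T * (Real.sqrt ε)⁻¹ := by ring
      _ ≤ _ := by gcongr; exact le_max_right _ _

/-- The part of the Green function that comes from the heat kernel for times up to `T`. -/
def heatTail (d : ℕ) (T : ℝ) (E : ℂ) (r : ℝ) : ℂ := ∫ ε in (0 : ℝ)..T, heatFun d E r ε

theorem inv_eq_exp_add_integral {w : ℂ} (hw : w ≠ 0) (T : ℝ) :
    w⁻¹ = Complex.exp (-T * w) * w⁻¹ + ∫ ε in (0 : ℝ)..T, Complex.exp (-ε * w) := by
  have h := integral_exp_mul_complex (a := 0) (b := T) (neg_ne_zero.2 hw)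
  have e : ∀ ε : ℝ, Complex.exp (-ε * w) = Complex.exp (-w * ε) := fun ε => by ring_nf
  simp only [e, h]
  simp only [Complex.ofReal_zero, mul_zero, Complex.exp_zero]
  field_simp
  ring

theorem setIntegral_greenIntegrand (hd : 2 ≤ d) {k : CV d} (hk : imV k ≠ 0) (x : RV d) {T : ℝ}
    (hT : 0 < T) (N : ℝ) :
    ∫ ξ in Metric.closedBall (0 : RV d) N, greenIntegrand x k ξ =
      (∫ ξ in Metric.closedBall (0 : RV d) N,
        planeWave (toC ξ) x * (Complex.exp (-T * symb k ξ) * (symb k ξ)⁻¹)) +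
      ∫ ε in (0 : ℝ)..T, ∫ ξ in Metric.closedBall (0 : RV d) N, heatKer ε x k ξ := by
  have hswap : Integrable (Function.uncurry fun (ε : ℝ) (ξ : RV d) => heatKer ε x k ξ)
      ((volume.restrict (Set.Ioc 0 T)).prod
        (volume.restrict (Metric.closedBall (0 : RV d) N))) := by
    rw [Measure.prod_restrict]
    refine IntegrableOn.mono_set (t := Set.Icc 0 T ×ˢ Metric.closedBall (0 : RV d) N) ?_
      (Set.prod_mono Set.Ioc_subset_Icc_self subset_rfl)
    exact (continuous_heatKer x k).continuousOn.integrableOn_compact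
      (isCompact_Icc.prod (isCompact_closedBall _ _))
  have hI : Integrable (fun ξ : RV d => ∫ ε in Set.Ioc 0 T, heatKer ε x k ξ)
      (volume.restrict (Metric.closedBall (0 : RV d) N)) := hswap.integral_prod_right
  rw [intervalIntegral.integral_of_le hT.le, integral_integral_swap hswap, ← integral_add
    (integrable_regInt hd hk x hT).integrableOn hI]
  refine integral_congr_ae (ae_restrict_of_ae ?_)
  filter_upwards [ae_symb_ne_zero hk] with ξ hξ
  simp only [heatKer]
  rw [← intervalIntegral.integral_of_le hT.le, intervalIntegral.integral_const_mul,
    greenIntegrand_eq, ← mul_add, ← inv_eq_exp_add_integral hξ]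

theorem tendsto_integral_closedBall {f : RV d → ℂ} (hf : Integrable f) :
    Tendsto (fun N : ℝ => ∫ ξ in Metric.closedBall (0 : RV d) N, f ξ) atTop (𝓝 (∫ ξ, f ξ)) :=
  (aecover_closedBall (μ := volume) (x := (0 : RV d)) tendsto_id).integral_tendsto_of_countably_generated
    hf

theorem intervalIntegrable_inv_sqrt (T : ℝ) :
    IntervalIntegrable (fun ε : ℝ => (Real.sqrt ε)⁻¹) volume 0 T := by
  have h : IntervalIntegrable (fun ε : ℝ => ε ^ (-(1 / 2) : ℝ)) volume 0 T :=
    intervalIntegral.intervalIntegrable_rpow' (by norm_num)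
  refine h.mono_fun (by fun_prop) (Eventually.of_forall fun ε => ?_)
  simp only
  rcases lt_or_ge ε 0 with h | h
  · rw [Real.sqrt_eq_zero_of_nonpos h.le]
    simp
  · rw [Real.rpow_neg h, Real.sqrt_eq_rpow]

theorem tendsto_greenCutoff (hd : d = 2 ∨ d = 3) {k : CV d} (hk : imV k ≠ 0) {x : RV d}
    (hx : x ≠ 0) {T : ℝ} (hT : 0 < T) :
    Tendsto (greenCutoff x k) atTop (𝓝 (-(1 / (2 * (Real.pi : ℂ)) ^ d) *
      (regInt T x k + planeWave (-k) x * heatTail d T (cdot k k) ‖x‖))) := by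
  have hd2 : 2 ≤ d := by omega
  refine Tendsto.const_mul _ ?_
  have e : (fun N : ℝ => ∫ ξ in Metric.closedBall (0 : RV d) N, greenIntegrand x k ξ) =
      fun N => _ := funext fun N => setIntegral_greenIntegrand hd2 hk x hT N
  rw [e]
  refine (tendsto_integral_closedBall (integrable_regInt hd2 hk x hT)).add ?_
  rw [heatTail, ← intervalIntegral.integral_const_mul]
  obtain ⟨C, hC⟩ := heat_ball_bound hd hx k hT
  refine intervalIntegral.tendsto_integral_filter_of_dominated_convergence
    (fun ε => C * (Real.sqrt ε)⁻¹) (Eventually.of_forall fun N => ?_) ?_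
    ((intervalIntegrable_inv_sqrt T).const_mul C) ?_
  · exact ((continuous_heatKer x k).stronglyMeasurable.integral_prod_right
      (ν := volume.restrict (Metric.closedBall (0 : RV d) N))).aestronglyMeasurable
  · filter_upwards [eventually_ge_atTop 0] with N hN
    refine Eventually.of_forall fun ε hε => ?_
    rw [Set.uIoc_of_le hT.le] at hε
    exact hC ε hε.1 hε.2 N hN
  · refine Eventually.of_forall fun ε hε => ?_
    rw [Set.uIoc_of_le hT.le] at hε
    rw [← integral_heatKer hε.1]
    exact tendsto_integral_closedBall (integrable_heatKer hε.1 x k)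

theorem green_eq (hd : d = 2 ∨ d = 3) {k : CV d} (hk : imV k ≠ 0) {x : RV d}
    (hx : x ≠ 0) {T : ℝ} (hT : 0 < T) :
    green x k = -(1 / (2 * (Real.pi : ℂ)) ^ d) *
      (regInt T x k + planeWave (-k) x * heatTail d T (cdot k k) ‖x‖) :=
  (tendsto_greenCutoff hd hk hx hT).limUnder_eq

theorem greenConverges (hd : d = 2 ∨ d = 3) {k : CV d} (hk : imV k ≠ 0) {x : RV d}
    (hx : x ≠ 0) : GreenConverges x k := by
  refine ⟨fun N => integrableOn_greenIntegrand (by omega) hk x N, ?_⟩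
  rw [green_eq hd hk hx one_pos]
  exact tendsto_greenCutoff hd hk hx one_pos

/-- Translation of `k` by a real vector on the zero set of the symbol. -/
theorem symb_add_toC {k : CV d} {ξ : RV d} (h : symb k ξ = 0) (η : RV d) :
    symb (k + toC ξ) η = symb k (η + ξ) := by
  have h2 : symb k (η + ξ) = symb k η + symb k ξ + 2 * (inner ℝ ξ η : ℝ) := by
    simp only [symb, toC_add, cdot_add_right, norm_add_sq_real, real_inner_comm]
    push_cast
    ring
  rw [h2, h, symb, cdot_add_left, cdot_toC_toC, symb]
  ring

theorem cdot_self_add_toC {k : CV d} {ξ : RV d} (h : symb k ξ = 0) :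
    cdot (k + toC ξ) (k + toC ξ) = cdot k k := by
  have h1 : cdot (toC ξ) (toC ξ) = ((‖ξ‖ ^ 2 : ℝ) : ℂ) := by
    rw [cdot_toC_toC, real_inner_self_eq_norm_sq]
  rw [symb] at h
  rw [cdot_add_left, cdot_add_right, cdot_add_right, h1, cdot_comm (toC ξ) k]
  linear_combination h

theorem regInt_add_toC {T : ℝ} (x : RV d) {k : CV d} {ξ : RV d} (h : symb k ξ = 0) :
    regInt T x (k + toC ξ) = planeWave (-toC ξ) x * regInt T x k := by
  rw [regInt, regInt, ← integral_add_right_eq_self (μ := (volume : Measure (RV d)))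
    (fun η => planeWave (toC η) x * (Complex.exp (-T * symb k η) * (symb k η)⁻¹)) ξ,
    ← integral_const_mul]
  refine integral_congr_ae (Eventually.of_forall fun η => ?_)
  simp only
  rw [symb_add_toC h, toC_add, planeWave_add]
  linear_combination (-planeWave (toC η) x * (Complex.exp (-T * symb k (η + ξ)) *
    (symb k (η + ξ))⁻¹)) * planeWave_neg_mul (toC ξ) x

theorem green_add_toC (hd : d = 2 ∨ d = 3) {k : CV d} (hk : imV k ≠ 0) {x : RV d}
    (hx : x ≠ 0) {ξ : RV d} (h : symb k ξ = 0) :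
    green x (k + toC ξ) = planeWave (-toC ξ) x * green x k := by
  have hk' : imV (k + toC ξ) ≠ 0 := by rwa [imV_add, imV_toC, add_zero]
  rw [green_eq hd hk' hx one_pos, green_eq hd hk hx one_pos, regInt_add_toC x h,
    cdot_self_add_toC h, neg_add, planeWave_add]
  ring

/-- A smooth regularization of `w⁻¹` for `s > 0`; for `s = 0` it is `w⁻¹`. -/
def regInv (s : ℝ) (w : ℂ) : ℂ := (starRingEnd ℂ) w * ((‖w‖ ^ 2 + s : ℝ) : ℂ)⁻¹

theorem regInv_zero (w : ℂ) : regInv 0 w = w⁻¹ := by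
  rw [regInv, Complex.inv_def w, Complex.normSq_eq_norm_sq, add_zero, Complex.ofReal_inv]

theorem norm_regInv {s : ℝ} (hs : 0 ≤ s) (w : ℂ) : ‖regInv s w‖ = ‖w‖ * (‖w‖ ^ 2 + s)⁻¹ := by
  rw [regInv, norm_mul, RCLike.norm_conj, norm_inv, Complex.norm_real, Real.norm_of_nonneg
    (by positivity)]

theorem norm_regInv_le {s : ℝ} (hs : 0 ≤ s) (w : ℂ) : ‖regInv s w‖ ≤ ‖w‖⁻¹ := by
  rw [norm_regInv hs]
  rcases (norm_nonneg w).eq_or_lt with h | h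
  · rw [← h]; simp
  · rw [← div_eq_mul_inv, div_le_iff₀ (by positivity)]
    field_simp
    linarith

theorem norm_regInv_le_const {s : ℝ} (hs : 0 < s) (w : ℂ) : ‖regInv s w‖ ≤ s⁻¹ + 1 := by
  rw [norm_regInv hs.le, ← div_eq_mul_inv, div_le_iff₀ (by positivity)]
  have : (s⁻¹ + 1) * (‖w‖ ^ 2 + s) = s⁻¹ * ‖w‖ ^ 2 + ‖w‖ ^ 2 + 1 + s := by
    field_simp
    ring
  rw [this]
  have h := sq_nonneg (‖w‖ - 1)
  have h2 : 0 ≤ s⁻¹ * ‖w‖ ^ 2 := by positivity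
  nlinarith [sq_nonneg ‖w‖]

/-- The coefficient of the antilinear part of the derivative of `regInv`. -/
def deltaKer (s : ℝ) (w : ℂ) : ℝ := s * ((‖w‖ ^ 2 + s) ^ 2)⁻¹

/-- The coefficient of the linear part of the derivative of `exp (-w) * regInv s w`, without the
exponential factor. -/
def regInvLin (s : ℝ) (w : ℂ) : ℂ :=
  -((starRingEnd ℂ) w ^ 2 * (((‖w‖ ^ 2 + s : ℝ) : ℂ) ^ 2)⁻¹) - regInv s w

/-- The regularized resolvent with Gaussian factor. -/
def regExp (s : ℝ) (w : ℂ) : ℂ := Complex.exp (-w) * regInv s w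

theorem hasFDerivAt_regInv {s : ℝ} {w : ℂ} (h : ‖w‖ ^ 2 + s ≠ 0) :
    HasFDerivAt (regInv s) (((deltaKer s w : ℝ) : ℂ) • (Complex.conjCLE : ℂ →L[ℝ] ℂ) +
      (regInvLin s w + regInv s w) • ContinuousLinearMap.id ℝ ℂ) w := by
  have hD : ∀ z : ℂ, ((‖z‖ ^ 2 + s : ℝ) : ℂ) = z * (starRingEnd ℂ) z + s := fun z => by
    rw [Complex.mul_conj, Complex.normSq_eq_norm_sq]; push_cast; ring
  have hc : HasFDerivAt (fun z : ℂ => (starRingEnd ℂ) z) (Complex.conjCLE : ℂ →L[ℝ] ℂ) w :=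
    (Complex.conjCLE : ℂ →L[ℝ] ℂ).hasFDerivAt
  have hi : HasFDerivAt (fun z : ℂ => z) (ContinuousLinearMap.id ℝ ℂ) w := hasFDerivAt_id w
  have hne : w * (starRingEnd ℂ) w + s ≠ 0 := by rw [← hD]; exact_mod_cast h
  have hden := (hi.mul hc).add_const (s : ℂ)
  have hinv := ((hasDerivAt_inv hne).hasFDerivAt.restrictScalars ℝ).comp w hden
  have := hc.mul hinv
  have e : regInv s = fun z => (starRingEnd ℂ) z * (z * (starRingEnd ℂ) z + s)⁻¹ :=
    funext fun z => by rw [regInv, hD]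
  rw [e]
  refine this.congr_fderiv ?_
  ext1 v
  have hne2 : ((deltaKer s w : ℝ) : ℂ) = s * ((w * (starRingEnd ℂ) w + s) ^ 2)⁻¹ := by
    rw [deltaKer, ← hD]; push_cast; ring
  have hne3 : regInv s w = (starRingEnd ℂ) w * (w * (starRingEnd ℂ) w + s)⁻¹ := by rw [e]
  rw [regInvLin, hne3, hD, hne2]
  simp
  field_simp
  ring

theorem hasFDerivAt_regExp {s : ℝ} {w : ℂ} (h : ‖w‖ ^ 2 + s ≠ 0) :
    HasFDerivAt (regExp s) ((Complex.exp (-w) * ((deltaKer s w : ℝ) : ℂ)) •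
      (Complex.conjCLE : ℂ →L[ℝ] ℂ) +
      (Complex.exp (-w) * regInvLin s w) • ContinuousLinearMap.id ℝ ℂ) w := by
  have he : HasFDerivAt (fun z : ℂ => Complex.exp (-z)) _ w :=
    ((hasDerivAt_neg w).cexp).hasFDerivAt.restrictScalars ℝ
  refine (he.mul (hasFDerivAt_regInv h)).congr_fderiv ?_
  ext1 v
  simp
  ring

theorem norm_conj_sq_mul_inv_le {s : ℝ} (hs : 0 ≤ s) (w : ℂ) :
    ‖(starRingEnd ℂ) w ^ 2 * (((‖w‖ ^ 2 + s : ℝ) : ℂ) ^ 2)⁻¹‖ ≤ (‖w‖ ^ 2 + s)⁻¹ := by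
  rw [norm_mul, norm_pow, RCLike.norm_conj, norm_inv, norm_pow, Complex.norm_real,
    Real.norm_of_nonneg (by positivity)]
  rcases (by positivity : 0 ≤ ‖w‖ ^ 2 + s).eq_or_lt with h | h
  · rw [← h]; simp
  · rw [← div_eq_mul_inv, div_le_iff₀ (by positivity)]
    field_simp
    linarith

theorem deltaKer_nonneg {s : ℝ} (hs : 0 ≤ s) (w : ℂ) : 0 ≤ deltaKer s w := by
  unfold deltaKer; positivity

theorem deltaKer_le {s : ℝ} (hs : 0 ≤ s) (w : ℂ) : deltaKer s w ≤ (‖w‖ ^ 2 + s)⁻¹ := by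
  unfold deltaKer
  rcases (by positivity : 0 ≤ ‖w‖ ^ 2 + s).eq_or_lt with h | h
  · rw [← h]; simp
  · rw [← div_eq_mul_inv, div_le_iff₀ (by positivity)]
    field_simp
    nlinarith [sq_nonneg ‖w‖]

theorem norm_regInvLin_le {s : ℝ} (hs : 0 ≤ s) (w : ℂ) :
    ‖regInvLin s w‖ ≤ (‖w‖ ^ 2 + s)⁻¹ + ‖regInv s w‖ := by
  refine (norm_sub_le _ _).trans ?_
  rw [norm_neg]
  gcongr
  exact norm_conj_sq_mul_inv_le hs w

theorem inv_sq_add_le {s : ℝ} (hs : 0 ≤ s) (w : ℂ) : (‖w‖ ^ 2 + s)⁻¹ ≤ ‖w‖⁻¹ ^ 2 ∨ w = 0 := by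
  by_cases h : w = 0
  · exact Or.inr h
  · left
    have : 0 < ‖w‖ := norm_pos_iff.2 h
    rw [inv_pow]
    gcongr
    linarith

theorem measurable_regInv (s : ℝ) : Measurable (regInv s) := by
  unfold regInv
  have : Measurable fun w : ℂ => (starRingEnd ℂ) w := Complex.continuous_conj.measurable
  fun_prop

theorem measurable_deltaKer (s : ℝ) : Measurable (deltaKer s) := by
  unfold deltaKer; fun_prop

theorem measurable_regInvLin (s : ℝ) : Measurable (regInvLin s) := by
  unfold regInvLin
  have : Measurable fun w : ℂ => (starRingEnd ℂ) w := Complex.continuous_conj.measurable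
  have := measurable_regInv s
  fun_prop

theorem tendsto_regInv {w : ℂ} (hw : w ≠ 0) :
    Tendsto (fun s => regInv s w) (𝓝[>] 0) (𝓝 (regInv 0 w)) := by
  have : ContinuousAt (fun s => regInv s w) 0 := by
    unfold regInv
    have : (‖w‖ ^ 2 + 0 : ℝ) ≠ 0 := by simpa using hw
    refine continuousAt_const.mul (ContinuousAt.inv₀ (by fun_prop) (by exact_mod_cast this))
  exact this.tendsto.mono_left nhdsWithin_le_nhds

theorem tendsto_deltaKer {w : ℂ} (hw : w ≠ 0) :
    Tendsto (fun s => deltaKer s w) (𝓝[>] 0) (𝓝 (deltaKer 0 w)) := by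
  have : ContinuousAt (fun s => deltaKer s w) 0 := by
    unfold deltaKer
    refine continuousAt_id.mul (ContinuousAt.inv₀ (by fun_prop) (by simpa using hw))
  exact this.tendsto.mono_left nhdsWithin_le_nhds

theorem tendsto_regInvLin {w : ℂ} (hw : w ≠ 0) :
    Tendsto (fun s => regInvLin s w) (𝓝[>] 0) (𝓝 (regInvLin 0 w)) := by
  refine Tendsto.sub ?_ (tendsto_regInv hw)
  have : ContinuousAt (fun s : ℝ =>
      -((starRingEnd ℂ) w ^ 2 * (((‖w‖ ^ 2 + s : ℝ) : ℂ) ^ 2)⁻¹)) 0 := by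
    refine (continuousAt_const.mul (ContinuousAt.inv₀ (by fun_prop) ?_)).neg
    have : (‖w‖ ^ 2 + 0 : ℝ) ≠ 0 := by simpa using hw
    exact pow_ne_zero 2 (by exact_mod_cast this)
  exact this.tendsto.mono_left nhdsWithin_le_nhds

/-- The regularized integral `∫ exp (i ξ x) exp (-w) regInv s w`, with `w = ξ² + 2 k ξ`. -/
def smoothInt (s : ℝ) (x : RV d) (k : CV d) : ℂ :=
  ∫ ξ : RV d, planeWave (toC ξ) x * regExp s (symb k ξ)

theorem smoothInt_zero (x : RV d) (k : CV d) : smoothInt 0 x k = regInt 1 x k := by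
  simp [smoothInt, regInt, regExp, regInv_zero]

/-- `k ↦ k ξ` as a real-linear functional of the momentum. -/
def cdotMom (ξ : RV d) : CV d →L[ℝ] ℂ :=
  LinearMap.toContinuousLinearMap
    { toFun := fun k => cdot k (toC ξ)
      map_add' := fun k l => cdot_add_left k l _
      map_smul' := fun c k => by
        simp [cdot, Finset.mul_sum, mul_assoc] }

theorem cdotMom_apply (ξ : RV d) (k : CV d) : cdotMom ξ k = cdot k (toC ξ) := rfl

/-- `ξ ↦ cdotMom ξ` as a linear map. -/
def cdotMomL (d : ℕ) : RV d →L[ℝ] CV d →L[ℝ] ℂ :=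
  LinearMap.toContinuousLinearMap
    { toFun := cdotMom
      map_add' := fun ξ η => by ext1 k; simp [cdotMom_apply, toC_add, cdot_add_right]
      map_smul' := fun c ξ => by
        ext1 k
        rw [cdotMom_apply, toC_smul, cdot_smul_right]; rfl }

theorem cdotMomL_apply (ξ : RV d) : cdotMomL d ξ = cdotMom ξ := rfl

end

section

variable {d : ℕ}

section
variable {H : Type*} [NormedAddCommGroup H] [NormedSpace ℝ H]

/-- The real-linear map `v ↦ a * conj (L v) + b * L v`. -/
def mixL (a b : ℂ) (L : H →L[ℝ] ℂ) : H →L[ℝ] ℂ :=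
  a • (Complex.conjCLE : ℂ →L[ℝ] ℂ).comp L + b • L

theorem mixL_apply (a b : ℂ) (L : H →L[ℝ] ℂ) (v : H) :
    mixL a b L v = a * (starRingEnd ℂ) (L v) + b * L v := by
  simp [mixL]

theorem norm_mixL_le (a b : ℂ) (L : H →L[ℝ] ℂ) : ‖mixL a b L‖ ≤ (‖a‖ + ‖b‖) * ‖L‖ := by
  refine ContinuousLinearMap.opNorm_le_bound _ (by positivity) fun v => ?_
  rw [mixL_apply]
  refine (norm_add_le _ _).trans ?_
  rw [norm_mul, norm_mul, RCLike.norm_conj, ← add_mul, mul_assoc]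
  gcongr
  exact L.le_opNorm v

theorem _root_.MeasureTheory.AEStronglyMeasurable.mixL {X : Type*} [MeasurableSpace X]
    {μ : Measure X} {a b : X → ℂ} {L : X → H →L[ℝ] ℂ} (ha : AEStronglyMeasurable a μ)
    (hb : AEStronglyMeasurable b μ) (hL : AEStronglyMeasurable L μ) :
    AEStronglyMeasurable (fun x => mixL (a x) (b x) (L x)) μ := by
  unfold Faddeev.mixL
  have h : AEStronglyMeasurable (fun x => (Complex.conjCLE : ℂ →L[ℝ] ℂ).comp (L x)) μ :=
    ((ContinuousLinearMap.compL ℝ H ℂ ℂ (Complex.conjCLE : ℂ →L[ℝ] ℂ)).continuous).comp_aestronglyMeasurable hL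
  exact (ha.smul h).add (hb.smul hL)

theorem tendsto_mixL {ι : Type*} {l : Filter ι} {a b : ι → ℂ} {a₀ b₀ : ℂ} (L : H →L[ℝ] ℂ)
    (ha : Tendsto a l (𝓝 a₀)) (hb : Tendsto b l (𝓝 b₀)) :
    Tendsto (fun i => mixL (a i) (b i) L) l (𝓝 (mixL a₀ b₀ L)) :=
  (ha.smul_const _).add (hb.smul_const _)

theorem hasFDerivAt_regExp_comp {s : ℝ} {w : H → ℂ} {w' : H →L[ℝ] ℂ} {p : H}
    (hw : HasFDerivAt w w' p) (h : ‖w p‖ ^ 2 + s ≠ 0) :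
    HasFDerivAt (fun q => regExp s (w q)) (mixL (Complex.exp (-w p) * ((deltaKer s (w p) : ℝ) : ℂ))
      (Complex.exp (-w p) * regInvLin s (w p)) w') p := by
  refine ((hasFDerivAt_regExp h).comp p hw).congr_fderiv ?_
  ext1 v
  simp [mixL_apply]

end

theorem measurable_regExp (s : ℝ) : Measurable (regExp s) := by
  unfold regExp
  have := measurable_regInv s
  fun_prop

theorem norm_cexp_neg (w : ℂ) : ‖Complex.exp (-w)‖ = Real.exp (-w.re) := by
  rw [Complex.norm_exp, Complex.neg_re]

theorem exp_neg_symb_re_le {k : CV d} {M : ℝ} (hM : ‖reV k‖ ≤ M) (ξ : RV d) :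
    Real.exp (-(symb k ξ).re) ≤ Real.exp (2 * M ^ 2) * Real.exp (-(1 / 2) * ‖ξ‖ ^ 2) := by
  rw [← Real.exp_add]
  gcongr
  have h := symb_re_ge k ξ
  have : ‖reV k‖ ^ 2 ≤ M ^ 2 := by gcongr
  linarith

theorem norm_reV_le (k : CV d) : ‖reV k‖ ≤ ‖k‖ := by
  rw [EuclideanSpace.norm_eq, EuclideanSpace.norm_eq]
  gcongr with i
  exact Complex.abs_re_le_norm (k i)

/-- The derivative of the integrand of `smoothInt` with respect to the momentum. -/
def smoothIntD (s : ℝ) (x : RV d) (k : CV d) (ξ : RV d) : CV d →L[ℝ] ℂ :=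
  mixL (planeWave (toC ξ) x * (Complex.exp (-symb k ξ) * ((deltaKer s (symb k ξ) : ℝ) : ℂ)))
    (planeWave (toC ξ) x * (Complex.exp (-symb k ξ) * regInvLin s (symb k ξ)))
    ((2 : ℝ) • cdotMom ξ)

theorem hasFDerivAt_symb (k : CV d) (ξ : RV d) :
    HasFDerivAt (fun k => symb k ξ) ((2 : ℝ) • cdotMom ξ) k := by
  have h : (fun k : CV d => symb k ξ) = fun k => ((‖ξ‖ ^ 2 : ℝ) : ℂ) + ((2 : ℝ) • cdotMom ξ) k := by
    ext k; simp [symb, cdotMom_apply]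
  rw [h]
  exact ((2 : ℝ) • cdotMom ξ).hasFDerivAt.const_add _

theorem integrable_norm_mul_exp {F : Type*} [NormedAddCommGroup F] [InnerProductSpace ℝ F]
    [FiniteDimensional ℝ F] [MeasurableSpace F] [BorelSpace F] {c : ℝ} (hc : 0 < c) :
    Integrable fun v : F => ‖v‖ * Real.exp (-c * ‖v‖ ^ 2) := by
  obtain ⟨C, hC, h⟩ := exists_pow_le_exp_sq (c / 2) (by positivity) 1
  refine ((integrable_exp_neg_mul_norm_sq (F := F) (half_pos hc)).const_mul C).mono'
    (by fun_prop) (Eventually.of_forall fun v => ?_)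
  have h1 := h ‖v‖
  rw [abs_norm, pow_one] at h1
  rw [Real.norm_of_nonneg (by positivity)]
  calc ‖v‖ * Real.exp (-c * ‖v‖ ^ 2) ≤ C * Real.exp (c / 2 * ‖v‖ ^ 2) * Real.exp (-c * ‖v‖ ^ 2) := by
        gcongr
    _ = _ := by rw [mul_assoc, ← Real.exp_add]; ring_nf

theorem smoothInt_dbar {s : ℝ} (hs : 0 < s) (x : RV d) (k : CV d) :
    ∃ L : CV d →L[ℝ] ℂ, HasFDerivAt (smoothInt s x) L k ∧
      ∀ h : CV d, (L h + Complex.I * L (Complex.I • h)) / 2 =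
        ∫ ξ : RV d, planeWave (toC ξ) x * Complex.exp (-symb k ξ) * (deltaKer s (symb k ξ) : ℝ) *
          (2 * (starRingEnd ℂ) (cdot h (toC ξ))) := by
  set M := ‖k‖ + 1 with hM
  set bound : RV d → ℝ := fun ξ => (Real.exp (2 * M ^ 2) * (s⁻¹ + (s⁻¹ + (s⁻¹ + 1)))) *
    (2 * ‖cdotMomL d‖) * (‖ξ‖ * Real.exp (-(1 / 2) * ‖ξ‖ ^ 2)) with hbound
  have hbI : Integrable bound := (integrable_norm_mul_exp (by norm_num)).const_mul _
  have hbd : ∀ (ξ : RV d), ∀ k' ∈ Metric.ball k 1, ‖smoothIntD s x k' ξ‖ ≤ bound ξ := by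
    intro ξ k' hk'
    have hk2 : ‖reV k'‖ ≤ M := by
      refine (norm_reV_le k').trans ?_
      have := norm_sub_norm_le k' k
      rw [mem_ball_iff_norm] at hk'
      linarith
    refine (norm_mixL_le _ _ _).trans ?_
    set w := symb k' ξ
    have h0 : (‖w‖ ^ 2 + s)⁻¹ ≤ s⁻¹ := by gcongr; nlinarith [sq_nonneg ‖w‖]
    have h1 : ‖((deltaKer s w : ℝ) : ℂ)‖ ≤ s⁻¹ := by
      rw [Complex.norm_real, Real.norm_of_nonneg (deltaKer_nonneg hs.le _)]
      exact (deltaKer_le hs.le w).trans h0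
    have h2 : ‖regInvLin s w‖ ≤ s⁻¹ + (s⁻¹ + 1) :=
      (norm_regInvLin_le hs.le w).trans (add_le_add h0 (norm_regInv_le_const hs w))
    have h3 : ‖(2 : ℝ) • cdotMom ξ‖ ≤ 2 * ‖cdotMomL d‖ * ‖ξ‖ := by
      rw [norm_smul, mul_assoc, Real.norm_of_nonneg zero_le_two]
      gcongr
      exact (cdotMomL d).le_opNorm ξ
    rw [norm_mul, norm_mul, norm_mul, norm_mul, norm_planeWave_toC, one_mul, one_mul, ← mul_add,
      norm_cexp_neg]
    have h4 := exp_neg_symb_re_le hk2 ξ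
    calc Real.exp (-w.re) * (‖((deltaKer s w : ℝ) : ℂ)‖ + ‖regInvLin s w‖) * ‖(2 : ℝ) • cdotMom ξ‖
        ≤ (Real.exp (2 * M ^ 2) * Real.exp (-(1 / 2) * ‖ξ‖ ^ 2)) * (s⁻¹ + (s⁻¹ + (s⁻¹ + 1))) *
          (2 * ‖cdotMomL d‖ * ‖ξ‖) := by gcongr
      _ = _ := by rw [hbound]; ring
  have hmeas : ∀ k' : CV d, AEStronglyMeasurable (fun ξ : RV d =>
      planeWave (toC ξ) x * regExp s (symb k' ξ)) volume := fun k' =>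
    ((continuous_planeWave_toC x).measurable.mul
      ((measurable_regExp s).comp (continuous_symb k').measurable)).aestronglyMeasurable
  have hcL : AEStronglyMeasurable (fun ξ : RV d => (2 : ℝ) • cdotMom ξ) volume :=
    ((cdotMomL d).continuous.const_smul (2 : ℝ)).aestronglyMeasurable
  have hmeas' : AEStronglyMeasurable (smoothIntD s x k) volume := by
    have hc := (continuous_symb k).measurable
    have hp := (continuous_planeWave_toC x).measurable
    have he : Measurable fun ξ : RV d => Complex.exp (-symb k ξ) := by fun_prop
    refine AEStronglyMeasurable.mixL ?_ ?_ hcL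
    · exact (hp.mul (he.mul (Complex.measurable_ofReal.comp
        ((measurable_deltaKer s).comp hc)))).aestronglyMeasurable
    · exact (hp.mul (he.mul ((measurable_regInvLin s).comp hc))).aestronglyMeasurable
  have hint : Integrable (fun ξ : RV d => planeWave (toC ξ) x * regExp s (symb k ξ)) := by
    refine (((integrable_exp_neg_mul_norm_sq (F := RV d) (c := 1 / 2) (by norm_num)).const_mul
      (Real.exp (2 * M ^ 2))).mul_const (s⁻¹ + 1)).mono' (hmeas k) (Eventually.of_forall fun ξ => ?_)
    rw [norm_mul, norm_planeWave_toC, one_mul, regExp, norm_mul, norm_cexp_neg]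
    have hk2 : ‖reV k‖ ≤ M := (norm_reV_le k).trans (by linarith)
    have := exp_neg_symb_re_le hk2 ξ
    have := norm_regInv_le_const hs (symb k ξ)
    gcongr
  have hD := hasFDerivAt_integral_of_dominated_of_fderiv_le (μ := volume) (bound := bound)
    (F := fun k' ξ => planeWave (toC ξ) x * regExp s (symb k' ξ)) (F' := smoothIntD s x)
    (Metric.ball_mem_nhds k one_pos) (Eventually.of_forall hmeas) hint hmeas'
    (Eventually.of_forall hbd) hbI (Eventually.of_forall fun ξ k' _ => by
      have h1 := hasFDerivAt_regExp_comp (s := s) (hasFDerivAt_symb k' ξ)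
        (by positivity : ‖symb k' ξ‖ ^ 2 + s ≠ 0)
      refine (h1.const_mul (planeWave (toC ξ) x)).congr_fderiv ?_
      ext1 v
      simp only [smoothIntD, mixL_apply, _root_.smul_apply, smul_eq_mul]
      ring)
  have hI' : Integrable (smoothIntD s x k) :=
    hbI.mono' hmeas' (Eventually.of_forall fun ξ => hbd ξ k (Metric.mem_ball_self one_pos))
  refine ⟨_, hD, fun h => ?_⟩
  rw [ContinuousLinearMap.integral_apply hI', ContinuousLinearMap.integral_apply hI',
    ← integral_const_mul, ← integral_add (hI'.apply_continuousLinearMap h)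
      ((hI'.apply_continuousLinearMap _).const_mul _), ← integral_div]
  refine integral_congr_ae (Eventually.of_forall fun ξ => ?_)
  simp only [smoothIntD, mixL_apply, _root_.smul_apply, cdotMom_apply,
    cdot_smul_left, Complex.real_smul, map_mul, Complex.conj_I, Complex.conj_ofReal]
  push_cast
  linear_combination (planeWave (toC ξ) x * Complex.exp (-symb k ξ) * (deltaKer s (symb k ξ) : ℝ) *
    (starRingEnd ℂ) (cdot h (toC ξ)) * (-1) + planeWave (toC ξ) x * Complex.exp (-symb k ξ) *
    regInvLin s (symb k ξ) * cdot h (toC ξ)) * Complex.I_sq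

end

section

variable {d : ℕ}

/-- The functional `(A, B) ↦ A (|η|² - 1) + i B ⟪n, η⟫`. -/
def normSymb (n η : RV d) : ℝ × ℝ →L[ℝ] ℂ :=
  ((‖η‖ ^ 2 - 1 : ℝ) : ℂ) • Complex.ofRealCLM.comp (ContinuousLinearMap.fst ℝ ℝ ℝ) +
    (Complex.I * ((inner ℝ n η : ℝ) : ℂ)) • Complex.ofRealCLM.comp (ContinuousLinearMap.snd ℝ ℝ ℝ)

theorem normSymb_apply (n η : RV d) (q : ℝ × ℝ) :
    normSymb n η q = ((q.1 * (‖η‖ ^ 2 - 1) : ℝ) : ℂ) + ((q.2 * inner ℝ n η : ℝ) : ℂ) * Complex.I := by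
  simp [normSymb]
  ring

theorem normSymb_re (n η : RV d) (q : ℝ × ℝ) : (normSymb n η q).re = q.1 * (‖η‖ ^ 2 - 1) := by
  rw [normSymb_apply, Complex.add_re, Complex.re_ofReal_mul, Complex.ofReal_re, Complex.I_re]
  simp

theorem normSymb_im (n η : RV d) (q : ℝ × ℝ) : (normSymb n η q).im = q.2 * inner ℝ n η := by
  rw [normSymb_apply, Complex.add_im, Complex.im_ofReal_mul, Complex.ofReal_im, Complex.I_im]
  simp

theorem ae_inner_ne_zero {n : RV d} (hn : n ≠ 0) : ∀ᵐ η : RV d, inner ℝ n η ≠ 0 := by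
  have h : ∀ᵐ η : RV d, η ∉ ((Submodule.span ℝ {n})ᗮ : Submodule ℝ (RV d)) := by
    rw [ae_iff]
    simp only [not_not]
    refine Measure.addHaar_submodule (volume : Measure (RV d)) ((Submodule.span ℝ {n})ᗮ)
      fun h => hn ?_
    have : n ∈ (Submodule.span ℝ {n})ᗮ := h ▸ Submodule.mem_top
    rw [Submodule.mem_orthogonal_singleton_iff_inner_right] at this
    exact inner_self_eq_zero.1 this
  filter_upwards [h] with η hη h0
  exact hη (Submodule.mem_orthogonal_singleton_iff_inner_right.2 h0)

theorem normSymb_norm_le {n η : RV d} {q q₀ : ℝ × ℝ} (h1 : |q₀.1| ≤ 2 * |q.1|)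
    (h2 : |q₀.2| ≤ 2 * |q.2|) : ‖normSymb n η q₀‖ ≤ 2 * ‖normSymb n η q‖ := by
  have e : ∀ q, ‖normSymb n η q‖ ^ 2 = (|q.1| * |‖η‖ ^ 2 - 1|) ^ 2 + (|q.2| * |inner ℝ n η|) ^ 2 := by
    intro q
    rw [← Complex.normSq_eq_norm_sq, Complex.normSq_apply, normSymb_re, normSymb_im, ← abs_mul,
      ← abs_mul, sq_abs, sq_abs]
    ring
  refine le_of_sq_le_sq ?_ (by positivity)
  rw [mul_pow, e, e]
  have h3 : (|q₀.1| * |‖η‖ ^ 2 - 1|) ^ 2 ≤ (2 * |q.1| * |‖η‖ ^ 2 - 1|) ^ 2 := by gcongr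
  have h4 : (|q₀.2| * |inner ℝ n η|) ^ 2 ≤ (2 * |q.2| * |inner ℝ n η|) ^ 2 := by gcongr
  nlinarith

theorem norm_normSymb_le {n η : RV d} {q : ℝ × ℝ} (h1 : q.1 ≠ 0) (h2 : q.2 ≠ 0) :
    ‖normSymb n η‖ ≤ (|q.1|⁻¹ + |q.2|⁻¹) * ‖normSymb n η q‖ := by
  have h1' : 0 < |q.1| := abs_pos.2 h1
  have h2' : 0 < |q.2| := abs_pos.2 h2
  have e1 : |‖η‖ ^ 2 - 1| ≤ |q.1|⁻¹ * ‖normSymb n η q‖ := by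
    have := Complex.abs_re_le_norm (normSymb n η q)
    rw [normSymb_re, abs_mul] at this
    rwa [inv_mul_eq_div, le_div_iff₀' h1']
  have e2 : |inner ℝ n η| ≤ |q.2|⁻¹ * ‖normSymb n η q‖ := by
    have := Complex.abs_im_le_norm (normSymb n η q)
    rw [normSymb_im, abs_mul] at this
    rwa [inv_mul_eq_div, le_div_iff₀' h2']
  refine ContinuousLinearMap.opNorm_le_bound _ (by positivity) fun v => ?_
  rw [normSymb_apply]
  refine (norm_add_le _ _).trans ?_
  rw [norm_mul, Complex.norm_I, mul_one, Complex.norm_real, Complex.norm_real, norm_mul, norm_mul,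
    add_mul, add_mul]
  have hv1 := norm_fst_le v
  have hv2 := norm_snd_le v
  rw [mul_comm ‖v.1‖, mul_comm ‖v.2‖]
  simp only [Real.norm_eq_abs] at *
  gcongr

theorem normSymb_eq_qsym (n η : RV d) {q : ℝ × ℝ} (h : q.1 ≠ 0) :
    normSymb n η q = q.1 * qsym 0 ((q.2 / q.1) • n) (-1) η := by
  have : (q.1 : ℂ) ≠ 0 := by exact_mod_cast h
  rw [normSymb_apply, qsym, inner_zero_left, inner_smul_left]
  simp only [conj_trivial]
  push_cast
  field_simp
  ring

theorem integrable_exp_mul_inv_normSymb (hd : 2 ≤ d) {n : RV d} (hn : n ≠ 0) {q : ℝ × ℝ}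
    (h1 : q.1 ≠ 0) (h2 : q.2 ≠ 0) {γ : ℝ} (hγ : 0 < γ) :
    Integrable fun η : RV d => Real.exp (-γ * ‖η‖ ^ 2) * ‖normSymb n η q‖⁻¹ := by
  have := (integrable_exp_mul_inv_qsym (F := RV d) (by simpa using hd) 0 ((q.2 / q.1) • n)
    (smul_ne_zero (div_ne_zero h2 h1) hn) (-1) hγ).const_mul |q.1|⁻¹
  refine this.congr (Eventually.of_forall fun η => ?_)
  simp only
  rw [normSymb_eq_qsym n η h1, norm_mul, Complex.norm_real, Real.norm_eq_abs, mul_inv]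
  ring

/-- `normSymb n` as a continuous function. -/
theorem continuous_normSymb (n : RV d) : Continuous (normSymb n) := by
  unfold normSymb
  fun_prop

/-- The integral in normalized coordinates; the parameter is `(y, A, B)`. -/
def normInt (s : ℝ) (n : RV d) (p : RV d × ℝ × ℝ) : ℂ :=
  ∫ η : RV d, planeWave (toC η) p.1 * regExp s (normSymb n η p.2)

def normIntD (s : ℝ) (n : RV d) (p : RV d × ℝ × ℝ) (η : RV d) : RV d × ℝ × ℝ →L[ℝ] ℂ :=
  (planeWave (toC η) p.1 * Complex.I * regExp s (normSymb n η p.2)) •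
    Complex.ofRealCLM.comp ((innerSL ℝ η).comp (ContinuousLinearMap.fst ℝ (RV d) (ℝ × ℝ))) +
  mixL (planeWave (toC η) p.1 * (Complex.exp (-normSymb n η p.2) *
      ((deltaKer s (normSymb n η p.2) : ℝ) : ℂ)))
    (planeWave (toC η) p.1 * (Complex.exp (-normSymb n η p.2) * regInvLin s (normSymb n η p.2)))
    ((normSymb n η).comp (ContinuousLinearMap.snd ℝ (RV d) (ℝ × ℝ)))

theorem norm_regExp_le {s : ℝ} (hs : 0 ≤ s) (w : ℂ) :
    ‖regExp s w‖ ≤ Real.exp (-w.re) * ‖w‖⁻¹ := by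
  rw [regExp, norm_mul, norm_cexp_neg]
  gcongr
  exact norm_regInv_le hs w

theorem normIntD_bound (hd : 2 ≤ d) {n : RV d} (hn : n ≠ 0) {q₀ : ℝ × ℝ} (hA : 0 < q₀.1)
    (hB : q₀.2 ≠ 0) : ∃ r : ℝ, 0 < r ∧ ∃ bound : RV d → ℝ, Integrable bound ∧
      ∀ s : ℝ, 0 ≤ s → ∀ y : RV d, ∀ q ∈ Metric.ball q₀ r, ∀ η : RV d, normSymb n η q₀ ≠ 0 →
        normSymb n η q ≠ 0 ∧ ‖normIntD s n (y, q) η‖ ≤ bound η ∧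
        ‖planeWave (toC η) y * regExp s (normSymb n η q)‖ ≤ bound η := by
  obtain ⟨C₁, hC₁, hexp⟩ := exists_pow_le_exp_sq (q₀.1 / 4) (by positivity) 1
  set C := |q₀.1|⁻¹ + |q₀.2|⁻¹ with hC
  have hC0 : 0 ≤ C := by positivity
  set E₀ := Real.exp (3 * q₀.1 / 2) with hE₀
  have hB' : 0 < |q₀.2| := abs_pos.2 hB
  refine ⟨min (q₀.1 / 2) (|q₀.2| / 2), by positivity, fun η => E₀ * (2 * C₁ + 8 * C + 2) *
    (Real.exp (-(q₀.1 / 4) * ‖η‖ ^ 2) * ‖normSymb n η q₀‖⁻¹) +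
    E₀ * (2 * C) * Real.exp (-(q₀.1 / 2) * ‖η‖ ^ 2), ?_, ?_⟩
  · exact ((integrable_exp_mul_inv_normSymb hd hn hA.ne' hB (by positivity)).const_mul _).add
      ((integrable_exp_neg_mul_norm_sq (by positivity)).const_mul _)
  intro s hs y q hq η hη
  rw [mem_ball_iff_norm] at hq
  have hq1 : |q.1 - q₀.1| < q₀.1 / 2 :=
    (norm_fst_le (q - q₀)).trans_lt (hq.trans_le (min_le_left _ _))
  have hq2 : |q.2 - q₀.2| < |q₀.2| / 2 :=
    (norm_snd_le (q - q₀)).trans_lt (hq.trans_le (min_le_right _ _))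
  have hq1' := abs_lt.1 hq1
  have hqpos : 0 < q.1 := by linarith
  have h1 : |q₀.1| ≤ 2 * |q.1| := by
    rw [abs_of_pos hA, abs_of_pos hqpos]; linarith
  have h2 : |q₀.2| ≤ 2 * |q.2| := by
    have := abs_sub_abs_le_abs_sub q₀.2 q.2
    rw [abs_sub_comm] at this
    linarith
  set w₀ := normSymb n η q₀ with hw₀
  set w := normSymb n η q with hw
  have hww : ‖w₀‖ ≤ 2 * ‖w‖ := normSymb_norm_le h1 h2
  have hw0p : 0 < ‖w₀‖ := norm_pos_iff.2 hη
  have hwp : 0 < ‖w‖ := by linarith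
  have hwne : w ≠ 0 := norm_pos_iff.1 hwp
  have hinv : ‖w‖⁻¹ ≤ 2 * ‖w₀‖⁻¹ := by
    rw [← div_eq_mul_inv, le_div_iff₀ hw0p, inv_mul_le_iff₀ hwp]; linarith
  have hinv2 : (‖w‖ ^ 2 + s)⁻¹ ≤ 4 * ‖w₀‖⁻¹ ^ 2 := by
    refine ((inv_sq_add_le hs w).resolve_right hwne).trans ?_
    calc ‖w‖⁻¹ ^ 2 ≤ (2 * ‖w₀‖⁻¹) ^ 2 := by gcongr
      _ = _ := by ring
  have hre : Real.exp (-w.re) ≤ E₀ * Real.exp (-(q₀.1 / 2) * ‖η‖ ^ 2) := by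
    rw [hE₀, ← Real.exp_add]
    gcongr
    rw [hw, normSymb_re]
    nlinarith [sq_nonneg ‖η‖, hq1'.1, hq1'.2]
  have hee : Real.exp (-(q₀.1 / 2) * ‖η‖ ^ 2) ≤ Real.exp (-(q₀.1 / 4) * ‖η‖ ^ 2) := by
    gcongr
    linarith
  have hηe : ‖η‖ * Real.exp (-(q₀.1 / 2) * ‖η‖ ^ 2) ≤ C₁ * Real.exp (-(q₀.1 / 4) * ‖η‖ ^ 2) := by
    have := hexp ‖η‖
    rw [abs_norm, pow_one] at this
    calc _ ≤ C₁ * Real.exp (q₀.1 / 4 * ‖η‖ ^ 2) * Real.exp (-(q₀.1 / 2) * ‖η‖ ^ 2) := by gcongr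
      _ = _ := by rw [mul_assoc, ← Real.exp_add]; ring_nf
  have hreg : ‖regExp s w‖ ≤ E₀ * Real.exp (-(q₀.1 / 2) * ‖η‖ ^ 2) * (2 * ‖w₀‖⁻¹) :=
    (norm_regExp_le hs w).trans (by gcongr)
  refine ⟨hwne, ?_, ?_⟩
  · have hN : ‖(normSymb n η).comp (ContinuousLinearMap.snd ℝ (RV d) (ℝ × ℝ))‖ ≤ C * ‖w₀‖ := by
      refine (ContinuousLinearMap.opNorm_comp_le _ _).trans ?_
      refine (mul_le_of_le_one_right (norm_nonneg _) (ContinuousLinearMap.norm_snd_le ..)).trans ?_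
      exact norm_normSymb_le hA.ne' hB
    have hin : ‖Complex.ofRealCLM.comp ((innerSL ℝ η).comp
        (ContinuousLinearMap.fst ℝ (RV d) (ℝ × ℝ)))‖ ≤ ‖η‖ := by
      refine (ContinuousLinearMap.opNorm_comp_le _ _).trans ?_
      rw [Complex.ofRealCLM_norm, one_mul]
      refine (ContinuousLinearMap.opNorm_comp_le _ _).trans ?_
      rw [innerSL_apply_norm]
      exact mul_le_of_le_one_right (norm_nonneg _) (ContinuousLinearMap.norm_fst_le ..)
    have hd1 : ‖((deltaKer s w : ℝ) : ℂ)‖ ≤ 4 * ‖w₀‖⁻¹ ^ 2 := by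
      rw [Complex.norm_real, Real.norm_of_nonneg (deltaKer_nonneg hs _)]
      exact (deltaKer_le hs w).trans hinv2
    have hl1 : ‖regInvLin s w‖ ≤ 4 * ‖w₀‖⁻¹ ^ 2 + 2 * ‖w₀‖⁻¹ :=
      (norm_regInvLin_le hs w).trans (add_le_add hinv2 ((norm_regInv_le hs w).trans hinv))
    have hcancel : ‖w₀‖⁻¹ * ‖w₀‖ = 1 := inv_mul_cancel₀ hw0p.ne'
    refine (norm_add_le _ _).trans ?_
    have t1 : ‖(planeWave (toC η) y * Complex.I * regExp s w) •
        Complex.ofRealCLM.comp ((innerSL ℝ η).comp (ContinuousLinearMap.fst ℝ (RV d) (ℝ × ℝ)))‖ ≤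
        E₀ * (2 * C₁) * (Real.exp (-(q₀.1 / 4) * ‖η‖ ^ 2) * ‖w₀‖⁻¹) := by
      rw [norm_smul, norm_mul, norm_mul, norm_planeWave_toC, Complex.norm_I, one_mul, one_mul]
      calc _ ≤ (E₀ * Real.exp (-(q₀.1 / 2) * ‖η‖ ^ 2) * (2 * ‖w₀‖⁻¹)) * ‖η‖ := by gcongr
        _ = E₀ * 2 * (‖η‖ * Real.exp (-(q₀.1 / 2) * ‖η‖ ^ 2)) * ‖w₀‖⁻¹ := by ring
        _ ≤ E₀ * 2 * (C₁ * Real.exp (-(q₀.1 / 4) * ‖η‖ ^ 2)) * ‖w₀‖⁻¹ := by gcongr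
        _ = _ := by ring
    have t2 := norm_mixL_le (planeWave (toC η) y * (Complex.exp (-w) * ((deltaKer s w : ℝ) : ℂ)))
      (planeWave (toC η) y * (Complex.exp (-w) * regInvLin s w))
      ((normSymb n η).comp (ContinuousLinearMap.snd ℝ (RV d) (ℝ × ℝ)))
    rw [norm_mul, norm_mul, norm_mul, norm_mul, norm_planeWave_toC, one_mul, one_mul, ← mul_add,
      norm_cexp_neg] at t2
    have t3 : Real.exp (-w.re) * (‖((deltaKer s w : ℝ) : ℂ)‖ + ‖regInvLin s w‖) *
        ‖(normSymb n η).comp (ContinuousLinearMap.snd ℝ (RV d) (ℝ × ℝ))‖ ≤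
        E₀ * (8 * C) * (Real.exp (-(q₀.1 / 4) * ‖η‖ ^ 2) * ‖w₀‖⁻¹) +
          E₀ * (2 * C) * Real.exp (-(q₀.1 / 2) * ‖η‖ ^ 2) := by
      calc _ ≤ (E₀ * Real.exp (-(q₀.1 / 2) * ‖η‖ ^ 2)) *
            (4 * ‖w₀‖⁻¹ ^ 2 + (4 * ‖w₀‖⁻¹ ^ 2 + 2 * ‖w₀‖⁻¹)) * (C * ‖w₀‖) := by gcongr
        _ = E₀ * (8 * C) * (Real.exp (-(q₀.1 / 2) * ‖η‖ ^ 2) * ‖w₀‖⁻¹) * (‖w₀‖⁻¹ * ‖w₀‖) +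
            E₀ * (2 * C) * Real.exp (-(q₀.1 / 2) * ‖η‖ ^ 2) * (‖w₀‖⁻¹ * ‖w₀‖) := by ring
        _ ≤ _ := by rw [hcancel, mul_one, mul_one]; gcongr
    have t4 : 0 ≤ E₀ * 2 * (Real.exp (-(q₀.1 / 4) * ‖η‖ ^ 2) * ‖w₀‖⁻¹) := by positivity
    have := t2.trans t3
    simp only
    linarith
  · rw [norm_mul, norm_planeWave_toC, one_mul]
    refine hreg.trans ?_
    have t4 : 0 ≤ E₀ * (2 * C) * Real.exp (-(q₀.1 / 2) * ‖η‖ ^ 2) := by positivity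
    have t5 : 0 ≤ E₀ * (2 * C₁ + 8 * C) * (Real.exp (-(q₀.1 / 4) * ‖η‖ ^ 2) * ‖w₀‖⁻¹) := by
      positivity
    have t6 : E₀ * Real.exp (-(q₀.1 / 2) * ‖η‖ ^ 2) * (2 * ‖w₀‖⁻¹) ≤
        E₀ * Real.exp (-(q₀.1 / 4) * ‖η‖ ^ 2) * (2 * ‖w₀‖⁻¹) := by gcongr
    simp only
    nlinarith

theorem aestronglyMeasurable_normIntD (s : ℝ) (n : RV d) (p : RV d × ℝ × ℝ) :
    AEStronglyMeasurable (normIntD s n p) volume := by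
  have hc : Measurable fun η => normSymb n η p.2 :=
    ((continuous_normSymb n).clm_apply continuous_const).measurable
  have hp := (continuous_planeWave_toC p.1).measurable
  have he : Measurable fun η : RV d => Complex.exp (-normSymb n η p.2) := by fun_prop
  have h1 : AEStronglyMeasurable (fun η => planeWave (toC η) p.1 * Complex.I *
      regExp s (normSymb n η p.2)) volume :=
    ((hp.mul_const _).mul ((measurable_regExp s).comp hc)).aestronglyMeasurable
  have h2 : AEStronglyMeasurable (fun η : RV d => Complex.ofRealCLM.comp
      ((innerSL ℝ η).comp (ContinuousLinearMap.fst ℝ (RV d) (ℝ × ℝ)))) volume := by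
    refine Continuous.aestronglyMeasurable ?_
    have : Continuous fun η : RV d => innerSL ℝ η := (innerSL ℝ).continuous
    fun_prop
  refine (h1.smul h2).add (AEStronglyMeasurable.mixL ?_ ?_ ?_)
  · exact (hp.mul (he.mul (Complex.measurable_ofReal.comp
        ((measurable_deltaKer s).comp hc)))).aestronglyMeasurable
  · exact (hp.mul (he.mul ((measurable_regInvLin s).comp hc))).aestronglyMeasurable
  · refine Continuous.aestronglyMeasurable ?_
    have := continuous_normSymb n
    fun_prop

theorem ae_normSymb_ne_zero {n : RV d} (hn : n ≠ 0) {q : ℝ × ℝ} (h2 : q.2 ≠ 0) :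
    ∀ᵐ η : RV d, normSymb n η q ≠ 0 := by
  filter_upwards [ae_inner_ne_zero hn] with η hη h
  have := normSymb_im n η q
  rw [h, Complex.zero_im] at this
  exact mul_ne_zero h2 hη this.symm

theorem hasFDerivAt_planeWave (η y : RV d) :
    HasFDerivAt (fun y => planeWave (toC η) y)
      ((planeWave (toC η) y * Complex.I) • Complex.ofRealCLM.comp (innerSL ℝ η)) y := by
  have e : (fun y => planeWave (toC η) y) = fun y =>
      Complex.exp (Complex.ofRealCLM.comp (innerSL ℝ η) y * Complex.I) := by
    ext y; simp [planeWave_toC]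
  have h1 := ((Complex.ofRealCLM.comp (innerSL ℝ η)).hasFDerivAt (x := y)).mul_const Complex.I
  rw [e]
  refine (h1.cexp).congr_fderiv ?_
  rw [planeWave_toC]
  ext1 v
  simp
  ring

theorem hasFDerivAt_normInt_integrand {s : ℝ} {n η : RV d} {p : RV d × ℝ × ℝ}
    (h : ‖normSymb n η p.2‖ ^ 2 + s ≠ 0) :
    HasFDerivAt (fun p' : RV d × ℝ × ℝ => planeWave (toC η) p'.1 * regExp s (normSymb n η p'.2))
      (normIntD s n p η) p := by
  have h0 : HasFDerivAt (fun p' : RV d × ℝ × ℝ => normSymb n η p'.2)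
      ((normSymb n η).comp (ContinuousLinearMap.snd ℝ (RV d) (ℝ × ℝ))) p :=
    ((normSymb n η).comp (ContinuousLinearMap.snd ℝ (RV d) (ℝ × ℝ))).hasFDerivAt
  have h1 : HasFDerivAt (fun p' : RV d × ℝ × ℝ => planeWave (toC η) p'.1) _ p :=
    (hasFDerivAt_planeWave η p.1).comp p hasFDerivAt_fst
  have h2 := hasFDerivAt_regExp_comp h0 h
  refine (h1.mul h2).congr_fderiv (ContinuousLinearMap.ext fun v => ?_)
  simp only [normIntD, mixL_apply, _root_.smul_apply, smul_eq_mul, _root_.add_apply,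
    ContinuousLinearMap.comp_apply]
  ring

theorem hasFDerivAt_normInt (hd : 2 ≤ d) {n : RV d} (hn : n ≠ 0) {p : RV d × ℝ × ℝ}
    (hA : 0 < p.2.1) (hB : p.2.2 ≠ 0) {s : ℝ} (hs : 0 ≤ s) :
    HasFDerivAt (normInt s n) (∫ η, normIntD s n p η) p := by
  obtain ⟨r, hr, bound, hbI, hb⟩ := normIntD_bound hd hn hA hB
  have hmem : ∀ p' ∈ Metric.ball p r, p'.2 ∈ Metric.ball p.2 r := fun p' hp' => by
    rw [mem_ball_iff_norm] at hp' ⊢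
    exact (norm_snd_le (p' - p)).trans_lt hp'
  have hmeas : ∀ p' : RV d × ℝ × ℝ, AEStronglyMeasurable (fun η : RV d =>
      planeWave (toC η) p'.1 * regExp s (normSymb n η p'.2)) volume := fun p' =>
    ((continuous_planeWave_toC p'.1).measurable.mul ((measurable_regExp s).comp
      ((continuous_normSymb n).clm_apply continuous_const).measurable)).aestronglyMeasurable
  have h1 : Integrable fun η : RV d => planeWave (toC η) p.1 * regExp s (normSymb n η p.2) := by
    refine hbI.mono' (hmeas p) ?_
    filter_upwards [ae_normSymb_ne_zero hn hB] with η hη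
    exact (hb s hs p.1 p.2 (Metric.mem_ball_self hr) η hη).2.2
  have h2 : ∀ᵐ η : RV d, ∀ p' ∈ Metric.ball p r, ‖normIntD s n p' η‖ ≤ bound η := by
    filter_upwards [ae_normSymb_ne_zero hn hB] with η hη p' hp'
    exact (hb s hs p'.1 p'.2 (hmem p' hp') η hη).2.1
  have h3 : ∀ᵐ η : RV d, ∀ p' ∈ Metric.ball p r, HasFDerivAt
      (fun p' : RV d × ℝ × ℝ => planeWave (toC η) p'.1 * regExp s (normSymb n η p'.2))
      (normIntD s n p' η) p' := by
    filter_upwards [ae_normSymb_ne_zero hn hB] with η hη p' hp'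
    have hne := (hb s hs p'.1 p'.2 (hmem p' hp') η hη).1
    have hne' : ‖normSymb n η p'.2‖ ^ 2 + s ≠ 0 := by
      have := norm_pos_iff.2 hne
      positivity
    exact hasFDerivAt_normInt_integrand hne'
  exact hasFDerivAt_integral_of_dominated_of_fderiv_le (Metric.ball_mem_nhds p hr)
    (Eventually.of_forall hmeas) h1 (aestronglyMeasurable_normIntD s n p) h2 hbI h3

theorem tendsto_normIntD (hd : 2 ≤ d) {n : RV d} (hn : n ≠ 0) {p : RV d × ℝ × ℝ}
    (hA : 0 < p.2.1) (hB : p.2.2 ≠ 0) :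
    Tendsto (fun s => ∫ η, normIntD s n p η) (𝓝[>] 0) (𝓝 (∫ η, normIntD 0 n p η)) := by
  obtain ⟨r, hr, bound, hbI, hb⟩ := normIntD_bound hd hn hA hB
  refine tendsto_integral_filter_of_dominated_convergence bound
    (Eventually.of_forall fun s => aestronglyMeasurable_normIntD s n p) ?_ hbI ?_
  · filter_upwards [self_mem_nhdsWithin] with s hs
    filter_upwards [ae_normSymb_ne_zero hn hB] with η hη
    exact (hb s (le_of_lt hs) p.1 p.2 (Metric.mem_ball_self hr) η hη).2.1
  · filter_upwards [ae_normSymb_ne_zero hn hB] with η hη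
    refine Tendsto.add (Tendsto.smul_const ?_ _) (tendsto_mixL _ ?_ ?_)
    · exact (tendsto_const_nhds.mul (tendsto_regInv hη)).const_mul _
    · exact ((Complex.continuous_ofReal.tendsto _).comp (tendsto_deltaKer hη)).const_mul _
        |>.const_mul _
    · exact ((tendsto_regInvLin hη).const_mul _).const_mul _

theorem cdot_self (k : CV d) :
    cdot k k = ((‖reV k‖ ^ 2 - ‖imV k‖ ^ 2 : ℝ) : ℂ) +
      ((2 * inner ℝ (reV k) (imV k) : ℝ) : ℂ) * Complex.I := by
  nth_rw 2 [← toC_reV_add_imV k]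
  rw [cdot_add_right, cdot_smul_right, cdot_toC, cdot_toC, real_inner_self_eq_norm_sq,
    real_inner_self_eq_norm_sq, real_inner_comm (reV k) (imV k)]
  push_cast
  linear_combination (‖imV k‖ : ℂ) ^ 2 * Complex.I_sq

theorem inner_of_mem_SigmaE {E : ℝ} {k : CV d} (hk : k ∈ SigmaE d E) :
    inner ℝ (reV k) (imV k) = 0 := by
  have h : cdot k k = E := hk
  rw [cdot_self] at h
  have := congrArg Complex.im h
  rw [Complex.add_im, Complex.ofReal_im, Complex.im_ofReal_mul, Complex.I_im, mul_one, zero_add,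
    Complex.ofReal_im] at this
  linarith

theorem norm_sq_of_mem_SigmaE {E : ℝ} {k : CV d} (hk : k ∈ SigmaE d E) :
    ‖reV k‖ ^ 2 - ‖imV k‖ ^ 2 = E := by
  have h : cdot k k = E := hk
  rw [cdot_self] at h
  have := congrArg Complex.re h
  rw [Complex.add_re, Complex.re_ofReal_mul, Complex.ofReal_re, Complex.I_re, mul_zero,
    add_zero, Complex.ofReal_re] at this
  exact this

theorem symb_sub_reV {k : CV d} (h : inner ℝ (reV k) (imV k) = 0) (ζ : RV d) :
    symb k (ζ - reV k) = ((‖ζ‖ ^ 2 - ‖reV k‖ ^ 2 : ℝ) : ℂ) +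
      ((2 * inner ℝ (imV k) ζ : ℝ) : ℂ) * Complex.I := by
  rw [symb, cdot_toC, inner_sub_right, inner_sub_right, real_inner_self_eq_norm_sq,
    real_inner_comm (reV k) (imV k), h, norm_sub_sq_real, real_inner_comm ζ]
  push_cast
  ring

theorem smoothInt_shift (s : ℝ) (x : RV d) {k : CV d} (h : inner ℝ (reV k) (imV k) = 0) :
    smoothInt s x k = planeWave (toC (-reV k)) x * ∫ ζ : RV d, planeWave (toC ζ) x *
      regExp s (((‖ζ‖ ^ 2 - ‖reV k‖ ^ 2 : ℝ) : ℂ) +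
        ((2 * inner ℝ (imV k) ζ : ℝ) : ℂ) * Complex.I) := by
  rw [smoothInt, ← integral_sub_right_eq_self _ (reV k), ← integral_const_mul]
  refine integral_congr_ae (Eventually.of_forall fun ζ => ?_)
  simp only
  rw [symb_sub_reV h, sub_eq_add_neg, toC_add, planeWave_add]
  ring

/-- The reflection in the line spanned by `n₀ + b / |b|`, applied to `x`. -/
def reflAt (n₀ b x : RV d) : RV d :=
  (2 * (inner ℝ (n₀ + ‖b‖⁻¹ • b) x / ‖n₀ + ‖b‖⁻¹ • b‖ ^ 2)) • (n₀ + ‖b‖⁻¹ • b) - x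

theorem reflAt_eq (n₀ b x : RV d) :
    reflAt n₀ b x = Submodule.reflection (Submodule.span ℝ {n₀ + ‖b‖⁻¹ • b}) x := by
  rw [Submodule.reflection_singleton_apply, reflAt, ← smul_assoc, nsmul_eq_mul]
  rfl

theorem reflAt_base {n₀ b : RV d} (hn : ‖n₀‖ = 1) (hb : b ≠ 0) (hm : n₀ + ‖b‖⁻¹ • b ≠ 0) :
    reflAt n₀ b b = ‖b‖ • n₀ := by
  have hb1 := norm_unit hb
  set n := ‖b‖⁻¹ • b with hn'
  have hbn : b = ‖b‖ • n := by rw [hn', smul_smul, mul_inv_cancel₀ (norm_ne_zero_iff.2 hb), one_smul]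
  have h1 : ‖n₀ + n‖ ^ 2 = 2 * inner ℝ (n₀ + n) n := by
    rw [norm_add_sq_real, hn, hb1, inner_add_left, real_inner_self_eq_norm_sq, hb1]
    ring
  have h2 : ‖n₀ + n‖ ^ 2 ≠ 0 := pow_ne_zero 2 (norm_ne_zero_iff.2 hm)
  have h3 : inner ℝ (n₀ + n) b = ‖b‖ * inner ℝ (n₀ + n) n := by
    nth_rw 1 [hbn]; rw [inner_smul_right]
  have h4 : inner ℝ (n₀ + n) n ≠ 0 := by
    intro h0; rw [h0, mul_zero] at h1; exact h2 h1
  rw [reflAt, ← hn', h3, h1]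
  have : 2 * (‖b‖ * inner ℝ (n₀ + n) n / (2 * inner ℝ (n₀ + n) n)) = ‖b‖ := by
    field_simp
  rw [this, smul_add, ← hbn]
  abel

/-- The normalized parameters at a complex momentum. -/
def normParam (n₀ x : RV d) (k : CV d) : RV d × ℝ × ℝ :=
  (‖reV k‖ • reflAt n₀ (imV k) x, ‖reV k‖ ^ 2, 2 * ‖reV k‖ * ‖imV k‖)

theorem smoothInt_eq_normInt (s : ℝ) (x : RV d) {k : CV d} {n₀ : RV d}
    (h : inner ℝ (reV k) (imV k) = 0) (ha : reV k ≠ 0) (hb : imV k ≠ 0) (hn : ‖n₀‖ = 1)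
    (hm : n₀ + ‖imV k‖⁻¹ • imV k ≠ 0) :
    smoothInt s x k = planeWave (toC (-reV k)) x * ((‖reV k‖ ^ d : ℝ) : ℂ) *
      normInt s n₀ (normParam n₀ x k) := by
  have hρ : 0 < ‖reV k‖ := norm_pos_iff.2 ha
  set S := Submodule.reflection (Submodule.span ℝ {n₀ + ‖imV k‖⁻¹ • imV k}) with hS
  have hSb : S (imV k) = ‖imV k‖ • n₀ := by rw [← reflAt_base hn hb hm, reflAt_eq]
  have hSS : ∀ u v : RV d, inner ℝ u (S v) = inner ℝ (S u) v := fun u v => by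
    rw [← S.inner_map_map u (S v), hS, Submodule.reflection_reflection]
  rw [smoothInt_shift s x h, mul_assoc]
  congr 1
  set f : RV d → ℂ := fun ζ => planeWave (toC ζ) x *
      regExp s (((‖ζ‖ ^ 2 - ‖reV k‖ ^ 2 : ℝ) : ℂ) +
        ((2 * inner ℝ (imV k) ζ : ℝ) : ℂ) * Complex.I) with hf
  have h1 := Measure.integral_comp_smul (volume : Measure (RV d)) (fun ζ => f (S ζ)) ‖reV k‖
  have h2 : ∫ ζ, f (S ζ) = ∫ ζ, f ζ :=
    S.measurePreserving.integral_comp S.toHomeomorph.measurableEmbedding f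
  rw [h2, finrank_euclideanSpace_fin, abs_of_pos (by positivity)] at h1
  have h3 : ∫ ζ, f ζ = ((‖reV k‖ ^ d : ℝ) : ℂ) * ∫ η, f (S (‖reV k‖ • η)) := by
    rw [h1, Complex.real_smul, ← mul_assoc, ← Complex.ofReal_mul,
      mul_inv_cancel₀ (by positivity), Complex.ofReal_one, one_mul]
  rw [h3]
  congr 1
  refine integral_congr_ae (Eventually.of_forall fun η => ?_)
  have e1 : normSymb n₀ η (normParam n₀ x k).2 =
      ((‖S (‖reV k‖ • η)‖ ^ 2 - ‖reV k‖ ^ 2 : ℝ) : ℂ) +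
        ((2 * inner ℝ (imV k) (S (‖reV k‖ • η)) : ℝ) : ℂ) * Complex.I := by
    rw [normSymb_apply, S.norm_map, norm_smul, norm_norm, hSS, hSb, inner_smul_left,
      inner_smul_right, normParam]
    simp only [conj_trivial]
    congr 3 <;> ring
  have e2 : planeWave (toC η) (normParam n₀ x k).1 = planeWave (toC (S (‖reV k‖ • η))) x := by
    rw [planeWave_toC, planeWave_toC, normParam, real_inner_comm x, hSS, inner_smul_right,
      inner_smul_right, reflAt_eq, ← hS, real_inner_comm η]
  simp only [hf]
  rw [e1, e2]

/-- The real part as a continuous linear map. -/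
def reVL (d : ℕ) : CV d →L[ℝ] RV d :=
  LinearMap.toContinuousLinearMap
    { toFun := reV
      map_add' := reV_add
      map_smul' := fun c k => by ext j; simp [reV] }

/-- The imaginary part as a continuous linear map. -/
def imVL (d : ℕ) : CV d →L[ℝ] RV d :=
  LinearMap.toContinuousLinearMap
    { toFun := imV
      map_add' := imV_add
      map_smul' := fun c k => by ext j; simp [imV] }

theorem hasFDerivAt_reV (k : CV d) : HasFDerivAt reV (reVL d) k := (reVL d).hasFDerivAt
theorem hasFDerivAt_imV (k : CV d) : HasFDerivAt imV (imVL d) k := (imVL d).hasFDerivAt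

theorem continuous_reV : Continuous (reV : CV d → RV d) := (reVL d).continuous
theorem continuous_imV : Continuous (imV : CV d → RV d) := (imVL d).continuous

theorem differentiableAt_normParam (n₀ x : RV d) {k : CV d} (ha : reV k ≠ 0) (hb : imV k ≠ 0)
    (hm : n₀ + ‖imV k‖⁻¹ • imV k ≠ 0) : DifferentiableAt ℝ (normParam n₀ x) k := by
  have h1 : DifferentiableAt ℝ (reV : CV d → RV d) k := (hasFDerivAt_reV k).differentiableAt
  have h2 : DifferentiableAt ℝ (imV : CV d → RV d) k := (hasFDerivAt_imV k).differentiableAt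
  have h3 := h1.norm ℝ ha
  have h4 := h2.norm ℝ hb
  have h5 : DifferentiableAt ℝ (fun k => n₀ + ‖imV k‖⁻¹ • imV k) k :=
    ((h4.inv (norm_ne_zero_iff.2 hb)).smul h2).const_add _
  have h6 := h5.norm_sq ℝ
  have h7 : ‖n₀ + ‖imV k‖⁻¹ • imV k‖ ^ 2 ≠ 0 := pow_ne_zero 2 (norm_ne_zero_iff.2 hm)
  have h8 : DifferentiableAt ℝ (fun k => reflAt n₀ (imV k) x) k := by
    have h9 : DifferentiableAt ℝ (fun k : CV d => inner ℝ (n₀ + ‖imV k‖⁻¹ • imV k) x /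
        ‖n₀ + ‖imV k‖⁻¹ • imV k‖ ^ 2) k := by
      simp only [div_eq_mul_inv]
      exact (h5.inner ℝ (differentiableAt_const x)).mul (h6.inv h7)
    exact ((h9.const_mul 2).smul h5).sub_const _
  exact (h3.smul h8).prodMk ((h3.pow 2).prodMk ((h3.const_mul 2).mul h4))

theorem differentiableAt_phase (x : RV d) {k : CV d} (ha : reV k ≠ 0) :
    DifferentiableAt ℝ (fun k : CV d => planeWave (toC (-reV k)) x * ((‖reV k‖ ^ d : ℝ) : ℂ)) k := by
  have h1 : DifferentiableAt ℝ (reV : CV d → RV d) k := (hasFDerivAt_reV k).differentiableAt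
  have h3 := (h1.norm ℝ ha).pow d
  have h4 : DifferentiableAt ℝ (fun k : CV d => planeWave (toC (-reV k)) x) k := by
    simp only [planeWave_toC]
    exact ((Complex.ofRealCLM.differentiableAt.comp k
      (h1.neg.inner ℝ (differentiableAt_const x))).mul_const _).cexp
  exact h4.mul (Complex.ofRealCLM.differentiableAt.comp k h3)

theorem tendsto_normInt (hd : 2 ≤ d) {n : RV d} (hn : n ≠ 0) {p : RV d × ℝ × ℝ}
    (hA : 0 < p.2.1) (hB : p.2.2 ≠ 0) :
    Tendsto (fun s => normInt s n p) (𝓝[>] 0) (𝓝 (normInt 0 n p)) := by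
  obtain ⟨r, hr, bound, hbI, hb⟩ := normIntD_bound hd hn hA hB
  refine tendsto_integral_filter_of_dominated_convergence bound
    (Eventually.of_forall fun s => ((continuous_planeWave_toC p.1).measurable.mul
      ((measurable_regExp s).comp
      ((continuous_normSymb n).clm_apply continuous_const).measurable)).aestronglyMeasurable) ?_ hbI ?_
  · filter_upwards [self_mem_nhdsWithin] with s hs
    filter_upwards [ae_normSymb_ne_zero hn hB] with η hη
    exact (hb s (le_of_lt hs) p.1 p.2 (Metric.mem_ball_self hr) η hη).2.2
  · filter_upwards [ae_normSymb_ne_zero hn hB] with η hη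
    exact ((tendsto_regInv hη).const_mul _).const_mul _

/-- Every tangent vector at a non-real point is the velocity of a curve in the variety. -/
theorem exists_curve {E : ℝ} {k h : CV d} (hk : k ∈ SigmaE d E) (hb : imV k ≠ 0)
    (ha : reV k ≠ 0) (hh : h ∈ tangentSigma k) :
    ∃ φ : ℝ → CV d, φ 0 = k ∧ HasDerivAt φ h 0 ∧ ∀ᶠ t in 𝓝 0, φ t ∈ SigmaE d E := by
  have hρ : 0 < ‖reV k‖ := norm_pos_iff.2 ha
  have hβ : 0 < ‖imV k‖ := norm_pos_iff.2 hb
  have hperp := inner_of_mem_SigmaE hk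
  have hperp' : inner ℝ (imV k) (reV k) = 0 := by rw [real_inner_comm, hperp]
  have hρ' : (‖reV k‖ : ℂ) ≠ 0 := by exact_mod_cast hρ.ne'
  have hβ' : (‖imV k‖ : ℂ) ≠ 0 := by exact_mod_cast hβ.ne'
  set v : CV d := ((‖reV k‖ : ℂ)⁻¹) • toC (reV k) + (-Complex.I * (‖imV k‖ : ℂ)⁻¹) • toC (imV k)
    with hv
  have hvv : cdot v v = 0 := by
    rw [hv]
    simp only [cdot_add_left, cdot_add_right, cdot_smul_left, cdot_smul_right, cdot_toC_toC,
      hperp, hperp', real_inner_self_eq_norm_sq]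
    push_cast
    field_simp
    linear_combination (‖reV k‖ * ‖imV k‖ : ℂ) * Complex.I_sq
  have hkv : cdot k v = ‖reV k‖ + ‖imV k‖ := by
    rw [hv]
    simp only [cdot_add_right, cdot_smul_right, cdot_toC, hperp, hperp', real_inner_self_eq_norm_sq]
    push_cast
    field_simp
    linear_combination (-(‖reV k‖ * ‖imV k‖ ^ 2 : ℂ)) * Complex.I_sq
  have hkv0 : cdot k v ≠ 0 := by
    rw [hkv]; exact_mod_cast (add_pos hρ hβ).ne'
  set σ : ℝ → ℂ := fun t => -((t : ℂ) ^ 2 * cdot h h) / (2 * (cdot k v + t * cdot h v)) with hσ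
  have hden : 2 * (cdot k v + ((0 : ℝ) : ℂ) * cdot h v) ≠ 0 := by simpa using hkv0
  have hid : HasDerivAt (fun t : ℝ => (t : ℂ)) 1 0 := Complex.ofRealCLM.hasDerivAt
  have hσd : HasDerivAt σ 0 0 := by
    have h1 := (((hid.pow 2).mul_const (cdot h h)).neg).div
      (((hid.mul_const (cdot h v)).const_add (cdot k v)).const_mul 2) hden
    refine h1.congr_deriv ?_
    simp
  refine ⟨fun t => k + (t : ℂ) • h + σ t • v, by simp [hσ], ?_, ?_⟩
  · refine (((hid.smul_const h).const_add k).add (hσd.smul_const v)).congr_deriv ?_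
    simp
  · have hc : ContinuousAt (fun t : ℝ => 2 * (cdot k v + (t : ℂ) * cdot h v)) 0 := by fun_prop
    filter_upwards [hc.eventually_ne hden] with t ht
    have hkh : cdot k h = 0 := hh
    have hkk : cdot k k = E := hk
    change cdot _ _ = (E : ℂ)
    have hσt : σ t * (2 * (cdot k v + t * cdot h v)) = -((t : ℂ) ^ 2 * cdot h h) := by
      simp only [hσ]; rw [div_mul_cancel₀ _ ht]
    simp only [cdot_add_left, cdot_add_right, cdot_smul_left, cdot_smul_right, hvv, hkk, hkh,
      cdot_comm h k, cdot_comm v k, cdot_comm v h]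
    linear_combination hσt

theorem regInt_dbar_tendsto (hd : 2 ≤ d) (x : RV d) {E : ℝ} {k : CV d} (hk : k ∈ SigmaE d E)
    (hb : imV k ≠ 0) (ha : reV k ≠ 0) :
    ∃ L : CV d →L[ℝ] ℂ, HasFDerivWithinAt (regInt 1 x) L (SigmaE d E) k ∧
      ∀ h ∈ tangentSigma k, Tendsto (fun s : ℝ => ∫ ξ : RV d, planeWave (toC ξ) x *
        Complex.exp (-symb k ξ) * (deltaKer s (symb k ξ) : ℝ) *
          (2 * (starRingEnd ℂ) (cdot h (toC ξ)))) (𝓝[>] 0)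
        (𝓝 ((L h + Complex.I * L (Complex.I • h)) / 2)) := by
  set n₀ : RV d := ‖imV k‖⁻¹ • imV k with hn₀
  have hn : ‖n₀‖ = 1 := norm_unit hb
  have hn0 : n₀ ≠ 0 := by rintro h; rw [h] at hn; simp at hn
  have hm : n₀ + ‖imV k‖⁻¹ • imV k ≠ 0 := by
    rw [← hn₀, ← two_smul ℝ]; exact smul_ne_zero two_ne_zero hn0
  have hρ : 0 < ‖reV k‖ := norm_pos_iff.2 ha
  have hβ : 0 < ‖imV k‖ := norm_pos_iff.2 hb
  set c : CV d → ℂ := fun k => planeWave (toC (-reV k)) x * ((‖reV k‖ ^ d : ℝ) : ℂ)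
  have hc := (differentiableAt_phase x ha).hasFDerivAt
  have hY := (differentiableAt_normParam n₀ x ha hb hm).hasFDerivAt
  set c' := fderiv ℝ c k
  set Y' := fderiv ℝ (normParam n₀ x) k
  have hA : 0 < (normParam n₀ x k).2.1 := by simp only [normParam]; positivity
  have hB : (normParam n₀ x k).2.2 ≠ 0 := by simp only [normParam]; positivity
  set Ls : ℝ → CV d →L[ℝ] ℂ := fun s => c k • (∫ η, normIntD s n₀ (normParam n₀ x k) η).comp Y' +
    normInt s n₀ (normParam n₀ x k) • c' with hLs
  have hu : ∀ s : ℝ, 0 ≤ s →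
      HasFDerivAt (fun k => c k * normInt s n₀ (normParam n₀ x k)) (Ls s) k := fun s hs =>
    hc.mul ((hasFDerivAt_normInt hd hn0 hA hB hs).comp k hY)
  have hev : ∀ᶠ k' in 𝓝 k, reV k' ≠ 0 ∧ imV k' ≠ 0 ∧ n₀ + ‖imV k'‖⁻¹ • imV k' ≠ 0 := by
    have h1 : ContinuousAt (fun k' : CV d => n₀ + ‖imV k'‖⁻¹ • imV k') k :=
      continuousAt_const.add ((continuous_imV.norm.continuousAt.inv₀ hβ.ne').smul
        continuous_imV.continuousAt)
    filter_upwards [continuous_reV.continuousAt.eventually_ne ha,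
      continuous_imV.continuousAt.eventually_ne hb, h1.eventually_ne hm] with k' h1 h2 h3
    exact ⟨h1, h2, h3⟩
  have heq : ∀ s : ℝ, ∀ᶠ k' in 𝓝 k, k' ∈ SigmaE d E →
      smoothInt s x k' = c k' * normInt s n₀ (normParam n₀ x k') := fun s => by
    filter_upwards [hev] with k' hk' hS
    exact smoothInt_eq_normInt s x (inner_of_mem_SigmaE hS) hk'.1 hk'.2.1 hn hk'.2.2
  refine ⟨Ls 0, ?_, fun h hh => ?_⟩
  · refine (hu 0 le_rfl).hasFDerivWithinAt.congr_of_eventuallyEq ?_ ?_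
    · filter_upwards [eventually_nhdsWithin_of_eventually_nhds (heq 0), self_mem_nhdsWithin]
        with k' h1 h2
      rw [← h1 h2, smoothInt_zero]
    · rw [← (heq 0).self_of_nhds hk, smoothInt_zero]
  · have hLt : ∀ v : CV d, Tendsto (fun s => Ls s v) (𝓝[>] 0) (𝓝 (Ls 0 v)) := by
      intro v
      have h1 := tendsto_normIntD hd hn0 hA hB
      have h2 := tendsto_normInt hd hn0 hA hB
      have h3 : Tendsto (fun s => (∫ η, normIntD s n₀ (normParam n₀ x k) η) (Y' v)) (𝓝[>] 0)
          (𝓝 ((∫ η, normIntD 0 n₀ (normParam n₀ x k) η) (Y' v))) :=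
        ((ContinuousLinearMap.apply ℝ ℂ (Y' v)).continuous.tendsto _).comp h1
      simp only [hLs, _root_.add_apply, _root_.smul_apply, ContinuousLinearMap.comp_apply,
        smul_eq_mul]
      exact (h3.const_mul _).add (h2.mul_const _)
    have hIh : Complex.I • h ∈ tangentSigma k := by
      change cdot k (Complex.I • h) = 0
      rw [cdot_smul_right, show cdot k h = 0 from hh, mul_zero]
    have hlim := ((hLt h).add ((hLt (Complex.I • h)).const_mul Complex.I)).div_const 2
    refine hlim.congr' ?_
    filter_upwards [self_mem_nhdsWithin] with s hs
    obtain ⟨L', hL', hdb⟩ := smoothInt_dbar (show 0 < s from hs) x k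
    have huniq : ∀ v ∈ tangentSigma k, Ls s v = L' v := by
      intro v hv
      obtain ⟨φ, h0, hφ, hφS⟩ := exists_curve hk hb ha hv
      have h1 : HasDerivAt (fun t => smoothInt s x (φ t)) (L' v) 0 :=
        HasFDerivAt.comp_hasDerivAt (0 : ℝ) (l := smoothInt s x) (h0.symm ▸ hL') hφ
      have h2 : HasDerivAt (fun t => c (φ t) * normInt s n₀ (normParam n₀ x (φ t))) (Ls s v) 0 :=
        HasFDerivAt.comp_hasDerivAt (0 : ℝ) (l := fun k => c k * normInt s n₀ (normParam n₀ x k))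
          (h0.symm ▸ hu s (le_of_lt hs)) hφ
      refine h2.unique (h1.congr_of_eventuallyEq ?_)
      have h3 : Tendsto φ (𝓝 0) (𝓝 k) := h0 ▸ hφ.continuousAt.tendsto
      filter_upwards [hφS, h3.eventually (heq s)] with t ht1 ht2
      exact (ht2 ht1).symm
    rw [huniq h hh, huniq _ hIh, hdb]

end

section

theorem integral_integral_inv_one_add_sq_sq :
    ∫ x : ℝ, ∫ y : ℝ, ((1 + x ^ 2 + y ^ 2) ^ 2)⁻¹ = Real.pi := by
  have hint : Integrable (fun p : ℝ × ℝ => ((1 + p.1 ^ 2 + p.2 ^ 2) ^ 2)⁻¹) := by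
    refine (integrable_inv_one_add_sq.mul_prod integrable_inv_one_add_sq).mono' ?_
      (Eventually.of_forall fun p => ?_)
    · exact (by fun_prop : Measurable _).aestronglyMeasurable
    · rw [Real.norm_of_nonneg (by positivity), ← mul_inv]
      gcongr
      nlinarith [sq_nonneg p.1, sq_nonneg p.2, mul_nonneg (sq_nonneg p.1) (sq_nonneg p.2)]
  rw [← integral_prod _ hint, ← Measure.volume_eq_prod, ← integral_comp_polarCoord_symm]
  have e : ∀ p : ℝ × ℝ, p.1 • ((1 + (polarCoord.symm p).1 ^ 2 + (polarCoord.symm p).2 ^ 2) ^ 2)⁻¹ =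
      p.1 * ((1 + p.1 ^ 2) ^ 2)⁻¹ * (fun _ : ℝ => (1 : ℝ)) p.2 := fun p => by
    rw [polarCoord_symm_apply]
    simp only [smul_eq_mul, mul_one]
    congr 3
    linear_combination p.1 ^ 2 * Real.cos_sq_add_sin_sq p.2
  simp only [e]
  rw [polarCoord_target, Measure.volume_eq_prod,
    setIntegral_prod_mul (fun r : ℝ => r * ((1 + r ^ 2) ^ 2)⁻¹) (fun _ : ℝ => (1 : ℝ))]
  have h1 : ∫ r in Set.Ioi (0 : ℝ), r * ((1 + r ^ 2) ^ 2)⁻¹ = 0 - (-(1 / 2) * (1 + (0 : ℝ) ^ 2)⁻¹) := by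
    refine integral_Ioi_of_hasDerivAt_of_nonneg' (g := fun r : ℝ => -(1 / 2) * (1 + r ^ 2)⁻¹) ?_ ?_ ?_
    · intro r _
      have h0 : (1 + r ^ 2 : ℝ) ≠ 0 := by positivity
      have := ((((hasDerivAt_id r).pow 2).const_add 1).inv h0).const_mul (-(1 / 2) : ℝ)
      refine this.congr_deriv ?_
      simp
      field_simp
    · intro r hr
      have : 0 < r := hr
      positivity
    · have : Tendsto (fun r : ℝ => (1 + r ^ 2)⁻¹) atTop (𝓝 0) :=
        tendsto_inv_atTop_zero.comp (tendsto_atTop_add_const_left _ _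
          (tendsto_pow_atTop two_ne_zero))
      simpa using this.const_mul (-(1 / 2) : ℝ)
  rw [h1]
  simp
  rw [max_eq_left (by positivity)]
  ring

theorem integral_mul_left_real {G : Type*} [NormedAddCommGroup G] [NormedSpace ℝ G] (g : ℝ → G) {a : ℝ} (ha : 0 < a) :
    ∫ x, g x = a • ∫ x, g (a * x) := by
  rw [Measure.integral_comp_mul_left, abs_of_pos (by positivity), smul_smul,
    mul_inv_cancel₀ ha.ne', one_smul]

theorem integral_integral_delta {ρ β : ℝ} (hρ : 0 < ρ) (hβ : 0 < β) :
    ∫ q : ℝ, ∫ τ : ℝ, ((1 + (2 * ρ * q) ^ 2 + (2 * β * τ) ^ 2) ^ 2)⁻¹ =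
      Real.pi / (4 * ρ * β) := by
  have h1 := integral_mul_left_real
    (fun x : ℝ => ∫ y : ℝ, ((1 + x ^ 2 + y ^ 2) ^ 2)⁻¹) (by positivity : 0 < 2 * ρ)
  have h2 : ∀ x : ℝ, ∫ y : ℝ, ((1 + x ^ 2 + y ^ 2) ^ 2)⁻¹ =
      (2 * β) • ∫ y : ℝ, ((1 + x ^ 2 + (2 * β * y) ^ 2) ^ 2)⁻¹ := fun x =>
    integral_mul_left_real (fun y => ((1 + x ^ 2 + y ^ 2) ^ 2)⁻¹) (by positivity : 0 < 2 * β)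
  rw [integral_integral_inv_one_add_sq_sq] at h1
  simp only [h2, smul_eq_mul] at h1
  rw [integral_const_mul] at h1
  rw [h1]
  field_simp
  ring

/-- The regularized delta function of `t² + r² - ρ² + 2 i β t`. -/
def rayKer (ρ β ε t r : ℝ) : ℝ :=
  ε ^ 2 * (((t ^ 2 + r ^ 2 - ρ ^ 2) ^ 2 + (2 * β * t) ^ 2 + ε ^ 2) ^ 2)⁻¹

theorem exists_sq_add_sq_ge {ρ β : ℝ} (hρ : 0 < ρ) (hβ : 0 < β) :
    ∃ c : ℝ, 0 < c ∧ ∀ t r : ℝ, |t| ≤ 1 → 0 ≤ r →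
      c * ((r - ρ) ^ 2 + t ^ 2) ≤ (t ^ 2 + r ^ 2 - ρ ^ 2) ^ 2 + (2 * β * t) ^ 2 := by
  set B := 2 * β ^ 2 with hB
  have hBpos : 0 < B := by positivity
  set l := B / (1 + B) with hl
  have hlpos : 0 < l := by positivity
  refine ⟨min (l * ρ ^ 2) B, by positivity, fun t r ht hr => ?_⟩
  have h1 : (r - ρ) ^ 2 * ρ ^ 2 ≤ (r ^ 2 - ρ ^ 2) ^ 2 := by
    have : (r ^ 2 - ρ ^ 2) ^ 2 = (r - ρ) ^ 2 * (r + ρ) ^ 2 := by ring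
    rw [this]
    gcongr
    linarith
  have ht4 : t ^ 4 ≤ t ^ 2 := by
    have : t ^ 2 ≤ 1 := by rw [← sq_abs]; exact pow_le_one₀ (abs_nonneg _) ht
    nlinarith [sq_nonneg t]
  have h2 : l * (r ^ 2 - ρ ^ 2) ^ 2 ≤ (t ^ 2 + r ^ 2 - ρ ^ 2) ^ 2 + B * t ^ 4 := by
    rw [hl, div_mul_eq_mul_div, div_le_iff₀ (by positivity)]
    nlinarith [sq_nonneg ((t ^ 2 + r ^ 2 - ρ ^ 2) + B * t ^ 2)]
  have h3 : (2 * β * t) ^ 2 = B * t ^ 2 + B * t ^ 2 := by rw [hB]; ring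
  have h4 : min (l * ρ ^ 2) B * (r - ρ) ^ 2 ≤ l * ρ ^ 2 * (r - ρ) ^ 2 := by
    gcongr; exact min_le_left _ _
  have h5 : min (l * ρ ^ 2) B * t ^ 2 ≤ B * t ^ 2 := by
    gcongr; exact min_le_right _ _
  have h6 : l * ρ ^ 2 * (r - ρ) ^ 2 ≤ l * (r ^ 2 - ρ ^ 2) ^ 2 := by
    rw [mul_assoc, mul_comm (ρ ^ 2)]; gcongr
  have h7 : B * t ^ 4 ≤ B * t ^ 2 := by gcongr
  rw [h3, mul_add]
  linarith

/-- The rescaled integrand in the variables `r = ρ + ε q`, `t = ε τ`. -/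
def rayScaled (ρ β : ℝ) (Ψ : ℝ → ℝ → ℂ) (ε q τ : ℝ) : ℂ :=
  if 0 < ρ + ε * q ∧ |ε * τ| ≤ 1 then
    Ψ (ε * τ) (ρ + ε * q) * ((ε ^ 2 * rayKer ρ β ε (ε * τ) (ρ + ε * q) : ℝ) : ℂ) else 0

theorem integral_rayKer_eq (ρ β : ℝ) (Ψ : ℝ → ℝ → ℂ) {ε : ℝ} (hε : 0 < ε) :
    ∫ r in Set.Ioi (0 : ℝ), ∫ t in Set.Icc (-1 : ℝ) 1, Ψ t r * (rayKer ρ β ε t r : ℝ) =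
      ∫ q : ℝ, ∫ τ : ℝ, rayScaled ρ β Ψ ε q τ := by
  set f : ℝ → ℝ → ℂ := fun r t => if 0 < r ∧ |t| ≤ 1 then Ψ t r * (rayKer ρ β ε t r : ℝ) else 0 with hf
  have h1 : ∫ r in Set.Ioi (0 : ℝ), ∫ t in Set.Icc (-1 : ℝ) 1, Ψ t r * (rayKer ρ β ε t r : ℝ) =
      ∫ r, ∫ t, f r t := by
    rw [← integral_indicator measurableSet_Ioi]
    refine integral_congr_ae (Eventually.of_forall fun r => ?_)
    simp only
    by_cases hr : 0 < r
    · rw [Set.indicator_of_mem (by exact hr), ← integral_indicator measurableSet_Icc]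
      refine integral_congr_ae (Eventually.of_forall fun t => ?_)
      simp only [hf, hr, true_and, Set.indicator_apply, Set.mem_Icc, abs_le]
    · rw [Set.indicator_of_notMem (by exact hr)]
      simp [hf, hr]
  rw [h1, ← integral_add_left_eq_self _ ρ, integral_mul_left_real _ hε, ← integral_smul]
  refine integral_congr_ae (Eventually.of_forall fun q => ?_)
  simp only
  rw [integral_mul_left_real _ hε, ← integral_smul, ← integral_smul]
  refine integral_congr_ae (Eventually.of_forall fun τ => ?_)
  simp only [hf, rayScaled]
  split_ifs
  · rw [Complex.real_smul, Complex.real_smul]; push_cast; ring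
  · simp

theorem norm_rayScaled_le {ρ β : ℝ} (hρ : 0 < ρ) (hβ : 0 < β) :
    ∃ c : ℝ, 0 < c ∧ ∀ (Ψ : ℝ → ℝ → ℂ) (C : ℝ), 0 ≤ C → (∀ t r, |t| ≤ 1 → 0 ≤ r → ‖Ψ t r‖ ≤ C) →
      ∀ ε : ℝ, 0 < ε → ∀ q τ : ℝ,
        ‖rayScaled ρ β Ψ ε q τ‖ ≤ C * ((1 + (c * q) ^ 2)⁻¹ * (1 + (c * τ) ^ 2)⁻¹) := by
  obtain ⟨c, hc, h⟩ := exists_sq_add_sq_ge hρ hβ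
  refine ⟨Real.sqrt c, Real.sqrt_pos.2 hc, fun Ψ C hC hΨ ε hε q τ => ?_⟩
  have hcs := Real.sq_sqrt hc.le
  rw [rayScaled]
  split_ifs with hif
  · rw [norm_mul, Complex.norm_real]
    have hb := h (ε * τ) (ρ + ε * q) hif.2 hif.1.le
    have hk0 : 0 ≤ ε ^ 2 * rayKer ρ β ε (ε * τ) (ρ + ε * q) := by unfold rayKer; positivity
    rw [Real.norm_of_nonneg hk0]
    refine mul_le_mul (hΨ _ _ hif.2 hif.1.le) ?_ hk0 hC
    rw [rayKer, ← mul_inv]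
    set W := ((ε * τ) ^ 2 + (ρ + ε * q) ^ 2 - ρ ^ 2) ^ 2 + (2 * β * (ε * τ)) ^ 2
    have hW : ε ^ 2 * (c * (q ^ 2 + τ ^ 2)) ≤ W := by
      refine le_trans (le_of_eq ?_) hb; ring
    have hW2 : (ε ^ 2 * (1 + c * (q ^ 2 + τ ^ 2))) ^ 2 ≤ (W + ε ^ 2) ^ 2 := by
      gcongr; linarith
    calc ε ^ 2 * (ε ^ 2 * ((W + ε ^ 2) ^ 2)⁻¹)
        ≤ ε ^ 2 * (ε ^ 2 * ((ε ^ 2 * (1 + c * (q ^ 2 + τ ^ 2))) ^ 2)⁻¹) := by gcongr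
      _ = ((1 + c * (q ^ 2 + τ ^ 2)) ^ 2)⁻¹ := by field_simp
      _ ≤ _ := by
        gcongr
        rw [mul_pow, mul_pow, hcs]
        nlinarith [sq_nonneg q, sq_nonneg τ, mul_nonneg hc.le (sq_nonneg q),
          mul_nonneg hc.le (sq_nonneg τ)]
  · rw [norm_zero]; positivity

theorem integrable_inv_one_add_mul_sq {c : ℝ} (hc : 0 < c) :
    Integrable fun q : ℝ => (1 + (c * q) ^ 2)⁻¹ :=
  integrable_inv_one_add_sq.comp_mul_left' hc.ne'

theorem measurable_rayScaled (ρ β : ℝ) {Ψ : ℝ → ℝ → ℂ} (hΨ : Continuous (Function.uncurry Ψ))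
    (ε : ℝ) : Measurable (Function.uncurry (rayScaled ρ β Ψ ε)) := by
  have h1 : Measurable fun p : ℝ × ℝ => Ψ (ε * p.2) (ρ + ε * p.1) :=
    (hΨ.comp (by fun_prop : Continuous fun p : ℝ × ℝ => (ε * p.2, ρ + ε * p.1))).measurable
  have hs : MeasurableSet {p : ℝ × ℝ | 0 < ρ + ε * p.1 ∧ |ε * p.2| ≤ 1} := by
    have s1 : MeasurableSet {p : ℝ × ℝ | 0 < ρ + ε * p.1} :=
      (isOpen_lt continuous_const (by fun_prop)).measurableSet
    have s2 : MeasurableSet {p : ℝ × ℝ | |ε * p.2| ≤ 1} :=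
      (isClosed_le (by fun_prop) continuous_const).measurableSet
    exact s1.inter s2
  refine Measurable.ite hs (h1.mul ?_) measurable_const
  · refine Complex.measurable_ofReal.comp ?_
    unfold rayKer
    fun_prop

theorem tendsto_rayScaled {ρ β : ℝ} (hρ : 0 < ρ) {Ψ : ℝ → ℝ → ℂ}
    (hΨ : Continuous (Function.uncurry Ψ)) (q τ : ℝ) :
    Tendsto (fun ε => rayScaled ρ β Ψ ε q τ) (𝓝[>] 0)
      (𝓝 (Ψ 0 ρ * ((((1 + (2 * ρ * q) ^ 2 + (2 * β * τ) ^ 2) ^ 2)⁻¹ : ℝ) : ℂ))) := by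
  have hc : ContinuousAt (fun ε : ℝ => Ψ (ε * τ) (ρ + ε * q) *
      ((((1 + (2 * ρ * q + ε * (q ^ 2 + τ ^ 2)) ^ 2 + (2 * β * τ) ^ 2) ^ 2)⁻¹ : ℝ) : ℂ)) 0 := by
    have h1 : Continuous fun ε : ℝ => Ψ (ε * τ) (ρ + ε * q) :=
      hΨ.comp (by fun_prop : Continuous fun ε : ℝ => (ε * τ, ρ + ε * q))
    refine h1.continuousAt.mul (Complex.continuous_ofReal.continuousAt.comp
      (ContinuousAt.inv₀ (by fun_prop) (by positivity)))
  have h2 := hc.tendsto.mono_left (nhdsWithin_le_nhds (s := Set.Ioi 0))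
  simp only [zero_mul, add_zero] at h2
  refine h2.congr' ?_
  have e1 : ∀ᶠ ε : ℝ in 𝓝[>] 0, 0 < ρ + ε * q := by
    have : ContinuousAt (fun ε : ℝ => ρ + ε * q) 0 := by fun_prop
    exact nhdsWithin_le_nhds (this.eventually (lt_mem_nhds (by simpa)))
  have e2 : ∀ᶠ ε : ℝ in 𝓝[>] 0, |ε * τ| ≤ 1 := by
    have : ContinuousAt (fun ε : ℝ => |ε * τ|) 0 := by fun_prop
    exact nhdsWithin_le_nhds ((this.eventually (gt_mem_nhds (by simp : |(0 : ℝ) * τ| < 1))).mono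
      fun _ h => h.le)
  filter_upwards [e1, e2, self_mem_nhdsWithin] with ε h1 h2 h3
  have hε : 0 < ε := h3
  rw [rayScaled, if_pos ⟨h1, h2⟩, rayKer]
  congr 2
  have : ((ε * τ) ^ 2 + (ρ + ε * q) ^ 2 - ρ ^ 2) ^ 2 + (2 * β * (ε * τ)) ^ 2 + ε ^ 2 =
      ε ^ 2 * (1 + (2 * ρ * q + ε * (q ^ 2 + τ ^ 2)) ^ 2 + (2 * β * τ) ^ 2) := by ring
  rw [this]
  field_simp

theorem ray_delta_limit {ρ β : ℝ} (hρ : 0 < ρ) (hβ : 0 < β) :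
    ∃ D : ℝ, 0 ≤ D ∧ ∀ (Ψ : ℝ → ℝ → ℂ) (C : ℝ), 0 ≤ C → (∀ t r, |t| ≤ 1 → 0 ≤ r → ‖Ψ t r‖ ≤ C) →
      Continuous (Function.uncurry Ψ) →
      (∀ ε : ℝ, 0 < ε → ‖∫ r in Set.Ioi (0 : ℝ), ∫ t in Set.Icc (-1 : ℝ) 1,
        Ψ t r * (rayKer ρ β ε t r : ℝ)‖ ≤ C * D) ∧
      Tendsto (fun ε : ℝ => ∫ r in Set.Ioi (0 : ℝ), ∫ t in Set.Icc (-1 : ℝ) 1,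
        Ψ t r * (rayKer ρ β ε t r : ℝ)) (𝓝[>] 0)
        (𝓝 (Ψ 0 ρ * ((Real.pi / (4 * ρ * β) : ℝ) : ℂ))) := by
  obtain ⟨c, hc, hb⟩ := norm_rayScaled_le hρ hβ
  have hI := integrable_inv_one_add_mul_sq hc
  set K := ∫ τ : ℝ, (1 + (c * τ) ^ 2)⁻¹ with hK
  refine ⟨K * K, mul_self_nonneg K, fun Ψ C hC hΨ hcont => ?_⟩
  have hbI : ∀ q : ℝ, Integrable fun τ : ℝ => C * ((1 + (c * q) ^ 2)⁻¹ * (1 + (c * τ) ^ 2)⁻¹) :=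
    fun q => (hI.const_mul _).const_mul _
  have hinner : ∀ ε : ℝ, 0 < ε → ∀ q : ℝ, ‖∫ τ, rayScaled ρ β Ψ ε q τ‖ ≤
      C * K * (1 + (c * q) ^ 2)⁻¹ := fun ε hε q => by
    refine (norm_integral_le_of_norm_le (hbI q)
      (Eventually.of_forall fun τ => hb Ψ C hC hΨ ε hε q τ)).trans (le_of_eq ?_)
    rw [integral_const_mul, integral_const_mul]; ring
  have hbI2 : Integrable fun q : ℝ => C * K * (1 + (c * q) ^ 2)⁻¹ := hI.const_mul _
  refine ⟨fun ε hε => ?_, ?_⟩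
  · rw [integral_rayKer_eq ρ β Ψ hε]
    refine (norm_integral_le_of_norm_le hbI2 (Eventually.of_forall (hinner ε hε))).trans
      (le_of_eq ?_)
    rw [integral_const_mul]; ring
  · have hmeas := measurable_rayScaled ρ β hcont
    have hlim : Tendsto (fun ε => ∫ q : ℝ, ∫ τ : ℝ, rayScaled ρ β Ψ ε q τ) (𝓝[>] 0)
        (𝓝 (∫ q : ℝ, ∫ τ : ℝ, Ψ 0 ρ *
          ((((1 + (2 * ρ * q) ^ 2 + (2 * β * τ) ^ 2) ^ 2)⁻¹ : ℝ) : ℂ))) := by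
      refine tendsto_integral_filter_of_dominated_convergence _
        (Eventually.of_forall fun ε => ?_) ?_ hbI2 (Eventually.of_forall fun q => ?_)
      · exact (hmeas ε).stronglyMeasurable.integral_prod_right.aestronglyMeasurable
      · filter_upwards [self_mem_nhdsWithin] with ε hε
        exact Eventually.of_forall (hinner ε hε)
      · refine tendsto_integral_filter_of_dominated_convergence _
          (Eventually.of_forall fun ε => ?_) ?_ (hbI q) (Eventually.of_forall fun τ => ?_)
        · exact ((hmeas ε).comp measurable_prodMk_left).aestronglyMeasurable
        · filter_upwards [self_mem_nhdsWithin] with ε hε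
          exact Eventually.of_forall fun τ => hb Ψ C hC hΨ ε hε q τ
        · exact tendsto_rayScaled hρ hcont q τ
    have hval : ∫ q : ℝ, ∫ τ : ℝ, Ψ 0 ρ *
          ((((1 + (2 * ρ * q) ^ 2 + (2 * β * τ) ^ 2) ^ 2)⁻¹ : ℝ) : ℂ) =
        Ψ 0 ρ * ((Real.pi / (4 * ρ * β) : ℝ) : ℂ) := by
      simp only [integral_const_mul, integral_complex_ofReal]
      rw [integral_integral_delta hρ hβ]
    rw [← hval]
    refine hlim.congr' ?_
    filter_upwards [self_mem_nhdsWithin] with ε hε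
    exact (integral_rayKer_eq ρ β Ψ hε).symm

end

section

variable {d : ℕ}

theorem rayKer_nonneg (ρ β ε t r : ℝ) : 0 ≤ rayKer ρ β ε t r := by
  unfold rayKer; positivity

theorem rayKer_le (ρ β t r : ℝ) {ε : ℝ} (hε : 0 < ε) : rayKer ρ β ε t r ≤ (ε ^ 2)⁻¹ := by
  have h : ε ^ 2 * ((ε ^ 2) ^ 2)⁻¹ = (ε ^ 2)⁻¹ := by field_simp
  rw [rayKer, ← h]
  gcongr
  nlinarith [sq_nonneg (t ^ 2 + r ^ 2 - ρ ^ 2), sq_nonneg (2 * β * t)]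

theorem rayKer_le_of_one_le {ρ β t r : ℝ} (hβ : 0 < β) {ε : ℝ} (ht : 1 ≤ |t|) :
    rayKer ρ β ε t r ≤ ε ^ 2 * (((2 * β) ^ 2) ^ 2)⁻¹ := by
  rw [rayKer]
  have h1 : 1 ≤ t ^ 2 := by rw [← sq_abs]; exact one_le_pow₀ ht
  have h2 : (2 * β) ^ 2 ≤ (t ^ 2 + r ^ 2 - ρ ^ 2) ^ 2 + (2 * β * t) ^ 2 + ε ^ 2 := by
    rw [mul_pow _ t]
    nlinarith [sq_nonneg (t ^ 2 + r ^ 2 - ρ ^ 2), sq_nonneg ε, sq_nonneg (2 * β)]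
  gcongr

section
variable {V : Type*} [NormedAddCommGroup V] [InnerProductSpace ℝ V] [FiniteDimensional ℝ V]
  [MeasurableSpace V] [BorelSpace V]

theorem continuous_rayKer_norm (ρ β : ℝ) {ε : ℝ} (hε : 0 < ε) :
    Continuous fun p : ℝ × V => rayKer ρ β ε p.1 ‖p.2‖ := by
  unfold rayKer
  refine continuous_const.mul (Continuous.inv₀ (by fun_prop) fun p => ?_)
  positivity

theorem slab_delta_limit [Nontrivial V] {ρ β : ℝ} (hρ : 0 < ρ) (hβ : 0 < β) {Φ : ℝ × V → ℂ}
    (hc : Continuous Φ) (hI : Integrable Φ) {C : ℝ} (hC : 0 ≤ C)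
    (hb : ∀ p : ℝ × V, ‖p.2‖ ^ (Module.finrank ℝ V - 1) * ‖Φ p‖ ≤ C) :
    Tendsto (fun ε : ℝ => ∫ p : ℝ × V, Φ p * (rayKer ρ β ε p.1 ‖p.2‖ : ℝ)) (𝓝[>] 0)
      (𝓝 (((Real.pi / (4 * ρ * β) : ℝ) : ℂ) * ((ρ ^ (Module.finrank ℝ V - 1) : ℝ) : ℂ) *
        ∫ ω : Metric.sphere (0 : V) 1, Φ (0, ρ • (ω : V)) ∂(sphereMeasure V))) := by
  set m := Module.finrank ℝ V - 1 with hm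
  set S : Set (ℝ × V) := {p | p.1 ∈ Set.Icc (-1 : ℝ) 1} with hS
  have hSm : MeasurableSet S := measurable_fst measurableSet_Icc
  obtain ⟨D, hD, hray⟩ := ray_delta_limit hρ hβ
  set Ψ : Metric.sphere (0 : V) 1 → ℝ → ℝ → ℂ := fun ω t r => ((r ^ m : ℝ) : ℂ) * Φ (t, r • (ω : V))
    with hΨ
  have hΨc : ∀ ω, Continuous (Function.uncurry (Ψ ω)) := fun ω => by
    have : Continuous fun p : ℝ × ℝ => Φ (p.1, p.2 • (ω : V)) := hc.comp (by fun_prop)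
    exact (Complex.continuous_ofReal.comp (by fun_prop)).mul this
  have hΨb : ∀ ω t r, |t| ≤ 1 → 0 ≤ r → ‖Ψ ω t r‖ ≤ C := fun ω t r _ hr => by
    have h1 := hb (t, r • (ω : V))
    have h2 : ‖(ω : V)‖ = 1 := by simp
    simp only [norm_smul, h2, mul_one, Real.norm_of_nonneg hr] at h1
    rw [hΨ]
    simp only
    rw [norm_mul, Complex.norm_real, Real.norm_of_nonneg (by positivity)]
    exact h1
  have hfI : ∀ ε : ℝ, 0 < ε → Integrable fun p : ℝ × V => Φ p * (rayKer ρ β ε p.1 ‖p.2‖ : ℝ) :=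
    fun ε hε => by
      refine (hI.norm.mul_const ((ε ^ 2)⁻¹)).mono' ?_ (Eventually.of_forall fun p => ?_)
      · exact (hc.mul (Complex.continuous_ofReal.comp
          (continuous_rayKer_norm ρ β hε))).aestronglyMeasurable
      · rw [norm_mul, Complex.norm_real, Real.norm_of_nonneg (rayKer_nonneg ..)]
        gcongr
        exact rayKer_le _ _ _ _ hε
  have hout : Tendsto (fun ε : ℝ => ∫ p in Sᶜ, Φ p * (rayKer ρ β ε p.1 ‖p.2‖ : ℝ)) (𝓝[>] 0)
      (𝓝 0) := by
    have hbnd : ∀ ε : ℝ, ‖∫ p in Sᶜ, Φ p * (rayKer ρ β ε p.1 ‖p.2‖ : ℝ)‖ ≤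
        ε ^ 2 * (((2 * β) ^ 2) ^ 2)⁻¹ * ∫ p, ‖Φ p‖ := fun ε => by
      rw [← integral_const_mul]
      have hI2 : Integrable fun p => ε ^ 2 * (((2 * β) ^ 2) ^ 2)⁻¹ * ‖Φ p‖ := hI.norm.const_mul _
      refine (norm_integral_le_of_norm_le hI2.integrableOn ?_).trans
        (setIntegral_le_integral hI2 (Eventually.of_forall fun p => by positivity))
      filter_upwards [ae_restrict_mem hSm.compl] with p hp
      rw [norm_mul, Complex.norm_real, Real.norm_of_nonneg (rayKer_nonneg ..), mul_comm]
      gcongr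
      refine rayKer_le_of_one_le hβ ?_
      by_contra h
      exact hp (abs_le.1 (not_le.1 h).le)
    refine squeeze_zero_norm hbnd ?_
    have : ContinuousAt (fun ε : ℝ => ε ^ 2 * (((2 * β) ^ 2) ^ 2)⁻¹ * ∫ p, ‖Φ p‖) 0 := by fun_prop
    simpa using this.tendsto.mono_left (nhdsWithin_le_nhds (s := Set.Ioi 0))
  have hin : ∀ ε : ℝ, 0 < ε → ∫ p in S, Φ p * (rayKer ρ β ε p.1 ‖p.2‖ : ℝ) =
      ∫ ω, (∫ r in Set.Ioi (0 : ℝ), ∫ t in Set.Icc (-1 : ℝ) 1,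
        Ψ ω t r * (rayKer ρ β ε t r : ℝ)) ∂(sphereMeasure V) := fun ε hε => by
    have hSi := (hfI ε hε).indicator hSm
    rw [Measure.volume_eq_prod] at hSi
    have e1 : ∀ σ : V, ∫ t, S.indicator (fun p => Φ p * (rayKer ρ β ε p.1 ‖p.2‖ : ℝ)) (t, σ) =
        ∫ t in Set.Icc (-1 : ℝ) 1, Φ (t, σ) * (rayKer ρ β ε t ‖σ‖ : ℝ) := fun σ => by
      rw [← integral_indicator measurableSet_Icc]
      rfl
    have hGI := hSi.integral_prod_right
    simp only [e1] at hGI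
    rw [← integral_indicator hSm, Measure.volume_eq_prod, integral_prod_symm _ hSi]
    simp only [e1]
    rw [integral_polar hGI]
    refine integral_congr_ae (Eventually.of_forall fun ω => ?_)
    simp only
    refine setIntegral_congr_fun measurableSet_Ioi fun r hr => ?_
    have hr' : 0 < r := hr
    have h2 : ‖(ω : V)‖ = 1 := by simp
    simp only [norm_smul, h2, mul_one, Real.norm_of_nonneg hr'.le, ← integral_smul]
    refine integral_congr_ae (Eventually.of_forall fun t => ?_)
    simp only [hΨ, Complex.real_smul, hm]
    ring
  have hinlim : Tendsto (fun ε : ℝ => ∫ p in S, Φ p * (rayKer ρ β ε p.1 ‖p.2‖ : ℝ)) (𝓝[>] 0)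
      (𝓝 (∫ ω, Ψ ω 0 ρ * ((Real.pi / (4 * ρ * β) : ℝ) : ℂ) ∂(sphereMeasure V))) := by
    have : Tendsto (fun ε : ℝ => ∫ ω, (∫ r in Set.Ioi (0 : ℝ), ∫ t in Set.Icc (-1 : ℝ) 1,
        Ψ ω t r * (rayKer ρ β ε t r : ℝ)) ∂(sphereMeasure V)) (𝓝[>] 0)
        (𝓝 (∫ ω, Ψ ω 0 ρ * ((Real.pi / (4 * ρ * β) : ℝ) : ℂ) ∂(sphereMeasure V))) := by
      refine tendsto_integral_filter_of_dominated_convergence (fun _ => C * D) ?_ ?_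
        (integrable_const _) (Eventually.of_forall fun ω => ?_)
      · filter_upwards [self_mem_nhdsWithin] with ε hε
        have h3 : Continuous fun q : (Metric.sphere (0 : V) 1 × ℝ) × ℝ =>
            Ψ q.1.1 q.2 q.1.2 * (rayKer ρ β ε q.2 q.1.2 : ℝ) := by
          refine Continuous.mul ?_ (Complex.continuous_ofReal.comp ?_)
          · exact (Complex.continuous_ofReal.comp (by fun_prop)).mul (hc.comp (by fun_prop))
          · have hε' : 0 < ε := hε
            unfold rayKer
            refine continuous_const.mul (Continuous.inv₀ (by fun_prop) fun p => ?_)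
            positivity
        have h4 : StronglyMeasurable fun q : Metric.sphere (0 : V) 1 × ℝ =>
            ∫ t in Set.Icc (-1 : ℝ) 1, Ψ q.1 t q.2 * (rayKer ρ β ε t q.2 : ℝ) :=
          h3.stronglyMeasurable.integral_prod_right (ν := volume.restrict (Set.Icc (-1 : ℝ) 1))
        exact (h4.integral_prod_right (ν := volume.restrict (Set.Ioi (0 : ℝ)))).aestronglyMeasurable
      · filter_upwards [self_mem_nhdsWithin] with ε hε
        exact Eventually.of_forall fun ω => (hray (Ψ ω) C hC (hΨb ω) (hΨc ω)).1 ε hε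
      · exact (hray (Ψ ω) C hC (hΨb ω) (hΨc ω)).2
    refine this.congr' ?_
    filter_upwards [self_mem_nhdsWithin] with ε hε
    exact (hin ε hε).symm
  have hfin := hinlim.add hout
  rw [add_zero] at hfin
  have hval : ∫ ω, Ψ ω 0 ρ * ((Real.pi / (4 * ρ * β) : ℝ) : ℂ) ∂(sphereMeasure V) =
      ((Real.pi / (4 * ρ * β) : ℝ) : ℂ) * ((ρ ^ m : ℝ) : ℂ) *
        ∫ ω : Metric.sphere (0 : V) 1, Φ (0, ρ • (ω : V)) ∂(sphereMeasure V) := by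
    rw [← integral_const_mul]
    refine integral_congr_ae (Eventually.of_forall fun ω => ?_)
    simp only [hΨ]
    ring
  rw [hval] at hfin
  refine hfin.congr' ?_
  filter_upwards [self_mem_nhdsWithin] with ε hε
  exact integral_add_compl hSm (hfI ε hε)

end

/-- Slices along the unit vector `n`, over the hyperplane orthogonal to it. -/
theorem slice_measurePreserving {n : RV d} (hn : ‖n‖ = 1) {U : Submodule ℝ (RV d)}
    (hU : U = (Submodule.span ℝ {n})ᗮ) :
    MeasurePreserving (fun p : ℝ × U => p.1 • n + (p.2 : RV d)) ∧
    MeasurableEmbedding (fun p : ℝ × U => p.1 • n + (p.2 : RV d)) := by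
  subst hU
  exact ⟨slicePt_measurePreserving n hn, slicePt_measurableEmbedding n hn⟩

theorem delta_limit (hd : 2 ≤ d) {E : ℝ} {k : CV d} (hk : k ∈ SigmaE d E) (hb : imV k ≠ 0)
    (ha : reV k ≠ 0) {φ : RV d → ℂ} (hφ : Continuous φ) (hφI : Integrable φ) {C : ℝ} (hC : 0 ≤ C)
    (hφb : ∀ ξ, ‖ξ + reV k‖ ^ (d - 2) * ‖φ ξ‖ ≤ C) :
    Tendsto (fun s : ℝ => ∫ ξ : RV d, φ ξ * (deltaKer s (symb k ξ) : ℝ)) (𝓝[>] 0)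
      (𝓝 (Real.pi * intDeltaFaddeev k φ)) := by
  set b := imV k with hbdef
  set a := reV k with hadef
  set n : RV d := ‖b‖⁻¹ • b with hndef
  have hβ : 0 < ‖b‖ := norm_pos_iff.2 hb
  have hρ : 0 < ‖a‖ := norm_pos_iff.2 ha
  have hn : ‖n‖ = 1 := norm_unit hb
  have hperp : inner ℝ a b = 0 := inner_of_mem_SigmaE hk
  have hU : (Submodule.span ℝ {b})ᗮ = (Submodule.span ℝ {n})ᗮ := by
    rw [hndef, Submodule.span_singleton_smul_eq (IsUnit.mk0 _ (inv_ne_zero hβ.ne'))]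
  obtain ⟨hmp, hme⟩ := slice_measurePreserving hn hU
  have hfr : Module.finrank ℝ (Perp b) + 1 = d := by
    rw [finrank_perp hb, finrank_euclideanSpace_fin]
  have : Nontrivial (Perp b) := Module.nontrivial_of_finrank_pos (R := ℝ) (by omega)
  have hm : Module.finrank ℝ (Perp b) - 1 = d - 2 := by omega
  set Φ : ℝ × Perp b → ℂ := fun p => φ (p.1 • n + (p.2 : RV d) - a) with hΦ
  have hΦc : Continuous Φ := hφ.comp (by fun_prop)
  have hΦI : Integrable Φ := hmp.integrable_comp_of_integrable (g := fun ζ => φ (ζ - a))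
    (hφI.comp_sub_right a)
  have hnσ : ∀ σ : Perp b, inner ℝ n (σ : RV d) = 0 := fun σ => by
    rw [hndef, inner_smul_left, inner_perp, mul_zero]
  have hnorm : ∀ p : ℝ × Perp b, ‖p.1 • n + (p.2 : RV d)‖ ^ 2 = p.1 ^ 2 + ‖p.2‖ ^ 2 := fun p => by
    rw [norm_add_sq_real, norm_smul, hn, inner_smul_left, hnσ]
    simp
  have hΦb : ∀ p : ℝ × Perp b, ‖p.2‖ ^ (Module.finrank ℝ (Perp b) - 1) * ‖Φ p‖ ≤ C := fun p => by
    have h1 := hφb (p.1 • n + (p.2 : RV d) - a)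
    rw [sub_add_cancel] at h1
    refine le_trans ?_ h1
    rw [hm]
    have : ‖p.2‖ ≤ ‖p.1 • n + (p.2 : RV d)‖ := by
      refine le_of_sq_le_sq ?_ (norm_nonneg _)
      rw [hnorm]; nlinarith [sq_nonneg p.1]
    gcongr
  have hlim := slab_delta_limit hρ hβ hΦc hΦI hC hΦb
  have hval : ((Real.pi / (4 * ‖a‖ * ‖b‖) : ℝ) : ℂ) *
      ((‖a‖ ^ (Module.finrank ℝ (Perp b) - 1) : ℝ) : ℂ) *
        ∫ ω : Metric.sphere (0 : Perp b) 1, Φ (0, ‖a‖ • (ω : Perp b)) ∂(sphereMeasure (Perp b)) =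
      Real.pi * intDeltaFaddeev k φ := by
    rw [intDeltaFaddeev, ← hadef, ← hbdef, hm, ← mul_assoc]
    congr 1
    · push_cast
      ring
    · refine integral_congr_ae (Eventually.of_forall fun ω => ?_)
      simp only [hΦ, zero_smul, zero_add]
      congr 1
      rw [Submodule.coe_smul]
      abel
  rw [hval] at hlim
  have hsq : Tendsto Real.sqrt (𝓝[>] 0) (𝓝[>] 0) := by
    refine tendsto_nhdsWithin_iff.2 ⟨?_, ?_⟩
    · have := Real.continuous_sqrt.tendsto 0
      rw [Real.sqrt_zero] at this
      exact this.mono_left nhdsWithin_le_nhds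
    · filter_upwards [self_mem_nhdsWithin] with s hs
      exact Real.sqrt_pos.2 hs
  refine (hlim.comp hsq).congr' ?_
  filter_upwards [self_mem_nhdsWithin] with s hs
  have hs' : 0 < s := hs
  simp only [Function.comp_apply]
  rw [← integral_sub_right_eq_self (μ := (volume : Measure (RV d)))
    (fun ξ => φ ξ * (deltaKer s (symb k ξ) : ℝ)) a, ← hmp.integral_comp hme]
  refine integral_congr_ae (Eventually.of_forall fun p => ?_)
  simp only [hΦ]
  congr 2
  have hbz : inner ℝ b (p.1 • n + (p.2 : RV d)) = ‖b‖ * p.1 := by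
    have hbn : b = ‖b‖ • n := by
      rw [hndef, smul_smul, mul_inv_cancel₀ hβ.ne', one_smul]
    nth_rw 1 [hbn]
    rw [inner_smul_left, inner_add_right, inner_smul_right, hnσ, real_inner_self_eq_norm_sq, hn]
    simp
  rw [hadef, symb_sub_reV (by rw [← hadef, ← hbdef, hperp]), ← hadef, ← hbdef, hbz, hnorm, rayKer,
    deltaKer, Real.sq_sqrt hs'.le, ← Complex.normSq_eq_norm_sq, Complex.normSq_add_mul_I]
  congr 3
  ring

end

section

variable {d : ℕ}

theorem symb_sphere_eq_zero {E : ℝ} {k : CV d} (hk : k ∈ SigmaE d E)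
    (ω : Metric.sphere (0 : Perp (imV k)) 1) :
    symb k (-reV k + ‖reV k‖ • ((ω : Perp (imV k)) : RV d)) = 0 := by
  have hω : ‖((ω : Perp (imV k)) : RV d)‖ = 1 := by
    have : ‖(ω : Perp (imV k))‖ = 1 := by simp
    exact this
  rw [neg_add_eq_sub, symb_sub_reV (inner_of_mem_SigmaE hk), norm_smul, hω, inner_smul_right,
    inner_perp]
  simp

theorem intDeltaFaddeev_congr {E : ℝ} {k : CV d} (hk : k ∈ SigmaE d E) {F G : RV d → ℂ}
    (h : ∀ ξ, symb k ξ = 0 → F ξ = G ξ) : intDeltaFaddeev k F = intDeltaFaddeev k G := by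
  rw [intDeltaFaddeev, intDeltaFaddeev]
  congr 1
  exact integral_congr_ae (Eventually.of_forall fun ω => h _ (symb_sphere_eq_zero hk ω))

theorem intDeltaFaddeev_const_mul (k : CV d) (c : ℂ) (F : RV d → ℂ) :
    intDeltaFaddeev k (fun ξ => c * F ξ) = c * intDeltaFaddeev k F := by
  rw [intDeltaFaddeev, intDeltaFaddeev, integral_const_mul]
  ring

theorem intDeltaFaddeev_sum {ι : Type*} (s : Finset ι) (k : CV d) {F : ι → RV d → ℂ}
    (hF : ∀ i ∈ s, Continuous (F i)) :
    intDeltaFaddeev k (fun ξ => ∑ i ∈ s, F i ξ) = ∑ i ∈ s, intDeltaFaddeev k (F i) := by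
  simp only [intDeltaFaddeev]
  rw [← Finset.mul_sum]
  congr 1
  refine integral_finsetSum s fun i hi => ?_
  have : Continuous fun ω : Metric.sphere (0 : Perp (imV k)) 1 =>
      F i (-reV k + ‖reV k‖ • ((ω : Perp (imV k)) : RV d)) :=
    (hF i hi).comp (by fun_prop)
  exact this.integrable_of_hasCompactSupport (μ := sphereMeasure (Perp (imV k)))
    (HasCompactSupport.of_compactSpace _)

theorem continuous_toC_coord_mul_planeWave (j : Fin d) (x : RV d) :
    Continuous fun ξ : RV d => (ξ j : ℂ) * planeWave (toC ξ) x :=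
  (Complex.continuous_ofReal.comp (by fun_prop)).mul (continuous_planeWave_toC x)

theorem conj_cdot_toC (h : CV d) (ξ : RV d) :
    (starRingEnd ℂ) (cdot h (toC ξ)) = ∑ j, (ξ j : ℂ) * (starRingEnd ℂ) (h j) := by
  simp [cdot, toC, mul_comm]

theorem norm_cdot_toC_le (h : CV d) (ξ : RV d) :
    ‖cdot h (toC ξ)‖ ≤ ‖cdotMomL d‖ * ‖h‖ * ‖ξ‖ := by
  rw [← cdotMom_apply, ← cdotMomL_apply, mul_right_comm]
  exact ((cdotMomL d ξ).le_opNorm h).trans (by gcongr; exact (cdotMomL d).le_opNorm ξ)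

theorem regInt_dbar (hd : d = 2 ∨ d = 3) (x : RV d) {E : ℝ} {k : CV d} (hk : k ∈ SigmaE d E)
    (hb : imV k ≠ 0) (ha : reV k ≠ 0) :
    HasDbarWithinAt (regInt 1 x) (fun j => 2 * (Real.pi : ℂ) * intDeltaFaddeev k fun ξ =>
      (ξ j : ℂ) * planeWave (toC ξ) x) (SigmaE d E) (tangentSigma k) k := by
  have hd2 : 2 ≤ d := by omega
  obtain ⟨L, hL, hlim⟩ := regInt_dbar_tendsto hd2 x hk hb ha
  refine ⟨L, hL, fun h hh => ?_⟩
  set φ : RV d → ℂ := fun ξ => planeWave (toC ξ) x * Complex.exp (-symb k ξ) *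
    (2 * (starRingEnd ℂ) (cdot h (toC ξ))) with hφ
  have hcd : Continuous fun ξ : RV d => cdot h (toC ξ) := by
    simp only [← cdotL_apply]; exact (cdotL h).continuous
  have hφc : Continuous φ :=
    ((continuous_planeWave_toC x).mul (continuous_symb k).neg.cexp).mul
      (continuous_const.mul (Complex.continuous_conj.comp hcd))
  set M := 2 * (‖cdotMomL d‖ * ‖h‖) * Real.exp (2 * ‖reV k‖ ^ 2) with hM
  have hφn : ∀ ξ, ‖φ ξ‖ ≤ M * (‖ξ‖ * Real.exp (-(1 / 2) * ‖ξ‖ ^ 2)) := fun ξ => by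
    rw [hφ]
    simp only
    rw [norm_mul, norm_mul, norm_planeWave_toC, one_mul, norm_mul, RCLike.norm_conj, norm_cexp_neg]
    have h1 := exp_neg_symb_re_le (k := k) le_rfl ξ
    have h2 := norm_cdot_toC_le h ξ
    have h3 : ‖(2 : ℂ)‖ = 2 := by simp
    rw [h3]
    calc _ ≤ (Real.exp (2 * ‖reV k‖ ^ 2) * Real.exp (-(1 / 2) * ‖ξ‖ ^ 2)) *
          (2 * (‖cdotMomL d‖ * ‖h‖ * ‖ξ‖)) := by gcongr
      _ = _ := by rw [hM]; ring
  have hM0 : 0 ≤ M := by positivity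
  have hφI : Integrable φ := ((integrable_norm_mul_exp (by norm_num)).const_mul M).mono'
    hφc.aestronglyMeasurable (Eventually.of_forall hφn)
  obtain ⟨C₁, hC₁, h1⟩ := exists_pow_le_exp_sq (1 / 2) (by norm_num) 1
  obtain ⟨C₂, hC₂, h2⟩ := exists_pow_le_exp_sq (1 / 2) (by norm_num) 2
  have hbound : ∀ ξ, ‖ξ + reV k‖ ^ (d - 2) * ‖φ ξ‖ ≤ M * ((1 + ‖reV k‖) * C₁ + C₂) := fun ξ => by
    have e1 : ‖ξ + reV k‖ ^ (d - 2) ≤ 1 + ‖reV k‖ + ‖ξ‖ := by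
      have h3 : d - 2 ≤ 1 := by omega
      have h4 := norm_add_le ξ (reV k)
      interval_cases hdd : d - 2
      · rw [pow_zero]
        nlinarith [norm_nonneg ξ, norm_nonneg (reV k)]
      · rw [pow_one]; linarith
    have h1' := h1 ‖ξ‖
    have h2' := h2 ‖ξ‖
    rw [abs_norm] at h1' h2'
    rw [pow_one] at h1'
    set e := Real.exp (-(1 / 2) * ‖ξ‖ ^ 2) with he
    have hee : Real.exp (1 / 2 * ‖ξ‖ ^ 2) * e = 1 := by
      rw [he, ← Real.exp_add]; simp
    have he0 : 0 < e := Real.exp_pos _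
    have f1 : ‖ξ‖ * e ≤ C₁ := by
      calc ‖ξ‖ * e ≤ C₁ * Real.exp (1 / 2 * ‖ξ‖ ^ 2) * e := by gcongr
        _ = C₁ := by rw [mul_assoc, hee, mul_one]
    have f2 : ‖ξ‖ ^ 2 * e ≤ C₂ := by
      calc ‖ξ‖ ^ 2 * e ≤ C₂ * Real.exp (1 / 2 * ‖ξ‖ ^ 2) * e := by gcongr
        _ = C₂ := by rw [mul_assoc, hee, mul_one]
    calc _ ≤ (1 + ‖reV k‖ + ‖ξ‖) * (M * (‖ξ‖ * e)) := by gcongr; exact hφn ξ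
      _ = M * ((1 + ‖reV k‖) * (‖ξ‖ * e) + ‖ξ‖ ^ 2 * e) := by ring
      _ ≤ _ := by gcongr
  have hdl := delta_limit hd2 hk hb ha hφc hφI (by positivity) hbound
  have hlim' := hlim h hh
  have e : (fun s : ℝ => ∫ ξ : RV d, planeWave (toC ξ) x * Complex.exp (-symb k ξ) *
      (deltaKer s (symb k ξ) : ℝ) * (2 * (starRingEnd ℂ) (cdot h (toC ξ)))) =
      fun s : ℝ => ∫ ξ : RV d, φ ξ * (deltaKer s (symb k ξ) : ℝ) := by
    ext s
    refine integral_congr_ae (Eventually.of_forall fun ξ => ?_)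
    simp only [hφ]; ring
  rw [e] at hlim'
  rw [tendsto_nhds_unique hlim' hdl]
  have e2 : intDeltaFaddeev k φ = intDeltaFaddeev k (fun ξ => ∑ j, (2 * (starRingEnd ℂ) (h j)) *
      ((ξ j : ℂ) * planeWave (toC ξ) x)) := by
    refine intDeltaFaddeev_congr hk fun ξ hξ => ?_
    simp only [hφ]
    rw [hξ, neg_zero, Complex.exp_zero, conj_cdot_toC, mul_one, Finset.mul_sum, Finset.mul_sum]
    exact Finset.sum_congr rfl fun j _ => by ring
  have hcont : ∀ j ∈ (Finset.univ : Finset (Fin d)), Continuous fun ξ : RV d =>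
      (2 * (starRingEnd ℂ) (h j)) * ((ξ j : ℂ) * planeWave (toC ξ) x) := fun j _ =>
    continuous_const.mul (continuous_toC_coord_mul_planeWave j x)
  rw [e2, intDeltaFaddeev_sum _ _ hcont, Finset.mul_sum]
  refine Finset.sum_congr rfl fun j _ => ?_
  rw [intDeltaFaddeev_const_mul]
  ring

end

section

theorem rect_identity {g : ℂ → ℂ} {a b h : ℝ}
    (hg : DifferentiableOn ℂ g (Set.uIcc a b ×ℂ Set.uIcc 0 h)) :
    (∫ x in a..b, g x) - (∫ x in a..b, g (x + h * Complex.I)) +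
      Complex.I * (∫ y in (0 : ℝ)..h, g (b + y * Complex.I)) -
      Complex.I * (∫ y in (0 : ℝ)..h, g (a + y * Complex.I)) = 0 := by
  have := Complex.integral_boundary_rect_eq_zero_of_differentiableOn g (a : ℂ) (b + h * Complex.I)
    (by simpa using hg)
  simpa using this

theorem tendsto_vertical_side {g : ℂ → ℂ} {h : ℝ} {G : ℝ → ℝ} {l : Filter ℝ}
    (hb : ∀ᶠ x : ℝ in l, ∀ y ∈ Set.uIcc 0 h, ‖g (x + y * Complex.I)‖ ≤ G x) (hG : Tendsto G l (𝓝 0)) :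
    Tendsto (fun x : ℝ => ∫ y in (0 : ℝ)..h, g (x + y * Complex.I)) l (𝓝 0) := by
  refine squeeze_zero_norm' (a := fun x => G x * |h - 0|) ?_ (by simpa using hG.mul_const |h - 0|)
  filter_upwards [hb] with x hx
  exact intervalIntegral.norm_integral_le_of_norm_le_const fun y hy =>
    hx y (Set.uIoc_subset_uIcc hy)

/-- Shift of the line of integration inside a strip. -/
theorem integral_strip_shift {g : ℂ → ℂ} {h : ℝ} {G : ℝ → ℝ}
    (hg : DifferentiableOn ℂ g (Set.univ ×ℂ Set.uIcc 0 h))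
    (hb : ∀ x : ℝ, ∀ y ∈ Set.uIcc 0 h, ‖g (x + y * Complex.I)‖ ≤ G x) (hG : Integrable G)
    (hG1 : Tendsto G atTop (𝓝 0)) (hG2 : Tendsto G atBot (𝓝 0)) :
    ∫ x : ℝ, g (x + h * Complex.I) = ∫ x : ℝ, g x := by
  have hline : ∀ y ∈ Set.uIcc 0 h, Integrable fun x : ℝ => g (x + y * Complex.I) := fun y hy => by
    refine hG.mono' (Continuous.aestronglyMeasurable ?_) (Eventually.of_forall fun x => hb x y hy)
    refine hg.continuousOn.comp_continuous (by fun_prop) fun x => ?_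
    simpa [Complex.mem_reProdIm] using hy
  have h0 : Integrable fun x : ℝ => g x := by simpa using hline 0 Set.left_mem_uIcc
  have h1 := hline h Set.right_mem_uIcc
  have hR : Tendsto (fun R : ℝ => (∫ x in -R..R, g x) - (∫ x in -R..R, g (x + h * Complex.I)) +
      Complex.I * (∫ y in (0 : ℝ)..h, g (R + y * Complex.I)) -
      Complex.I * (∫ y in (0 : ℝ)..h, g ((-R : ℝ) + y * Complex.I))) atTop
      (𝓝 ((∫ x : ℝ, g x) - (∫ x : ℝ, g (x + h * Complex.I)) + Complex.I * 0 - Complex.I * 0)) := by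
    refine (((intervalIntegral_tendsto_integral h0 tendsto_neg_atTop_atBot tendsto_id).sub
      (intervalIntegral_tendsto_integral h1 tendsto_neg_atTop_atBot tendsto_id)).add
      ((tendsto_vertical_side (Eventually.of_forall hb) hG1).const_mul _)).sub
      (((tendsto_vertical_side (Eventually.of_forall hb) hG2).comp
        tendsto_neg_atTop_atBot).const_mul _)
  have hz : (fun R : ℝ => (∫ x in -R..R, g x) - (∫ x in -R..R, g (x + h * Complex.I)) +
      Complex.I * (∫ y in (0 : ℝ)..h, g (R + y * Complex.I)) -
      Complex.I * (∫ y in (0 : ℝ)..h, g ((-R : ℝ) + y * Complex.I))) = fun _ => 0 := by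
    ext R
    exact rect_identity (hg.mono (Set.inter_subset_inter_left _ (by simp)))
  rw [hz] at hR
  have := tendsto_nhds_unique hR tendsto_const_nhds
  simp only [mul_zero, add_zero, sub_zero] at this
  exact (sub_eq_zero.1 this).symm

theorem tendsto_exp_neg_mul_sq_atTop {c : ℝ} (hc : 0 < c) :
    Tendsto (fun t : ℝ => Real.exp (-c * t ^ 2)) atTop (𝓝 0) := by
  refine Real.tendsto_exp_atBot.comp ?_
  exact (tendsto_pow_atTop two_ne_zero).const_mul_atTop_of_neg (by linarith)

theorem tendsto_exp_neg_mul_sq_atBot {c : ℝ} (hc : 0 < c) :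
    Tendsto (fun t : ℝ => Real.exp (-c * t ^ 2)) atBot (𝓝 0) := by
  have := (tendsto_exp_neg_mul_sq_atTop hc).comp tendsto_neg_atBot_atTop
  refine this.congr fun t => ?_
  simp

/-- The one-dimensional resolvent integrand with Gaussian factor. -/
def gaussRes (X : ℝ) (c z : ℂ) : ℂ :=
  Complex.exp (Complex.I * z * X) * (Complex.exp (-(z ^ 2 + c)) * (z ^ 2 + c)⁻¹)

theorem re_sq_add (t y : ℝ) (c : ℂ) :
    (((t : ℂ) + y * Complex.I) ^ 2 + c).re = t ^ 2 - y ^ 2 + c.re := by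
  simp [pow_two]

theorem im_sq_add (t y : ℝ) (c : ℂ) :
    (((t : ℂ) + y * Complex.I) ^ 2 + c).im = 2 * t * y + c.im := by
  simp [pow_two]; ring

theorem norm_gaussRes (X t y : ℝ) (c : ℂ) :
    ‖gaussRes X c (t + y * Complex.I)‖ = Real.exp (-(y * X)) * (Real.exp (-(t ^ 2 - y ^ 2 + c.re)) *
      ‖((t : ℂ) + y * Complex.I) ^ 2 + c‖⁻¹) := by
  rw [gaussRes, norm_mul, norm_mul, norm_inv, norm_cexp_neg, re_sq_add, Complex.norm_exp]
  congr 3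
  simp

theorem exists_strip_lower_bound {c : ℂ} {β : ℝ} (hβ : 0 ≤ β)
    (h : ∀ t y : ℝ, 0 ≤ y → y ≤ β → ((t : ℂ) + y * Complex.I) ^ 2 + c ≠ 0) :
    ∃ δ : ℝ, 0 < δ ∧ ∀ t y : ℝ, 0 ≤ y → y ≤ β → δ ≤ ‖((t : ℂ) + y * Complex.I) ^ 2 + c‖ := by
  set R := Real.sqrt (β ^ 2 + |c.re| + 1) with hR
  have hR2 : R ^ 2 = β ^ 2 + |c.re| + 1 := Real.sq_sqrt (by positivity)
  have hR0 : 0 ≤ R := Real.sqrt_nonneg _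
  have hK : IsCompact (Set.Icc (-R) R ×ˢ Set.Icc 0 β) := isCompact_Icc.prod isCompact_Icc
  have hne : (Set.Icc (-R) R ×ˢ Set.Icc 0 β).Nonempty :=
    ⟨(0, 0), ⟨⟨by linarith, hR0⟩, ⟨le_rfl, hβ⟩⟩⟩
  have hcont : Continuous fun p : ℝ × ℝ => ‖((p.1 : ℂ) + p.2 * Complex.I) ^ 2 + c‖ := by fun_prop
  obtain ⟨p, hp, hmin⟩ := hK.exists_isMinOn hne hcont.continuousOn
  have hp2 : p.2 ∈ Set.Icc 0 β := hp.2
  have hpos : 0 < ‖((p.1 : ℂ) + p.2 * Complex.I) ^ 2 + c‖ :=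
    norm_pos_iff.2 (h p.1 p.2 hp2.1 hp2.2)
  refine ⟨min 1 ‖((p.1 : ℂ) + p.2 * Complex.I) ^ 2 + c‖, lt_min one_pos hpos, fun t y hy0 hyβ => ?_⟩
  by_cases ht : t ∈ Set.Icc (-R) R
  · have hmem : (t, y) ∈ Set.Icc (-R) R ×ˢ Set.Icc 0 β := ⟨ht, hy0, hyβ⟩
    exact (min_le_right _ _).trans (isMinOn_iff.1 hmin (t, y) hmem)
  · refine (min_le_left _ _).trans (le_trans ?_ (Complex.abs_re_le_norm _))
    rw [re_sq_add]
    have h1 : R ^ 2 ≤ t ^ 2 := by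
      rw [← sq_abs t]
      have : R ≤ |t| := by
        by_contra hcon
        exact ht (abs_le.1 (not_le.1 hcon).le)
      gcongr
    have h2 : y ^ 2 ≤ β ^ 2 := by gcongr
    have h3 := neg_abs_le c.re
    exact le_trans (by linarith) (le_abs_self _)

theorem gaussRes_shift {X : ℝ} {c : ℂ} {β : ℝ} (hβ : 0 ≤ β)
    (h : ∀ t y : ℝ, 0 ≤ y → y ≤ β → ((t : ℂ) + y * Complex.I) ^ 2 + c ≠ 0) :
    ∫ t : ℝ, gaussRes X c (t + β * Complex.I) = ∫ t : ℝ, gaussRes X c t := by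
  obtain ⟨δ, hδ, hlow⟩ := exists_strip_lower_bound hβ h
  set M := Real.exp (β * |X| + β ^ 2 + |c.re|) * δ⁻¹ with hM
  refine integral_strip_shift (G := fun t => M * Real.exp (-1 * t ^ 2)) ?_ ?_
    ((integrable_exp_neg_mul_sq one_pos).const_mul _) ?_ ?_
  · intro z hz
    rw [Set.uIcc_of_le hβ, Complex.mem_reProdIm] at hz
    have hne : z ^ 2 + c ≠ 0 := by
      have := h z.re z.im hz.2.1 hz.2.2
      rwa [Complex.re_add_im] at this
    have h1 : DifferentiableAt ℂ (fun z => gaussRes X c z) z := by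
      unfold gaussRes
      refine DifferentiableAt.mul (by fun_prop) (DifferentiableAt.mul (by fun_prop) ?_)
      exact DifferentiableAt.inv (by fun_prop) hne
    exact h1.differentiableWithinAt
  · intro t y hy
    rw [Set.uIcc_of_le hβ] at hy
    rw [norm_gaussRes, hM, ← mul_assoc, ← Real.exp_add, mul_right_comm, ← Real.exp_add]
    have h1 : -(y * X) ≤ β * |X| := by
      refine (neg_le_abs _).trans ?_
      rw [abs_mul, abs_of_nonneg hy.1]
      gcongr
      exact hy.2
    have h2 : y ^ 2 ≤ β ^ 2 := by have := hy.1; have := hy.2; gcongr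
    have h3 := neg_abs_le c.re
    have h4 := hlow t y hy.1 hy.2
    refine mul_le_mul (Real.exp_le_exp.2 (by linarith)) (by gcongr) (by positivity) (by positivity)
  · simpa using (tendsto_exp_neg_mul_sq_atTop one_pos).const_mul M
  · simpa using (tendsto_exp_neg_mul_sq_atBot one_pos).const_mul M

end

section

variable {d : ℕ}

theorem symb_sub_reV_slicePt {k : CV d} {n : RV d} (hn : ‖n‖ = 1) {β : ℝ} (hb : imV k = β • n)
    (p : ℝ × Perp n) :
    symb k (slicePt n p - reV k) =
      ((p.1 : ℂ) + β * Complex.I) ^ 2 + (((‖p.2‖ ^ 2 : ℝ) : ℂ) - cdot k k) := by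
  have h1 : inner ℝ n (slicePt n p) = p.1 := inner_slicePt_left hn p
  have h2 : ‖imV k‖ ^ 2 = β ^ 2 := by rw [hb, norm_smul, hn, mul_one, Real.norm_eq_abs, sq_abs]
  rw [symb, cdot_toC, cdot_self, inner_sub_right, inner_sub_right, norm_sub_sq_real,
    norm_sq_slicePt hn, real_inner_comm (reV k) (slicePt n p), real_inner_self_eq_norm_sq,
    real_inner_comm (reV k) (imV k), h2, hb, inner_smul_left, h1]
  simp only [conj_trivial]
  push_cast
  have hI := Complex.I_sq
  linear_combination -(β : ℂ) ^ 2 * hI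

theorem planeWave_slicePt {k : CV d} {n : RV d} {β : ℝ} (hb : imV k = β • n)
    (p : ℝ × Perp n) (x : RV d) :
    planeWave (toC (slicePt n p - reV k)) x = planeWave (-k) x *
      (planeWave (toC (p.2 : RV d)) x *
        Complex.exp (Complex.I * ((p.1 : ℂ) + β * Complex.I) * ((inner ℝ n x : ℝ) : ℂ))) := by
  rw [planeWave, planeWave, planeWave, ← Complex.exp_add, ← Complex.exp_add,
    show -k = (-1 : ℂ) • k by simp, cdot_smul_left, cdot_toC_toC, cdot_toC_toC, cdot_toC, hb,
    slicePt, inner_sub_left, inner_add_left, inner_smul_left, inner_smul_left]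
  congr 1
  simp only [conj_trivial]
  push_cast
  ring

/-- The Gaussian part of the outgoing fundamental solution of `-Δ - E`. -/
def resInt (x : RV d) (E : ℂ) : ℂ :=
  ∫ ζ : RV d, planeWave (toC ζ) x *
    (Complex.exp (-(((‖ζ‖ ^ 2 : ℝ) : ℂ) - E)) * (((‖ζ‖ ^ 2 : ℝ) : ℂ) - E)⁻¹)

theorem resInt_integrand_slicePt {n : RV d} (hn : ‖n‖ = 1) (x : RV d) (E : ℂ)
    (p : ℝ × Perp n) :
    planeWave (toC (slicePt n p)) x *
      (Complex.exp (-(((‖slicePt n p‖ ^ 2 : ℝ) : ℂ) - E)) *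
        (((‖slicePt n p‖ ^ 2 : ℝ) : ℂ) - E)⁻¹) =
      planeWave (toC (p.2 : RV d)) x *
        gaussRes (inner ℝ n x) (((‖p.2‖ ^ 2 : ℝ) : ℂ) - E) p.1 := by
  have h1 : planeWave (toC (slicePt n p)) x = planeWave (toC (p.2 : RV d)) x *
      Complex.exp (Complex.I * (p.1 : ℂ) * ((inner ℝ n x : ℝ) : ℂ)) := by
    rw [slicePt, add_comm, toC_add, planeWave_add, toC_smul]
    congr 1
    rw [planeWave, cdot_smul_left, cdot_toC_toC, mul_assoc]
  rw [h1, norm_sq_slicePt hn, gaussRes]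
  push_cast
  rw [add_sub_assoc]
  ring

theorem regInt_integrand_slicePt {k : CV d} {n : RV d} (hn : ‖n‖ = 1) {β : ℝ}
    (hb : imV k = β • n) (x : RV d) (p : ℝ × Perp n) :
    planeWave (toC (slicePt n p - reV k)) x *
      (Complex.exp (-(1 : ℝ) * symb k (slicePt n p - reV k)) *
        (symb k (slicePt n p - reV k))⁻¹) =
      planeWave (-k) x * (planeWave (toC (p.2 : RV d)) x *
        gaussRes (inner ℝ n x) (((‖p.2‖ ^ 2 : ℝ) : ℂ) - cdot k k) (p.1 + β * Complex.I)) := by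
  rw [planeWave_slicePt hb, symb_sub_reV_slicePt hn hb, gaussRes]
  simp only [Complex.ofReal_one, neg_mul, one_mul]
  ring

theorem regInt_slicePt {k : CV d} {n : RV d} (hn : ‖n‖ = 1) {β : ℝ}
    (hb : imV k = β • n) (x : RV d) :
    regInt 1 x k = planeWave (-k) x * ∫ p : ℝ × Perp n, planeWave (toC (p.2 : RV d)) x *
        gaussRes (inner ℝ n x) (((‖p.2‖ ^ 2 : ℝ) : ℂ) - cdot k k) (p.1 + β * Complex.I) := by
  rw [regInt, ← integral_sub_right_eq_self _ (reV k), integral_slicePt n hn, ← integral_const_mul]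
  exact integral_congr_ae (Eventually.of_forall fun p => regInt_integrand_slicePt hn hb x p)

theorem integrable_gaussRes_slicePt (hd : 2 ≤ d) {k : CV d} {n : RV d} (hn : ‖n‖ = 1) {β : ℝ}
    (hb : imV k = β • n) (hβ : β ≠ 0) (x : RV d) :
    Integrable fun p : ℝ × Perp n => planeWave (toC (p.2 : RV d)) x *
        gaussRes (inner ℝ n x) (((‖p.2‖ ^ 2 : ℝ) : ℂ) - cdot k k) (p.1 + β * Complex.I) := by
  have hk : imV k ≠ 0 := by
    rw [hb]; exact smul_ne_zero hβ (norm_ne_zero_iff.1 (by rw [hn]; exact one_ne_zero))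
  have h := ((integrable_slicePt n hn _).1
    ((integrable_regInt hd hk x one_pos).comp_sub_right (reV k))).const_mul (planeWave k x)
  refine h.congr (Eventually.of_forall fun p => ?_)
  simp only
  rw [regInt_integrand_slicePt hn hb, ← mul_assoc, mul_comm (planeWave k x), planeWave_neg_mul,
    one_mul]

theorem integrable_resInt (x : RV d) {E : ℂ} {δ : ℝ} (hδ : 0 < δ)
    (h : ∀ ζ : RV d, δ ≤ ‖((‖ζ‖ ^ 2 : ℝ) : ℂ) - E‖) :
    Integrable fun ζ : RV d => planeWave (toC ζ) x *
      (Complex.exp (-(((‖ζ‖ ^ 2 : ℝ) : ℂ) - E)) * (((‖ζ‖ ^ 2 : ℝ) : ℂ) - E)⁻¹) := by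
  refine ((integrable_exp_neg_mul_norm_sq (F := RV d) one_pos).const_mul
    (Real.exp E.re * δ⁻¹)).mono' ?_ (Eventually.of_forall fun ζ => ?_)
  · refine ((continuous_planeWave_toC x).mul (Continuous.mul (by fun_prop)
      (Continuous.inv₀ (by fun_prop) fun ζ hζ => ?_))).aestronglyMeasurable
    have := h ζ
    rw [hζ, norm_zero] at this
    linarith
  · rw [norm_mul, norm_planeWave_toC, one_mul, norm_mul, norm_cexp_neg, norm_inv]
    have e : (((‖ζ‖ ^ 2 : ℝ) : ℂ) - E).re = ‖ζ‖ ^ 2 - E.re := by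
      rw [Complex.sub_re, Complex.ofReal_re]
    rw [e, neg_sub, sub_eq_add_neg, Real.exp_add, mul_right_comm, mul_assoc, neg_one_mul]
    have := h ζ
    rw [← mul_assoc]
    gcongr

theorem regInt_sub_resInt (hd : 2 ≤ d) {k : CV d} {n : RV d} (hn : ‖n‖ = 1) {β : ℝ}
    (hb : imV k = β • n) (hβ : 0 < β) (x : RV d) {δ : ℝ} (hδ : 0 < δ)
    (h : ∀ ζ : RV d, δ ≤ ‖((‖ζ‖ ^ 2 : ℝ) : ℂ) - cdot k k‖) :
    planeWave k x * regInt 1 x k - resInt x (cdot k k) =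
      ∫ s : Perp n, planeWave (toC (s : RV d)) x *
        ((∫ t : ℝ, gaussRes (inner ℝ n x) (((‖s‖ ^ 2 : ℝ) : ℂ) - cdot k k) (t + β * Complex.I)) -
        ∫ t : ℝ, gaussRes (inner ℝ n x) (((‖s‖ ^ 2 : ℝ) : ℂ) - cdot k k) t) := by
  have i1 := integrable_gaussRes_slicePt hd hn hb hβ.ne' x
  have i2 := (integrable_slicePt n hn _).1 (integrable_resInt x hδ h)
  simp only [resInt_integrand_slicePt hn] at i2
  have e1 : planeWave k x * regInt 1 x k = ∫ p : ℝ × Perp n, planeWave (toC (p.2 : RV d)) x *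
        gaussRes (inner ℝ n x) (((‖p.2‖ ^ 2 : ℝ) : ℂ) - cdot k k) (p.1 + β * Complex.I) := by
    rw [regInt_slicePt hn hb, ← mul_assoc, mul_comm (planeWave k x), planeWave_neg_mul, one_mul]
  have e2 : resInt x (cdot k k) = ∫ p : ℝ × Perp n, planeWave (toC (p.2 : RV d)) x *
        gaussRes (inner ℝ n x) (((‖p.2‖ ^ 2 : ℝ) : ℂ) - cdot k k) p.1 := by
    rw [resInt, integral_slicePt n hn]
    exact integral_congr_ae (Eventually.of_forall fun p => resInt_integrand_slicePt hn x _ p)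
  rw [e1, e2]
  rw [Measure.volume_eq_prod] at i1 i2 ⊢
  rw [integral_prod_symm _ i1, integral_prod_symm _ i2,
    ← integral_sub i1.integral_prod_right i2.integral_prod_right]
  refine integral_congr_ae (Eventually.of_forall fun s => ?_)
  simp only
  rw [integral_const_mul, integral_const_mul, mul_sub]

end

section

variable {d : ℕ}

/-- The profile of the singularity of a slice integral at the radius `ρ`. -/
def cylProfile (ρ r : ℝ) : ℝ :=
  if r < ρ then ρ ^ (-(1 / 4) : ℝ) * |r - ρ| ^ (-(1 / 4) : ℝ) else 0

theorem cylProfile_nonneg {ρ : ℝ} (hρ : 0 ≤ ρ) (r : ℝ) : 0 ≤ cylProfile ρ r := by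
  unfold cylProfile; split_ifs <;> positivity

theorem measurable_cylProfile (ρ : ℝ) : Measurable (cylProfile ρ) := by
  unfold cylProfile
  exact Measurable.ite measurableSet_Iio (by fun_prop) measurable_const

section

variable {F : Type*} [NormedAddCommGroup F] [InnerProductSpace ℝ F] [FiniteDimensional ℝ F]
  [MeasurableSpace F] [BorelSpace F]

theorem integrable_cylProfile [Nontrivial F] {ρ : ℝ} (hρ : 0 < ρ) :
    Integrable fun s : F => cylProfile ρ ‖s‖ := by
  have h := (integrable_norm_sub_rpow_mul_exp (F := F) ρ one_pos
    (s := -(1 / 4)) (by norm_num)).const_mul (ρ ^ (-(1 / 4) : ℝ) * Real.exp (ρ ^ 2))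
  refine h.mono' ((measurable_cylProfile ρ).comp measurable_norm).aestronglyMeasurable
    (Eventually.of_forall fun s => ?_)
  rw [Real.norm_eq_abs, abs_of_nonneg (cylProfile_nonneg hρ.le _), cylProfile]
  split_ifs with h1
  · rw [mul_assoc, mul_left_comm (Real.exp _), ← Real.exp_add]
    have h2 : 1 ≤ Real.exp (ρ ^ 2 + -1 * ‖s‖ ^ 2) := by
      apply Real.one_le_exp
      have : ‖s‖ ^ 2 ≤ ρ ^ 2 := by gcongr
      linarith
    gcongr
    exact le_mul_of_one_le_right (by positivity) h2
  · positivity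

/-- The integral of `cylProfile 1` over the plane. -/
def cylConst : ℝ :=
  2 * ((ENNReal.ofReal (Real.sqrt Real.pi ^ 2 / Real.Gamma ((2 : ℕ) / 2 + 1))).toReal *
    ∫ y in Set.Ioi (0 : ℝ), y * cylProfile 1 y)

theorem integral_cylProfile (hF : Module.finrank ℝ F = 2) {ρ : ℝ} (hρ : 0 < ρ) :
    ∫ s : F, cylProfile ρ ‖s‖ = cylConst * ρ ^ (3 / 2 : ℝ) := by
  have : Nontrivial F := Module.nontrivial_of_finrank_pos (R := ℝ) (by omega)
  rw [integral_fun_norm_addHaar (volume : Measure F) (cylProfile ρ), hF]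
  have h1 : (volume : Measure F).real (Metric.ball 0 1) =
      (ENNReal.ofReal (Real.sqrt Real.pi ^ 2 / Real.Gamma ((2 : ℕ) / 2 + 1))).toReal := by
    rw [Measure.real, InnerProductSpace.volume_ball, hF]
    simp
  have h2 : ∫ y in Set.Ioi (0 : ℝ), y ^ (2 - 1) • cylProfile ρ y =
      (∫ y in Set.Ioi (0 : ℝ), y * cylProfile 1 y) * ρ ^ (3 / 2 : ℝ) := by
    have h3 := integral_comp_mul_left_Ioi' (fun y => y ^ (2 - 1) • cylProfile ρ y) 0 hρ
    rw [mul_zero] at h3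
    rw [← h3, smul_eq_mul, ← integral_const_mul, ← integral_mul_const]
    refine integral_congr_ae (Eventually.of_forall fun y => ?_)
    simp only [smul_eq_mul, cylProfile]
    by_cases hy : y < 1
    · rw [if_pos (by nlinarith), if_pos hy, show ρ * y - ρ = ρ * (y - 1) by ring, abs_mul,
        abs_of_pos hρ, Real.mul_rpow hρ.le (abs_nonneg _), Real.one_rpow]
      have h4 : ρ ^ (3 / 2 : ℝ) = ρ * ρ * (ρ ^ (-(1 / 4) : ℝ) * ρ ^ (-(1 / 4) : ℝ)) := by
        rw [← Real.rpow_add hρ, ← pow_two ρ, ← Real.rpow_natCast, ← Real.rpow_add hρ]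
        norm_num
      rw [h4]
      ring
    · rw [if_neg (by nlinarith), if_neg hy]
      ring
  rw [h1, h2, cylConst]
  simp only [nsmul_eq_mul, smul_eq_mul]
  push_cast
  ring

end

theorem norm_gaussRes_shifted_le {X c₀ β m t : ℝ} (hm : 0 < m) (hβ : m ≤ β)
    (hA : 0 < β ^ 2 - c₀) (hA1 : β ^ 2 - c₀ ≤ 1) (ht : t ≠ 0) :
    ‖gaussRes X (c₀ : ℂ) (t + β * Complex.I)‖ ≤
      Real.exp (β * |X| + 1) * (1 + 1 / (2 * m)) * (β ^ 2 - c₀) ^ (-(1 / 4) : ℝ) *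
        (|t| ^ (-(3 / 4) : ℝ) * Real.exp (-1 * t ^ 2)) := by
  have hβ0 : 0 < β := hm.trans_le hβ
  set W := ‖((t : ℂ) + β * Complex.I) ^ 2 + (c₀ : ℂ)‖ with hW
  have hre : |t ^ 2 - (β ^ 2 - c₀)| ≤ W := by
    have := Complex.abs_re_le_norm (((t : ℂ) + β * Complex.I) ^ 2 + (c₀ : ℂ))
    rw [re_sq_add, Complex.ofReal_re] at this
    rwa [← sub_add]
  have him : 2 * m * |t| ≤ W := by
    have := Complex.abs_im_le_norm (((t : ℂ) + β * Complex.I) ^ 2 + (c₀ : ℂ))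
    rw [im_sq_add, Complex.ofReal_im, add_zero, abs_mul, abs_mul, abs_of_pos hβ0, abs_two] at this
    refine le_trans ?_ this
    nlinarith [abs_nonneg t]
  have ht' : |t| ≤ W / (2 * m) := by rw [le_div_iff₀ (by positivity)]; linarith
  have hW0 : 0 ≤ W := norm_nonneg _
  have e1 : W * (1 + 1 / (2 * m)) = W + W / (2 * m) := by ring
  have hA' : β ^ 2 - c₀ ≤ W * (1 + 1 / (2 * m)) := by
    rw [e1]
    rcases le_total |t| 1 with h | h
    · have h1 : t ^ 2 ≤ |t| := by rw [← sq_abs]; nlinarith [abs_nonneg t]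
      have h2 := neg_abs_le (t ^ 2 - (β ^ 2 - c₀))
      linarith
    · linarith
  have key := inv_le_of_two_bounds (h := Real.sqrt (β ^ 2 - c₀)) (t := |t|) (W := W)
    (D := 1 + 1 / (2 * m)) (Real.sqrt_pos.2 hA) (abs_pos.2 ht) (by positivity)
    (by rwa [Real.sq_sqrt hA.le]) (by rw [e1]; linarith)
  have e2 : Real.sqrt (β ^ 2 - c₀) ^ (-(1 / 2) : ℝ) = (β ^ 2 - c₀) ^ (-(1 / 4) : ℝ) := by
    rw [Real.sqrt_eq_rpow, ← Real.rpow_mul hA.le]; norm_num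
  rw [e2] at key
  rw [norm_gaussRes, ← hW, Complex.ofReal_re, ← mul_assoc, ← Real.exp_add]
  have e3 : Real.exp (-(β * X) + -(t ^ 2 - β ^ 2 + c₀)) ≤
      Real.exp (β * |X| + 1) * Real.exp (-1 * t ^ 2) := by
    rw [← Real.exp_add, Real.exp_le_exp]
    have : -(β * X) ≤ β * |X| := by
      rw [← mul_neg]; exact mul_le_mul_of_nonneg_left (neg_le_abs X) hβ0.le
    linarith
  calc _ ≤ (Real.exp (β * |X| + 1) * Real.exp (-1 * t ^ 2)) *
      ((1 + 1 / (2 * m)) * ((β ^ 2 - c₀) ^ (-(1 / 4) : ℝ) * |t| ^ (-(3 / 4) : ℝ))) := by gcongr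
    _ = _ := by ring

theorem norm_gaussRes_real_le {X c₀ m t : ℝ} (hm : 0 < m) (hc : m ^ 2 ≤ c₀) :
    ‖gaussRes X (c₀ : ℂ) t‖ ≤ (m ^ 2)⁻¹ * Real.exp (-1 * t ^ 2) := by
  have h := norm_gaussRes X t 0 (c₀ : ℂ)
  rw [Complex.ofReal_zero, zero_mul, add_zero, zero_mul, neg_zero, Real.exp_zero, one_mul,
    Complex.ofReal_re] at h
  have h1 : m ^ 2 ≤ ‖(t : ℂ) ^ 2 + (c₀ : ℂ)‖ := by
    rw [show (t : ℂ) ^ 2 + (c₀ : ℂ) = ((t ^ 2 + c₀ : ℝ) : ℂ) by push_cast; ring,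
      Complex.norm_real, Real.norm_eq_abs]
    exact le_trans (by nlinarith [sq_nonneg t]) (le_abs_self _)
  rw [h, mul_comm]
  have : 0 < m ^ 2 := by positivity
  gcongr
  nlinarith [sq_nonneg t]

theorem norm_slice_difference_le {X c₀ β m : ℝ} (hm : 0 < m) (hβ : m ≤ β)
    (hA : 0 < β ^ 2 - c₀) (hA1 : β ^ 2 - c₀ ≤ 1) (hc : m ^ 2 ≤ c₀) :
    ‖(∫ t : ℝ, gaussRes X (c₀ : ℂ) (t + β * Complex.I)) - ∫ t : ℝ, gaussRes X (c₀ : ℂ) t‖ ≤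
      (Real.exp (β * |X| + 1) * (1 + 1 / (2 * m)) *
        (∫ t : ℝ, |t| ^ (-(3 / 4) : ℝ) * Real.exp (-1 * t ^ 2)) +
        (m ^ 2)⁻¹ * ∫ t : ℝ, Real.exp (-1 * t ^ 2)) * (β ^ 2 - c₀) ^ (-(1 / 4) : ℝ) := by
  have hne : ∀ᵐ t : ℝ, t ≠ 0 := by simp [ae_iff]
  have h1 := norm_integral_le_of_norm_le
    ((integrable_abs_rpow_mul_exp (s := -(3 / 4)) one_pos (by norm_num)).const_mul
      (Real.exp (β * |X| + 1) * (1 + 1 / (2 * m)) * (β ^ 2 - c₀) ^ (-(1 / 4) : ℝ)))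
    (hne.mono fun t ht => norm_gaussRes_shifted_le (X := X) hm hβ hA hA1 ht)
  have h2 := norm_integral_le_of_norm_le
    ((integrable_exp_neg_mul_sq one_pos).const_mul (m ^ 2)⁻¹)
    (Eventually.of_forall fun t => norm_gaussRes_real_le (X := X) (t := t) hm hc)
  rw [integral_const_mul] at h1 h2
  have h3 : 1 ≤ (β ^ 2 - c₀) ^ (-(1 / 4) : ℝ) :=
    Real.one_le_rpow_of_pos_of_le_one_of_nonpos hA hA1 (by norm_num)
  have h4 : 0 ≤ (m ^ 2)⁻¹ * ∫ t : ℝ, Real.exp (-1 * t ^ 2) :=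
    mul_nonneg (by positivity) (integral_nonneg fun t => (Real.exp_pos _).le)
  refine (norm_sub_le _ _).trans ((add_le_add h1 h2).trans ?_)
  rw [add_mul]
  refine add_le_add (le_of_eq (by ring)) (le_mul_of_one_le_right h4 h3)

/-- Near a purely imaginary momentum the Gaussian part of the Green function is, up to an
exponential factor, constant on `Σ_E` to first order. -/
theorem norm_regInt_sub_resInt_le (x : RV 3) {m : ℝ} (hm : 0 < m) :
    ∃ C : ℝ, ∀ k : CV 3, k ∈ SigmaE 3 (-m ^ 2) → ‖reV k‖ ≤ 1 →
      ‖planeWave k x * regInt 1 x k - resInt x ((-m ^ 2 : ℝ) : ℂ)‖ ≤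
        C * ‖reV k‖ ^ (3 / 2 : ℝ) := by
  set J := ∫ t : ℝ, |t| ^ (-(3 / 4) : ℝ) * Real.exp (-1 * t ^ 2) with hJ
  have hJ0 : 0 ≤ J := integral_nonneg fun t => by positivity
  set J₂ := ∫ t : ℝ, Real.exp (-1 * t ^ 2) with hJ₂
  set C₀ := Real.exp ((m + 1) * ‖x‖ + 1) * (1 + 1 / (2 * m)) * J + (m ^ 2)⁻¹ * J₂ with hC₀
  refine ⟨C₀ * cylConst, fun k hk hρ1 => ?_⟩
  have hkk : cdot k k = ((-m ^ 2 : ℝ) : ℂ) := hk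
  set ρ := ‖reV k‖ with hρ
  set β := ‖imV k‖ with hβ
  have hβ2 : β ^ 2 = ρ ^ 2 + m ^ 2 := by have := norm_sq_of_mem_SigmaE hk; linarith
  have hρ0 : 0 ≤ ρ := norm_nonneg _
  have hmβ : m ≤ β := by
    apply le_of_sq_le_sq _ (norm_nonneg _)
    rw [hβ2]; nlinarith
  have hβm : β ≤ m + 1 := by
    apply le_of_sq_le_sq _ (by positivity)
    rw [hβ2]; nlinarith
  have hβ0 : 0 < β := hm.trans_le hmβ
  set n : RV 3 := β⁻¹ • imV k with hn'
  have hn : ‖n‖ = 1 := by rw [hn', norm_smul, norm_inv, norm_norm, ← hβ, inv_mul_cancel₀ hβ0.ne']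
  have hb : imV k = β • n := by rw [hn', smul_smul, mul_inv_cancel₀ hβ0.ne', one_smul]
  have hn0 : n ≠ 0 := norm_ne_zero_iff.1 (by rw [hn]; exact one_ne_zero)
  have hF : Module.finrank ℝ (Perp n) = 2 := by
    have := finrank_perp hn0
    rw [finrank_euclideanSpace_fin] at this
    omega
  have : Nontrivial (Perp n) := Module.nontrivial_of_finrank_pos (R := ℝ) (by omega)
  have hc : ∀ s : ℝ, ((s ^ 2 : ℝ) : ℂ) - cdot k k = ((s ^ 2 + m ^ 2 : ℝ) : ℂ) := fun s => by
    rw [hkk]; push_cast; ring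
  have hδ : ∀ ζ : RV 3, m ^ 2 ≤ ‖((‖ζ‖ ^ 2 : ℝ) : ℂ) - cdot k k‖ := fun ζ => by
    rw [hc, Complex.norm_real, Real.norm_eq_abs]
    exact le_trans (by nlinarith [sq_nonneg ‖ζ‖]) (le_abs_self _)
  rw [← hkk, regInt_sub_resInt (by norm_num) hn hb hβ0 x (by positivity : 0 < m ^ 2) hδ]
  simp only [hc]
  have hXx : |inner ℝ n x| ≤ ‖x‖ := by
    have := abs_real_inner_le_norm n x
    rwa [hn, one_mul] at this
  have hout : ∀ s : Perp n, ρ < ‖s‖ →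
      (∫ t : ℝ, gaussRes (inner ℝ n x) ((‖s‖ ^ 2 + m ^ 2 : ℝ) : ℂ) (t + β * Complex.I)) -
        ∫ t : ℝ, gaussRes (inner ℝ n x) ((‖s‖ ^ 2 + m ^ 2 : ℝ) : ℂ) t = 0 := fun s hs => by
    rw [gaussRes_shift hβ0.le, sub_self]
    intro t y hy0 hy h0
    have h1 := congrArg Complex.re h0
    have h2 := congrArg Complex.im h0
    rw [re_sq_add, Complex.ofReal_re, Complex.zero_re] at h1
    rw [im_sq_add, Complex.ofReal_im, add_zero, Complex.zero_im] at h2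
    have h3 : y ^ 2 ≤ β ^ 2 := by gcongr
    have h4 : ρ ^ 2 < ‖s‖ ^ 2 := by gcongr
    nlinarith [sq_nonneg t]
  rcases hρ0.eq_or_lt with h0 | hρpos
  · have hz : ∀ᵐ s : Perp n, planeWave (toC (s : RV 3)) x *
        ((∫ t : ℝ, gaussRes (inner ℝ n x) ((‖s‖ ^ 2 + m ^ 2 : ℝ) : ℂ) (t + β * Complex.I)) -
        ∫ t : ℝ, gaussRes (inner ℝ n x) ((‖s‖ ^ 2 + m ^ 2 : ℝ) : ℂ) t) = 0 := by
      filter_upwards [ae_norm_add_ne (0 : Perp n) 0] with s hs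
      rw [hout s, mul_zero]
      rw [add_zero] at hs
      rw [← h0]
      exact lt_of_le_of_ne (norm_nonneg _) hs.symm
    rw [integral_congr_ae hz, integral_zero, norm_zero, ← h0,
      Real.zero_rpow (by norm_num), mul_zero]
  · have hC₀0 : 0 ≤ C₀ := by
      have : 0 ≤ J₂ := integral_nonneg fun t => (Real.exp_pos _).le
      positivity
    have hb2 : ∀ᵐ s : Perp n, ‖planeWave (toC (s : RV 3)) x *
        ((∫ t : ℝ, gaussRes (inner ℝ n x) ((‖s‖ ^ 2 + m ^ 2 : ℝ) : ℂ) (t + β * Complex.I)) -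
        ∫ t : ℝ, gaussRes (inner ℝ n x) ((‖s‖ ^ 2 + m ^ 2 : ℝ) : ℂ) t)‖ ≤
        C₀ * cylProfile ρ ‖s‖ := by
      filter_upwards [ae_norm_add_ne (0 : Perp n) ρ] with s hs
      rw [add_zero] at hs
      rw [norm_mul, norm_planeWave_toC, one_mul]
      rcases lt_or_gt_of_ne hs with hlt | hgt
      · have eA : β ^ 2 - (‖s‖ ^ 2 + m ^ 2) = ρ ^ 2 - ‖s‖ ^ 2 := by rw [hβ2]; ring
        have hA : ρ * (ρ - ‖s‖) ≤ ρ ^ 2 - ‖s‖ ^ 2 := by nlinarith [norm_nonneg s]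
        have hApos : 0 < ρ * (ρ - ‖s‖) := mul_pos hρpos (by linarith)
        have h5 := norm_slice_difference_le (X := inner ℝ n x) (c₀ := ‖s‖ ^ 2 + m ^ 2) hm hmβ
          (by rw [eA]; linarith) (by rw [eA]; nlinarith [norm_nonneg s])
          (by nlinarith [norm_nonneg s])
        refine h5.trans ?_
        rw [eA, cylProfile, if_pos hlt]
        have h6 : (ρ ^ 2 - ‖s‖ ^ 2) ^ (-(1 / 4) : ℝ) ≤
            ρ ^ (-(1 / 4) : ℝ) * |‖s‖ - ρ| ^ (-(1 / 4) : ℝ) := by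
          rw [abs_sub_comm, abs_of_pos (by linarith : 0 < ρ - ‖s‖),
            ← Real.mul_rpow hρ0 (by linarith)]
          exact Real.rpow_le_rpow_of_nonpos hApos hA (by norm_num)
        have h7 : Real.exp (β * |inner ℝ n x| + 1) ≤ Real.exp ((m + 1) * ‖x‖ + 1) := by gcongr
        have h8 : 0 ≤ (m ^ 2)⁻¹ * J₂ :=
          mul_nonneg (by positivity) (integral_nonneg fun t => (Real.exp_pos _).le)
        refine mul_le_mul ?_ h6 (Real.rpow_nonneg (by linarith) _) hC₀0
        rw [hC₀]
        gcongr
      · rw [hout s hgt, norm_zero]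
        exact mul_nonneg hC₀0 (cylProfile_nonneg hρ0 _)
    refine (norm_integral_le_of_norm_le ((integrable_cylProfile hρpos).const_mul C₀) hb2).trans ?_
    rw [integral_const_mul, integral_cylProfile hF hρpos, mul_assoc]

end

section

variable {d : ℕ}

/-- `k ↦ k v` as a complex-linear functional. -/
def cdotRightL (v : CV d) : CV d →L[ℂ] ℂ :=
  LinearMap.toContinuousLinearMap
    { toFun := fun k => cdot k v
      map_add' := fun a b => cdot_add_left a b v
      map_smul' := fun r a => cdot_smul_left r a v }

theorem differentiable_planeWave (x : RV d) : Differentiable ℂ fun k : CV d => planeWave k x := by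
  have : (fun k : CV d => planeWave k x) =
      fun k => Complex.exp (Complex.I * cdotRightL (toC x) k) := rfl
  rw [this]
  fun_prop

theorem differentiable_planeWave_neg (x : RV d) :
    Differentiable ℂ fun k : CV d => planeWave (-k) x := by
  have : (fun k : CV d => planeWave (-k) x) =
      fun k => Complex.exp (Complex.I * cdotRightL (toC x) (-k)) := rfl
  rw [this]
  fun_prop

/-- The antilinear part of a real-linear functional. -/
def antiPart (L : CV d →L[ℝ] ℂ) (w : CV d) : ℂ := (L w + Complex.I * L (Complex.I • w)) / 2

theorem antiPart_add (L M : CV d →L[ℝ] ℂ) (w : CV d) :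
    antiPart (L + M) w = antiPart L w + antiPart M w := by
  simp only [antiPart, _root_.add_apply]; ring

theorem antiPart_smul (c : ℂ) (L : CV d →L[ℝ] ℂ) (w : CV d) :
    antiPart (c • L) w = c * antiPart L w := by
  simp only [antiPart, _root_.smul_apply, smul_eq_mul]; ring

theorem antiPart_restrictScalars (L : CV d →L[ℂ] ℂ) (w : CV d) :
    antiPart (L.restrictScalars ℝ) w = 0 := by
  simp only [antiPart, ContinuousLinearMap.coe_restrictScalars', map_smul, smul_eq_mul]
  linear_combination (L w / 2) * Complex.I_sq

variable {S T : Set (CV d)} {k : CV d} {u v : CV d → ℂ} {ω η : Fin d → ℂ}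

theorem HasDbarWithinAt.differentiableWithinAt (h : HasDbarWithinAt u ω S T k) :
    DifferentiableWithinAt ℝ u S k := by
  obtain ⟨L, hL, -⟩ := h
  exact hL.differentiableWithinAt

theorem hasDbarWithinAt_of_differentiable (h : DifferentiableAt ℂ u k) :
    HasDbarWithinAt u (fun _ => 0) S T k :=
  ⟨_, (h.hasFDerivAt.restrictScalars ℝ).hasFDerivWithinAt, fun w _ => by
    rw [← antiPart, antiPart_restrictScalars]; simp⟩

theorem hasDbarWithinAt_const (c : ℂ) : HasDbarWithinAt (fun _ => c) (fun _ => 0) S T k :=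
  hasDbarWithinAt_of_differentiable (differentiableAt_const c)

theorem HasDbarWithinAt.add (hu : HasDbarWithinAt u ω S T k) (hv : HasDbarWithinAt v η S T k) :
    HasDbarWithinAt (fun k => u k + v k) (fun j => ω j + η j) S T k := by
  obtain ⟨L, hL, h1⟩ := hu
  obtain ⟨M, hM, h2⟩ := hv
  refine ⟨L + M, hL.add hM, fun w hw => ?_⟩
  rw [← antiPart, antiPart_add, antiPart, antiPart, h1 w hw, h2 w hw, ← Finset.sum_add_distrib]
  exact Finset.sum_congr rfl fun j _ => by ring

theorem HasDbarWithinAt.mul (hu : HasDbarWithinAt u ω S T k) (hv : HasDbarWithinAt v η S T k) :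
    HasDbarWithinAt (fun k => u k * v k) (fun j => u k * η j + v k * ω j) S T k := by
  obtain ⟨L, hL, h1⟩ := hu
  obtain ⟨M, hM, h2⟩ := hv
  refine ⟨u k • M + v k • L, hL.mul hM, fun w hw => ?_⟩
  rw [← antiPart, antiPart_add, antiPart_smul, antiPart_smul, antiPart, antiPart, h1 w hw, h2 w hw,
    Finset.mul_sum, Finset.mul_sum, ← Finset.sum_add_distrib]
  exact Finset.sum_congr rfl fun j _ => by ring

theorem HasDbarWithinAt.const_mul (c : ℂ) (hu : HasDbarWithinAt u ω S T k) :
    HasDbarWithinAt (fun k => c * u k) (fun j => c * ω j) S T k := by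
  have := (hasDbarWithinAt_const c).mul hu
  simpa using this

theorem HasDbarWithinAt.sum {ι : Type*} (s : Finset ι) {u : ι → CV d → ℂ} {ω : ι → Fin d → ℂ}
    (h : ∀ i ∈ s, HasDbarWithinAt (u i) (ω i) S T k) :
    HasDbarWithinAt (fun k => ∑ i ∈ s, u i k) (fun j => ∑ i ∈ s, ω i j) S T k := by
  classical
  induction s using Finset.induction_on with
  | empty => simpa using hasDbarWithinAt_const (0 : ℂ)
  | insert i s hi ih =>
    simp only [Finset.sum_insert hi]
    exact (h i (Finset.mem_insert_self i s)).add
      (ih fun j hj => h j (Finset.mem_insert_of_mem hj))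

theorem HasDbarWithinAt.congr_of_eventuallyEq (hu : HasDbarWithinAt u ω S T k)
    (h : v =ᶠ[𝓝[S] k] u) (hk : k ∈ S) : HasDbarWithinAt v ω S T k := by
  obtain ⟨L, hL, h1⟩ := hu
  exact ⟨L, hL.congr_of_eventuallyEq h (h.eq_of_nhdsWithin hk), h1⟩

theorem HasDbarWithinAt.congr_form (hu : HasDbarWithinAt u ω S T k)
    (h : ∀ w ∈ T, ∑ j, η j * (starRingEnd ℂ) (w j) = ∑ j, ω j * (starRingEnd ℂ) (w j)) :
    HasDbarWithinAt u η S T k := by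
  obtain ⟨L, hL, h1⟩ := hu
  exact ⟨L, hL, fun w hw => by rw [h1 w hw, h w hw]⟩

theorem HasDbarWithinAt.mono {S' T' : Set (CV d)} (hu : HasDbarWithinAt u ω S T k)
    (hS : S' ⊆ S) (hT : T' ⊆ T) : HasDbarWithinAt u ω S' T' k := by
  obtain ⟨L, hL, h1⟩ := hu
  exact ⟨L, hL.mono hS, fun w hw => h1 w (hT hw)⟩

theorem intDeltaFaddeev_of_reV_eq_zero (hd : d = 2 → reV k ≠ 0) (hd' : d = 2 ∨ d = 3)
    (ha : reV k = 0) (F : RV d → ℂ) : intDeltaFaddeev k F = 0 := by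
  have : d = 3 := hd'.resolve_left fun h => hd h ha
  subst this
  rw [intDeltaFaddeev, ha]
  simp

/-- The Gaussian part is holomorphic along `Σ_E` at purely imaginary momenta. -/
theorem regInt_dbar_of_reV_eq_zero {E : ℝ} {k : CV 3} (x : RV 3) (hk : k ∈ SigmaE 3 E)
    (hb : imV k ≠ 0) (ha : reV k = 0) :
    HasDbarWithinAt (regInt 1 x) (fun _ => 0) (SigmaE 3 E) (tangentSigma k) k := by
  set m := ‖imV k‖ with hm
  have hm0 : 0 < m := norm_pos_iff.2 hb
  have hE : E = -m ^ 2 := by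
    have := norm_sq_of_mem_SigmaE hk
    rw [ha, norm_zero] at this; linarith
  subst hE
  obtain ⟨C, hC⟩ := norm_regInt_sub_resInt_le x hm0
  set r : CV 3 → ℂ := fun k' => planeWave k' x * regInt 1 x k' - resInt x ((-m ^ 2 : ℝ) : ℂ)
    with hr
  have hre : ∀ k' : CV 3, ‖reV k'‖ ≤ ‖k' - k‖ := fun k' => by
    have := norm_reV_le (k' - k)
    have e : reV (k' - k) = reV k' := by
      have := (reVL 3).map_sub k' k
      change reV (k' - k) = reV k' - reV k at this
      rw [this, ha, sub_zero]
    rwa [e] at this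
  have hnear : ∀ᶠ k' in 𝓝[SigmaE 3 (-m ^ 2)] k, ‖r k'‖ ≤ |C| * ‖‖k' - k‖ ^ (3 / 2 : ℝ)‖ := by
    have h1 : ∀ᶠ k' in 𝓝[SigmaE 3 (-m ^ 2)] k, ‖reV k'‖ < 1 := by
      refine nhdsWithin_le_nhds ((continuous_reV.norm.tendsto k).eventually_lt_const ?_)
      rw [ha, norm_zero]; exact one_pos
    filter_upwards [h1, self_mem_nhdsWithin] with k' h1 h2
    refine (hC k' h2 h1.le).trans ?_
    rw [Real.norm_eq_abs, abs_of_nonneg (a := ‖k' - k‖ ^ (3 / 2 : ℝ)) (by positivity)]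
    have h3 := hre k'
    calc C * ‖reV k'‖ ^ (3 / 2 : ℝ) ≤ |C| * ‖reV k'‖ ^ (3 / 2 : ℝ) := by
          gcongr; exact le_abs_self C
      _ ≤ _ := by gcongr
  have hrk : r k = 0 := by
    have := hC k hk (by rw [ha, norm_zero]; exact zero_le_one)
    rw [ha, norm_zero, Real.zero_rpow (by norm_num), mul_zero] at this
    exact norm_le_zero_iff.1 this
  have hlit : (fun k' : CV 3 => ‖k' - k‖ ^ (3 / 2 : ℝ)) =o[𝓝[SigmaE 3 (-m ^ 2)] k]
      fun k' => k' - k := by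
    have e : (fun k' : CV 3 => ‖k' - k‖ ^ (3 / 2 : ℝ)) = fun k' =>
        ‖k' - k‖ ^ (1 / 2 : ℝ) * ‖k' - k‖ := by
      ext k'
      rw [← Real.rpow_add_one' (norm_nonneg _) (by norm_num)]; norm_num
    rw [e]
    have h0 : (fun k' : CV 3 => ‖k' - k‖ ^ (1 / 2 : ℝ)) =o[𝓝[SigmaE 3 (-m ^ 2)] k]
        fun _ => (1 : ℝ) := by
      rw [Asymptotics.isLittleO_one_iff]
      have hc : Continuous fun k' : CV 3 => ‖k' - k‖ ^ (1 / 2 : ℝ) :=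
        (by fun_prop : Continuous fun k' : CV 3 => ‖k' - k‖).rpow_const fun _ => Or.inr (by norm_num)
      have := (hc.tendsto k).mono_left (nhdsWithin_le_nhds (s := SigmaE 3 (-m ^ 2)))
      simpa using this
    have := h0.mul_isBigO (Asymptotics.isBigO_refl (fun k' : CV 3 => ‖k' - k‖) _)
    simp only [one_mul] at this
    exact Asymptotics.isLittleO_norm_right.1 this
  have hder : HasFDerivWithinAt r (0 : CV 3 →L[ℝ] ℂ) (SigmaE 3 (-m ^ 2)) k := by
    rw [hasFDerivWithinAt_iff_isLittleO]
    simp only [hrk, sub_zero, _root_.zero_apply]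
    exact (Asymptotics.IsBigO.of_bound _ hnear).trans_isLittleO hlit
  have hrd : HasDbarWithinAt r (fun _ => 0) (SigmaE 3 (-m ^ 2)) (tangentSigma k) k :=
    ⟨0, hder, fun w _ => by simp⟩
  have hp : HasDbarWithinAt (fun k' => planeWave (-k') x) (fun _ => 0) (SigmaE 3 (-m ^ 2))
      (tangentSigma k) k := hasDbarWithinAt_of_differentiable
    (differentiable_planeWave_neg x k)
  have h := hp.mul (hrd.add (hasDbarWithinAt_const (resInt x ((-m ^ 2 : ℝ) : ℂ))))
  have e : regInt 1 x = fun k' => planeWave (-k') x * (r k' + resInt x ((-m ^ 2 : ℝ) : ℂ)) := by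
    ext k'
    rw [hr]
    simp only
    rw [sub_add_cancel, ← mul_assoc, planeWave_neg_mul, one_mul]
  rw [e]
  simpa using h

theorem regInt_dbar' (hd : d = 2 ∨ d = 3) (x : RV d) {E : ℝ} {k : CV d} (hk : k ∈ SigmaE d E)
    (hb : imV k ≠ 0) (ha : d = 2 → reV k ≠ 0) :
    HasDbarWithinAt (regInt 1 x) (fun j => 2 * (Real.pi : ℂ) * intDeltaFaddeev k fun ξ =>
      (ξ j : ℂ) * planeWave (toC ξ) x) (SigmaE d E) (tangentSigma k) k := by
  by_cases h0 : reV k = 0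
  · have h3 : d = 3 := hd.resolve_left fun h => ha h h0
    simp only [intDeltaFaddeev_of_reV_eq_zero ha hd h0, mul_zero]
    subst h3
    exact regInt_dbar_of_reV_eq_zero x hk hb h0
  · exact regInt_dbar hd x hk hb h0

/-- The coefficients of `∂̄g(x,·)` on `Σ_E`. -/
def dbarGreen (x : RV d) (k : CV d) (j : Fin d) : ℂ :=
  -(1 / (2 * (Real.pi : ℂ)) ^ d) * (2 * (Real.pi : ℂ) * intDeltaFaddeev k fun ξ =>
      (ξ j : ℂ) * planeWave (toC ξ) x)

theorem green_dbar (hd : d = 2 ∨ d = 3) {x : RV d} (hx : x ≠ 0) {E : ℝ} {k : CV d}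
    (hk : k ∈ SigmaE d E) (hb : imV k ≠ 0) (ha : d = 2 → reV k ≠ 0) :
    HasDbarWithinAt (green x) (dbarGreen x k) (SigmaE d E) (tangentSigma k) k := by
  have hp : HasDbarWithinAt (fun k' => planeWave (-k') x) (fun _ => 0) (SigmaE d E)
      (tangentSigma k) k := hasDbarWithinAt_of_differentiable
    (differentiable_planeWave_neg x k)
  have h := ((regInt_dbar' hd x hk hb ha).add
    (hp.mul (hasDbarWithinAt_const (heatTail d 1 E ‖x‖)))).const_mul
    (-(1 / (2 * (Real.pi : ℂ)) ^ d))
  have h' := h.congr_of_eventuallyEq (v := green x) ?_ hk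
  · refine h'.congr_form fun w _ => Finset.sum_congr rfl fun j _ => ?_
    simp [dbarGreen]
  · have h1 : ∀ᶠ k' in 𝓝[SigmaE d E] k, imV k' ≠ 0 :=
      nhdsWithin_le_nhds ((continuous_imV.tendsto k).eventually_ne hb)
    filter_upwards [h1, self_mem_nhdsWithin] with k' h1 h2
    rw [green_eq hd h1 hx one_pos, show cdot k' k' = (E : ℂ) from h2]

end

section

variable {d : ℕ}

theorem reV_I_smul (w : CV d) : reV (Complex.I • w) = -imV w := by
  ext j; simp [reV, imV]

theorem imV_I_smul (w : CV d) : imV (Complex.I • w) = reV w := by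
  ext j; simp [reV, imV]

theorem intDeltaFaddeev_coord {k : CV d} (j : Fin d) :
    intDeltaFaddeev k (fun ξ => (ξ j : ℂ) * planeWave (toC ξ) 0) =
      -(((‖reV k‖ ^ (d - 2) / ((2 * ‖reV k‖) * (2 * ‖imV k‖)) : ℝ) : ℂ) *
        (reV k j : ℂ) * ((sphereMeasure (Perp (imV k))).real Set.univ : ℝ)) := by
  rw [intDeltaFaddeev]
  change _ * ∫ ω : Metric.sphere (0 : Perp (imV k)) 1, _ ∂(sphereMeasure (Perp (imV k))) = _
  simp only [planeWave_zero_right, mul_one]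
  set F : Metric.sphere (0 : Perp (imV k)) 1 → ℂ := fun ω =>
    (((-reV k + ‖reV k‖ • ((ω : Perp (imV k)) : RV d)) j : ℝ) : ℂ) with hF
  have hc : Continuous F := Complex.continuous_ofReal.comp (by fun_prop)
  have hint : Integrable F (sphereMeasure (Perp (imV k))) :=
    hc.integrable_of_hasCompactSupport (HasCompactSupport.of_compactSpace _)
  have hneg := integral_sphere_neg F
  have e : ∀ ω, F (-ω) = -2 * (reV k j : ℂ) - F ω := fun ω => by
    simp only [hF, PiLp.add_apply, PiLp.neg_apply, PiLp.smul_apply, smul_eq_mul]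
    have : (((-ω : Metric.sphere (0 : Perp (imV k)) 1) : Perp (imV k)) : RV d) j =
      -((ω : Perp (imV k)) : RV d) j := rfl
    rw [this]
    push_cast
    ring
  simp only [e] at hneg
  rw [integral_sub (integrable_const _) hint, integral_const] at hneg
  have : ∫ ω, F ω ∂(sphereMeasure (Perp (imV k))) =
      -((reV k j : ℂ) * ((sphereMeasure (Perp (imV k))).real Set.univ : ℝ)) := by
    rw [Complex.real_smul] at hneg
    linear_combination -hneg / 2
  rw [this]
  ring

theorem sphereMeasure_real_univ_of_finrank_one {F : Type*} [NormedAddCommGroup F]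
    [InnerProductSpace ℝ F] [FiniteDimensional ℝ F] [MeasurableSpace F] [BorelSpace F]
    (hF : Module.finrank ℝ F = 1) : (sphereMeasure F).real Set.univ = 2 := by
  have : Nontrivial F := Module.nontrivial_of_finrank_pos (R := ℝ) (by omega)
  rw [sphereMeasure, Measure.toSphere_real_apply_univ, Measure.real, InnerProductSpace.volume_ball,
    hF]
  have h1 : Real.Gamma (((1 : ℕ) : ℝ) / 2 + 1) = 1 / 2 * Real.sqrt Real.pi := by
    rw [Real.Gamma_add_one (by norm_num), Nat.cast_one, Real.Gamma_one_half_eq]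
  have h2 : 0 < Real.sqrt Real.pi := Real.sqrt_pos.2 Real.pi_pos
  rw [h1, pow_one, pow_one, show Real.sqrt Real.pi / (1 / 2 * Real.sqrt Real.pi) = 2 by
    field_simp]
  simp

theorem sphereMeasure_real_univ_of_finrank_two {F : Type*} [NormedAddCommGroup F]
    [InnerProductSpace ℝ F] [FiniteDimensional ℝ F] [MeasurableSpace F] [BorelSpace F]
    (hF : Module.finrank ℝ F = 2) : (sphereMeasure F).real Set.univ = 2 * Real.pi := by
  have : Nontrivial F := Module.nontrivial_of_finrank_pos (R := ℝ) (by omega)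
  rw [sphereMeasure, Measure.toSphere_real_apply_univ, Measure.real, InnerProductSpace.volume_ball,
    hF]
  have h1 : Real.Gamma (((2 : ℕ) : ℝ) / 2 + 1) = 1 := by
    norm_num [Real.Gamma_two]
  rw [h1, Real.sq_sqrt Real.pi_pos.le]
  simp [ENNReal.toReal_ofReal Real.pi_pos.le]

theorem hasFDerivAt_norm_ne {F : Type*} [NormedAddCommGroup F] [InnerProductSpace ℝ F] {x : F}
    (hx : x ≠ 0) : HasFDerivAt (fun y : F => ‖y‖) (‖x‖⁻¹ • innerSL ℝ x) x := by
  have hx' : 0 < ‖x‖ := norm_pos_iff.2 hx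
  have h := (hasStrictFDerivAt_norm_sq x).hasFDerivAt.sqrt (by positivity)
  have e : (fun y : F => Real.sqrt (‖y‖ ^ 2)) = fun y => ‖y‖ := by
    ext y; rw [Real.sqrt_sq (norm_nonneg y)]
  rw [e, Real.sqrt_sq hx'.le] at h
  refine h.congr_fderiv (ContinuousLinearMap.ext fun v => ?_)
  simp only [_root_.smul_apply, smul_eq_mul, nsmul_eq_mul]
  field_simp
  simp

theorem inner_of_mem_tangentSigma {k w : CV d} (hw : w ∈ tangentSigma k) :
    inner ℝ (reV k) (reV w) = inner ℝ (imV k) (imV w) ∧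
      inner ℝ (reV k) (imV w) = -inner ℝ (imV k) (reV w) := by
  have h : cdot k w = 0 := hw
  rw [cdot_comm] at h
  nth_rw 1 [← toC_reV_add_imV k] at h
  rw [cdot_add_right, cdot_smul_right, cdot_toC, cdot_toC] at h
  have h1 := congrArg Complex.re h
  have h2 := congrArg Complex.im h
  simp at h1 h2
  rw [real_inner_comm (reV w), real_inner_comm (imV w), real_inner_comm (imV w) (reV k),
    real_inner_comm (reV w) (imV k)]
  constructor <;> linarith

/-- The scalar `λ` with `∂̄D = λ ∑ Re k_j d(conj k_j)` for the diagonal term `D`. -/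
theorem dbarGreen_zero_sum {k w : CV d} {c : ℝ} (hc : ∀ j, dbarGreen 0 k j = (c : ℂ) * (reV k j : ℂ))
    (hw : w ∈ tangentSigma k) :
    ∑ j, dbarGreen 0 k j * (starRingEnd ℂ) (w j) =
      (c : ℂ) * (((inner ℝ (imV k) (imV w) : ℝ) : ℂ) +
        Complex.I * ((inner ℝ (imV k) (reV w) : ℝ) : ℂ)) := by
  have h := conj_cdot_toC w (reV k)
  obtain ⟨h1, h2⟩ := inner_of_mem_tangentSigma hw
  rw [cdot_toC, real_inner_comm, h1, real_inner_comm (reV k), h2] at h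
  simp only [hc, mul_assoc]
  rw [← Finset.mul_sum, ← h]
  simp
  left
  ring

theorem dbarGreen_zero_two {k : CV 2} (ha : reV k ≠ 0) (hb : imV k ≠ 0) (j : Fin 2) :
    dbarGreen 0 k j = ((1 / (4 * Real.pi * ‖reV k‖ * ‖imV k‖) : ℝ) : ℂ) * (reV k j : ℂ) := by
  have hF : Module.finrank ℝ (Perp (imV k)) = 1 := by
    have := finrank_perp hb
    rw [finrank_euclideanSpace_fin] at this
    omega
  rw [dbarGreen, intDeltaFaddeev_coord, sphereMeasure_real_univ_of_finrank_one hF]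
  have h1 : (‖reV k‖ : ℂ) ≠ 0 := by simpa using ha
  have h2 : (‖imV k‖ : ℂ) ≠ 0 := by simpa using hb
  have h3 : (Real.pi : ℂ) ≠ 0 := by simp
  push_cast
  field_simp
  norm_num
  ring

theorem dbarGreen_zero_three {k : CV 3} (hb : imV k ≠ 0) (j : Fin 3) :
    dbarGreen 0 k j = ((1 / (8 * Real.pi * ‖imV k‖) : ℝ) : ℂ) * (reV k j : ℂ) := by
  have hF : Module.finrank ℝ (Perp (imV k)) = 2 := by
    have := finrank_perp hb
    rw [finrank_euclideanSpace_fin] at this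
    omega
  rw [dbarGreen, intDeltaFaddeev_coord, sphereMeasure_real_univ_of_finrank_two hF]
  by_cases ha : reV k = 0
  · simp [ha]
  have h1 : (‖reV k‖ : ℂ) ≠ 0 := by simpa using ha
  have h2 : (‖imV k‖ : ℂ) ≠ 0 := by simpa using hb
  have h3 : (Real.pi : ℂ) ≠ 0 := by simp
  push_cast
  field_simp
  norm_num
  ring

theorem hasDbarWithinAt_ofReal {f : CV d → ℝ} {f' : CV d →L[ℝ] ℝ} {S T : Set (CV d)} {k : CV d}
    {ω : Fin d → ℂ} (hf : HasFDerivAt f f' k)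
    (h : ∀ w ∈ T, ((f' w : ℂ) + Complex.I * (f' (Complex.I • w) : ℂ)) / 2 =
      ∑ j, ω j * (starRingEnd ℂ) (w j)) :
    HasDbarWithinAt (fun k => (f k : ℂ)) ω S T k :=
  ⟨Complex.ofRealCLM.comp f', (Complex.ofRealCLM.hasFDerivAt.comp k hf).hasFDerivWithinAt,
    fun w hw => h w hw⟩

theorem diagTerm_dbar (hd : d = 2 ∨ d = 3) {k : CV d} (S : Set (CV d)) (hb : imV k ≠ 0)
    (ha : d = 2 → reV k ≠ 0) :
    HasDbarWithinAt diagTerm (dbarGreen 0 k) S (tangentSigma k) k := by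
  have hπ : (Real.pi : ℂ) ≠ 0 := by simp
  have hbn : ‖imV k‖ ≠ 0 := norm_ne_zero_iff.2 hb
  have hbc : (‖imV k‖ : ℂ) ≠ 0 := by simpa using hb
  have hI : HasFDerivAt (fun k : CV d => ‖imV k‖)
      ((‖imV k‖⁻¹ • innerSL ℝ (imV k)).comp (imVL d)) k :=
    (hasFDerivAt_norm_ne hb).comp k (hasFDerivAt_imV k)
  rcases hd with rfl | rfl
  · have ha := ha rfl
    have han : ‖reV k‖ ≠ 0 := norm_ne_zero_iff.2 ha
    have hac : (‖reV k‖ : ℂ) ≠ 0 := by simpa using ha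
    have hR : HasFDerivAt (fun k : CV 2 => ‖reV k‖)
        ((‖reV k‖⁻¹ • innerSL ℝ (reV k)).comp (reVL 2)) k :=
      (hasFDerivAt_norm_ne ha).comp k (hasFDerivAt_reV k)
    have hpos : ‖reV k‖ + ‖imV k‖ ≠ 0 := by positivity
    have hf := ((hR.add hI).log hpos).mul_const (2 * Real.pi)⁻¹
    have e : (diagTerm : CV 2 → ℂ) = fun k =>
        ((Real.log (‖reV k‖ + ‖imV k‖) * (2 * Real.pi)⁻¹ : ℝ) : ℂ) := by
      ext k; simp [diagTerm, div_eq_mul_inv]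
    rw [e]
    refine hasDbarWithinAt_ofReal hf fun w hw => ?_
    rw [dbarGreen_zero_sum (dbarGreen_zero_two ha hb) hw]
    obtain ⟨h1, h2⟩ := inner_of_mem_tangentSigma hw
    have e1 : reVL 2 w = reV w := rfl
    have e2 : imVL 2 w = imV w := rfl
    have e3 : reVL 2 (Complex.I • w) = -imV w := reV_I_smul w
    have e4 : imVL 2 (Complex.I • w) = reV w := imV_I_smul w
    have hpc : (‖reV k‖ : ℂ) + (‖imV k‖ : ℂ) ≠ 0 := by exact_mod_cast hpos
    simp only [_root_.smul_apply, _root_.add_apply, ContinuousLinearMap.comp_apply, e1, e2, e3, e4,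
      Pi.add_apply,
      innerSL_apply_apply, inner_neg_right, h1, h2, smul_eq_mul]
    push_cast
    field_simp
    ring
  · have hf := hI.mul_const (4 * Real.pi)⁻¹
    have e : (diagTerm : CV 3 → ℂ) = fun k => ((‖imV k‖ * (4 * Real.pi)⁻¹ : ℝ) : ℂ) := by
      ext k; simp [diagTerm, div_eq_mul_inv]
    rw [e]
    refine hasDbarWithinAt_ofReal hf fun w hw => ?_
    rw [dbarGreen_zero_sum (dbarGreen_zero_three hb) hw]
    have e2 : imVL 3 w = imV w := rfl
    have e4 : imVL 3 (Complex.I • w) = reV w := imV_I_smul w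
    simp only [_root_.smul_apply, ContinuousLinearMap.comp_apply, e2, e4,
      innerSL_apply_apply, smul_eq_mul]
    push_cast
    field_simp
    ring

end

section

variable {d n : ℕ}

theorem norm_reV_add_toC {k : CV d} {ξ : RV d} (h : symb k ξ = 0) :
    ‖reV (k + toC ξ)‖ = ‖reV k‖ := by
  have h1 : ‖ξ‖ ^ 2 + 2 * inner ℝ (reV k) ξ = 0 := by rw [← symb_re, h, Complex.zero_re]
  rw [reV_add, reV_toC, ← sq_eq_sq₀ (norm_nonneg _) (norm_nonneg _), norm_add_sq_real]
  linarith

theorem diagTerm_add_toC {k : CV d} {ξ : RV d} (h : symb k ξ = 0) :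
    diagTerm (k + toC ξ) = diagTerm k := by
  rw [diagTerm, diagTerm, norm_reV_add_toC h, imV_add, imV_toC, add_zero]

theorem matA_add_toC (hd : d = 2 ∨ d = 3) {z : Fin n → RV d} (hz : Function.Injective z)
    (α : Fin n → ℝ) {k : CV d} (hk : imV k ≠ 0) {ξ : RV d} (h : symb k ξ = 0) (m j : Fin n) :
    matA z α (k + toC ξ) m j =
      planeWave (-toC ξ) (z m) * matA z α k m j * planeWave (toC ξ) (z j) := by
  simp only [matA, pointMatrix, Matrix.of_apply]
  split_ifs with hmj
  · subst hmj
    rw [diagTerm_add_toC h]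
    linear_combination (-(1 - (α m : ℂ) * diagTerm k)) * planeWave_neg_mul (toC ξ) (z m)
  · rw [green_add_toC hd hk (sub_ne_zero.2 fun e => hmj (hz e)) h, sub_eq_add_neg,
      planeWave_add_right, planeWave_neg (toC ξ) (-z j), neg_neg]
    ring

/-- The solution of the linear system with source `α exp (i ξ z)`. -/
def waveSol (z : Fin n → RV d) (α : Fin n → ℝ) (k : CV d) (ξ : RV d) : Fin n → ℂ :=
  (matA z α k)⁻¹.mulVec fun m => (α m : ℂ) * planeWave (toC ξ) (z m)

theorem inv_mulVec_of_conj {M N : Matrix (Fin n) (Fin n) ℂ} {a b : Fin n → ℂ}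
    (hN : ∀ m j, N m j = a m * M m j * b j) (hab : ∀ m, a m * b m = 1) (hM : M.det ≠ 0)
    (v : Fin n → ℂ) :
    N.det ≠ 0 ∧ N⁻¹.mulVec v = fun m => a m * M⁻¹.mulVec (fun j => b j * v j) m := by
  have hN' : N = Matrix.diagonal a * M * Matrix.diagonal b := by
    ext m j
    rw [Matrix.mul_diagonal, Matrix.diagonal_mul, hN]
  have hdet : N.det ≠ 0 := by
    rw [hN', Matrix.det_mul, Matrix.det_mul, Matrix.det_diagonal, Matrix.det_diagonal]
    exact mul_ne_zero (mul_ne_zero (Finset.prod_ne_zero_iff.2 fun m _ => left_ne_zero_of_mul_eq_one (hab m)) hM)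
      (Finset.prod_ne_zero_iff.2 fun m _ => right_ne_zero_of_mul_eq_one (hab m))
  refine ⟨hdet, ?_⟩
  set w := M⁻¹.mulVec (fun j => b j * v j) with hw
  have h1 : M.mulVec w = fun j => b j * v j := by
    rw [hw, Matrix.mulVec_mulVec, Matrix.mul_nonsing_inv _ (isUnit_iff_ne_zero.2 hM),
      Matrix.one_mulVec]
  have h2 : N.mulVec (fun m => a m * w m) = v := by
    ext m
    have h3 := congrFun h1 m
    simp only [Matrix.mulVec, dotProduct, hN] at h3 ⊢
    have e : ∀ j, a m * M m j * b j * (a j * w j) = a m * (M m j * w j) := fun j => by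
      linear_combination (a m * M m j * w j) * hab j
    simp only [e]
    rw [← Finset.mul_sum, h3]
    linear_combination v m * hab m
  rw [← h2, Matrix.mulVec_mulVec, Matrix.nonsing_inv_mul _ (isUnit_iff_ne_zero.2 hdet),
    Matrix.one_mulVec]

theorem coeff_add_toC (hd : d = 2 ∨ d = 3) {z : Fin n → RV d} (hz : Function.Injective z)
    (α : Fin n → ℝ) {k : CV d} (hk : imV k ≠ 0) (hdet : (matA z α k).det ≠ 0) {ξ : RV d}
    (h : symb k ξ = 0) (m : Fin n) :
    coeff z α (k + toC ξ) m = planeWave (-toC ξ) (z m) * waveSol z α k ξ m := by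
  have h1 := congrFun (inv_mulVec_of_conj (matA_add_toC hd hz α hk h)
    (fun _ => planeWave_neg_mul _ _) hdet fun m => (α m : ℂ)).2 m
  simp only [mul_comm (planeWave (toC ξ) _)] at h1
  exact h1

theorem HasDbarWithinAt.mul_of_eq_zero {S T : Set (CV d)} {k : CV d} {u v : CV d → ℂ}
    {ω : Fin d → ℂ} (hu : ContinuousWithinAt u S k) (hv : HasDbarWithinAt v ω S T k)
    (h0 : v k = 0) : HasDbarWithinAt (fun k => u k * v k) (fun j => u k * ω j) S T k := by
  obtain ⟨L, hL, h1⟩ := hv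
  refine ⟨u k • L, ?_, fun w hw => ?_⟩
  · rw [hasFDerivWithinAt_iff_isLittleO] at hL ⊢
    simp only [h0, sub_zero, mul_zero, _root_.smul_apply, smul_eq_mul] at hL ⊢
    have hO : v =O[𝓝[S] k] fun k' => k' - k := by
      have h2 := hL.isBigO.add (L.isBigO_sub (𝓝[S] k) k)
      refine h2.congr_left fun k' => by ring
    have ho : (fun k' => u k' - u k) =o[𝓝[S] k] fun _ => (1 : ℝ) := by
      rw [Asymptotics.isLittleO_one_iff]
      simpa using hu.sub_const (u k)
    have h3 := (ho.mul_isBigO hO.norm_right).norm_right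
    have h3' : (fun k' => (u k' - u k) * v k') =o[𝓝[S] k] fun k' => k' - k := by
      rw [← Asymptotics.isLittleO_norm_right]
      simpa using h3
    refine (h3'.add (hL.const_mul_left (u k))).congr_left fun k' => by ring
  · rw [← antiPart, antiPart_smul, antiPart, h1 w hw, Finset.mul_sum]
    exact Finset.sum_congr rfl fun j _ => by ring

theorem continuousWithinAt_matrix_inv {X : Type*} [TopologicalSpace X] {M : X → Matrix (Fin n) (Fin n) ℂ}
    {S : Set X} {k : X} (hM : ContinuousWithinAt M S k) (hdet : (M k).det ≠ 0) :
    ContinuousWithinAt (fun k => (M k)⁻¹) S k :=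
  (continuousAt_matrix_inv _ (by
    rw [show (Ring.inverse : ℂ → ℂ) = fun w => w⁻¹ from Ring.inverse_eq_inv']
    exact continuousAt_inv₀ hdet)).comp_continuousWithinAt hM

/-- Differentiation of the solution of a linear system with constant right-hand side. -/
theorem hasDbarWithinAt_inv_mulVec {S T : Set (CV d)} {k : CV d}
    {M : CV d → Matrix (Fin n) (Fin n) ℂ} {Ω : Fin n → Fin n → Fin d → ℂ}
    (hM : ∀ m j, HasDbarWithinAt (fun k => M k m j) (Ω m j) S T k) (hdet : (M k).det ≠ 0)
    (hk : k ∈ S) (a : Fin n → ℂ) (m : Fin n) :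
    HasDbarWithinAt (fun k => (M k)⁻¹.mulVec a m) (fun i => -∑ l, (M k)⁻¹ m l *
      ∑ j, Ω l j i * (M k)⁻¹.mulVec a j) S T k := by
  set c := (M k)⁻¹.mulVec a with hc
  have hMc : ContinuousWithinAt M S k := by
    exact tendsto_pi_nhds.2 fun m => tendsto_pi_nhds.2 fun j =>
      (hM m j).differentiableWithinAt.continuousWithinAt
  have hinv := continuousWithinAt_matrix_inv hMc hdet
  have hac : (M k).mulVec c = a := by
    rw [hc, Matrix.mulVec_mulVec, Matrix.mul_nonsing_inv _ (isUnit_iff_ne_zero.2 hdet),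
      Matrix.one_mulVec]
  have hv : ∀ l, HasDbarWithinAt (fun k' => a l + (-1) * ∑ j, c j * M k' l j)
      (fun i => 0 + (-1) * ∑ j, c j * Ω l j i) S T k := fun l =>
    (hasDbarWithinAt_const (a l)).add (HasDbarWithinAt.const_mul (-1)
      (HasDbarWithinAt.sum _ fun j _ => (hM l j).const_mul (c j)))
  have hv0 : ∀ l, a l + (-1) * ∑ j, c j * M k l j = 0 := fun l => by
    have := congrFun hac l
    rw [← this, Matrix.mulVec, dotProduct]
    have : ∑ j, M k l j * c j = ∑ j, c j * M k l j := Finset.sum_congr rfl fun j _ => mul_comm _ _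
    rw [this]; ring
  have hu : ∀ l, ContinuousWithinAt (fun k' => (M k')⁻¹ m l) S k := fun l =>
    tendsto_pi_nhds.1 (tendsto_pi_nhds.1 hinv m) l
  have hprod := HasDbarWithinAt.sum Finset.univ fun l _ =>
    HasDbarWithinAt.mul_of_eq_zero (hu l) (hv l) (hv0 l)
  have htot := (hasDbarWithinAt_const (c m)).add hprod
  have h' := htot.congr_of_eventuallyEq (v := fun k => (M k)⁻¹.mulVec a m) ?_ hk
  · refine h'.congr_form fun w _ => Finset.sum_congr rfl fun i _ => ?_
    congr 1
    rw [zero_add, ← Finset.sum_neg_distrib]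
    refine Finset.sum_congr rfl fun l _ => ?_
    rw [zero_add, mul_comm (-1 : ℂ), mul_neg_one, mul_neg]
    simp only [mul_comm (c _)]
  · have hdet' : ∀ᶠ k' in 𝓝[S] k, (M k').det ≠ 0 :=
      ((continuous_id.matrix_det.continuousAt (x := M k)).comp_continuousWithinAt hMc).eventually_ne
        hdet
    filter_upwards [hdet'] with k' hk'
    have e1 : c = (M k')⁻¹.mulVec ((M k').mulVec c) := by
      rw [Matrix.mulVec_mulVec, Matrix.nonsing_inv_mul _ (isUnit_iff_ne_zero.2 hk'),
        Matrix.one_mulVec]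
    have e2 : c m = ∑ l, (M k')⁻¹ m l * (∑ j, M k' l j * c j) := congrFun e1 m
    have e3 : (M k')⁻¹.mulVec a m = ∑ l, (M k')⁻¹ m l * a l := rfl
    rw [e2, e3, ← Finset.sum_add_distrib]
    refine Finset.sum_congr rfl fun l _ => ?_
    simp only [mul_comm (c _)]
    ring

theorem matA_dbar (hd : d = 2 ∨ d = 3) {z : Fin n → RV d} (hz : Function.Injective z)
    (α : Fin n → ℝ) {E : ℝ} {k : CV d} (hk : k ∈ SigmaE d E) (hb : imV k ≠ 0)
    (ha : d = 2 → reV k ≠ 0) (m j : Fin n) :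
    HasDbarWithinAt (fun k => matA z α k m j) (fun i => -(α m : ℂ) * dbarGreen (z m - z j) k i)
      (SigmaE d E) (tangentSigma k) k := by
  by_cases hmj : m = j
  · subst hmj
    have h := (hasDbarWithinAt_const (1 : ℂ)).add
      ((diagTerm_dbar hd (SigmaE d E) hb ha).const_mul (-(α m : ℂ)))
    simp only [matA, pointMatrix, Matrix.of_apply, if_true, sub_self]
    simpa [sub_eq_add_neg] using h
  · simp only [matA, pointMatrix, Matrix.of_apply, if_neg hmj]
    exact (green_dbar hd (sub_ne_zero.2 fun e => hmj (hz e)) hk hb ha).const_mul _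

theorem continuous_HData_neg (z : Fin n → RV d) (α : Fin n → ℝ) (k : CV d) :
    Continuous fun ξ : RV d => HData z α k (-ξ) := by
  unfold HData hData
  refine continuous_const.mul (continuous_finsetSum _ fun j _ => continuous_const.mul ?_)
  have : (fun ξ : RV d => planeWave (k - (k - toC (-ξ))) (z j)) =
      fun ξ => planeWave (toC ξ) (-(z j)) := by
    ext ξ
    rw [sub_sub_cancel, toC_neg, planeWave_neg]
  rw [this]
  exact continuous_planeWave_toC _

theorem HData_neg_mul_planeWave (z : Fin n → RV d) (α : Fin n → ℝ) (k : CV d) (ξ x : RV d) :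
    HData z α k (-ξ) * planeWave (toC ξ) x =
      1 / (2 * (Real.pi : ℂ)) ^ d * ∑ j, coeff z α k j * planeWave (toC ξ) (x - z j) := by
  rw [HData, hData, mul_assoc, Finset.sum_mul]
  congr 1
  refine Finset.sum_congr rfl fun j _ => ?_
  rw [sub_sub_cancel, toC_neg, planeWave_neg, sub_eq_add_neg x, planeWave_add_right]
  ring

theorem continuous_coord (i : Fin d) : Continuous fun ξ : RV d => (ξ i : ℂ) :=
  Complex.continuous_ofReal.comp (by fun_prop)

theorem intDeltaFaddeev_sum_const_mul {ι : Type*} (s : Finset ι) (k : CV d) (c : ι → ℂ)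
    {F : ι → RV d → ℂ} (hF : ∀ i ∈ s, Continuous (F i)) :
    intDeltaFaddeev k (fun ξ => ∑ i ∈ s, c i * F i ξ) = ∑ i ∈ s, c i * intDeltaFaddeev k (F i) := by
  have h : ∀ i ∈ s, Continuous fun ξ => c i * F i ξ := fun i hi => continuous_const.mul (hF i hi)
  rw [intDeltaFaddeev_sum s k h]
  exact Finset.sum_congr rfl fun i _ => intDeltaFaddeev_const_mul k (c i) (F i)

theorem sum_coeff_dbarGreen (z : Fin n → RV d) (α : Fin n → ℝ) (k : CV d) (x : RV d) (i : Fin d) :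
    ∑ j, dbarGreen (x - z j) k i * coeff z α k j = -2 * (Real.pi : ℂ) *
      intDeltaFaddeev k fun ξ => (ξ i : ℂ) * HData z α k (-ξ) * planeWave (toC ξ) x := by
  have e : (fun ξ : RV d => (ξ i : ℂ) * HData z α k (-ξ) * planeWave (toC ξ) x) = fun ξ =>
      ∑ j, (1 / (2 * (Real.pi : ℂ)) ^ d * coeff z α k j) *
        ((ξ i : ℂ) * planeWave (toC ξ) (x - z j)) := by
    ext ξ
    rw [mul_assoc, HData_neg_mul_planeWave, Finset.mul_sum, Finset.mul_sum]
    exact Finset.sum_congr rfl fun j _ => by ring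
  have hF : ∀ j ∈ Finset.univ, Continuous fun ξ : RV d =>
      (ξ i : ℂ) * planeWave (toC ξ) (x - z j) := fun j _ => continuous_toC_coord_mul_planeWave i _
  rw [e, intDeltaFaddeev_sum_const_mul _ _ _ hF, Finset.mul_sum]
  refine Finset.sum_congr rfl fun j _ => ?_
  rw [dbarGreen]
  ring

theorem coeff_dbar (hd : d = 2 ∨ d = 3) {z : Fin n → RV d} (hz : Function.Injective z)
    (α : Fin n → ℝ) {E : ℝ} {k : CV d} (hk : k ∈ SigmaE d E) (hb : imV k ≠ 0)
    (ha : d = 2 → reV k ≠ 0) (hdet : (matA z α k).det ≠ 0) (m : Fin n) :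
    HasDbarWithinAt (fun k => coeff z α k m) (fun i => -2 * (Real.pi : ℂ) *
      intDeltaFaddeev k fun ξ => (ξ i : ℂ) * HData z α k (-ξ) * waveSol z α k ξ m)
      (SigmaE d E) (tangentSigma k) k := by
  have h := hasDbarWithinAt_inv_mulVec (fun m j => matA_dbar hd hz α hk hb ha m j) hdet hk
    (fun m => (α m : ℂ)) m
  refine h.congr_form fun w _ => Finset.sum_congr rfl fun i _ => ?_
  congr 1
  have e : (fun ξ : RV d => (ξ i : ℂ) * HData z α k (-ξ) * waveSol z α k ξ m) = fun ξ =>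
      ∑ l, ((matA z α k)⁻¹ m l * (α l : ℂ)) *
        ((ξ i : ℂ) * HData z α k (-ξ) * planeWave (toC ξ) (z l)) := by
    ext ξ
    rw [waveSol, Matrix.mulVec, dotProduct, Finset.mul_sum]
    exact Finset.sum_congr rfl fun l _ => by ring
  have hF : ∀ l ∈ Finset.univ, Continuous fun ξ : RV d =>
      (ξ i : ℂ) * HData z α k (-ξ) * planeWave (toC ξ) (z l) := fun l _ =>
    ((continuous_coord i).mul (continuous_HData_neg z α k)).mul (continuous_planeWave_toC _)
  rw [e, intDeltaFaddeev_sum_const_mul _ _ _ hF, Finset.mul_sum, ← Finset.sum_neg_distrib]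
  refine Finset.sum_congr rfl fun l _ => ?_
  have h1 := sum_coeff_dbarGreen z α k (z l) i
  have h2 : ∑ j, -(α l : ℂ) * dbarGreen (z l - z j) k i * (matA z α k)⁻¹.mulVec (fun m => (α m : ℂ)) j
      = -(α l : ℂ) * ∑ j, dbarGreen (z l - z j) k i * coeff z α k j := by
    rw [Finset.mul_sum]
    exact Finset.sum_congr rfl fun j _ => by rw [mul_assoc]; rfl
  rw [h2, h1]
  ring

theorem continuous_waveSol (z : Fin n → RV d) (α : Fin n → ℝ) (k : CV d) (m : Fin n) :
    Continuous fun ξ : RV d => waveSol z α k ξ m := by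
  simp only [waveSol, Matrix.mulVec, dotProduct]
  exact continuous_finsetSum _ fun l _ => continuous_const.mul
    (continuous_const.mul (continuous_planeWave_toC _))

theorem mu_dbar (hd : d = 2 ∨ d = 3) {z : Fin n → RV d} (hz : Function.Injective z)
    (α : Fin n → ℝ) {E : ℝ} {k : CV d} (hk : k ∈ SigmaE d E) (hb : imV k ≠ 0)
    (ha : d = 2 → reV k ≠ 0) (hdet : (matA z α k).det ≠ 0) {x : RV d} (hx : ∀ j, x ≠ z j) :
    HasDbarWithinAt (mu z α x)
      (fun i => -2 * (Real.pi : ℂ) * intDeltaFaddeev k fun ξ =>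
        (ξ i : ℂ) * HData z α k (-ξ) * planeWave (toC ξ) x * mu z α x (k + toC ξ))
      (SigmaE d E) (tangentSigma k) k := by
  have h := (hasDbarWithinAt_const (1 : ℂ)).add (HasDbarWithinAt.sum Finset.univ fun m _ =>
    (coeff_dbar hd hz α hk hb ha hdet m).mul (green_dbar hd (sub_ne_zero.2 (hx m)) hk hb ha))
  refine HasDbarWithinAt.congr_form h fun w _ => Finset.sum_congr rfl fun i _ => ?_
  congr 1
  have e : intDeltaFaddeev k (fun ξ => (ξ i : ℂ) * HData z α k (-ξ) * planeWave (toC ξ) x *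
      mu z α x (k + toC ξ)) = intDeltaFaddeev k (fun ξ =>
      ∑ o : Option (Fin n), o.elim ((ξ i : ℂ) * HData z α k (-ξ) * planeWave (toC ξ) x)
        fun m => green (x - z m) k * ((ξ i : ℂ) * HData z α k (-ξ) * waveSol z α k ξ m)) := by
    refine intDeltaFaddeev_congr hk fun ξ hξ => ?_
    rw [Fintype.sum_option, mu, mul_add, mul_one, Finset.mul_sum]
    congr 1
    refine Finset.sum_congr rfl fun m _ => ?_
    rw [coeff_add_toC hd hz α hb hdet hξ, green_add_toC hd hb (sub_ne_zero.2 (hx m)) hξ,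
      Option.elim, planeWave_neg (toC ξ) (x - z m), neg_sub, sub_eq_add_neg, planeWave_add_right]
    have h1 := planeWave_neg_mul (toC ξ) (z m)
    have h2 := planeWave_neg_right_mul (toC ξ) x
    linear_combination ((ξ i : ℂ) * HData z α k (-ξ) * waveSol z α k ξ m * green (x - z m) k) *
      (planeWave (toC ξ) (-x) * planeWave (toC ξ) x) * h1 +
      ((ξ i : ℂ) * HData z α k (-ξ) * waveSol z α k ξ m * green (x - z m) k) * h2
  rw [e, intDeltaFaddeev_sum, Fintype.sum_option]
  · simp only [Option.elim]
    simp only [intDeltaFaddeev_const_mul]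
    rw [zero_add, mul_add, ← sum_coeff_dbarGreen, Finset.mul_sum, ← Finset.sum_add_distrib]
    exact Finset.sum_congr rfl fun m _ => by ring
  · intro o _
    have hc := (continuous_coord i).mul (continuous_HData_neg z α k)
    cases o with
    | none => exact hc.mul (continuous_planeWave_toC x)
    | some m => exact continuous_const.mul (hc.mul (continuous_waveSol z α k m))

theorem psi_dbar (hd : d = 2 ∨ d = 3) {z : Fin n → RV d} (hz : Function.Injective z)
    (α : Fin n → ℝ) {E : ℝ} {k : CV d} (hk : k ∈ SigmaE d E) (hb : imV k ≠ 0)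
    (ha : d = 2 → reV k ≠ 0) (hdet : (matA z α k).det ≠ 0) {x : RV d} (hx : ∀ j, x ≠ z j) :
    HasDbarWithinAt (psi z α x)
      (fun i => -2 * (Real.pi : ℂ) * intDeltaFaddeev k fun ξ =>
        (ξ i : ℂ) * HData z α k (-ξ) * psi z α x (k + toC ξ))
      (SigmaE d E) (tangentSigma k) k := by
  have h := HasDbarWithinAt.mul (hasDbarWithinAt_of_differentiable (differentiable_planeWave x k))
    (mu_dbar hd hz α hk hb ha hdet hx)
  refine HasDbarWithinAt.congr_form h fun w _ => Finset.sum_congr rfl fun i _ => ?_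
  congr 1
  rw [mul_zero, add_zero, mul_left_comm]
  have e : (fun ξ : RV d => (ξ i : ℂ) * HData z α k (-ξ) * psi z α x (k + toC ξ)) = fun ξ =>
      planeWave k x * ((ξ i : ℂ) * HData z α k (-ξ) * planeWave (toC ξ) x *
        mu z α x (k + toC ξ)) := by
    ext ξ
    rw [psi, planeWave_add]
    ring
  rw [e, intDeltaFaddeev_const_mul]

theorem HData_dbar (hd : d = 2 ∨ d = 3) {z : Fin n → RV d} (hz : Function.Injective z)
    (α : Fin n → ℝ) {E : ℝ} {p : RV d} {k : CV d} (hk : k ∈ OmegaE E p) (hb : imV k ≠ 0)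
    (ha : d = 2 → reV k ≠ 0) (hdet : (matA z α k).det ≠ 0) :
    HasDbarWithinAt (fun k' => HData z α k' p)
      (fun i => -2 * (Real.pi : ℂ) * intDeltaFaddeev k fun ξ =>
        (ξ i : ℂ) * HData z α k (-ξ) * HData z α (k + toC ξ) (p + ξ))
      (OmegaE E p) (tangentOmega p k) k := by
  have hk' : k ∈ SigmaE d E := hk.1
  have h := (HasDbarWithinAt.sum Finset.univ fun m _ =>
    (coeff_dbar hd hz α hk' hb ha hdet m).const_mul
      (1 / (2 * (Real.pi : ℂ)) ^ d * planeWave (toC p) (z m))).mono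
    (S' := OmegaE E p) (T' := tangentOmega p k) (fun _ h => h.1) (fun _ h => h.1)
  have e0 : (fun k' => HData z α k' p) = fun k' =>
      ∑ m, 1 / (2 * (Real.pi : ℂ)) ^ d * planeWave (toC p) (z m) * coeff z α k' m := by
    ext k'
    rw [HData, hData, Finset.mul_sum]
    exact Finset.sum_congr rfl fun m _ => by rw [sub_sub_cancel]; ring
  rw [e0]
  refine HasDbarWithinAt.congr_form h fun w _ => Finset.sum_congr rfl fun i _ => ?_
  congr 1
  have e : intDeltaFaddeev k (fun ξ => (ξ i : ℂ) * HData z α k (-ξ) *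
      HData z α (k + toC ξ) (p + ξ)) = intDeltaFaddeev k (fun ξ =>
      ∑ m, (1 / (2 * (Real.pi : ℂ)) ^ d * planeWave (toC p) (z m)) *
        ((ξ i : ℂ) * HData z α k (-ξ) * waveSol z α k ξ m)) := by
    refine intDeltaFaddeev_congr hk' fun ξ hξ => ?_
    rw [show HData z α (k + toC ξ) (p + ξ) = 1 / (2 * (Real.pi : ℂ)) ^ d *
      ∑ m, coeff z α (k + toC ξ) m * planeWave (k + toC ξ - (k + toC ξ - toC (p + ξ))) (z m)
      from rfl, Finset.mul_sum, Finset.mul_sum]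
    refine Finset.sum_congr rfl fun m _ => ?_
    rw [coeff_add_toC hd hz α hb hdet hξ, sub_sub_cancel, toC_add, planeWave_add]
    linear_combination ((ξ i : ℂ) * HData z α k (-ξ) * (1 / (2 * (Real.pi : ℂ)) ^ d) *
      waveSol z α k ξ m * planeWave (toC p) (z m)) * planeWave_neg_mul (toC ξ) (z m)
  have hF : ∀ m ∈ Finset.univ, Continuous fun ξ : RV d =>
      (ξ i : ℂ) * HData z α k (-ξ) * waveSol z α k ξ m := fun m _ =>
    ((continuous_coord i).mul (continuous_HData_neg z α k)).mul (continuous_waveSol z α k m)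
  rw [e, intDeltaFaddeev_sum_const_mul _ _ _ hF, Finset.mul_sum]
  refine Finset.sum_congr rfl fun m _ => ?_
  ring

end

section

/-- The symbol `r² + a r + b - κ²` along a ray. -/
def rayW (κ : ℝ) (a b : ℂ) (r : ℝ) : ℂ := (r : ℂ) ^ 2 + a * r + b - (κ : ℂ) ^ 2

/-- The integrand of the Gaussian resolvent integral along a ray. -/
def rayFun (m : ℕ) (X κ : ℝ) (a b : ℂ) (r : ℝ) : ℂ :=
  (r : ℂ) ^ m * Complex.exp (Complex.I * ((r * X : ℝ) : ℂ)) *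
    (Complex.exp (-rayW κ a b r) * (rayW κ a b r)⁻¹)

/-- The residue at the pole `r = κ`. -/
def rayRes (m : ℕ) (X κ : ℝ) : ℂ :=
  (κ : ℂ) ^ m * Complex.exp (Complex.I * ((κ * X : ℝ) : ℂ)) / (2 * κ)

/-- The integrand along a ray after subtraction of a logarithmic derivative. -/
def rayReg (m : ℕ) (X κ : ℝ) (a b : ℂ) (r : ℝ) : ℂ :=
  ((r : ℂ) ^ m * Complex.exp (Complex.I * ((r * X : ℝ) : ℂ)) * Complex.exp (-rayW κ a b r) -
    (if r ∈ Set.Ioc (κ / 2) (2 * κ) then rayRes m X κ * (2 * r + a) else 0)) * (rayW κ a b r)⁻¹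

/-- A range of admissible perturbations. -/
def raySize (κ : ℝ) : ℝ := min 1 (min (κ / 8) (κ ^ 2 / 8))

theorem raySize_pos {κ : ℝ} (hκ : 0 < κ) : 0 < raySize κ := by
  unfold raySize; positivity

theorem raySize_le_one (κ : ℝ) : raySize κ ≤ 1 := min_le_left _ _

theorem raySize_le (κ : ℝ) : raySize κ ≤ κ / 8 := (min_le_right _ _).trans (min_le_left _ _)

theorem raySize_le_sq (κ : ℝ) : raySize κ ≤ κ ^ 2 / 8 :=
  (min_le_right _ _).trans (min_le_right _ _)

theorem rayW_eq (κ : ℝ) (a b : ℂ) (r : ℝ) :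
    rayW κ a b r = ((r ^ 2 - κ ^ 2 : ℝ) : ℂ) + (a * r + b) := by
  rw [rayW]; push_cast; ring

theorem norm_perturbation_le {κ : ℝ} {a b : ℂ} (ha : ‖a‖ ≤ raySize κ) (hb : ‖b‖ ≤ raySize κ)
    {r : ℝ} (hr : 0 < r) : ‖a * r + b‖ ≤ raySize κ * (r + 1) := by
  refine (norm_add_le _ _).trans ?_
  rw [norm_mul, Complex.norm_real, Real.norm_eq_abs, abs_of_pos hr, mul_add, mul_one]
  gcongr

theorem norm_rayW_le {κ : ℝ} {a b : ℂ} (ha : ‖a‖ ≤ raySize κ) (hb : ‖b‖ ≤ raySize κ) {r : ℝ}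
    (hr : 0 < r) (hr2 : r ≤ 2 * κ) : ‖rayW κ a b r‖ ≤ 5 * κ ^ 2 + 2 * κ + 1 := by
  rw [rayW_eq]
  refine (norm_add_le _ _).trans ?_
  have h1 := norm_perturbation_le ha hb hr
  have h2 := raySize_le_one κ
  rw [Complex.norm_real, Real.norm_eq_abs]
  have h3 : |r ^ 2 - κ ^ 2| ≤ r ^ 2 + κ ^ 2 := by
    rw [abs_le]; constructor <;> nlinarith [sq_nonneg r, sq_nonneg κ]
  have h4 : r ^ 2 ≤ (2 * κ) ^ 2 := by gcongr
  have h5 : raySize κ * (r + 1) ≤ 1 * (r + 1) := by gcongr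
  nlinarith

theorem rayW_lower {κ : ℝ} (hκ : 0 < κ) {a b : ℂ} (ha : ‖a‖ ≤ raySize κ) (hb : ‖b‖ ≤ raySize κ)
    {r : ℝ} (hr : 0 < r) (hr2 : r ≤ κ / 2 ∨ 2 * κ ≤ r) : κ ^ 2 / 2 ≤ ‖rayW κ a b r‖ := by
  have h1 := norm_perturbation_le ha hb hr
  have h3 := raySize_le κ
  have h4 := raySize_le_sq κ
  have h5 : |r ^ 2 - κ ^ 2| - ‖a * r + b‖ ≤ ‖rayW κ a b r‖ := by
    rw [rayW_eq]
    have := norm_sub_le (((r ^ 2 - κ ^ 2 : ℝ) : ℂ) + (a * r + b)) (a * r + b)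
    rw [add_sub_cancel_right, Complex.norm_real, Real.norm_eq_abs] at this
    linarith
  rcases hr2 with h | h
  · have h6 := neg_abs_le (r ^ 2 - κ ^ 2)
    have h7 : raySize κ * r ≤ κ / 8 * (κ / 2) := by gcongr
    nlinarith
  · have h6 := le_abs_self (r ^ 2 - κ ^ 2)
    have h7 : raySize κ * r ≤ κ / 8 * r := by gcongr
    nlinarith

theorem norm_ray_numerator_outer {m : ℕ} : ∀ κ : ℝ, ∃ C : ℝ, 0 < C ∧ ∀ (X : ℝ) (a b : ℂ) (r : ℝ),
    ‖a‖ ≤ raySize κ → ‖b‖ ≤ raySize κ → 0 < r →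
    ‖(r : ℂ) ^ m * Complex.exp (Complex.I * ((r * X : ℝ) : ℂ)) * Complex.exp (-rayW κ a b r)‖ ≤
      C * Real.exp (-(1 / 4) * r ^ 2) := by
  intro κ
  obtain ⟨C, hC, hCb⟩ := exists_pow_le_exp_sq (1 / 4) (by norm_num) m
  refine ⟨C * Real.exp (κ ^ 2 + 2), by positivity, fun X a b r ha hb hr => ?_⟩
  have h1 := norm_perturbation_le ha hb hr
  have h2 := raySize_le_one κ
  have h3 : raySize κ * (r + 1) ≤ 1 * (r + 1) := by gcongr
  have h4 : -(rayW κ a b r).re ≤ κ ^ 2 + 2 - 1 / 2 * r ^ 2 := by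
    rw [rayW_eq, Complex.add_re, Complex.ofReal_re]
    have := neg_le_of_abs_le ((Complex.abs_re_le_norm (a * r + b)).trans (h1.trans h3))
    nlinarith [sq_nonneg (r - 1)]
  rw [norm_mul, norm_mul, norm_pow, Complex.norm_real, Real.norm_eq_abs, mul_comm Complex.I,
    Complex.norm_exp_ofReal_mul_I, mul_one, Complex.norm_exp, Complex.neg_re]
  calc |r| ^ m * Real.exp (-(rayW κ a b r).re)
      ≤ (C * Real.exp (1 / 4 * r ^ 2)) * Real.exp (κ ^ 2 + 2 - 1 / 2 * r ^ 2) := by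
        gcongr; exact hCb r
    _ = C * Real.exp (κ ^ 2 + 2) * Real.exp (-(1 / 4) * r ^ 2) := by
        rw [mul_assoc, mul_assoc, ← Real.exp_add, ← Real.exp_add]; ring_nf

theorem norm_ray_numerator_inner {m : ℕ} {κ : ℝ} (hκ : 0 < κ) (K Λ : ℝ) (hK : 0 ≤ K) :
    ∃ C : ℝ, 0 < C ∧ ∀ (X : ℝ) (a b : ℂ) (r : ℝ),
    |X| ≤ Λ → ‖a‖ ≤ raySize κ → ‖b‖ ≤ raySize κ → r ∈ Set.Icc (κ / 2) (2 * κ) →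
    |r - κ| + ‖a‖ ≤ K * ‖rayW κ a b r‖ →
    ‖(r : ℂ) ^ m * Complex.exp (Complex.I * ((r * X : ℝ) : ℂ)) * Complex.exp (-rayW κ a b r) -
      rayRes m X κ * (2 * r + a)‖ ≤ C * ‖rayW κ a b r‖ := by
  set M := Real.exp (5 * κ ^ 2 + 2 * κ + 1) with hM
  refine ⟨(m * (2 * κ) ^ (m - 1) + κ ^ m * |Λ|) * M * K + κ ^ m * (M + 2) + κ ^ m * κ⁻¹ * K,
    by positivity, fun X a b r hX ha hb hr hKw => ?_⟩
  set w := rayW κ a b r with hw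
  have hr0 : 0 < r := by have := hr.1; linarith
  have hwM : ‖w‖ ≤ 5 * κ ^ 2 + 2 * κ + 1 := norm_rayW_le ha hb hr0 hr.2
  have hexp : ‖Complex.exp (-w)‖ ≤ M := by
    rw [Complex.norm_exp, hM, Real.exp_le_exp]
    refine le_trans (Complex.re_le_norm _) ?_
    rwa [norm_neg]
  have hκc : (κ : ℂ) ≠ 0 := by exact_mod_cast hκ.ne'
  set er := Complex.exp (Complex.I * ((r * X : ℝ) : ℂ)) with her
  set eκ := Complex.exp (Complex.I * ((κ * X : ℝ) : ℂ)) with heκ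
  have hner : ‖er‖ = 1 := by rw [her, mul_comm, Complex.norm_exp_ofReal_mul_I]
  have hneκ : ‖eκ‖ = 1 := by rw [heκ, mul_comm, Complex.norm_exp_ofReal_mul_I]
  have e1 : (r : ℂ) ^ m * er * Complex.exp (-w) - rayRes m X κ * (2 * r + a) =
      (((r ^ m - κ ^ m : ℝ) : ℂ) * er + (κ : ℂ) ^ m * (er - eκ)) * Complex.exp (-w) +
      (κ : ℂ) ^ m * eκ * (Complex.exp (-w) - 1) +
      (κ : ℂ) ^ m * eκ * ((κ : ℂ)⁻¹ * (((κ - r : ℝ) : ℂ) - a / 2)) := by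
    rw [rayRes, ← heκ]
    push_cast
    field_simp
    ring
  have hab := abs_nonneg (r - κ)
  have hrκ : |r - κ| ≤ K * ‖w‖ := by have := norm_nonneg a; linarith
  have n1 : ‖((r ^ m - κ ^ m : ℝ) : ℂ)‖ ≤ |r - κ| * (m * (2 * κ) ^ (m - 1)) := by
    rw [Complex.norm_real, Real.norm_eq_abs]
    refine (abs_pow_sub_pow_le r κ m).trans ?_
    rw [mul_assoc, abs_of_pos hr0, abs_of_pos hκ]
    gcongr
    exact max_le hr.2 (by linarith)
  have n2 : ‖er - eκ‖ ≤ |r - κ| * |Λ| := by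
    have : er - eκ = eκ * (Complex.exp (Complex.I * (((r - κ) * X : ℝ) : ℂ)) - 1) := by
      rw [mul_sub, mul_one, her, heκ, ← Complex.exp_add]
      congr 2
      push_cast; ring
    rw [this, norm_mul, hneκ, one_mul]
    refine Real.norm_exp_I_mul_ofReal_sub_one_le.trans ?_
    rw [Real.norm_eq_abs, abs_mul]
    exact mul_le_mul_of_nonneg_left (hX.trans (le_abs_self _)) hab
  have n3 : ‖Complex.exp (-w) - 1‖ ≤ (M + 2) * ‖w‖ := by
    have hM0 : 0 < M := Real.exp_pos _
    rcases le_total ‖w‖ 1 with h | h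
    · have := Complex.norm_exp_sub_one_le (x := -w) (by rwa [norm_neg])
      rw [norm_neg] at this
      nlinarith [norm_nonneg w]
    · have := norm_sub_le (Complex.exp (-w)) 1
      rw [norm_one] at this
      nlinarith
  have n4 : ‖((κ - r : ℝ) : ℂ) - a / 2‖ ≤ K * ‖w‖ := by
    refine (norm_sub_le _ _).trans ?_
    rw [Complex.norm_real, Real.norm_eq_abs, abs_sub_comm, norm_div]
    have : ‖(2 : ℂ)‖ = 2 := by simp
    rw [this]
    have := norm_nonneg a
    linarith
  have hκm : ‖(κ : ℂ) ^ m‖ = κ ^ m := by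
    rw [norm_pow, Complex.norm_real, Real.norm_eq_abs, abs_of_pos hκ]
  have hκi : ‖(κ : ℂ)⁻¹‖ = κ⁻¹ := by
    rw [norm_inv, Complex.norm_real, Real.norm_eq_abs, abs_of_pos hκ]
  rw [e1]
  refine (norm_add₃_le).trans ?_
  have t1 : ‖(((r ^ m - κ ^ m : ℝ) : ℂ) * er + (κ : ℂ) ^ m * (er - eκ)) * Complex.exp (-w)‖ ≤
      ((m * (2 * κ) ^ (m - 1) + κ ^ m * |Λ|) * M * K) * ‖w‖ := by
    rw [norm_mul]
    calc _ ≤ (|r - κ| * (m * (2 * κ) ^ (m - 1)) * 1 + κ ^ m * (|r - κ| * |Λ|)) * M := by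
          gcongr
          refine (norm_add_le _ _).trans ?_
          rw [norm_mul, norm_mul, hner, hκm]
          gcongr
      _ = |r - κ| * ((m * (2 * κ) ^ (m - 1) + κ ^ m * |Λ|) * M) := by ring
      _ ≤ (K * ‖w‖) * ((m * (2 * κ) ^ (m - 1) + κ ^ m * |Λ|) * M) := by gcongr
      _ = _ := by ring
  have t2 : ‖(κ : ℂ) ^ m * eκ * (Complex.exp (-w) - 1)‖ ≤ (κ ^ m * (M + 2)) * ‖w‖ := by
    rw [norm_mul, norm_mul, hκm, hneκ, mul_one, mul_assoc]
    gcongr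
  have t3 : ‖(κ : ℂ) ^ m * eκ * ((κ : ℂ)⁻¹ * (((κ - r : ℝ) : ℂ) - a / 2))‖ ≤
      (κ ^ m * κ⁻¹ * K) * ‖w‖ := by
    rw [norm_mul, norm_mul, norm_mul, hκm, hneκ, hκi, mul_one, mul_assoc, mul_assoc]
    gcongr
  calc _ ≤ _ := add_le_add (add_le_add t1 t2) t3
    _ = _ := by ring

/-- The condition that the pole of the symbol is approached transversally. -/
def RayGood (κ K : ℝ) (a b : ℂ) : Prop :=
  ‖a‖ ≤ raySize κ ∧ ‖b‖ ≤ raySize κ ∧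
    ∀ r ∈ Set.Icc (κ / 2) (2 * κ), |r - κ| + ‖a‖ ≤ K * ‖rayW κ a b r‖

theorem norm_rayReg_le {m : ℕ} {κ : ℝ} (hκ : 0 < κ) (K Λ : ℝ) (hK : 0 ≤ K) :
    ∃ C : ℝ, 0 < C ∧ ∀ (X : ℝ) (a b : ℂ) (r : ℝ), |X| ≤ Λ → RayGood κ K a b → 0 < r →
      ‖rayReg m X κ a b r‖ ≤ C * Real.exp (-(1 / 4) * r ^ 2) := by
  obtain ⟨C₁, hC₁, h1⟩ := norm_ray_numerator_outer (m := m) κ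
  obtain ⟨C₂, hC₂, h2⟩ := norm_ray_numerator_inner (m := m) hκ K Λ hK
  refine ⟨C₁ * (κ ^ 2 / 2)⁻¹ + C₂ * Real.exp (κ ^ 2), by positivity, fun X a b r hX hg hr => ?_⟩
  obtain ⟨ha, hb, hg⟩ := hg
  rw [rayReg, norm_mul, norm_inv, add_mul]
  split_ifs with hmem
  · have hmem' : r ∈ Set.Icc (κ / 2) (2 * κ) := ⟨hmem.1.le, hmem.2⟩
    have h3 := h2 X a b r hX ha hb hmem' (hg r hmem')
    have h4 : 1 ≤ Real.exp (κ ^ 2) * Real.exp (-(1 / 4) * r ^ 2) := by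
      rw [← Real.exp_add]
      apply Real.one_le_exp
      have : r ^ 2 ≤ (2 * κ) ^ 2 := by have := hmem.2; gcongr
      linarith
    have h5 : ‖(r : ℂ) ^ m * Complex.exp (Complex.I * ((r * X : ℝ) : ℂ)) *
        Complex.exp (-rayW κ a b r) - rayRes m X κ * (2 * r + a)‖ * ‖rayW κ a b r‖⁻¹ ≤ C₂ := by
      rw [← div_eq_mul_inv]
      exact div_le_of_le_mul₀ (norm_nonneg _) hC₂.le h3
    have h6 : 0 ≤ C₁ * (κ ^ 2 / 2)⁻¹ * Real.exp (-(1 / 4) * r ^ 2) := by positivity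
    have h7 : C₂ ≤ C₂ * Real.exp (κ ^ 2) * Real.exp (-(1 / 4) * r ^ 2) := by
      rw [mul_assoc]; exact le_mul_of_one_le_right hC₂.le h4
    linarith
  · have hout : r ≤ κ / 2 ∨ 2 * κ ≤ r := by
      by_contra hcon
      push Not at hcon
      exact hmem ⟨hcon.1, hcon.2.le⟩
    have h3 := rayW_lower hκ ha hb hr hout
    have h4 := h1 X a b r ha hb hr
    rw [sub_zero]
    have h6 : 0 ≤ C₂ * Real.exp (κ ^ 2) * Real.exp (-(1 / 4) * r ^ 2) := by positivity
    have h7 : ‖(r : ℂ) ^ m * Complex.exp (Complex.I * ((r * X : ℝ) : ℂ)) *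
        Complex.exp (-rayW κ a b r)‖ * ‖rayW κ a b r‖⁻¹ ≤
        (C₁ * Real.exp (-(1 / 4) * r ^ 2)) * (κ ^ 2 / 2)⁻¹ := by gcongr
    linarith [mul_right_comm C₁ (Real.exp (-(1 / 4) * r ^ 2)) (κ ^ 2 / 2)⁻¹]

theorem measurable_rayW (κ : ℝ) (a b : ℂ) : Measurable (rayW κ a b) := by
  unfold rayW; fun_prop

theorem measurable_rayReg (m : ℕ) (X κ : ℝ) (a b : ℂ) : Measurable (rayReg m X κ a b) := by
  unfold rayReg
  have := measurable_rayW κ a b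
  exact (Measurable.sub (by fun_prop) (Measurable.ite measurableSet_Ioc (by fun_prop)
    measurable_const)).mul this.inv

theorem integrableOn_rayReg {m : ℕ} {X κ : ℝ} (hκ : 0 < κ) {K : ℝ} (hK : 0 ≤ K) {a b : ℂ}
    (h : RayGood κ K a b) : IntegrableOn (rayReg m X κ a b) (Set.Ioi 0) := by
  obtain ⟨C, -, hC⟩ := norm_rayReg_le (m := m) hκ K |X| hK
  refine (((integrable_exp_neg_mul_sq (b := 1 / 4) (by norm_num)).const_mul C).integrableOn).mono'
    (measurable_rayReg m X κ a b).aestronglyMeasurable ?_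
  filter_upwards [ae_restrict_mem measurableSet_Ioi] with r hr
  exact hC X a b r le_rfl h hr

theorem hasDerivAt_rayW (κ : ℝ) (a b : ℂ) (r : ℝ) : HasDerivAt (rayW κ a b) (2 * r + a) r := by
  have h1 : HasDerivAt (fun r : ℝ => (r : ℂ)) 1 r := Complex.ofRealCLM.hasDerivAt
  have h := (((h1.pow 2).add (h1.const_mul a)).add_const b).sub_const ((κ : ℂ) ^ 2)
  refine h.congr_deriv ?_
  simp

theorem mem_slitPlane_of_im_ne_zero {z : ℂ} (h : z.im ≠ 0) : z ∈ Complex.slitPlane :=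
  Or.inr h

theorem integral_log_deriv_rayW {κ : ℝ} (hκ : 0 < κ) {a b : ℂ}
    (h : ∀ r ∈ Set.Icc (κ / 2) (2 * κ), (rayW κ a b r).im ≠ 0) :
    IntegrableOn (fun r : ℝ => (2 * r + a) * (rayW κ a b r)⁻¹) (Set.Ioc (κ / 2) (2 * κ)) ∧
    ∫ r in Set.Ioc (κ / 2) (2 * κ), (2 * r + a) * (rayW κ a b r)⁻¹ =
      Complex.log (rayW κ a b (2 * κ)) - Complex.log (rayW κ a b (κ / 2)) := by
  have hle : κ / 2 ≤ 2 * κ := by linarith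
  have hderiv : ∀ r ∈ Set.uIcc (κ / 2) (2 * κ), HasDerivAt (fun r => Complex.log (rayW κ a b r))
      ((2 * r + a) * (rayW κ a b r)⁻¹) r := fun r hr => by
    rw [Set.uIcc_of_le hle] at hr
    rw [← div_eq_mul_inv]
    exact (hasDerivAt_rayW κ a b r).clog_real (mem_slitPlane_of_im_ne_zero (h r hr))
  have hcont : ContinuousOn (fun r : ℝ => (2 * r + a) * (rayW κ a b r)⁻¹)
      (Set.uIcc (κ / 2) (2 * κ)) := by
    rw [Set.uIcc_of_le hle]
    refine ContinuousOn.mul (by fun_prop) (ContinuousOn.inv₀ ?_ fun r hr h0 => h r hr (by simp [h0]))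
    exact fun r _ => (hasDerivAt_rayW κ a b r).continuousAt.continuousWithinAt
  have hint := hcont.intervalIntegrable (μ := volume)
  refine ⟨(intervalIntegrable_iff_integrableOn_Ioc_of_le hle).1 hint, ?_⟩
  rw [← intervalIntegral.integral_of_le hle]
  exact intervalIntegral.integral_eq_sub_of_hasDerivAt hderiv hint

/-- The integral along a ray. -/
theorem integral_rayFun {m : ℕ} {X κ : ℝ} (hκ : 0 < κ) {K : ℝ} (hK : 0 ≤ K) {a b : ℂ}
    (hg : RayGood κ K a b) (h : ∀ r ∈ Set.Icc (κ / 2) (2 * κ), (rayW κ a b r).im ≠ 0) :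
    ∫ r in Set.Ioi (0 : ℝ), rayFun m X κ a b r = (∫ r in Set.Ioi (0 : ℝ), rayReg m X κ a b r) +
      rayRes m X κ * (Complex.log (rayW κ a b (2 * κ)) - Complex.log (rayW κ a b (κ / 2))) := by
  obtain ⟨i1, e1⟩ := integral_log_deriv_rayW hκ h
  have hsub : Set.Ioc (κ / 2) (2 * κ) ⊆ Set.Ioi 0 := fun r hr => by
    have : κ / 2 < r := hr.1
    exact lt_trans (by positivity) this
  set g : ℝ → ℂ := (Set.Ioc (κ / 2) (2 * κ)).indicator
    fun r => rayRes m X κ * ((2 * r + a) * (rayW κ a b r)⁻¹) with hgdef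
  have ig : IntegrableOn g (Set.Ioi 0) :=
    ((integrable_indicator_iff measurableSet_Ioc).2
      (Integrable.const_mul i1 _)).integrableOn
  have e2 : ∫ r in Set.Ioi (0 : ℝ), g r = rayRes m X κ *
      (Complex.log (rayW κ a b (2 * κ)) - Complex.log (rayW κ a b (κ / 2))) := by
    rw [hgdef, setIntegral_indicator measurableSet_Ioc, Set.inter_eq_right.2 hsub,
      integral_const_mul, e1]
  rw [← e2, ← integral_add (integrableOn_rayReg hκ hK hg) ig]
  refine integral_congr_ae (Eventually.of_forall fun r => ?_)
  simp only [rayFun, rayReg, hgdef, Set.indicator]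
  split_ifs <;> ring

/-- The limit of the integral along a ray, from the side `σ` of the pole. -/
def rayLim (m : ℕ) (X κ σ : ℝ) : ℂ :=
  (∫ r in Set.Ioi (0 : ℝ), rayReg m X κ 0 0 r) +
    rayRes m X κ * (((Real.log (3 * κ ^ 2) - Real.log (3 / 4 * κ ^ 2) : ℝ) : ℂ) -
      σ * Real.pi * Complex.I)

theorem norm_log_le (z : ℂ) (hz : z ≠ 0) : ‖Complex.log z‖ ≤ ‖z‖ + ‖z‖⁻¹ + Real.pi := by
  have hz' : 0 < ‖z‖ := norm_pos_iff.2 hz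
  have h1 := Complex.norm_le_abs_re_add_abs_im (Complex.log z)
  rw [Complex.log_re, Complex.log_im] at h1
  have h2 := Complex.abs_arg_le_pi z
  have h3 : |Real.log ‖z‖| ≤ ‖z‖ + ‖z‖⁻¹ := by
    rw [abs_le]
    have h4 := Real.log_le_sub_one_of_pos hz'
    have h5 := Real.one_sub_inv_le_log_of_pos hz'
    have h6 : 0 < ‖z‖⁻¹ := inv_pos.2 hz'
    constructor <;> linarith
  linarith

theorem norm_integral_rayFun_le {m : ℕ} {κ : ℝ} (hκ : 0 < κ) (K Λ : ℝ) (hK : 0 ≤ K) :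
    ∃ C : ℝ, ∀ (X : ℝ) (a b : ℂ), |X| ≤ Λ → RayGood κ K a b →
      (∀ r ∈ Set.Icc (κ / 2) (2 * κ), (rayW κ a b r).im ≠ 0) →
      ‖∫ r in Set.Ioi (0 : ℝ), rayFun m X κ a b r‖ ≤ C := by
  obtain ⟨C, hC0, hC⟩ := norm_rayReg_le (m := m) hκ K Λ hK
  set L := 5 * κ ^ 2 + 2 * κ + 1 + (κ ^ 2 / 2)⁻¹ + Real.pi with hL
  refine ⟨(∫ r in Set.Ioi (0 : ℝ), C * Real.exp (-(1 / 4) * r ^ 2)) +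
    κ ^ m / (2 * κ) * (L + L), fun X a b hX hg him => ?_⟩
  rw [integral_rayFun hκ hK hg him]
  refine (norm_add_le _ _).trans (add_le_add ?_ ?_)
  · refine norm_integral_le_of_norm_le
      ((integrable_exp_neg_mul_sq (b := 1 / 4) (by norm_num)).const_mul C).integrableOn ?_
    filter_upwards [ae_restrict_mem measurableSet_Ioi] with r hr
    exact hC X a b r hX hg hr
  · have hlog : ∀ r, 0 < r → r ≤ 2 * κ → (r ≤ κ / 2 ∨ 2 * κ ≤ r) →
        ‖Complex.log (rayW κ a b r)‖ ≤ L := fun r h0 h1 h2 => by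
      have h3 := rayW_lower hκ hg.1 hg.2.1 h0 h2
      have h4 := norm_rayW_le hg.1 hg.2.1 h0 h1
      have h5 : 0 < κ ^ 2 / 2 := by positivity
      have h6 : ‖rayW κ a b r‖⁻¹ ≤ (κ ^ 2 / 2)⁻¹ := by gcongr
      have := norm_log_le (rayW κ a b r) (norm_pos_iff.1 (by linarith))
      rw [hL]; linarith
    rw [norm_mul]
    have hres : ‖rayRes m X κ‖ = κ ^ m / (2 * κ) := by
      rw [rayRes, norm_div, norm_mul, mul_comm Complex.I, Complex.norm_exp_ofReal_mul_I, mul_one,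
        norm_pow, norm_mul, Complex.norm_real, Real.norm_eq_abs, abs_of_pos hκ]
      simp
    rw [hres]
    gcongr
    exact (norm_sub_le _ _).trans (add_le_add (hlog _ (by linarith) le_rfl (Or.inr le_rfl))
      (hlog _ (by linarith) (by linarith) (Or.inl le_rfl)))

theorem tendsto_rayW {ι : Type*} {l : Filter ι} {a b : ι → ℂ} (κ : ℝ)
    (ha : Tendsto a l (𝓝 0)) (hb : Tendsto b l (𝓝 0)) (r : ℝ) :
    Tendsto (fun i => rayW κ (a i) (b i) r) l (𝓝 ((r ^ 2 - κ ^ 2 : ℝ) : ℂ)) := by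
  have h := ((ha.mul_const (r : ℂ)).add hb).const_add ((r ^ 2 - κ ^ 2 : ℝ) : ℂ)
  rw [zero_mul, add_zero, add_zero] at h
  exact h.congr fun i => (rayW_eq κ _ _ r).symm

theorem tendsto_integral_rayFun {ι : Type*} {l : Filter ι} [l.IsCountablyGenerated] {a b : ι → ℂ}
    (m : ℕ) (X : ℝ) {κ K σ : ℝ} (hκ : 0 < κ) (hK : 0 ≤ K) (hσ : σ = 1 ∨ σ = -1)
    (ha : Tendsto a l (𝓝 0)) (hb : Tendsto b l (𝓝 0)) (hg : ∀ᶠ i in l, RayGood κ K (a i) (b i))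
    (him : ∀ᶠ i in l, ∀ r ∈ Set.Icc (κ / 2) (2 * κ), 0 < σ * (rayW κ (a i) (b i) r).im) :
    Tendsto (fun i => ∫ r in Set.Ioi (0 : ℝ), rayFun m X κ (a i) (b i) r) l
      (𝓝 (rayLim m X κ σ)) := by
  have him' : ∀ᶠ i in l, ∀ r ∈ Set.Icc (κ / 2) (2 * κ), (rayW κ (a i) (b i) r).im ≠ 0 :=
    him.mono fun i hi r hr h0 => by
      have := hi r hr
      rw [h0, mul_zero] at this
      exact this.false
  have heq : ∀ᶠ i in l, (∫ r in Set.Ioi (0 : ℝ), rayReg m X κ (a i) (b i) r) +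
      rayRes m X κ * (Complex.log (rayW κ (a i) (b i) (2 * κ)) -
        Complex.log (rayW κ (a i) (b i) (κ / 2))) =
      ∫ r in Set.Ioi (0 : ℝ), rayFun m X κ (a i) (b i) r := by
    filter_upwards [hg, him'] with i h1 h2
    exact (integral_rayFun hκ hK h1 h2).symm
  refine Tendsto.congr' heq (Tendsto.add ?_ (Tendsto.const_mul _ ?_))
  · obtain ⟨C, -, hC⟩ := norm_rayReg_le (m := m) hκ K |X| hK
    refine tendsto_integral_filter_of_dominated_convergence
      (fun r => C * Real.exp (-(1 / 4) * r ^ 2))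
      (Eventually.of_forall fun i => (measurable_rayReg m X κ _ _).aestronglyMeasurable) ?_
      ((integrable_exp_neg_mul_sq (b := 1 / 4) (by norm_num)).const_mul C).integrableOn ?_
    · filter_upwards [hg] with i hi
      filter_upwards [ae_restrict_mem measurableSet_Ioi] with r hr
      exact hC X _ _ r le_rfl hi hr
    · have hne : ∀ᵐ r : ℝ ∂(volume.restrict (Set.Ioi 0)), r ≠ κ :=
        ae_restrict_of_ae (by simp [ae_iff])
      filter_upwards [ae_restrict_mem measurableSet_Ioi, hne] with r hr hrκ
      have hw := tendsto_rayW κ ha hb r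
      have hw0 := tendsto_rayW (l := l) κ (tendsto_const_nhds (x := (0 : ℂ)))
        (tendsto_const_nhds (x := (0 : ℂ))) r
      have e0 : rayW κ 0 0 r = ((r ^ 2 - κ ^ 2 : ℝ) : ℂ) := by rw [rayW_eq]; simp
      have hne0 : ((r ^ 2 - κ ^ 2 : ℝ) : ℂ) ≠ 0 := by
        rw [Complex.ofReal_ne_zero, sub_ne_zero, Ne, sq_eq_sq₀ (le_of_lt hr) hκ.le]
        exact hrκ
      simp only [rayReg, e0]
      refine Tendsto.mul (Tendsto.sub (Tendsto.const_mul _ hw.neg.cexp) ?_) (hw.inv₀ hne0)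
      split_ifs
      · exact Tendsto.const_mul _ (ha.const_add _)
      · exact tendsto_const_nhds
  · have h1 := tendsto_rayW κ ha hb (2 * κ)
    have h2 := tendsto_rayW κ ha hb (κ / 2)
    have e1 : (2 * κ) ^ 2 - κ ^ 2 = 3 * κ ^ 2 := by ring
    have e2 : (κ / 2) ^ 2 - κ ^ 2 = -(3 / 4 * κ ^ 2) := by ring
    rw [e1] at h1
    rw [e2] at h2
    have l1 : Tendsto (fun i => Complex.log (rayW κ (a i) (b i) (2 * κ))) l
        (𝓝 ((Real.log (3 * κ ^ 2) : ℝ) : ℂ)) := by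
      rw [Complex.ofReal_log (by positivity)]
      exact h1.clog (Or.inl (by rw [Complex.ofReal_re]; positivity))
    have hre : (((-(3 / 4 * κ ^ 2) : ℝ) : ℂ)).re < 0 := by
      rw [Complex.ofReal_re]; nlinarith
    have hn : ‖((-(3 / 4 * κ ^ 2) : ℝ) : ℂ)‖ = 3 / 4 * κ ^ 2 := by
      rw [Complex.norm_real, norm_neg, Real.norm_eq_abs, abs_of_pos (by positivity)]
    have hmem : κ / 2 ∈ Set.Icc (κ / 2) (2 * κ) := ⟨le_rfl, by linarith⟩
    have l2 : Tendsto (fun i => Complex.log (rayW κ (a i) (b i) (κ / 2))) l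
        (𝓝 (((Real.log (3 / 4 * κ ^ 2) : ℝ) : ℂ) + σ * Real.pi * Complex.I)) := by
      rcases hσ with rfl | rfl
      · have := Complex.tendsto_log_nhdsWithin_im_nonneg_of_re_neg_of_im_zero hre
          (Complex.ofReal_im _)
        rw [hn] at this
        rw [Complex.ofReal_one, one_mul]
        refine this.comp (tendsto_nhdsWithin_iff.2 ⟨h2, him.mono fun i hi => ?_⟩)
        have := hi _ hmem
        rw [one_mul] at this
        exact this.le
      · have := Complex.tendsto_log_nhdsWithin_im_neg_of_re_neg_of_im_zero hre
          (Complex.ofReal_im _)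
        rw [hn] at this
        rw [Complex.ofReal_neg, Complex.ofReal_one, neg_one_mul, neg_mul, ← sub_eq_add_neg]
        refine this.comp (tendsto_nhdsWithin_iff.2 ⟨h2, him.mono fun i hi => ?_⟩)
        have := hi _ hmem
        rw [neg_one_mul, neg_pos] at this
        exact this
    have := l1.sub l2
    rw [← sub_sub] at this
    rwa [Complex.ofReal_sub]

end

section

variable {d : ℕ}

theorem norm_heatFun_le (hd : d ≤ 4) {r : ℝ} (hr : 0 < r) :
    ∃ C : ℝ, 0 < C ∧ ∀ (E : ℂ) (ε : ℝ), 0 < ε →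
      ‖heatFun d E r ε‖ ≤ C * Real.exp (ε * E.re) * Real.exp (-(r ^ 2 / (8 * ε))) := by
  set c := r ^ 2 / (8 * Real.pi) with hc
  have hπ := Real.pi_pos
  have hc0 : 0 < c := by positivity
  refine ⟨1 + 2 / c ^ 2, by positivity, fun E ε hε => ?_⟩
  set u := Real.pi / ε with hu
  have hu0 : 0 < u := by positivity
  have h1 : u ^ ((d : ℝ) / 2) ≤ 1 + u ^ 2 := by
    have hd' : (d : ℝ) / 2 ≤ 2 := by
      have : (d : ℝ) ≤ 4 := by exact_mod_cast hd
      linarith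
    rcases le_total u 1 with h | h
    · have := Real.rpow_le_one hu0.le h (by positivity : 0 ≤ (d : ℝ) / 2)
      nlinarith [sq_nonneg u]
    · have := Real.rpow_le_rpow_of_exponent_le h hd'
      rw [Real.rpow_two] at this
      linarith
  have h2 : (1 + u ^ 2) * Real.exp (-(c * u)) ≤ 1 + 2 / c ^ 2 := by
    have h3 : (c * u) ^ 2 / (Nat.factorial 2 : ℝ) ≤ Real.exp (c * u) :=
      Real.pow_div_factorial_le_exp _ (by positivity) 2
    have h4 : Real.exp (c * u) * Real.exp (-(c * u)) = 1 := by rw [← Real.exp_add]; simp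
    have h5 : u ^ 2 ≤ 2 / c ^ 2 * Real.exp (c * u) := by
      rw [div_mul_eq_mul_div, le_div_iff₀ (by positivity)]
      norm_num [Nat.factorial] at h3
      nlinarith
    have h6 : Real.exp (-(c * u)) ≤ 1 := Real.exp_le_one_iff.2 (by nlinarith [mul_pos hc0 hu0])
    calc _ = Real.exp (-(c * u)) + u ^ 2 * Real.exp (-(c * u)) := by ring
      _ ≤ 1 + (2 / c ^ 2 * Real.exp (c * u)) * Real.exp (-(c * u)) := by gcongr
      _ = _ := by rw [mul_assoc, h4, mul_one]
  have e1 : -(r ^ 2 / (4 * ε)) = -(c * u) + -(r ^ 2 / (8 * ε)) := by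
    rw [hc, hu]; field_simp; ring
  have e2 : ((ε : ℂ) * E).re = ε * E.re := by simp
  rw [heatFun, norm_mul, Complex.norm_real, Complex.norm_exp, e2, Real.norm_eq_abs,
    abs_of_nonneg (by positivity), ← hu, e1, Real.exp_add]
  calc _ ≤ ((1 + u ^ 2) * (Real.exp (-(c * u)) * Real.exp (-(r ^ 2 / (8 * ε))))) *
        Real.exp (ε * E.re) := by gcongr
    _ = ((1 + u ^ 2) * Real.exp (-(c * u))) * Real.exp (ε * E.re) *
        Real.exp (-(r ^ 2 / (8 * ε))) := by ring
    _ ≤ _ := by gcongr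

theorem measurable_heatFun (E : ℂ) (r : ℝ) : Measurable (heatFun d E r) := by
  unfold heatFun; fun_prop

theorem tendsto_heatTail (hd : d ≤ 4) {r : ℝ} (hr : 0 < r) (E₀ : ℂ) :
    Tendsto (fun E => heatTail d 1 E r) (𝓝 E₀) (𝓝 (heatTail d 1 E₀ r)) := by
  obtain ⟨C, hC, hb⟩ := norm_heatFun_le hd hr
  refine intervalIntegral.tendsto_integral_filter_of_dominated_convergence
    (fun _ => C * Real.exp (|E₀.re| + 1)) (Eventually.of_forall fun E =>
      (measurable_heatFun E r).aestronglyMeasurable) ?_ intervalIntegrable_const ?_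
  · have h1 : ∀ᶠ E : ℂ in 𝓝 E₀, |E.re| < |E₀.re| + 1 :=
      (Complex.continuous_re.abs.tendsto E₀).eventually_lt_const (by linarith)
    filter_upwards [h1] with E hE
    refine Eventually.of_forall fun ε hε => ?_
    rw [Set.uIoc_of_le zero_le_one] at hε
    refine (hb E ε hε.1).trans ?_
    have h2 : Real.exp (-(r ^ 2 / (8 * ε))) ≤ 1 :=
      Real.exp_le_one_iff.2 (neg_nonpos.2 (by have := hε.1; positivity))
    have h3 : ε * E.re ≤ |E₀.re| + 1 := by
      have := le_abs_self E.re
      have h4 : ε * E.re ≤ ε * |E.re| := by have := hε.1; gcongr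
      nlinarith [abs_nonneg E.re, hε.1, hε.2]
    calc _ ≤ C * Real.exp (|E₀.re| + 1) * 1 := by gcongr
      _ = _ := mul_one _
  · refine Eventually.of_forall fun ε _ => ?_
    unfold heatFun
    exact ((by fun_prop : Continuous fun E : ℂ => _ * Complex.exp (ε * E)).tendsto E₀)

theorem conj_heatTail (T E r : ℝ) :
    (starRingEnd ℂ) (heatTail d T (E : ℂ) r) = heatTail d T (E : ℂ) r := by
  rw [heatTail, intervalIntegral.intervalIntegral_eq_integral_uIoc]
  rw [Complex.real_smul, map_mul, Complex.conj_ofReal, ← integral_conj]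
  congr 2
  ext ε
  rw [heatFun, map_mul, Complex.conj_ofReal, ← Complex.exp_conj, map_mul, Complex.conj_ofReal,
    Complex.conj_ofReal]

/-- The regular part of the limit along a ray. -/
def rayBase (m : ℕ) (X κ : ℝ) : ℂ :=
  (∫ r in Set.Ioi (0 : ℝ), rayReg m X κ 0 0 r) +
    rayRes m X κ * ((Real.log (3 * κ ^ 2) - Real.log (3 / 4 * κ ^ 2) : ℝ) : ℂ)

theorem rayLim_eq (m : ℕ) (X κ σ : ℝ) :
    rayLim m X κ σ = rayBase m X κ - σ * (Real.pi * Complex.I * rayRes m X κ) := by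
  rw [rayLim, rayBase]; ring

theorem conj_rayRes (m : ℕ) (X κ : ℝ) :
    (starRingEnd ℂ) (rayRes m X κ) = rayRes m (-X) κ := by
  rw [rayRes, rayRes, map_div₀, map_mul, map_pow, Complex.conj_ofReal, ← Complex.exp_conj, map_mul,
    Complex.conj_I, Complex.conj_ofReal, map_mul, Complex.conj_ofReal, map_ofNat]
  congr 3
  push_cast; ring

theorem conj_rayBase (m : ℕ) (X κ : ℝ) :
    (starRingEnd ℂ) (rayBase m X κ) = rayBase m (-X) κ := by
  rw [rayBase, rayBase, map_add, map_mul, Complex.conj_ofReal, conj_rayRes, ← integral_conj]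
  congr 2
  ext r
  have hw : rayW κ 0 0 r = ((r ^ 2 - κ ^ 2 : ℝ) : ℂ) := by rw [rayW_eq]; simp
  rw [rayReg, rayReg, hw, map_mul, map_sub, map_mul, map_mul, map_pow, Complex.conj_ofReal,
    map_inv₀, Complex.conj_ofReal, ← Complex.exp_conj, ← Complex.exp_conj, map_neg,
    Complex.conj_ofReal, map_mul, Complex.conj_I, Complex.conj_ofReal]
  have e1 : (starRingEnd ℂ) (if r ∈ Set.Ioc (κ / 2) (2 * κ) then rayRes m X κ * (2 * (r : ℂ) + 0)
      else 0) = if r ∈ Set.Ioc (κ / 2) (2 * κ) then rayRes m (-X) κ * (2 * (r : ℂ) + 0) else 0 := by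
    split_ifs
    · have h2 : (starRingEnd ℂ) (2 : ℂ) = 2 := map_ofNat _ 2
      rw [map_mul, conj_rayRes, map_add, map_mul, Complex.conj_ofReal, h2, map_zero]
    · simp
  rw [e1]
  congr 5
  push_cast; ring

theorem rayGood_zero {κ : ℝ} (hκ : 0 < κ) : RayGood κ κ⁻¹ 0 0 := by
  refine ⟨by simpa using (raySize_pos hκ).le, by simpa using (raySize_pos hκ).le, fun r hr => ?_⟩
  rw [rayW_eq, zero_mul, add_zero, add_zero, norm_zero, add_zero, Complex.norm_real,
    Real.norm_eq_abs, show r ^ 2 - κ ^ 2 = (r - κ) * (r + κ) by ring, abs_mul, mul_left_comm]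
  have h1 : 1 ≤ κ⁻¹ * |r + κ| := by
    rw [inv_mul_eq_div, one_le_div hκ]
    refine le_trans ?_ (le_abs_self _)
    linarith [hr.1]
  exact le_mul_of_one_le_right (abs_nonneg _) h1

theorem continuous_rayRes (m : ℕ) (κ : ℝ) : Continuous fun X => rayRes m X κ := by
  unfold rayRes; fun_prop

theorem stronglyMeasurable_integral_rayReg (m : ℕ) (κ : ℝ) :
    StronglyMeasurable fun X => ∫ r in Set.Ioi (0 : ℝ), rayReg m X κ 0 0 r := by
  have h : Measurable (Function.uncurry fun X r => rayReg m X κ 0 0 r) := by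
    have hw : Measurable fun p : ℝ × ℝ => rayW κ 0 0 p.2 :=
      (measurable_rayW κ 0 0).comp measurable_snd
    have hres : Measurable fun p : ℝ × ℝ => rayRes m p.1 κ :=
      (continuous_rayRes m κ).measurable.comp measurable_fst
    unfold Function.uncurry rayReg
    refine (Measurable.sub (Measurable.mul (by fun_prop) (hw.neg.cexp))
      (Measurable.ite (measurable_snd measurableSet_Ioc) (hres.mul (by fun_prop))
        measurable_const)).mul hw.inv
  exact StronglyMeasurable.integral_prod_right h.stronglyMeasurable

theorem integrable_rayBase (m : ℕ) {κ : ℝ} (hκ : 0 < κ) (x : RV d) :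
    Integrable (fun ω : Metric.sphere (0 : RV d) 1 => rayBase m (inner ℝ (ω : RV d) x) κ)
      (sphereMeasure (RV d)) := by
  have hin : Continuous fun ω : Metric.sphere (0 : RV d) 1 => inner ℝ (ω : RV d) x := by fun_prop
  have hcont : Continuous fun ω : Metric.sphere (0 : RV d) 1 => rayRes m (inner ℝ (ω : RV d) x) κ :=
    (continuous_rayRes m κ).comp hin
  refine Integrable.add ?_ ((hcont.integrable_of_hasCompactSupport
    (HasCompactSupport.of_compactSpace _)).mul_const _)
  obtain ⟨C, hC0, hC⟩ := norm_rayReg_le (m := m) hκ κ⁻¹ ‖x‖ (by positivity)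
  refine Integrable.of_bound ((stronglyMeasurable_integral_rayReg m κ).comp_measurable
    hin.measurable).aestronglyMeasurable
    (∫ r in Set.Ioi (0 : ℝ), C * Real.exp (-(1 / 4) * r ^ 2)) (Eventually.of_forall fun ω => ?_)
  refine norm_integral_le_of_norm_le
    ((integrable_exp_neg_mul_sq (b := 1 / 4) (by norm_num)).const_mul C).integrableOn ?_
  filter_upwards [ae_restrict_mem measurableSet_Ioi] with r hr
  refine hC _ 0 0 r ?_ (rayGood_zero hκ) hr
  have := abs_real_inner_le_norm (ω : RV d) x
  have h1 : ‖(ω : RV d)‖ = 1 := by simp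
  rwa [h1, one_mul] at this

theorem integrable_rayRes (m : ℕ) (κ : ℝ) (x : RV d) :
    Integrable (fun ω : Metric.sphere (0 : RV d) 1 => rayRes m (inner ℝ (ω : RV d) x) κ)
      (sphereMeasure (RV d)) := by
  have hcont : Continuous fun ω : Metric.sphere (0 : RV d) 1 => rayRes m (inner ℝ (ω : RV d) x) κ :=
    (continuous_rayRes m κ).comp (by fun_prop)
  exact hcont.integrable_of_hasCompactSupport (HasCompactSupport.of_compactSpace _)

theorem tendsto_integral_of_rays (hd : 2 ≤ d) {f : ℝ → RV d → ℂ} {x : RV d} {κ K ε₀ : ℝ}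
    {a b : ℝ → Metric.sphere (0 : RV d) 1 → ℂ} {σ : Metric.sphere (0 : RV d) 1 → ℝ}
    (hκ : 0 < κ) (hK : 0 ≤ K) (hε₀ : 0 < ε₀)
    (hf : ∀ ε, 0 < ε → Integrable (f ε)) (hfm : ∀ ε, Measurable (f ε))
    (hray : ∀ ε (ω : Metric.sphere (0 : RV d) 1) (r : ℝ), 0 < r →
      (r : ℝ) ^ (d - 1) • f ε (r • (ω : RV d)) =
        rayFun (d - 1) (inner ℝ (ω : RV d) x) κ (a ε ω) (b ε ω) r)
    (ha : ∀ ω, Tendsto (fun ε => a ε ω) (𝓝[>] 0) (𝓝 0))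
    (hb : ∀ ω, Tendsto (fun ε => b ε ω) (𝓝[>] 0) (𝓝 0))
    (hσ : ∀ ω, σ ω = 1 ∨ σ ω = -1)
    (hgood : ∀ᵐ ω ∂(sphereMeasure (RV d)), ∀ ε, 0 < ε → ε < ε₀ →
      RayGood κ K (a ε ω) (b ε ω) ∧
        ∀ r ∈ Set.Icc (κ / 2) (2 * κ), 0 < σ ω * (rayW κ (a ε ω) (b ε ω) r).im) :
    Tendsto (fun ε => ∫ ζ, f ε ζ) (𝓝[>] 0) (𝓝 (∫ ω : Metric.sphere (0 : RV d) 1,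
      rayLim (d - 1) (inner ℝ (ω : RV d) x) κ (σ ω) ∂(sphereMeasure (RV d)))) := by
  have hrank : Module.finrank ℝ (RV d) = d := finrank_euclideanSpace_fin
  have : Nontrivial (RV d) := Module.nontrivial_of_finrank_pos (R := ℝ) (by omega)
  have hev : ∀ᶠ ε : ℝ in 𝓝[>] 0, 0 < ε ∧ ε < ε₀ :=
    Ioo_mem_nhdsGT hε₀
  have heq : ∀ᶠ ε : ℝ in 𝓝[>] 0, ∫ ω : Metric.sphere (0 : RV d) 1,
      (∫ r in Set.Ioi (0 : ℝ), rayFun (d - 1) (inner ℝ (ω : RV d) x) κ (a ε ω) (b ε ω) r)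
      ∂(sphereMeasure (RV d)) = ∫ ζ, f ε ζ := by
    filter_upwards [hev] with ε hε
    rw [integral_polar (hf ε hε.1), hrank]
    refine integral_congr_ae (Eventually.of_forall fun ω => ?_)
    exact setIntegral_congr_fun measurableSet_Ioi fun r hr => (hray ε ω r hr).symm
  refine Tendsto.congr' heq ?_
  obtain ⟨C, hC⟩ := norm_integral_rayFun_le (m := d - 1) hκ K ‖x‖ hK
  refine tendsto_integral_filter_of_dominated_convergence (fun _ => C) ?_ ?_
    (integrable_const _) ?_
  · refine Eventually.of_forall fun ε => ?_
    have hm : Measurable (Function.uncurry fun (ω : Metric.sphere (0 : RV d) 1) (r : ℝ) =>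
        (r : ℝ) ^ (d - 1) • f ε (r • (ω : RV d))) := by
      unfold Function.uncurry
      have : Measurable fun p : Metric.sphere (0 : RV d) 1 × ℝ => f ε (p.2 • (p.1 : RV d)) :=
        (hfm ε).comp (by fun_prop)
      exact ((measurable_snd (α := Metric.sphere (0 : RV d) 1)).pow_const (d - 1)).smul this
    have h2 := StronglyMeasurable.integral_prod_right (ν := volume.restrict (Set.Ioi (0 : ℝ)))
      hm.stronglyMeasurable
    refine (h2.aestronglyMeasurable (μ := sphereMeasure (RV d))).congr
      (Eventually.of_forall fun ω => ?_)
    exact setIntegral_congr_fun measurableSet_Ioi fun r hr => hray ε ω r hr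
  · filter_upwards [hev] with ε hε
    filter_upwards [hgood] with ω hω
    obtain ⟨h1, h2⟩ := hω ε hε.1 hε.2
    refine hC _ _ _ ?_ h1 fun r hr h0 => ?_
    · have := abs_real_inner_le_norm (ω : RV d) x
      have h1 : ‖(ω : RV d)‖ = 1 := by simp
      rwa [h1, one_mul] at this
    · have := h2 r hr
      rw [h0, mul_zero] at this
      exact this.false
  · filter_upwards [hgood] with ω hω
    refine tendsto_integral_rayFun (d - 1) _ hκ hK (hσ ω) (ha ω) (hb ω) ?_ ?_
    · filter_upwards [hev] with ε hε
      exact (hω ε hε.1 hε.2).1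
    · filter_upwards [hev] with ε hε
      exact (hω ε hε.1 hε.2).2

theorem reV_shiftIm (k η : RV d) (ε : ℝ) : reV (shiftIm k η ε) = k := by
  ext j; simp [shiftIm, reV, toC]

theorem imV_shiftIm (k η : RV d) (ε : ℝ) : imV (shiftIm k η ε) = ε • η := by
  ext j; simp [shiftIm, imV, toC]

theorem cdot_shiftIm (k η : RV d) (ε : ℝ) :
    cdot (shiftIm k η ε) (shiftIm k η ε) = ((‖k‖ ^ 2 - ε ^ 2 * ‖η‖ ^ 2 : ℝ) : ℂ) +
      ((2 * (ε * inner ℝ k η) : ℝ) : ℂ) * Complex.I := by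
  rw [cdot_self, reV_shiftIm, imV_shiftIm, norm_smul, inner_smul_right, mul_pow,
    Real.norm_eq_abs, sq_abs]

theorem continuous_shiftIm (k η : RV d) : Continuous fun ε => shiftIm k η ε := by
  unfold shiftIm; fun_prop

theorem tendsto_shiftIm_cdot (k η : RV d) :
    Tendsto (fun ε => cdot (shiftIm k η ε) (shiftIm k η ε)) (𝓝[>] 0)
      (𝓝 ((‖k‖ ^ 2 : ℝ) : ℂ)) := by
  have h : Continuous fun ε : ℝ => ((‖k‖ ^ 2 - ε ^ 2 * ‖η‖ ^ 2 : ℝ) : ℂ) +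
      ((2 * (ε * inner ℝ k η) : ℝ) : ℂ) * Complex.I := by fun_prop
  have h1 := (h.tendsto 0).mono_left (nhdsWithin_le_nhds (s := Set.Ioi 0))
  simp only [cdot_shiftIm]
  simpa using h1

theorem tendsto_shiftIm_planeWave (k η x : RV d) :
    Tendsto (fun ε => planeWave (-shiftIm k η ε) x) (𝓝[>] 0) (𝓝 (planeWave (-toC k) x)) := by
  have h := (((differentiable_planeWave_neg x).continuous.comp
    (continuous_shiftIm k η)).tendsto 0).mono_left (nhdsWithin_le_nhds (s := Set.Ioi 0))
  have e : shiftIm k η 0 = toC k := by simp [shiftIm]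
  simpa [Function.comp_def, e] using h

theorem imV_shiftIm_ne_zero {k η : RV d} (hη : η ≠ 0) {ε : ℝ} (hε : 0 < ε) :
    imV (shiftIm k η ε) ≠ 0 := by
  rw [imV_shiftIm]; exact smul_ne_zero hε.ne' hη

/-- The boundary value of the Green function whose Gaussian part is `S`. -/
def greenLimit (x k : RV d) (S : ℂ) : ℂ :=
  -(1 / (2 * (Real.pi : ℂ)) ^ d) *
    (planeWave (-toC k) x * (S + heatTail d 1 ((‖k‖ ^ 2 : ℝ) : ℂ) ‖x‖))

theorem tendsto_green_shiftIm (hd : d = 2 ∨ d = 3) {k η x : RV d} (hη : η ≠ 0) (hx : x ≠ 0)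
    {V : ℝ → ℂ} {S : ℂ} (hV : Tendsto V (𝓝[>] 0) (𝓝 S)) {P : ℝ → ℂ}
    (hP : Tendsto P (𝓝[>] 0) (𝓝 (planeWave (-toC k) x)))
    (h : ∀ ε, 0 < ε → regInt 1 x (shiftIm k η ε) = P ε * V ε) :
    Tendsto (fun ε => green x (shiftIm k η ε)) (𝓝[>] 0) (𝓝 (greenLimit x k S)) := by
  have hheat := (tendsto_heatTail (d := d) (by omega) (norm_pos_iff.2 hx)
    ((‖k‖ ^ 2 : ℝ) : ℂ)).comp (tendsto_shiftIm_cdot k η)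
  have h1 := ((hP.mul hV).add ((tendsto_shiftIm_planeWave k η x).mul hheat)).const_mul
    (-(1 / (2 * (Real.pi : ℂ)) ^ d))
  rw [greenLimit, mul_add]
  refine h1.congr' ?_
  filter_upwards [self_mem_nhdsWithin] with ε hε
  rw [green_eq hd (imV_shiftIm_ne_zero hη hε) hx one_pos, h ε hε]
  rfl

theorem planeWave_smul_sphere (r : ℝ) (ω x : RV d) :
    planeWave (toC (r • ω)) x = Complex.exp (Complex.I * ((r * inner ℝ ω x : ℝ) : ℂ)) := by
  rw [planeWave, cdot_toC_toC, inner_smul_left]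
  rfl

/-- The side from which the pole is approached for the direction `γ`. -/
def raySide (γ : RV d) (ω : Metric.sphere (0 : RV d) 1) : ℝ :=
  if 0 < inner ℝ γ (ω : RV d) then 1 else -1

theorem tendsto_green_gamma (hd : d = 2 ∨ d = 3) {γ k x : RV d} (hγ : ‖γ‖ = 1) (hk : k ≠ 0)
    (hkγ : inner ℝ k γ = 0) (hx : x ≠ 0) :
    Tendsto (fun ε => green x (shiftIm k γ ε)) (𝓝[>] 0) (𝓝 (greenLimit x k
      (∫ ω : Metric.sphere (0 : RV d) 1, rayLim (d - 1) (inner ℝ (ω : RV d) x) ‖k‖ (raySide γ ω)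
        ∂(sphereMeasure (RV d))))) := by
  have hd2 : 2 ≤ d := by omega
  have hγ0 : γ ≠ 0 := norm_ne_zero_iff.1 (by rw [hγ]; exact one_ne_zero)
  set κ := ‖k‖ with hκ
  have hκ0 : 0 < κ := norm_pos_iff.2 hk
  have horth : ∀ ε, inner ℝ (reV (shiftIm k γ ε)) (imV (shiftIm k γ ε)) = 0 := fun ε => by
    rw [reV_shiftIm, imV_shiftIm, inner_smul_right, hkγ, mul_zero]
  set f : ℝ → RV d → ℂ := fun ε ζ => planeWave (toC ζ) x *
    (Complex.exp (-symb (shiftIm k γ ε) (ζ - k)) * (symb (shiftIm k γ ε) (ζ - k))⁻¹) with hf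
  have hshift : ∀ ε ζ, planeWave (toC (ζ - k)) x * (Complex.exp (-(1 : ℝ) *
      symb (shiftIm k γ ε) (ζ - k)) * (symb (shiftIm k γ ε) (ζ - k))⁻¹) =
      planeWave (-toC k) x * f ε ζ := fun ε ζ => by
    rw [hf, sub_eq_add_neg ζ k, toC_add, toC_neg, planeWave_add, ← sub_eq_add_neg]
    simp only [Complex.ofReal_one, neg_mul, one_mul]
    ring
  have hsymb : ∀ ε (ω : Metric.sphere (0 : RV d) 1) (r : ℝ),
      symb (shiftIm k γ ε) (r • (ω : RV d) - k) =
      rayW κ (((2 * ε * inner ℝ γ (ω : RV d) : ℝ) : ℂ) * Complex.I) 0 r := fun ε ω r => by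
    have h := symb_sub_reV (horth ε) (r • (ω : RV d))
    have hω : ‖(ω : RV d)‖ = 1 := by simp
    rw [reV_shiftIm, imV_shiftIm, norm_smul, hω, mul_one, Real.norm_eq_abs, sq_abs,
      inner_smul_left, inner_smul_right] at h
    rw [h, rayW_eq, ← hκ]
    simp only [conj_trivial]
    push_cast
    ring
  refine tendsto_green_shiftIm hd hγ0 hx (V := fun ε => ∫ ζ, f ε ζ)
    (P := fun _ => planeWave (-toC k) x) ?_ tendsto_const_nhds fun ε hε => ?_
  · refine tendsto_integral_of_rays hd2 (K := 3 / κ) (ε₀ := raySize κ / 2)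
      (a := fun ε ω => ((2 * ε * inner ℝ γ (ω : RV d) : ℝ) : ℂ) * Complex.I) (b := fun _ _ => 0)
      hκ0 (by positivity) (half_pos (raySize_pos hκ0)) ?_ ?_ ?_ ?_ ?_ ?_ ?_
    · intro ε hε
      have h := ((integrable_regInt hd2 (imV_shiftIm_ne_zero (k := k) hγ0 hε) x
        one_pos).comp_sub_right k).const_mul (planeWave (toC k) x)
      refine h.congr (Eventually.of_forall fun ζ => ?_)
      simp only
      rw [hshift, ← mul_assoc, mul_comm (planeWave (toC k) x), planeWave_neg_mul, one_mul]
    · intro ε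
      have h1 : Continuous fun ζ => symb (shiftIm k γ ε) (ζ - k) :=
        (continuous_symb _).comp (continuous_id.sub continuous_const)
      exact (continuous_planeWave_toC x).measurable.mul
        (h1.neg.cexp.measurable.mul h1.measurable.inv)
    · intro ε ω r hr
      simp only [hf]
      rw [hsymb, planeWave_smul_sphere, rayFun, Complex.real_smul]
      push_cast
      ring
    · intro ω
      have h : Continuous fun ε : ℝ => ((2 * ε * inner ℝ γ (ω : RV d) : ℝ) : ℂ) * Complex.I := by
        fun_prop
      simpa using (h.tendsto 0).mono_left (nhdsWithin_le_nhds (s := Set.Ioi 0))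
    · exact fun _ => tendsto_const_nhds
    · intro ω
      unfold raySide
      split_ifs <;> simp
    · filter_upwards [sphereMeasure_hyperplane γ hγ0] with ω hω ε hε hε0
      set p := inner ℝ γ (ω : RV d) with hp
      have hp1 : |p| ≤ 1 := by
        have := abs_real_inner_le_norm γ (ω : RV d)
        have hω : ‖(ω : RV d)‖ = 1 := by simp
        rwa [hγ, hω, one_mul] at this
      have hna : ‖((2 * ε * p : ℝ) : ℂ) * Complex.I‖ = 2 * ε * |p| := by
        rw [norm_mul, Complex.norm_I, mul_one, Complex.norm_real, Real.norm_eq_abs, abs_mul,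
          abs_of_pos (by positivity)]
      have him : ∀ r, (rayW κ (((2 * ε * p : ℝ) : ℂ) * Complex.I) 0 r).im = 2 * ε * p * r :=
        fun r => by rw [rayW_eq, Complex.add_im, Complex.ofReal_im]; simp
      have hre : ∀ r, (rayW κ (((2 * ε * p : ℝ) : ℂ) * Complex.I) 0 r).re = r ^ 2 - κ ^ 2 :=
        fun r => by rw [rayW_eq, Complex.add_re, Complex.ofReal_re]; simp
      refine ⟨⟨?_, by simpa using (raySize_pos hκ0).le, fun r hr => ?_⟩, fun r hr => ?_⟩
      · rw [hna]; nlinarith [abs_nonneg p]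
      · have h1 := Complex.abs_re_le_norm (rayW κ (((2 * ε * p : ℝ) : ℂ) * Complex.I) 0 r)
        have h2 := Complex.abs_im_le_norm (rayW κ (((2 * ε * p : ℝ) : ℂ) * Complex.I) 0 r)
        set W := ‖rayW κ (((2 * ε * p : ℝ) : ℂ) * Complex.I) 0 r‖
        have hr1 : κ / 2 ≤ r := hr.1
        have hr0 : 0 < r := by linarith
        rw [hre, show r ^ 2 - κ ^ 2 = (r - κ) * (r + κ) by ring, abs_mul,
          abs_of_pos (by linarith : 0 < r + κ)] at h1
        rw [him, abs_mul, abs_mul, abs_of_pos (by positivity : 0 < 2 * ε), abs_of_pos hr0] at h2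
        rw [hna, div_mul_eq_mul_div, le_div_iff₀ hκ0]
        have h3 : 0 ≤ 2 * ε * |p| := by positivity
        nlinarith [abs_nonneg (r - κ)]
      · rw [him, raySide]
        have hr0 : 0 < r := by have := hr.1; linarith
        split_ifs with hpos
        · have : 0 < p := hpos
          positivity
        · have : p < 0 := lt_of_le_of_ne (not_lt.1 hpos) hω
          have h4 : 0 < 2 * ε * (-p) * r := by
            have : 0 < -p := by linarith
            positivity
          linarith
  · rw [regInt, ← integral_sub_right_eq_self _ k, ← integral_const_mul]
    exact integral_congr_ae (Eventually.of_forall fun ζ => hshift ε ζ)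

theorem regInt_shiftIm_self (hd : 2 ≤ d) {k : RV d} (hk : k ≠ 0) (x : RV d) {ε : ℝ}
    (hε : 0 < ε) : regInt 1 x (shiftIm k k ε) = planeWave (-shiftIm k k ε) x *
      resInt x (cdot (shiftIm k k ε) (shiftIm k k ε)) := by
  set κ := ‖k‖ with hκ
  have hκ0 : 0 < κ := norm_pos_iff.2 hk
  set n : RV d := κ⁻¹ • k with hn'
  have hn : ‖n‖ = 1 := by rw [hn', norm_smul, norm_inv, norm_norm, ← hκ, inv_mul_cancel₀ hκ0.ne']
  have hn0 : n ≠ 0 := norm_ne_zero_iff.1 (by rw [hn]; exact one_ne_zero)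
  have : Nontrivial (Perp n) := nontrivial_perp (by rwa [finrank_euclideanSpace_fin]) hn0
  have hb : imV (shiftIm k k ε) = (ε * κ) • n := by
    rw [imV_shiftIm, hn', smul_smul, mul_assoc, mul_inv_cancel₀ hκ0.ne', mul_one]
  set E := cdot (shiftIm k k ε) (shiftIm k k ε) with hE
  have hEre : E.re = κ ^ 2 - ε ^ 2 * κ ^ 2 := by
    rw [hE, cdot_shiftIm, Complex.add_re, Complex.ofReal_re, Complex.re_ofReal_mul]; simp [hκ]
  have hEim : E.im = 2 * (ε * κ ^ 2) := by
    rw [hE, cdot_shiftIm, Complex.add_im, Complex.ofReal_im, Complex.im_ofReal_mul,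
      real_inner_self_eq_norm_sq]; simp [hκ]
  have hβ : 0 < ε * κ := by positivity
  have hδ : ∀ ζ : RV d, 2 * (ε * κ ^ 2) ≤ ‖((‖ζ‖ ^ 2 : ℝ) : ℂ) - E‖ := fun ζ => by
    have := Complex.abs_im_le_norm (((‖ζ‖ ^ 2 : ℝ) : ℂ) - E)
    rw [Complex.sub_im, Complex.ofReal_im, hEim, zero_sub, abs_neg,
      abs_of_pos (by positivity)] at this
    exact this
  have key := regInt_sub_resInt hd hn hb hβ x (by positivity : 0 < 2 * (ε * κ ^ 2)) hδ
  have hz : ∀ᵐ s : Perp n, planeWave (toC (s : RV d)) x *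
      ((∫ t : ℝ, gaussRes (inner ℝ n x) (((‖s‖ ^ 2 : ℝ) : ℂ) - E)
        (t + ((ε * κ : ℝ) : ℂ) * Complex.I)) -
      ∫ t : ℝ, gaussRes (inner ℝ n x) (((‖s‖ ^ 2 : ℝ) : ℂ) - E) t) = 0 := by
    filter_upwards [ae_norm_add_ne (0 : Perp n) 0] with s hs
    rw [add_zero] at hs
    rw [gaussRes_shift hβ.le, sub_self, mul_zero]
    intro t y hy0 hy h0
    have h1 := congrArg Complex.re h0
    have h2 := congrArg Complex.im h0
    rw [re_sq_add, Complex.sub_re, Complex.ofReal_re, hEre, Complex.zero_re] at h1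
    rw [im_sq_add, Complex.sub_im, Complex.ofReal_im, hEim, Complex.zero_im] at h2
    have h3 : 0 < ‖s‖ ^ 2 := by positivity
    have hty : t * y = ε * κ ^ 2 := by linarith
    have hty0 : 0 < t * y := by rw [hty]; positivity
    have hypos : 0 < y := lt_of_le_of_ne hy0 fun h => by rw [← h, mul_zero] at hty0; exact hty0.false
    have ht : κ ≤ t := by
      by_contra hcon
      have : t * y < κ * (ε * κ) := by nlinarith [(pos_iff_pos_of_mul_pos hty0).2 hypos]
      nlinarith
    have h5 : y ^ 2 ≤ (ε * κ) ^ 2 := by gcongr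
    have h6 : κ ^ 2 ≤ t ^ 2 := by gcongr
    nlinarith
  rw [integral_congr_ae hz, integral_zero, sub_eq_zero] at key
  rw [← key, ← mul_assoc, planeWave_neg_mul, one_mul]

theorem tendsto_green_plus (hd : d = 2 ∨ d = 3) {k x : RV d} (hk : k ≠ 0) (hx : x ≠ 0) :
    Tendsto (fun ε => green x (shiftIm k k ε)) (𝓝[>] 0) (𝓝 (greenLimit x k
      (∫ ω : Metric.sphere (0 : RV d) 1, rayLim (d - 1) (inner ℝ (ω : RV d) x) ‖k‖ (-1)
        ∂(sphereMeasure (RV d))))) := by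
  have hd2 : 2 ≤ d := by omega
  set κ := ‖k‖ with hκ
  have hκ0 : 0 < κ := norm_pos_iff.2 hk
  set b : ℝ → ℂ := fun ε => ((ε ^ 2 * κ ^ 2 : ℝ) : ℂ) - ((2 * (ε * κ ^ 2) : ℝ) : ℂ) * Complex.I
    with hb
  set f : ℝ → RV d → ℂ := fun ε ζ => planeWave (toC ζ) x *
    (Complex.exp (-(((‖ζ‖ ^ 2 : ℝ) : ℂ) - cdot (shiftIm k k ε) (shiftIm k k ε))) *
      (((‖ζ‖ ^ 2 : ℝ) : ℂ) - cdot (shiftIm k k ε) (shiftIm k k ε))⁻¹) with hf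
  have hsymb : ∀ ε (ω : Metric.sphere (0 : RV d) 1) (r : ℝ),
      ((‖r • (ω : RV d)‖ ^ 2 : ℝ) : ℂ) - cdot (shiftIm k k ε) (shiftIm k k ε) =
        rayW κ 0 (b ε) r := fun ε ω r => by
    have hω : ‖(ω : RV d)‖ = 1 := by simp
    rw [cdot_shiftIm, norm_smul, hω, mul_one, Real.norm_eq_abs, sq_abs,
      real_inner_self_eq_norm_sq, rayW_eq, ← hκ]
    simp only [hb]
    push_cast
    ring
  refine tendsto_green_shiftIm hd hk hx (V := fun ε => ∫ ζ, f ε ζ)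
    (P := fun ε => planeWave (-shiftIm k k ε) x) ?_ (tendsto_shiftIm_planeWave k k x) fun ε hε => ?_
  · refine tendsto_integral_of_rays hd2 (K := 2 / κ) (ε₀ := min 1 (raySize κ / (3 * κ ^ 2)))
      (a := fun _ _ => 0) (b := fun ε _ => b ε) (σ := fun _ => -1)
      hκ0 (by positivity) (lt_min one_pos (div_pos (raySize_pos hκ0) (by positivity))) ?_ ?_ ?_ ?_ ?_
      ?_ ?_
    · intro ε hε
      refine integrable_resInt x (by positivity : 0 < 2 * (ε * κ ^ 2)) fun ζ => ?_
      have := Complex.abs_im_le_norm (((‖ζ‖ ^ 2 : ℝ) : ℂ) - cdot (shiftIm k k ε) (shiftIm k k ε))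
      rw [Complex.sub_im, Complex.ofReal_im, cdot_shiftIm, Complex.add_im, Complex.ofReal_im,
        Complex.im_ofReal_mul, real_inner_self_eq_norm_sq, Complex.I_im, mul_one, zero_add,
        zero_sub, abs_neg, ← hκ, abs_of_pos (by positivity)] at this
      rw [cdot_shiftIm, real_inner_self_eq_norm_sq]
      exact this
    · intro ε
      have h1 : Continuous fun ζ : RV d =>
          ((‖ζ‖ ^ 2 : ℝ) : ℂ) - cdot (shiftIm k k ε) (shiftIm k k ε) := by fun_prop
      exact (continuous_planeWave_toC x).measurable.mul
        (h1.neg.cexp.measurable.mul h1.measurable.inv)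
    · intro ε ω r hr
      simp only [hf]
      rw [hsymb, planeWave_smul_sphere, rayFun, Complex.real_smul]
      push_cast
      ring
    · exact fun _ => tendsto_const_nhds
    · intro _
      have h : Continuous b := by simp only [hb]; fun_prop
      simpa [hb] using (h.tendsto 0).mono_left (nhdsWithin_le_nhds (s := Set.Ioi 0))
    · exact fun _ => Or.inr rfl
    · refine Eventually.of_forall fun ω ε hε hε0 => ?_
      have hε1 : ε < 1 := lt_of_lt_of_le hε0 (min_le_left _ _)
      have hε2 : ε * (3 * κ ^ 2) < raySize κ := by
        have := lt_of_lt_of_le hε0 (min_le_right _ _)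
        rwa [lt_div_iff₀ (by positivity)] at this
      have him : ∀ r, (rayW κ 0 (b ε) r).im = -(2 * (ε * κ ^ 2)) :=
        fun r => by
          rw [rayW_eq, Complex.add_im, Complex.ofReal_im, zero_mul, zero_add, zero_add, hb]
          simp only [Complex.sub_im, Complex.ofReal_im, Complex.im_ofReal_mul, Complex.I_im,
            mul_one, zero_sub]
      have hre : ∀ r, (rayW κ 0 (b ε) r).re = r ^ 2 - κ ^ 2 + ε ^ 2 * κ ^ 2 :=
        fun r => by
          rw [rayW_eq, Complex.add_re, Complex.ofReal_re, zero_mul, zero_add, hb]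
          simp only [Complex.sub_re, Complex.ofReal_re, Complex.re_ofReal_mul, Complex.I_re,
            mul_zero, sub_zero]
      have hεκ : ε ^ 2 * κ ^ 2 ≤ ε * κ ^ 2 := by gcongr; nlinarith
      refine ⟨⟨by simpa using (raySize_pos hκ0).le, ?_, fun r hr => ?_⟩, fun r _ => ?_⟩
      · refine le_trans ?_ hε2.le
        simp only [hb]
        refine (norm_sub_le _ _).trans ?_
        rw [norm_mul, Complex.norm_I, mul_one, Complex.norm_real, Complex.norm_real,
          Real.norm_eq_abs, Real.norm_eq_abs, abs_of_pos (by positivity),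
          abs_of_pos (by positivity)]
        linarith
      · have h1 := Complex.abs_re_le_norm (rayW κ 0 (b ε) r)
        have h2 := Complex.abs_im_le_norm (rayW κ 0 (b ε) r)
        set W := ‖rayW κ 0 (b ε) r‖
        have hr1 : κ / 2 ≤ r := hr.1
        rw [him, abs_neg, abs_of_pos (by positivity)] at h2
        rw [hre] at h1
        have h3 : |r ^ 2 - κ ^ 2| ≤ |r ^ 2 - κ ^ 2 + ε ^ 2 * κ ^ 2| + ε ^ 2 * κ ^ 2 := by
          have := abs_sub (r ^ 2 - κ ^ 2 + ε ^ 2 * κ ^ 2) (ε ^ 2 * κ ^ 2)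
          rw [add_sub_cancel_right, abs_of_nonneg (by positivity : 0 ≤ ε ^ 2 * κ ^ 2)] at this
          exact this
        rw [show r ^ 2 - κ ^ 2 = (r - κ) * (r + κ) by ring, abs_mul,
          abs_of_pos (by linarith : 0 < r + κ),
          show (r - κ) * (r + κ) = r ^ 2 - κ ^ 2 by ring] at h3
        rw [norm_zero, add_zero, div_mul_eq_mul_div, le_div_iff₀ hκ0]
        have h4 : |r - κ| * κ ≤ |r - κ| * (r + κ) := by gcongr; linarith
        have h5 : 0 < ε * κ ^ 2 := by positivity
        linarith
      · rw [him, neg_one_mul, neg_neg]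
        positivity
  · exact regInt_shiftIm_self hd2 hk x hε

/-- The outgoing Green function up to the factor `-(2π)^{-d} exp (-i k x)`. -/
def outFun (κ : ℝ) (x : RV d) : ℂ :=
  (∫ ω : Metric.sphere (0 : RV d) 1, rayLim (d - 1) (inner ℝ (ω : RV d) x) κ (-1)
        ∂(sphereMeasure (RV d))) + heatTail d 1 ((κ ^ 2 : ℝ) : ℂ) ‖x‖

theorem greenPlus_eq (hd : d = 2 ∨ d = 3) {k x : RV d} (hk : k ≠ 0) (hx : x ≠ 0) :
    greenPlus x k = -(1 / (2 * (Real.pi : ℂ)) ^ d) * (planeWave (-toC k) x * outFun ‖k‖ x) :=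
  (tendsto_green_plus hd hk hx).limUnder_eq

theorem integral_rayLim {κ : ℝ} (hκ : 0 < κ) (x : RV d)
    {σ : Metric.sphere (0 : RV d) 1 → ℝ} (hσm : Measurable σ) (hσ : ∀ ω, |σ ω| ≤ 1) :
    ∫ ω : Metric.sphere (0 : RV d) 1, rayLim (d - 1) (inner ℝ (ω : RV d) x) κ (σ ω)
        ∂(sphereMeasure (RV d)) =
      (∫ ω : Metric.sphere (0 : RV d) 1, rayBase (d - 1) (inner ℝ (ω : RV d) x) κ
        ∂(sphereMeasure (RV d))) - Real.pi * Complex.I *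
      ∫ ω : Metric.sphere (0 : RV d) 1, (σ ω : ℂ) * rayRes (d - 1) (inner ℝ (ω : RV d) x) κ
        ∂(sphereMeasure (RV d)) := by
  simp only [rayLim_eq]
  have h1 : Integrable (fun ω : Metric.sphere (0 : RV d) 1 =>
      (σ ω : ℂ) * rayRes (d - 1) (inner ℝ (ω : RV d) x) κ) (sphereMeasure (RV d)) :=
    (integrable_rayRes (d - 1) κ x).bdd_mul (c := 1)
      (Complex.measurable_ofReal.comp hσm).aestronglyMeasurable
      (Eventually.of_forall fun ω => by
        rw [Complex.norm_real, Real.norm_eq_abs]; exact hσ ω)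
  have e : ∀ ω : Metric.sphere (0 : RV d) 1,
      (σ ω : ℂ) * (Real.pi * Complex.I * rayRes (d - 1) (inner ℝ (ω : RV d) x) κ) =
      Real.pi * Complex.I * ((σ ω : ℂ) * rayRes (d - 1) (inner ℝ (ω : RV d) x) κ) :=
    fun ω => by ring
  simp only [e]
  rw [integral_sub (integrable_rayBase (d - 1) hκ x) (h1.const_mul _), integral_const_mul]

theorem rayRes_eq (κ : ℝ) (ω x : RV d) :
    rayRes (d - 1) (inner ℝ ω x) κ =
      ((κ ^ (d - 1) / (2 * κ) : ℝ) : ℂ) * planeWave (toC (κ • ω)) x := by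
  rw [planeWave_smul_sphere, rayRes]
  push_cast
  ring

theorem greenGamma_sub_greenPlus (hd : d = 2 ∨ d = 3) {γ k x : RV d} (hγ : ‖γ‖ = 1)
    (hk : k ≠ 0) (hkγ : inner ℝ k γ = 0) (hx : x ≠ 0) :
    greenGamma γ x k = greenPlus x k + 2 * (Real.pi : ℂ) * Complex.I *
      (1 / (2 * (Real.pi : ℂ)) ^ d) * intDeltaSphere ‖k‖ fun ξ =>
        heaviside (inner ℝ (ξ - k) γ) * planeWave (toC (ξ - k)) x := by
  have hd2 : 2 ≤ d := by omega
  have hκ0 : 0 < ‖k‖ := norm_pos_iff.2 hk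
  have h1 : greenGamma γ x k = _ := (tendsto_green_gamma hd hγ hk hkγ hx).limUnder_eq
  have h2 : greenPlus x k = _ := (tendsto_green_plus hd hk hx).limUnder_eq
  have hm : Measurable (raySide γ) := by
    unfold raySide
    exact Measurable.ite (measurableSet_lt measurable_const (by fun_prop)) measurable_const
      measurable_const
  have hm1 : ∀ ω, |raySide γ ω| ≤ 1 := fun ω => by unfold raySide; split_ifs <;> simp
  have e1 := integral_rayLim hκ0 x hm hm1
  have e2 := integral_rayLim hκ0 x (σ := fun _ => -1) measurable_const (fun _ => by simp)
  have i1 : Integrable (fun ω : Metric.sphere (0 : RV d) 1 =>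
      (raySide γ ω : ℂ) * rayRes (d - 1) (inner ℝ (ω : RV d) x) ‖k‖) (sphereMeasure (RV d)) :=
    (integrable_rayRes (d - 1) ‖k‖ x).bdd_mul (c := 1)
      (Complex.measurable_ofReal.comp hm).aestronglyMeasurable
      (Eventually.of_forall fun ω => by
        rw [Complex.norm_real, Real.norm_eq_abs]; exact hm1 ω)
  have i2 := (integrable_rayRes (d - 1) ‖k‖ x).const_mul ((-1 : ℝ) : ℂ)
  have e3 : (∫ ω : Metric.sphere (0 : RV d) 1, (raySide γ ω : ℂ) *
        rayRes (d - 1) (inner ℝ (ω : RV d) x) ‖k‖ ∂(sphereMeasure (RV d))) -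
      ∫ ω : Metric.sphere (0 : RV d) 1, ((-1 : ℝ) : ℂ) *
        rayRes (d - 1) (inner ℝ (ω : RV d) x) ‖k‖ ∂(sphereMeasure (RV d)) =
      2 * (planeWave (toC k) x * intDeltaSphere ‖k‖ fun ξ =>
        heaviside (inner ℝ (ξ - k) γ) * planeWave (toC (ξ - k)) x) := by
    rw [← integral_sub i1 i2, intDeltaSphere]
    change _ = 2 * (_ * (_ * ∫ ω : Metric.sphere (0 : RV d) 1, _ ∂(sphereMeasure (RV d))))
    rw [← integral_const_mul, ← integral_const_mul, ← integral_const_mul]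
    refine integral_congr_ae (Eventually.of_forall fun ω => ?_)
    simp only
    have h3 : planeWave (toC (‖k‖ • (ω : RV d) - k)) x =
        planeWave (toC (‖k‖ • (ω : RV d))) x * planeWave (-toC k) x := by
      rw [sub_eq_add_neg, toC_add, toC_neg, planeWave_add]
    rw [rayRes_eq, h3, inner_sub_left, hkγ, sub_zero, inner_smul_left, real_inner_comm, raySide,
      heaviside]
    have h4 := planeWave_neg_mul (toC k) x
    have h5 : (0 < (starRingEnd ℝ) ‖k‖ * inner ℝ γ (ω : RV d)) ↔ 0 < inner ℝ γ (ω : RV d) := by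
      rw [conj_trivial]; exact mul_pos_iff_of_pos_left hκ0
    simp only [h5]
    split_ifs
    · push_cast
      linear_combination (-2 * ((‖k‖ : ℂ) ^ (d - 1) / (2 * ‖k‖)) *
        planeWave (toC (‖k‖ • (ω : RV d))) x) * h4
    · push_cast; ring
  rw [h1, h2, greenLimit, greenLimit, e1, e2]
  have h4 := planeWave_neg_mul (toC k) x
  set J := intDeltaSphere ‖k‖ fun ξ => heaviside (inner ℝ (ξ - k) γ) * planeWave (toC (ξ - k)) x
  linear_combination (1 / (2 * (Real.pi : ℂ)) ^ d * planeWave (-toC k) x * Real.pi * Complex.I) *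
    e3 + (1 / (2 * (Real.pi : ℂ)) ^ d * Real.pi * Complex.I * 2 * J) * h4

theorem outFun_neg (κ : ℝ) (x : RV d) : outFun κ (-x) = outFun κ x := by
  rw [outFun, outFun, norm_neg, ← integral_sphere_neg]
  congr 2
  ext ω
  have : (((-ω : Metric.sphere (0 : RV d) 1)) : RV d) = -(ω : RV d) := rfl
  rw [this, inner_neg_neg]

theorem outFun_im {κ : ℝ} (hκ : 0 < κ) (x : RV d) :
    outFun κ x = (starRingEnd ℂ) (outFun κ x) +
      2 * Real.pi * Complex.I * intDeltaSphere κ fun ξ => planeWave (toC ξ) x := by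
  have e2 := integral_rayLim hκ x (σ := fun _ => -1) measurable_const (fun _ => by simp)
  set B := ∫ ω : Metric.sphere (0 : RV d) 1, rayBase (d - 1) (inner ℝ (ω : RV d) x) κ
        ∂(sphereMeasure (RV d)) with hB
  set R := ∫ ω : Metric.sphere (0 : RV d) 1, rayRes (d - 1) (inner ℝ (ω : RV d) x) κ
        ∂(sphereMeasure (RV d)) with hR
  have hneg : ∀ ω : Metric.sphere (0 : RV d) 1,
      inner ℝ ((-ω : Metric.sphere (0 : RV d) 1) : RV d) x = -inner ℝ (ω : RV d) x := fun ω => by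
    have : (((-ω : Metric.sphere (0 : RV d) 1)) : RV d) = -(ω : RV d) := rfl
    rw [this, inner_neg_left]
  have hBc : (starRingEnd ℂ) B = B := by
    have h := integral_sphere_neg fun ω : Metric.sphere (0 : RV d) 1 =>
      rayBase (d - 1) (inner ℝ (ω : RV d) x) κ
    simp only [hneg] at h
    rw [hB, ← integral_conj]
    simp only [conj_rayBase]
    exact h
  have hRc : (starRingEnd ℂ) R = R := by
    have h := integral_sphere_neg fun ω : Metric.sphere (0 : RV d) 1 =>
      rayRes (d - 1) (inner ℝ (ω : RV d) x) κ
    simp only [hneg] at h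
    rw [hR, ← integral_conj]
    simp only [conj_rayRes]
    exact h
  have hRd : R = intDeltaSphere κ fun ξ => planeWave (toC ξ) x := by
    rw [hR]
    simp only [rayRes_eq]
    rw [integral_const_mul]
    rfl
  have hout : outFun κ x = B + Real.pi * Complex.I * R + heatTail d 1 ((κ ^ 2 : ℝ) : ℂ) ‖x‖ := by
    rw [outFun, e2, integral_const_mul]
    push_cast; ring
  rw [← hRd, hout, map_add, map_add, map_mul, map_mul, hBc, hRc, conj_heatTail,
    Complex.conj_ofReal, Complex.conj_I]
  ring

end

section

variable {d n : ℕ}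

theorem greenGamma_tendsto (hd : d = 2 ∨ d = 3) {γ k x : RV d} (hγ : ‖γ‖ = 1) (hk : k ≠ 0)
    (hkγ : inner ℝ k γ = 0) (hx : x ≠ 0) :
    Tendsto (fun ε : ℝ => green x (shiftIm k γ ε)) (𝓝[>] 0) (𝓝 (greenGamma γ x k)) :=
  tendsto_nhds_limUnder ⟨_, tendsto_green_gamma hd hγ hk hkγ hx⟩

theorem greenPlus_tendsto (hd : d = 2 ∨ d = 3) {k x : RV d} (hk : k ≠ 0) (hx : x ≠ 0) :
    (∀ ε : ℝ, 0 < ε → GreenConverges x (shiftIm k k ε)) ∧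
      Tendsto (fun ε : ℝ => green x (shiftIm k k ε)) (𝓝[>] 0) (𝓝 (greenPlus x k)) :=
  ⟨fun _ hε => greenConverges hd (imV_shiftIm_ne_zero hk hε) hx,
    tendsto_nhds_limUnder ⟨_, tendsto_green_plus hd hk hx⟩⟩

/-! ### The diagonal terms and the mass of the sphere -/

theorem intDeltaSphere_one (hd : d = 2 ∨ d = 3) {κ : ℝ} (hκ : 0 < κ) :
    intDeltaSphere κ (fun _ : RV d => 1) = if d = 3 then 2 * (Real.pi : ℂ) * κ else (Real.pi : ℂ) := by
  have hκ' : (κ : ℂ) ≠ 0 := by simpa using hκ.ne'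
  rw [intDeltaSphere, integral_const, Complex.real_smul, mul_one]
  rcases hd with rfl | rfl
  · have h := sphereMeasure_real_univ_of_finrank_two (F := RV 2) finrank_euclideanSpace_fin
    rw [h]
    push_cast
    simp
    field_simp
  · rw [Measure.toSphere_real_apply_univ, Measure.real, EuclideanSpace.volume_ball_fin_three,
      finrank_euclideanSpace_fin]
    rw [ENNReal.ofReal_one, one_pow, one_mul, ENNReal.toReal_ofReal (by positivity)]
    rw [if_pos rfl]
    push_cast
    field_simp
    norm_num

theorem intDeltaSphere_heaviside {γ k : RV d} (hγ : γ ≠ 0) (hk : k ≠ 0) (hkγ : inner ℝ k γ = 0) :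
    2 * intDeltaSphere ‖k‖ (fun ξ => heaviside (inner ℝ (ξ - k) γ)) =
      intDeltaSphere ‖k‖ (fun _ : RV d => 1) := by
  have hκ0 : 0 < ‖k‖ := norm_pos_iff.2 hk
  rw [intDeltaSphere, intDeltaSphere]
  change 2 * (_ * ∫ ω : Metric.sphere (0 : RV d) 1, _ ∂(sphereMeasure (RV d))) =
    _ * ∫ ω : Metric.sphere (0 : RV d) 1, _ ∂(sphereMeasure (RV d))
  have e : ∀ ω : RV d, heaviside (inner ℝ (‖k‖ • ω - k) γ) = if 0 < inner ℝ γ ω then 1 else 0 :=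
    fun ω => by
      rw [heaviside, inner_sub_left, hkγ, sub_zero, inner_smul_left, real_inner_comm, conj_trivial]
      simp only [mul_pos_iff_of_pos_left hκ0]
  simp only [e]
  have hm : Measurable fun ω : Metric.sphere (0 : RV d) 1 =>
      if 0 < inner ℝ γ (ω : RV d) then (1 : ℂ) else 0 :=
    Measurable.ite (measurableSet_lt measurable_const (by fun_prop)) measurable_const
      measurable_const
  have hi : Integrable (fun ω : Metric.sphere (0 : RV d) 1 =>
      if 0 < inner ℝ γ (ω : RV d) then (1 : ℂ) else 0) (sphereMeasure (RV d)) :=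
    Integrable.of_bound hm.aestronglyMeasurable 1
      (Eventually.of_forall fun ω => by split_ifs <;> simp)
  have hi' : Integrable (fun ω : Metric.sphere (0 : RV d) 1 =>
      if 0 < inner ℝ γ (-(ω : RV d)) then (1 : ℂ) else 0) (sphereMeasure (RV d)) :=
    Integrable.of_bound (hm.comp measurable_neg).aestronglyMeasurable 1
      (Eventually.of_forall fun ω => by split_ifs <;> simp)
  have h1 := integral_sphere_neg fun ω : Metric.sphere (0 : RV d) 1 =>
    if 0 < inner ℝ γ (ω : RV d) then (1 : ℂ) else 0
  have h2 : ∫ ω : Metric.sphere (0 : RV d) 1, ((if 0 < inner ℝ γ (ω : RV d) then (1 : ℂ) else 0) +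
      if 0 < inner ℝ γ (-(ω : RV d)) then (1 : ℂ) else 0) ∂(sphereMeasure (RV d)) =
      ∫ ω : Metric.sphere (0 : RV d) 1, (1 : ℂ) ∂(sphereMeasure (RV d)) := by
    refine integral_congr_ae ?_
    filter_upwards [sphereMeasure_hyperplane γ hγ] with ω hω
    rw [inner_neg_right]
    rcases lt_or_gt_of_ne hω with h | h <;> simp [h, not_lt.2 h.le]
  rw [integral_add hi hi'] at h2
  change (∫ ω : Metric.sphere (0 : RV d) 1,
    (if 0 < inner ℝ γ (-(ω : RV d)) then (1 : ℂ) else 0) ∂(sphereMeasure (RV d))) = _ at h1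
  rw [h1] at h2
  rw [← h2]
  ring

theorem diagTermGamma_sub (hd : d = 2 ∨ d = 3) {γ k : RV d} (hγ : γ ≠ 0) (hk : k ≠ 0)
    (hkγ : inner ℝ k γ = 0) :
    diagTermGamma k = diagTermPlus k + 2 * (Real.pi : ℂ) * Complex.I *
      (1 / (2 * (Real.pi : ℂ)) ^ d) * intDeltaSphere ‖k‖ fun ξ =>
        heaviside (inner ℝ (ξ - k) γ) := by
  have h := intDeltaSphere_heaviside hγ hk hkγ
  rw [intDeltaSphere_one hd (norm_pos_iff.2 hk)] at h
  have h3 : (Real.pi : ℂ) ≠ 0 := by simp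
  set J := intDeltaSphere ‖k‖ fun ξ => heaviside (inner ℝ (ξ - k) γ)
  rcases hd with rfl | rfl
  · have e : J = Real.pi / 2 := by simp at h; rw [← h]; ring
    rw [e, diagTermGamma, diagTermPlus]
    simp
    field_simp
    ring
  · have e : J = Real.pi * ‖k‖ := by simp at h; linear_combination h / 2
    rw [e, diagTermGamma, diagTermPlus]
    simp
    field_simp
    ring

/-! ### The outgoing system in symmetric form -/

/-- `exp (i k x) g⁺(x,k)` for `|k| = κ`. -/
def outGreen (κ : ℝ) (x : RV d) : ℂ := -(1 / (2 * (Real.pi : ℂ)) ^ d) * outFun κ x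

/-- The diagonal term of the outgoing system for `|k| = κ`. -/
def outDiag (d : ℕ) (κ : ℝ) : ℂ :=
  if d = 3 then -(Complex.I * (κ : ℂ)) / (4 * (Real.pi : ℂ))
  else -((Real.pi : ℂ) * Complex.I - 2 * (Real.log κ : ℂ)) / (4 * (Real.pi : ℂ))

/-- The matrix of the outgoing system after conjugation by the plane wave. -/
def outMat (z : Fin n → RV d) (α : Fin n → ℝ) (κ : ℝ) : Matrix (Fin n) (Fin n) ℂ :=
  pointMatrix z α (outDiag d κ) (outGreen κ)

theorem planeWave_mul_greenPlus (hd : d = 2 ∨ d = 3) {k x : RV d} (hk : k ≠ 0) (hx : x ≠ 0) :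
    planeWave (toC k) x * greenPlus x k = outGreen ‖k‖ x := by
  rw [greenPlus_eq hd hk hx, outGreen]
  linear_combination (-(1 / (2 * (Real.pi : ℂ)) ^ d) * outFun ‖k‖ x) *
    planeWave_neg_mul (toC k) x

theorem planeWave_sub_right (k : CV d) (x y : RV d) :
    planeWave k (x - y) = planeWave k x * planeWave (-k) y := by
  rw [sub_eq_add_neg, planeWave_add_right, planeWave_neg]

theorem matAPlus_apply (hd : d = 2 ∨ d = 3) {z : Fin n → RV d} (hz : Function.Injective z)
    (α : Fin n → ℝ) {k : RV d} (hk : k ≠ 0) (m j : Fin n) :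
    matAPlus z α k m j =
      planeWave (-toC k) (z m) * outMat z α ‖k‖ m j * planeWave (toC k) (z j) := by
  simp only [matAPlus, outMat, pointMatrix, Matrix.of_apply]
  split_ifs with hmj
  · subst hmj
    change 1 - (α m : ℂ) * outDiag d ‖k‖ = _
    linear_combination (-(1 - (α m : ℂ) * outDiag d ‖k‖)) * planeWave_neg_mul (toC k) (z m)
  · rw [← planeWave_mul_greenPlus hd hk (sub_ne_zero.2 fun e => hmj (hz e)), planeWave_sub_right]
    linear_combination (α m * greenPlus (z m - z j) k) * (planeWave (-toC k) (z j) *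
      planeWave (toC k) (z j) * planeWave_neg_mul (toC k) (z m) + planeWave_neg_mul (toC k) (z j))

theorem outDiag_im (hd : d = 2 ∨ d = 3) {κ : ℝ} (hκ : 0 < κ) :
    outDiag d κ = (starRingEnd ℂ) (outDiag d κ) - (1 / (2 * (Real.pi : ℂ)) ^ d) *
      (2 * Real.pi * Complex.I * intDeltaSphere κ fun _ : RV d => 1) := by
  have h3 : (Real.pi : ℂ) ≠ 0 := by simp
  rw [intDeltaSphere_one hd hκ, outDiag]
  rcases hd with rfl | rfl
  · simp [map_ofNat]
    field_simp
    ring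
  · simp [map_ofNat]
    field_simp
    ring

theorem outGreen_neg (κ : ℝ) (x : RV d) : outGreen κ (-x) = outGreen κ x := by
  rw [outGreen, outFun_neg, outGreen]

theorem outGreen_im {κ : ℝ} (hκ : 0 < κ) (x : RV d) :
    outGreen κ x = (starRingEnd ℂ) (outGreen κ x) - (1 / (2 * (Real.pi : ℂ)) ^ d) *
      (2 * Real.pi * Complex.I * intDeltaSphere κ fun ξ => planeWave (toC ξ) x) := by
  have h := outFun_im hκ x
  set J := intDeltaSphere κ fun ξ => planeWave (toC ξ) x
  rw [outGreen, map_mul]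
  nth_rw 1 [h]
  simp only [map_neg, map_div₀, map_one, map_pow, map_mul, Complex.conj_ofReal, map_ofNat]
  ring

theorem exists_unit_orthogonal (hd : 2 ≤ d) {u : RV d} (hu : u ≠ 0) :
    ∃ v : RV d, ‖v‖ = 1 ∧ inner ℝ v u = 0 := by
  have hF := finrank_perp hu
  rw [finrank_euclideanSpace_fin] at hF
  have : Nontrivial (Perp u) := Module.nontrivial_of_finrank_pos (R := ℝ) (by omega)
  obtain ⟨w, hw⟩ := exists_norm_eq (Perp u) zero_le_one
  exact ⟨w, hw, Submodule.mem_orthogonal_singleton_iff_inner_left.1 w.2⟩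

theorem exists_unit_smul (hd : 2 ≤ d) (y : RV d) : ∃ u : RV d, ‖u‖ = 1 ∧ y = ‖y‖ • u := by
  by_cases hy : y = 0
  · have : Nontrivial (RV d) :=
      Module.nontrivial_of_finrank_pos (R := ℝ) (by rw [finrank_euclideanSpace_fin]; omega)
    obtain ⟨u, hu⟩ := exists_norm_eq (RV d) zero_le_one
    exact ⟨u, hu, by simp [hy]⟩
  · refine ⟨‖y‖⁻¹ • y, norm_smul_inv_norm hy, ?_⟩
    rw [smul_smul, mul_inv_cancel₀ (norm_ne_zero_iff.2 hy), one_smul]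

/-- Exponentials with distinct frequencies are linearly independent on any sphere. -/
theorem eq_zero_of_sum_planeWave_eq_zero (hd : 2 ≤ d) {z : Fin n → RV d}
    (hz : Function.Injective z) {κ : ℝ} (hκ : 0 < κ) {a : Fin n → ℂ}
    (h : ∀ ξ : RV d, ‖ξ‖ = κ → ∑ j, a j * planeWave (toC ξ) (z j) = 0) : a = 0 := by
  by_contra ha
  obtain ⟨j, hj⟩ := Function.ne_iff.1 ha
  obtain ⟨i, hi, hmax⟩ := (Finset.univ.filter fun j => a j ≠ 0).exists_max_image
    (fun j => ‖z j‖) ⟨j, by simpa using hj⟩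
  simp only [Finset.mem_filter, Finset.mem_univ, true_and] at hi hmax
  obtain ⟨u, hu1, hu⟩ := exists_unit_smul hd (z i)
  obtain ⟨v, hv1, hvu⟩ := exists_unit_orthogonal hd (norm_ne_zero_iff.1 (by rw [hu1]; simp) : u ≠ 0)
  have hzi : inner ℝ u (z i) = ‖z i‖ := by
    rw [hu, inner_smul_right, real_inner_self_eq_norm_sq, hu1, norm_smul, hu1]; simp
  have hvi : inner ℝ v (z i) = 0 := by rw [hu, inner_smul_right, hvu, mul_zero]
  have hlt : ∀ j, j ≠ i → a j ≠ 0 → inner ℝ u (z j) < ‖z i‖ := fun j hji hj => by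
    have h1 := real_inner_le_norm u (z j)
    rw [hu1, one_mul] at h1
    refine lt_of_le_of_ne (h1.trans (hmax j hj)) fun e => hji (hz ?_)
    have h2 : ‖z j‖ = ‖z i‖ := le_antisymm (hmax j hj) (e ▸ h1)
    have h3 : ‖z j - z i‖ ^ 2 = 0 := by
      rw [norm_sub_sq_real, h2]
      nth_rw 2 [hu]
      rw [inner_smul_right, real_inner_comm, e]
      ring
    exact sub_eq_zero.1 (norm_eq_zero.1 (pow_eq_zero_iff two_ne_zero |>.1 h3))
  let f : ℂ → ℂ := fun φ => ∑ j, a j * Complex.exp (Complex.I * κ *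
    (Complex.cos φ * (inner ℝ v (z j) : ℝ) + Complex.sin φ * (inner ℝ u (z j) : ℝ)))
  have hf : Differentiable ℂ f := by fun_prop
  have hreal : ∀ φ : ℝ, f φ = 0 := fun φ => by
    have hn : ‖κ • (Real.cos φ • v + Real.sin φ • u)‖ = κ := by
      have : ‖Real.cos φ • v + Real.sin φ • u‖ ^ 2 = 1 := by
        rw [norm_add_sq_real, inner_smul_left, inner_smul_right, hvu, norm_smul, norm_smul, hv1,
          hu1, Real.norm_eq_abs, Real.norm_eq_abs, mul_one, mul_one, sq_abs, sq_abs]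
        have := Real.sin_sq_add_cos_sq φ
        simp
      have h1 : ‖Real.cos φ • v + Real.sin φ • u‖ = 1 := by
        rwa [pow_eq_one_iff_of_nonneg (norm_nonneg _) two_ne_zero] at this
      rw [norm_smul, h1, Real.norm_eq_abs, abs_of_pos hκ, mul_one]
    rw [← h _ hn]
    refine Finset.sum_congr rfl fun j _ => ?_
    rw [planeWave_toC, inner_smul_left, inner_add_left, inner_smul_left, inner_smul_left]
    simp only [conj_trivial]
    push_cast
    ring_nf
  have hzero : f = fun _ => 0 := by
    refine AnalyticOnNhd.eq_of_frequently_eq (z₀ := 0) (hf.differentiableOn.analyticOnNhd isOpen_univ)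
      analyticOnNhd_const ?_
    have ht : Tendsto (fun t : ℝ => (t : ℂ)) (𝓝[≠] 0) (𝓝[≠] 0) := by
      refine tendsto_nhdsWithin_iff.2 ⟨?_, ?_⟩
      · exact (Complex.continuous_ofReal.tendsto' 0 0 (by simp)).mono_left nhdsWithin_le_nhds
      · filter_upwards [self_mem_nhdsWithin] with t ht
        simpa using ht
    exact ht.frequently (Frequently.of_forall hreal)
  have hcosh : ∀ y : ℝ, ∑ j, a j * Complex.exp (κ * Real.sinh y * (inner ℝ u (z j) - ‖z i‖ : ℝ) +
      Complex.I * (κ * Real.cosh y * inner ℝ v (z j) : ℝ)) = 0 := fun y => by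
    have h1 : f (-(y * Complex.I)) = 0 := by rw [hzero]
    have h2 : ∀ j, a j * Complex.exp (κ * Real.sinh y * (inner ℝ u (z j) - ‖z i‖ : ℝ) +
        Complex.I * (κ * Real.cosh y * inner ℝ v (z j) : ℝ)) =
        Complex.exp (-(κ * Real.sinh y * ‖z i‖)) * (a j * Complex.exp (Complex.I * κ *
          (Complex.cos (-(y * Complex.I)) * (inner ℝ v (z j) : ℝ) +
            Complex.sin (-(y * Complex.I)) * (inner ℝ u (z j) : ℝ)))) := fun j => by
      rw [mul_left_comm, ← Complex.exp_add]
      congr 2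
      rw [Complex.cos_neg, Complex.sin_neg, Complex.cos_mul_I, Complex.sin_mul_I]
      push_cast
      linear_combination ((κ * Complex.sinh y * (inner ℝ u (z j) : ℝ)) : ℂ) * Complex.I_sq
    simp only [h2]
    rw [← Finset.mul_sum]
    exact mul_eq_zero_of_right _ h1
  have hlim : Tendsto (fun y : ℝ => ∑ j, a j * Complex.exp (κ * Real.sinh y *
      (inner ℝ u (z j) - ‖z i‖ : ℝ) + Complex.I * (κ * Real.cosh y * inner ℝ v (z j) : ℝ)))
      atTop (𝓝 (∑ j, if j = i then a i else 0)) := by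
    refine tendsto_finsetSum _ fun j _ => ?_
    split_ifs with hji
    · subst hji
      simp [hzi, hvi]
    by_cases hj : a j = 0
    · simp [hj]
    rw [← mul_zero (a j)]
    refine Tendsto.const_mul _ (tendsto_zero_iff_norm_tendsto_zero.2 ?_)
    have e : ∀ y : ℝ, ‖Complex.exp (κ * Real.sinh y * (inner ℝ u (z j) - ‖z i‖ : ℝ) +
        Complex.I * (κ * Real.cosh y * inner ℝ v (z j) : ℝ))‖ =
        Real.exp (κ * (inner ℝ u (z j) - ‖z i‖) * Real.sinh y) := fun y => by
      rw [Complex.norm_exp, Complex.add_re, ← Complex.ofReal_mul, ← Complex.ofReal_mul,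
        Complex.ofReal_re, Complex.re_mul_ofReal, Complex.I_re, zero_mul, add_zero]
      ring_nf
    simp only [e]
    refine Real.tendsto_exp_atBot.comp (Tendsto.const_mul_atTop_of_neg ?_ ?_)
    · exact mul_neg_of_pos_of_neg hκ (sub_neg.2 (hlt j hji hj))
    · exact tendsto_atTop_mono' _ ((eventually_ge_atTop 0).mono fun y hy => Real.self_le_sinh_iff.2 hy)
        tendsto_id
  simp only [hcosh, Finset.sum_ite_eq', Finset.mem_univ, if_true] at hlim
  exact hi (tendsto_nhds_unique hlim tendsto_const_nhds)

theorem intDeltaSphere_sum_const_mul {ι : Type*} (s : Finset ι) (κ : ℝ) (c : ι → ℂ)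
    {F : ι → RV d → ℂ} (hF : ∀ i ∈ s, Continuous (F i)) :
    intDeltaSphere κ (fun ξ => ∑ i ∈ s, c i * F i ξ) = ∑ i ∈ s, c i * intDeltaSphere κ (F i) := by
  simp only [intDeltaSphere]
  change _ * ∫ ω : Metric.sphere (0 : RV d) 1, _ ∂(sphereMeasure (RV d)) =
    ∑ i ∈ s, c i * (_ * ∫ ω : Metric.sphere (0 : RV d) 1, _ ∂(sphereMeasure (RV d)))
  rw [integral_finsetSum, Finset.mul_sum]
  · refine Finset.sum_congr rfl fun i _ => ?_
    rw [integral_const_mul]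
    ring
  · intro i hi
    have hc : Continuous fun ω : Metric.sphere (0 : RV d) 1 => F i (κ • (ω : RV d)) :=
      (hF i hi).comp (by fun_prop)
    exact (hc.integrable_of_hasCompactSupport (HasCompactSupport.of_compactSpace _)).const_mul _

theorem eq_zero_of_intDeltaSphere_eq_zero {κ : ℝ} (hκ : 0 < κ) {F : RV d → ℂ} (hF : Continuous F)
    (h : intDeltaSphere κ (fun ξ => (starRingEnd ℂ) (F ξ) * F ξ) = 0) {ξ : RV d} (hξ : ‖ξ‖ = κ) :
    F ξ = 0 := by
  have hc : Continuous fun ω : Metric.sphere (0 : RV d) 1 => ‖F (κ • (ω : RV d))‖ ^ 2 :=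
    ((hF.comp (by fun_prop)).norm).pow 2
  have h1 : ∫ ω : Metric.sphere (0 : RV d) 1, ‖F (κ • (ω : RV d))‖ ^ 2 ∂(sphereMeasure (RV d)) = 0 := by
    have h2 := (mul_eq_zero.1 h).resolve_left (by
      rw [← ne_eq, Complex.ofReal_ne_zero]; positivity)
    have e : ∀ ξ : RV d, (starRingEnd ℂ) (F ξ) * F ξ = ((‖F ξ‖ ^ 2 : ℝ) : ℂ) := fun ξ => by
      rw [mul_comm, Complex.mul_conj, Complex.normSq_eq_norm_sq]
    simp only [e] at h2
    rw [integral_complex_ofReal] at h2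
    exact Complex.ofReal_eq_zero.1 h2
  rw [integral_eq_zero_iff_of_nonneg (fun ω => sq_nonneg _)
    (hc.integrable_of_hasCompactSupport (HasCompactSupport.of_compactSpace _))] at h1
  have h3 := Continuous.ae_eq_iff_eq _ hc continuous_const |>.1 h1
  have h4 := congrFun h3 ⟨κ⁻¹ • ξ, by
    rw [mem_sphere_zero_iff_norm, norm_smul, hξ, Real.norm_eq_abs, abs_of_pos (by positivity),
      inv_mul_cancel₀ hκ.ne']⟩
  simp only [smul_smul, mul_inv_cancel₀ hκ.ne', one_smul] at h4
  exact norm_eq_zero.1 (pow_eq_zero_iff two_ne_zero |>.1 h4)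

theorem conj_planeWave_toC (ξ x : RV d) :
    (starRingEnd ℂ) (planeWave (toC ξ) x) = planeWave (-toC ξ) x := by
  rw [← toC_neg, planeWave_toC, planeWave_toC, ← Complex.exp_conj, inner_neg_left]
  simp

theorem outMat_det_ne_zero (hd : d = 2 ∨ d = 3) {z : Fin n → RV d} (hz : Function.Injective z)
    (α : Fin n → ℝ) {κ : ℝ} (hκ : 0 < κ) : (outMat z α κ).det ≠ 0 := by
  intro hdet
  obtain ⟨v, hv0, hv⟩ := Matrix.exists_mulVec_eq_zero_iff.2 hdet
  refine hv0 ?_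
  let Q : Fin n → Fin n → ℂ := fun m j => if m = j then outDiag d κ else outGreen κ (z m - z j)
  have hrow : ∀ m, v m = α m * ∑ j, Q m j * v j := fun m => by
    have h1 : ∑ j, outMat z α κ m j * v j = 0 := congrFun hv m
    have h2 : ∀ j, outMat z α κ m j * v j = (if m = j then v j else 0) - α m * (Q m j * v j) := by
      intro j
      simp only [outMat, pointMatrix, Matrix.of_apply, Q]
      split_ifs <;> ring
    simp only [h2] at h1
    rw [Finset.sum_sub_distrib, Finset.sum_ite_eq, if_pos (Finset.mem_univ m),
      ← Finset.mul_sum] at h1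
    exact sub_eq_zero.1 h1
  have hQ : ∀ m j, Q m j - (starRingEnd ℂ) (Q j m) = -(1 / (2 * (Real.pi : ℂ)) ^ d) *
      (2 * Real.pi * Complex.I * intDeltaSphere κ fun ξ => planeWave (toC ξ) (z m - z j)) := by
    intro m j
    by_cases hmj : m = j
    · subst hmj
      simp only [Q, if_true, sub_self, planeWave_zero_right]
      nth_rw 1 [outDiag_im hd hκ]
      ring
    · simp only [Q, hmj, Ne.symm hmj, if_false]
      rw [← neg_sub (z m), outGreen_neg]
      nth_rw 1 [outGreen_im hκ]
      ring
  have hsum : ∑ m, ∑ j, (starRingEnd ℂ) (v m) * (Q m j - (starRingEnd ℂ) (Q j m)) * v j = 0 := by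
    have e : ∀ m j, (starRingEnd ℂ) (v m) * (Q m j - (starRingEnd ℂ) (Q j m)) * v j =
      (starRingEnd ℂ) (v m) * (Q m j * v j) -
        (starRingEnd ℂ) (Q j m) * (starRingEnd ℂ) (v m) * v j := fun m j => by ring
    simp only [e, Finset.sum_sub_distrib]
    rw [Finset.sum_comm (f := fun m j => (starRingEnd ℂ) (Q j m) * (starRingEnd ℂ) (v m) * v j),
      ← Finset.sum_sub_distrib]
    refine Finset.sum_eq_zero fun m _ => ?_
    rw [← Finset.mul_sum, ← Finset.sum_mul]
    have h1 : ∑ j, (starRingEnd ℂ) (Q m j) * (starRingEnd ℂ) (v j) =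
        (starRingEnd ℂ) (∑ j, Q m j * v j) := by
      rw [map_sum]; simp only [map_mul]
    rw [h1, hrow m]
    set q := ∑ j, Q m j * v j
    rw [map_mul, Complex.conj_ofReal]
    ring
  have hF : Continuous fun ξ : RV d => ∑ j, v j * planeWave (-toC ξ) (z j) := by
    simp only [← toC_neg]
    exact continuous_finsetSum _ fun j _ =>
      continuous_const.mul ((continuous_planeWave_toC (z j)).comp continuous_neg)
  have hint : intDeltaSphere κ (fun ξ : RV d => (starRingEnd ℂ)
      (∑ j, v j * planeWave (-toC ξ) (z j)) * ∑ j, v j * planeWave (-toC ξ) (z j)) = 0 := by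
    have e : ∀ ξ : RV d, (starRingEnd ℂ) (∑ j, v j * planeWave (-toC ξ) (z j)) *
        ∑ j, v j * planeWave (-toC ξ) (z j) = ∑ p : Fin n × Fin n,
        ((starRingEnd ℂ) (v p.1) * v p.2) * planeWave (toC ξ) (z p.1 - z p.2) := fun ξ => by
      rw [map_sum, Finset.sum_mul_sum, ← Finset.sum_product', Finset.univ_product_univ]
      refine Finset.sum_congr rfl fun p _ => ?_
      rw [map_mul, ← toC_neg, conj_planeWave_toC, toC_neg, neg_neg, planeWave_sub_right]
      ring
    simp only [e]
    rw [intDeltaSphere_sum_const_mul Finset.univ κ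
      (fun p : Fin n × Fin n => (starRingEnd ℂ) (v p.1) * v p.2)
      (F := fun p ξ => planeWave (toC ξ) (z p.1 - z p.2))
      (fun p _ => continuous_planeWave_toC _), ← Finset.univ_product_univ, Finset.sum_product]
    have hpi : (2 * (Real.pi : ℂ)) ^ d ≠ 0 := pow_ne_zero _ (by simp)
    have hpi' : (2 * (Real.pi : ℂ)) * Complex.I ≠ 0 := by simp
    have hc : -(1 / (2 * (Real.pi : ℂ)) ^ d) * (2 * Real.pi * Complex.I) ≠ 0 :=
      mul_ne_zero (neg_ne_zero.2 (one_div_ne_zero hpi)) hpi'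
    refine (mul_eq_zero.1 ?_).resolve_left hc
    rw [← hsum, Finset.mul_sum]
    refine Finset.sum_congr rfl fun m _ => ?_
    rw [Finset.mul_sum]
    refine Finset.sum_congr rfl fun j _ => ?_
    rw [hQ]
    ring
  refine eq_zero_of_sum_planeWave_eq_zero (by omega) hz hκ fun ξ hξ => ?_
  have := eq_zero_of_intDeltaSphere_eq_zero hκ hF hint (ξ := -ξ) (by rwa [norm_neg])
  simpa only [toC_neg, neg_neg] using this

/-- The solution of the symmetric outgoing system with source `α exp (i ξ z)`. -/
def outSol (z : Fin n → RV d) (α : Fin n → ℝ) (κ : ℝ) (ξ : RV d) : Fin n → ℂ :=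
  (outMat z α κ)⁻¹.mulVec fun m => (α m : ℂ) * planeWave (toC ξ) (z m)

theorem continuous_outSol (z : Fin n → RV d) (α : Fin n → ℝ) (κ : ℝ) (m : Fin n) :
    Continuous fun ξ => outSol z α κ ξ m := by
  simp only [outSol, Matrix.mulVec, dotProduct]
  exact continuous_finsetSum _ fun j _ =>
    continuous_const.mul (continuous_const.mul (continuous_planeWave_toC _))

theorem matAPlus_inv_mulVec (hd : d = 2 ∨ d = 3) {z : Fin n → RV d}
    (hz : Function.Injective z) (α : Fin n → ℝ) {k : RV d} (hk : k ≠ 0) (v : Fin n → ℂ) :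
    (matAPlus z α k).det ≠ 0 ∧ (matAPlus z α k)⁻¹.mulVec v = fun m => planeWave (-toC k) (z m) *
      (outMat z α ‖k‖)⁻¹.mulVec (fun j => planeWave (toC k) (z j) * v j) m :=
  inv_mulVec_of_conj (matAPlus_apply hd hz α hk) (fun _ => planeWave_neg_mul _ _)
    (outMat_det_ne_zero hd hz α (norm_pos_iff.2 hk)) v

theorem coeffPlus_eq (hd : d = 2 ∨ d = 3) {z : Fin n → RV d} (hz : Function.Injective z)
    (α : Fin n → ℝ) {k : RV d} (hk : k ≠ 0) (m : Fin n) :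
    coeffPlus z α k m = planeWave (-toC k) (z m) * outSol z α ‖k‖ k m := by
  have h := congrFun (matAPlus_inv_mulVec hd hz α hk fun m => (α m : ℂ)).2 m
  simp only [mul_comm (planeWave (toC k) _)] at h
  exact h

theorem psiPlus_eq (hd : d = 2 ∨ d = 3) {z : Fin n → RV d} (hz : Function.Injective z)
    (α : Fin n → ℝ) {x k : RV d} (hk : k ≠ 0) (hx : ∀ j, x ≠ z j) :
    psiPlus z α x k = planeWave (toC k) x +
      ∑ m, outSol z α ‖k‖ k m * outGreen ‖k‖ (x - z m) := by
  rw [psiPlus, mul_add, mul_one, Finset.mul_sum]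
  congr 1
  refine Finset.sum_congr rfl fun m _ => ?_
  rw [coeffPlus_eq hd hz α hk, ← planeWave_mul_greenPlus hd hk (sub_ne_zero.2 (hx m)),
    planeWave_sub_right]
  ring

/-! ### Integrals over half spheres -/

/-- `∫ θ((ξ - k) γ) δ(ξ² - k²) F(ξ) dξ`. -/
def halfInt (γ k : RV d) (F : RV d → ℂ) : ℂ :=
  intDeltaSphere ‖k‖ fun ξ => heaviside (inner ℝ (ξ - k) γ) * F ξ

theorem halfInt_congr {γ k : RV d} {F G : RV d → ℂ} (h : ∀ ξ, ‖ξ‖ = ‖k‖ → F ξ = G ξ) :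
    halfInt γ k F = halfInt γ k G := by
  rw [halfInt, halfInt, intDeltaSphere, intDeltaSphere]
  congr 2
  ext ω
  rw [h _ (by rw [norm_smul, norm_norm, mem_sphere_zero_iff_norm.1 ω.2, mul_one])]

theorem integrable_heaviside_mul (γ k : RV d) (κ : ℝ) {F : RV d → ℂ} (hF : Continuous F) :
    Integrable (fun ω : Metric.sphere (0 : RV d) 1 =>
      heaviside (inner ℝ (κ • (ω : RV d) - k) γ) * F (κ • (ω : RV d))) (sphereMeasure (RV d)) := by
  have hc : Continuous fun ω : Metric.sphere (0 : RV d) 1 => F (κ • (ω : RV d)) :=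
    hF.comp (by fun_prop)
  refine (hc.integrable_of_hasCompactSupport (HasCompactSupport.of_compactSpace _)).bdd_mul (c := 1)
    (Measurable.aestronglyMeasurable ?_) (Eventually.of_forall fun ω => ?_)
  · unfold heaviside
    exact Measurable.ite (measurableSet_lt measurable_const (by fun_prop)) measurable_const
      measurable_const
  · unfold heaviside
    split_ifs <;> simp

theorem halfInt_add {γ k : RV d} {F G : RV d → ℂ} (hF : Continuous F) (hG : Continuous G) :
    halfInt γ k (fun ξ => F ξ + G ξ) = halfInt γ k F + halfInt γ k G := by
  simp only [halfInt, intDeltaSphere, mul_add]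
  rw [← mul_add]
  congr 1
  exact integral_add (integrable_heaviside_mul γ k _ hF) (integrable_heaviside_mul γ k _ hG)

theorem halfInt_sum_const_mul {ι : Type*} (s : Finset ι) (γ k : RV d) (c : ι → ℂ)
    {F : ι → RV d → ℂ} (hF : ∀ i ∈ s, Continuous (F i)) :
    halfInt γ k (fun ξ => ∑ i ∈ s, c i * F i ξ) = ∑ i ∈ s, c i * halfInt γ k (F i) := by
  simp only [halfInt, intDeltaSphere, Finset.mul_sum]
  change _ * ∫ ω : Metric.sphere (0 : RV d) 1, _ ∂(sphereMeasure (RV d)) =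
    ∑ i ∈ s, c i * (_ * ∫ ω : Metric.sphere (0 : RV d) 1, _ ∂(sphereMeasure (RV d)))
  simp only [mul_left_comm _ (c _)]
  rw [integral_finsetSum, Finset.mul_sum]
  · refine Finset.sum_congr rfl fun i _ => ?_
    rw [integral_const_mul]
    ring
  · exact fun i hi => (integrable_heaviside_mul γ k _ (hF i hi)).const_mul _

theorem greenGamma_eq (hd : d = 2 ∨ d = 3) {γ k x : RV d} (hγ : ‖γ‖ = 1) (hk : k ≠ 0)
    (hkγ : inner ℝ k γ = 0) (hx : x ≠ 0) :
    greenGamma γ x k = greenPlus x k + 2 * (Real.pi : ℂ) * Complex.I *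
      (1 / (2 * (Real.pi : ℂ)) ^ d) * halfInt γ k fun ξ => planeWave (toC (ξ - k)) x :=
  greenGamma_sub_greenPlus hd hγ hk hkγ hx

theorem matAGamma_apply (hd : d = 2 ∨ d = 3) {z : Fin n → RV d} (hz : Function.Injective z)
    (α : Fin n → ℝ) {γ k : RV d} (hγ : ‖γ‖ = 1) (hk : k ≠ 0) (hkγ : inner ℝ k γ = 0)
    (m j : Fin n) :
    matAGamma z α γ k m j = matAPlus z α k m j - α m * (2 * (Real.pi : ℂ) * Complex.I *
      (1 / (2 * (Real.pi : ℂ)) ^ d) *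
        halfInt γ k fun ξ => planeWave (toC (ξ - k)) (z m - z j)) := by
  simp only [matAGamma, matAPlus, pointMatrix, Matrix.of_apply]
  split_ifs with hmj
  · subst hmj
    rw [diagTermGamma_sub hd (norm_ne_zero_iff.1 (by rw [hγ]; exact one_ne_zero)) hk hkγ, halfInt]
    simp only [sub_self, planeWave_zero_right, mul_one]
    ring
  · rw [greenGamma_eq hd hγ hk hkγ (sub_ne_zero.2 fun e => hmj (hz e))]
    ring

theorem continuous_planeWave_sub (k x : RV d) :
    Continuous fun ξ : RV d => planeWave (toC (ξ - k)) x :=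
  (continuous_planeWave_toC x).comp (by fun_prop)

theorem continuous_hGamma (z : Fin n → RV d) (α : Fin n → ℝ) (γ k : RV d) :
    Continuous (hGamma z α γ k) := by
  unfold hGamma
  refine continuous_const.mul (continuous_finsetSum _ fun j _ => continuous_const.mul ?_)
  exact (continuous_planeWave_toC (z j)).comp (by fun_prop)

theorem sum_coeffGamma_halfInt (z : Fin n → RV d) (α : Fin n → ℝ) (γ k x : RV d) :
    ∑ j, coeffGamma z α γ k j * ((1 / (2 * (Real.pi : ℂ)) ^ d) *
      halfInt γ k fun ξ => planeWave (toC (ξ - k)) (x - z j)) =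
      halfInt γ k fun ξ => hGamma z α γ k ξ * planeWave (toC (ξ - k)) x := by
  have h := halfInt_sum_const_mul Finset.univ γ k
    (fun j => coeffGamma z α γ k j * (1 / (2 * (Real.pi : ℂ)) ^ d))
    (F := fun j ξ => planeWave (toC (ξ - k)) (x - z j)) fun j _ => continuous_planeWave_sub k _
  simp only [mul_assoc] at h ⊢
  rw [← h]
  refine halfInt_congr fun ξ _ => ?_
  rw [hGamma, Finset.mul_sum, Finset.sum_mul]
  refine Finset.sum_congr rfl fun j _ => ?_
  rw [planeWave_sub_right, ← toC_neg, neg_sub]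
  ring

theorem coeffGamma_eq (hd : d = 2 ∨ d = 3) {z : Fin n → RV d} (hz : Function.Injective z)
    (α : Fin n → ℝ) {γ k : RV d} (hγ : ‖γ‖ = 1) (hk : k ≠ 0) (hkγ : inner ℝ k γ = 0)
    (hdet : (matAGamma z α γ k).det ≠ 0) (m : Fin n) :
    coeffGamma z α γ k m = planeWave (-toC k) (z m) * (outSol z α ‖k‖ k m +
      2 * (Real.pi : ℂ) * Complex.I * halfInt γ k fun ξ =>
        hGamma z α γ k ξ * outSol z α ‖k‖ ξ m) := by
  set c := coeffGamma z α γ k with hc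
  have h1 : (matAGamma z α γ k).mulVec c = fun m => (α m : ℂ) := by
    have : c = (matAGamma z α γ k)⁻¹.mulVec fun m => (α m : ℂ) := rfl
    rw [this, Matrix.mulVec_mulVec, Matrix.mul_nonsing_inv _ (isUnit_iff_ne_zero.2 hdet),
      Matrix.one_mulVec]
  have h2 : (matAPlus z α k).mulVec c = fun m => (α m : ℂ) * (1 + 2 * (Real.pi : ℂ) * Complex.I *
      halfInt γ k fun ξ => hGamma z α γ k ξ * planeWave (toC (ξ - k)) (z m)) := by
    ext m
    have h3 := congrFun h1 m
    simp only [Matrix.mulVec, dotProduct, matAGamma_apply hd hz α hγ hk hkγ] at h3 ⊢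
    rw [← sum_coeffGamma_halfInt, ← hc]
    simp only [sub_mul, Finset.sum_sub_distrib] at h3
    rw [sub_eq_iff_eq_add] at h3
    rw [h3, mul_add, mul_one, Finset.mul_sum, Finset.mul_sum]
    congr 1
    exact Finset.sum_congr rfl fun j _ => by ring
  have h3 := (matAPlus_inv_mulVec hd hz α hk ((matAPlus z α k).mulVec c)).2
  rw [Matrix.mulVec_mulVec, Matrix.nonsing_inv_mul _
    (isUnit_iff_ne_zero.2 (matAPlus_inv_mulVec hd hz α hk 0).1), Matrix.one_mulVec, h2] at h3
  rw [h3]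
  simp only
  congr 1
  have h4 := halfInt_sum_const_mul Finset.univ γ k
    (fun j => (outMat z α ‖k‖)⁻¹ m j * α j * planeWave (toC k) (z j))
    (F := fun j ξ => hGamma z α γ k ξ * planeWave (toC (ξ - k)) (z j))
    fun j _ => (continuous_hGamma z α γ k).mul (continuous_planeWave_sub k _)
  have h5 : (halfInt γ k fun ξ => hGamma z α γ k ξ * outSol z α ‖k‖ ξ m) =
      halfInt γ k fun ξ => ∑ j, (outMat z α ‖k‖)⁻¹ m j * α j * planeWave (toC k) (z j) *
        (hGamma z α γ k ξ * planeWave (toC (ξ - k)) (z j)) := by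
    refine halfInt_congr fun ξ _ => ?_
    rw [outSol, Matrix.mulVec, dotProduct, Finset.mul_sum]
    refine Finset.sum_congr rfl fun j _ => ?_
    have h6 : planeWave (toC ξ) (z j) = planeWave (toC k) (z j) * planeWave (toC (ξ - k)) (z j) := by
      rw [← planeWave_add, ← toC_add, add_sub_cancel]
    rw [h6]
    ring
  rw [h5, h4, outSol]
  simp only [Matrix.mulVec, dotProduct]
  rw [Finset.mul_sum, ← Finset.sum_add_distrib]
  exact Finset.sum_congr rfl fun j _ => by ring

theorem hGamma_eq (hd : d = 2 ∨ d = 3) {z : Fin n → RV d} (hz : Function.Injective z)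
    (α : Fin n → ℝ) {γ k : RV d} (hγ : ‖γ‖ = 1) (hk : k ≠ 0) (hkγ : inner ℝ k γ = 0)
    (hdet : (matAGamma z α γ k).det ≠ 0) (l : RV d) :
    hGamma z α γ k l = fAmp z α k l + 2 * (Real.pi : ℂ) * Complex.I * intDeltaSphere ‖k‖ fun ξ =>
      hGamma z α γ k ξ * heaviside (inner ℝ (ξ - k) γ) * fAmp z α ξ l := by
  have h1 : (intDeltaSphere ‖k‖ fun ξ =>
      hGamma z α γ k ξ * heaviside (inner ℝ (ξ - k) γ) * fAmp z α ξ l) =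
      halfInt γ k fun ξ => ∑ m, (1 / (2 * (Real.pi : ℂ)) ^ d * planeWave (-toC l) (z m)) *
        (hGamma z α γ k ξ * outSol z α ‖k‖ ξ m) := by
    have e : ∀ ξ, hGamma z α γ k ξ * heaviside (inner ℝ (ξ - k) γ) * fAmp z α ξ l =
      heaviside (inner ℝ (ξ - k) γ) * (hGamma z α γ k ξ * fAmp z α ξ l) := fun ξ => by ring
    simp only [e]
    refine halfInt_congr fun ξ hξ => ?_
    have hξ0 : ξ ≠ 0 := norm_ne_zero_iff.1 (by rw [hξ]; exact norm_ne_zero_iff.2 hk)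
    rw [fAmp, Finset.mul_sum, Finset.mul_sum]
    refine Finset.sum_congr rfl fun m _ => ?_
    rw [coeffPlus_eq hd hz α hξ0, hξ, sub_eq_add_neg, toC_add, planeWave_add, toC_neg]
    linear_combination (hGamma z α γ k ξ * (1 / (2 * (Real.pi : ℂ)) ^ d) * outSol z α ‖k‖ ξ m *
      planeWave (-toC l) (z m)) * planeWave_neg_mul (toC ξ) (z m)
  rw [h1, halfInt_sum_const_mul Finset.univ γ k _ (F := fun m ξ => hGamma z α γ k ξ *
    outSol z α ‖k‖ ξ m) fun m _ => (continuous_hGamma z α γ k).mul (continuous_outSol z α _ m)]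
  conv_lhs => rw [hGamma]
  rw [fAmp, Finset.mul_sum, Finset.mul_sum, Finset.mul_sum, ← Finset.sum_add_distrib]
  refine Finset.sum_congr rfl fun m _ => ?_
  rw [coeffGamma_eq hd hz α hγ hk hkγ hdet, coeffPlus_eq hd hz α hk, sub_eq_add_neg, toC_add,
    planeWave_add, toC_neg]
  set J := halfInt γ k fun ξ => hGamma z α γ k ξ * outSol z α ‖k‖ ξ m
  linear_combination (1 / (2 * (Real.pi : ℂ)) ^ d * (2 * (Real.pi : ℂ) * Complex.I * J) *
    planeWave (-toC l) (z m)) * planeWave_neg_mul (toC k) (z m)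

theorem psiGamma_eq (hd : d = 2 ∨ d = 3) {z : Fin n → RV d} (hz : Function.Injective z)
    (α : Fin n → ℝ) {γ k : RV d} (hγ : ‖γ‖ = 1) (hk : k ≠ 0) (hkγ : inner ℝ k γ = 0)
    (hdet : (matAGamma z α γ k).det ≠ 0) {x : RV d} (hx : ∀ j, x ≠ z j) :
    psiGamma z α γ x k = psiPlus z α x k +
      2 * (Real.pi : ℂ) * Complex.I * intDeltaSphere ‖k‖ fun ξ =>
        hGamma z α γ k ξ * heaviside (inner ℝ (ξ - k) γ) * psiPlus z α x ξ := by
  have hFm : ∀ m ∈ (Finset.univ : Finset (Fin n)), Continuous fun ξ =>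
      hGamma z α γ k ξ * outSol z α ‖k‖ ξ m := fun m _ =>
    (continuous_hGamma z α γ k).mul (continuous_outSol z α _ m)
  have hF0 : ∀ j ∈ ({()} : Finset Unit), Continuous fun ξ =>
      hGamma z α γ k ξ * planeWave (toC (ξ - k)) x := fun _ _ =>
    (continuous_hGamma z α γ k).mul (continuous_planeWave_sub k x)
  have h1 : (intDeltaSphere ‖k‖ fun ξ =>
      hGamma z α γ k ξ * heaviside (inner ℝ (ξ - k) γ) * psiPlus z α x ξ) =
      halfInt γ k fun ξ => (∑ _j ∈ ({()} : Finset Unit), planeWave (toC k) x *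
        (hGamma z α γ k ξ * planeWave (toC (ξ - k)) x)) +
        ∑ m, outGreen ‖k‖ (x - z m) * (hGamma z α γ k ξ * outSol z α ‖k‖ ξ m) := by
    have e : ∀ ξ, hGamma z α γ k ξ * heaviside (inner ℝ (ξ - k) γ) * psiPlus z α x ξ =
      heaviside (inner ℝ (ξ - k) γ) * (hGamma z α γ k ξ * psiPlus z α x ξ) := fun ξ => by ring
    simp only [e]
    refine halfInt_congr fun ξ hξ => ?_
    have hξ0 : ξ ≠ 0 := norm_ne_zero_iff.1 (by rw [hξ]; exact norm_ne_zero_iff.2 hk)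
    have h6 : planeWave (toC ξ) x = planeWave (toC k) x * planeWave (toC (ξ - k)) x := by
      rw [← planeWave_add, ← toC_add, add_sub_cancel]
    rw [psiPlus_eq hd hz α hξ0 hx, hξ, mul_add, Finset.mul_sum, h6, Finset.sum_singleton]
    congr 1
    · ring
    · exact Finset.sum_congr rfl fun m _ => by ring
  have hC0 : Continuous fun ξ => ∑ _j ∈ ({()} : Finset Unit), planeWave (toC k) x *
      (hGamma z α γ k ξ * planeWave (toC (ξ - k)) x) :=
    continuous_finsetSum _ fun j hj => continuous_const.mul (hF0 j hj)
  have hCm : Continuous fun ξ => ∑ m, outGreen ‖k‖ (x - z m) *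
      (hGamma z α γ k ξ * outSol z α ‖k‖ ξ m) :=
    continuous_finsetSum _ fun m hm => continuous_const.mul (hFm m hm)
  rw [h1, halfInt_add hC0 hCm, halfInt_sum_const_mul _ γ k (fun _ => planeWave (toC k) x) hF0,
    halfInt_sum_const_mul _ γ k (fun m => outGreen ‖k‖ (x - z m)) hFm, Finset.sum_singleton,
    psiPlus_eq hd hz α hk hx, ← sum_coeffGamma_halfInt, psiGamma, mul_add, mul_one, add_assoc,
    Finset.mul_sum, Finset.mul_sum, mul_add, Finset.mul_sum, Finset.mul_sum, add_left_comm,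
    ← Finset.sum_add_distrib, add_left_comm (∑ m, _), ← Finset.sum_add_distrib]
  congr 1
  refine Finset.sum_congr rfl fun m _ => ?_
  have hxm := sub_ne_zero.2 (hx m)
  rw [greenGamma_eq hd hγ hk hkγ hxm, ← planeWave_mul_greenPlus hd hk hxm, planeWave_sub_right,
    coeffGamma_eq hd hz α hγ hk hkγ hdet]
  ring

theorem reV_ofReal_smul (c : ℝ) (k : CV d) : reV ((c : ℂ) • k) = c • reV k := by
  ext j; simp [reV]

theorem imV_ofReal_smul (c : ℝ) (k : CV d) : imV ((c : ℂ) • k) = c • imV k := by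
  ext j; simp [imV]

theorem regInt_scale {ρ : ℝ} (hρ : 0 < ρ) (x : RV d) (k : CV d) :
    regInt (ρ ^ 2)⁻¹ x k =
      ((ρ ^ d / ρ ^ 2 : ℝ) : ℂ) * regInt 1 (ρ • x) (((ρ⁻¹ : ℝ) : ℂ) • k) := by
  have h := Measure.integral_comp_smul (volume : Measure (RV d)) (fun ξ => planeWave (toC ξ) x *
    (Complex.exp (-((ρ ^ 2)⁻¹ : ℝ) * symb k ξ) * (symb k ξ)⁻¹)) ρ
  rw [finrank_euclideanSpace_fin, abs_of_pos (by positivity), Complex.real_smul] at h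
  have hρ' : (ρ : ℂ) ≠ 0 := by exact_mod_cast hρ.ne'
  have h2 : regInt (ρ ^ 2)⁻¹ x k = ((ρ ^ d : ℝ) : ℂ) * ∫ η : RV d, planeWave (toC (ρ • η)) x *
      (Complex.exp (-((ρ ^ 2)⁻¹ : ℝ) * symb k (ρ • η)) * (symb k (ρ • η))⁻¹) := by
    rw [h, ← mul_assoc, ← Complex.ofReal_mul, mul_inv_cancel₀ (by positivity), Complex.ofReal_one,
      one_mul]
    rfl
  rw [h2, regInt, ← integral_const_mul, ← integral_const_mul]
  refine integral_congr_ae (Eventually.of_forall fun η => ?_)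
  simp only
  have e1 : symb k (ρ • η) = (ρ : ℂ) ^ 2 * symb (((ρ⁻¹ : ℝ) : ℂ) • k) η := by
    rw [symb, symb, toC_smul, cdot_smul_right, cdot_smul_left, norm_smul, Real.norm_eq_abs,
      abs_of_pos hρ]
    push_cast
    field_simp
  have e2 : planeWave (toC (ρ • η)) x = planeWave (toC η) (ρ • x) := by
    rw [planeWave_toC, planeWave_toC, inner_smul_left, inner_smul_right]
    rfl
  rw [e1, e2]
  have e3 : -(((ρ ^ 2)⁻¹ : ℝ) : ℂ) * ((ρ : ℂ) ^ 2 * symb (((ρ⁻¹ : ℝ) : ℂ) • k) η) =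
      -((1 : ℝ) : ℂ) * symb (((ρ⁻¹ : ℝ) : ℂ) • k) η := by
    push_cast
    field_simp
  rw [e3, mul_inv]
  push_cast
  ring

/-- The Riemann–Lebesgue lemma, uniformly in a parameter of the symbol. -/
theorem tendsto_normInt_cocompact (hd : 2 ≤ d) {n : RV d} (hn : n ≠ 0) :
    Tendsto (fun p : RV d × ℝ => normInt 0 n (p.1, 1, p.2)) (cocompact (RV d) ×ˢ 𝓝 2) (𝓝 0) := by
  obtain ⟨r, hr, bound, hbI, hb⟩ := normIntD_bound hd hn (q₀ := (1, 2)) one_pos two_ne_zero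
  have hae := ae_normSymb_ne_zero hn (q := (1, 2)) two_ne_zero
  have hmeas : ∀ (y : RV d) (B : ℝ), AEStronglyMeasurable (fun η : RV d =>
      planeWave (toC η) y * regExp 0 (normSymb n η (1, B))) volume := fun y B =>
    ((continuous_planeWave_toC y).measurable.mul ((measurable_regExp 0).comp
      ((continuous_normSymb n).clm_apply continuous_const).measurable)).aestronglyMeasurable
  have hmem : ∀ᶠ B in 𝓝 (2 : ℝ), ((1, B) : ℝ × ℝ) ∈ Metric.ball ((1, 2) : ℝ × ℝ) r :=
    (Continuous.prodMk_right (1 : ℝ)).continuousAt.eventually_mem (Metric.ball_mem_nhds _ hr)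
  have hint : ∀ (y : RV d) (B : ℝ), ((1, B) : ℝ × ℝ) ∈ Metric.ball ((1, 2) : ℝ × ℝ) r →
      Integrable fun η : RV d => planeWave (toC η) y * regExp 0 (normSymb n η (1, B)) :=
    fun y B hB => hbI.mono' (hmeas y B) (hae.mono fun η hη => (hb 0 le_rfl y _ hB η hη).2.2)
  have hregm : ∀ B : ℝ, AEStronglyMeasurable (fun η : RV d => regExp 0 (normSymb n η (1, B)))
      volume := fun B => ((measurable_regExp 0).comp
      ((continuous_normSymb n).clm_apply continuous_const).measurable).aestronglyMeasurable
  have hregb : ∀ B : ℝ, ((1, B) : ℝ × ℝ) ∈ Metric.ball ((1, 2) : ℝ × ℝ) r → ∀ η : RV d,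
      normSymb n η (1, 2) ≠ 0 → ‖regExp 0 (normSymb n η (1, B))‖ ≤ bound η := fun B hB η hη => by
    have := (hb 0 le_rfl 0 _ hB η hη).2.2
    rwa [norm_mul, norm_planeWave_toC, one_mul] at this
  -- the dependence on the symbol
  have hD : Tendsto (fun B : ℝ => ∫ η : RV d, ‖regExp 0 (normSymb n η (1, B)) -
      regExp 0 (normSymb n η (1, 2))‖) (𝓝 2) (𝓝 0) := by
    rw [show 𝓝 (0 : ℝ) = 𝓝 (∫ _η : RV d, (0 : ℝ)) by rw [integral_zero]]
    refine tendsto_integral_filter_of_dominated_convergence (fun η => bound η + bound η)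
      (Eventually.of_forall fun B => ((hregm B).sub (hregm 2)).norm) ?_ (hbI.add hbI) ?_
    · filter_upwards [hmem] with B hB
      filter_upwards [hae] with η hη
      rw [norm_norm]
      exact (norm_sub_le _ _).trans (add_le_add (hregb B hB η hη)
        (hregb 2 (Metric.mem_ball_self hr) η hη))
    · filter_upwards [hae] with η hη
      have hc : ContinuousAt (fun B : ℝ => regExp 0 (normSymb n η (1, B))) 2 := by
        refine ContinuousAt.comp (g := regExp 0) (f := fun B : ℝ => normSymb n η (1, B))
          (hasFDerivAt_regExp ?_).continuousAt
          ((normSymb n η).continuous.comp (Continuous.prodMk_right (1 : ℝ))).continuousAt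
        simpa using hη
      have := (hc.tendsto.sub_const (regExp 0 (normSymb n η (1, 2)))).norm
      rwa [sub_self, norm_zero] at this
  have hRL : Tendsto (fun y : RV d => normInt 0 n (y, 1, 2)) (cocompact (RV d)) (𝓝 0) := by
    have h1 := tendsto_integral_exp_inner_smul_cocompact
      (fun η : RV d => regExp 0 (normSymb n η (1, 2)))
    have hc : (-(2 * Real.pi)⁻¹ : ℝ) ≠ 0 := neg_ne_zero.2 (by positivity)
    have h2 := h1.comp (Homeomorph.smulOfNeZero (α := RV d) _ hc).isClosedEmbedding.tendsto_cocompact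
    refine h2.congr fun y => ?_
    simp only [Function.comp, Homeomorph.smulOfNeZero_apply]
    refine integral_congr_ae (Eventually.of_forall fun η => ?_)
    simp only
    rw [Circle.smul_def, Real.fourierChar_apply, planeWave_toC, smul_eq_mul, inner_smul_right]
    congr 3
    push_cast
    field_simp
  have hsum : Tendsto (fun p : RV d × ℝ => (∫ η : RV d, ‖regExp 0 (normSymb n η (1, p.2)) -
      regExp 0 (normSymb n η (1, 2))‖) + ‖normInt 0 n (p.1, 1, 2)‖)
      (cocompact (RV d) ×ˢ 𝓝 2) (𝓝 0) := by
    have := (hD.comp tendsto_snd).add (hRL.norm.comp (tendsto_fst (g := 𝓝 (2 : ℝ))))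
    simpa using this
  refine squeeze_zero_norm' ?_ hsum
  filter_upwards [tendsto_snd.eventually hmem] with p hp
  have h2 := hint p.1 2 (Metric.mem_ball_self hr)
  have e : normInt 0 n (p.1, 1, p.2) = (normInt 0 n (p.1, 1, p.2) - normInt 0 n (p.1, 1, 2)) +
      normInt 0 n (p.1, 1, 2) := by ring
  rw [e]
  refine (norm_add_le _ _).trans (add_le_add_left ?_ _)
  rw [normInt, normInt, ← integral_sub (hint p.1 p.2 hp) h2]
  refine (norm_integral_le_integral_norm _).trans (le_of_eq (integral_congr_ae
    (Eventually.of_forall fun η => ?_)))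
  simp only
  rw [← mul_sub, norm_mul, norm_planeWave_toC, one_mul]

/-- The filter of momenta of energy `E` with large imaginary part. -/
def largeIm (d : ℕ) (E : ℝ) : Filter (CV d) :=
  comap (fun k : CV d => ‖imV k‖) atTop ⊓ 𝓟 (SigmaE d E)

theorem largeIm_mem (E : ℝ) : ∀ᶠ k in largeIm d E, k ∈ SigmaE d E :=
  mem_inf_of_right (mem_principal_self _)

theorem tendsto_norm_imV (E : ℝ) : Tendsto (fun k : CV d => ‖imV k‖) (largeIm d E) atTop :=
  tendsto_comap.mono_left inf_le_left

theorem tendsto_norm_reV (E : ℝ) : Tendsto (fun k : CV d => ‖reV k‖) (largeIm d E) atTop := by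
  have h : Tendsto (fun β : ℝ => Real.sqrt (β ^ 2 + E)) atTop atTop :=
    Real.tendsto_sqrt_atTop.comp (tendsto_atTop_add_const_right _ _
      (tendsto_pow_atTop two_ne_zero))
  refine (h.comp (tendsto_norm_imV E)).congr' ?_
  filter_upwards [largeIm_mem E] with k hk
  have := norm_sq_of_mem_SigmaE hk
  rw [Function.comp, ← this, add_sub_cancel, Real.sqrt_sq (norm_nonneg _)]

theorem tendsto_imV_div_reV (E : ℝ) :
    Tendsto (fun k : CV d => ‖imV k‖ / ‖reV k‖) (largeIm d E) (𝓝 1) := by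
  have h1 : Tendsto (fun ρ : ℝ => Real.sqrt (1 - E / ρ ^ 2)) atTop (𝓝 1) := by
    have h2 : Tendsto (fun ρ : ℝ => 1 - E / ρ ^ 2) atTop (𝓝 (1 - 0)) :=
      (tendsto_const_nhds.div_atTop (tendsto_pow_atTop two_ne_zero)).const_sub 1
    have := (Real.continuous_sqrt.tendsto _).comp h2
    rwa [sub_zero, Real.sqrt_one] at this
  refine (h1.comp (tendsto_norm_reV E)).congr' ?_
  filter_upwards [largeIm_mem E, (tendsto_norm_reV E).eventually_gt_atTop 0] with k hk hρ
  have := norm_sq_of_mem_SigmaE hk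
  have e : 1 - E / ‖reV k‖ ^ 2 = (‖imV k‖ / ‖reV k‖) ^ 2 := by
    rw [← this]
    field_simp
    ring
  rw [Function.comp, e, Real.sqrt_sq (by positivity)]

theorem norm_reflAt (n₀ b x : RV d) : ‖reflAt n₀ b x‖ = ‖x‖ := by
  rw [reflAt_eq, LinearIsometryEquiv.norm_map]

theorem tendsto_normInt_normParam (hd : 2 ≤ d) (E : ℝ) {n₀ x : RV d} (hn : n₀ ≠ 0) (hx : x ≠ 0) :
    Tendsto (fun k : CV d => normInt 0 n₀ (normParam n₀ (‖reV k‖ • x)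
      (((‖reV k‖⁻¹ : ℝ) : ℂ) • k))) (largeIm d E) (𝓝 0) := by
  have h1 : Tendsto (fun k : CV d => reflAt n₀ (imV (((‖reV k‖⁻¹ : ℝ) : ℂ) • k)) (‖reV k‖ • x))
      (largeIm d E) (cocompact (RV d)) := by
    rw [← Metric.cobounded_eq_cocompact, ← tendsto_norm_atTop_iff_cobounded]
    simp only [norm_reflAt, norm_smul, norm_norm]
    exact (tendsto_norm_reV E).atTop_mul_const (norm_pos_iff.2 hx)
  have h2 : Tendsto (fun k : CV d => 2 * (‖imV k‖ / ‖reV k‖)) (largeIm d E) (𝓝 2) := by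
    have := (tendsto_imV_div_reV (d := d) E).const_mul 2
    rwa [mul_one] at this
  refine ((tendsto_normInt_cocompact hd hn).comp (h1.prodMk h2)).congr' ?_
  filter_upwards [(tendsto_norm_reV E).eventually_gt_atTop 0] with k hρ
  have h3 : ‖reV (((‖reV k‖⁻¹ : ℝ) : ℂ) • k)‖ = 1 := by
    rw [reV_ofReal_smul, norm_smul, norm_inv, norm_norm, inv_mul_cancel₀ hρ.ne']
  have h4 : ‖imV (((‖reV k‖⁻¹ : ℝ) : ℂ) • k)‖ = ‖imV k‖ / ‖reV k‖ := by
    rw [imV_ofReal_smul, norm_smul, norm_inv, norm_norm, inv_mul_eq_div]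
  rw [Function.comp, normParam, h3, h4]
  simp

theorem norm_regInt_le (hd : 2 ≤ d) {E : ℝ} {k : CV d} (hk : k ∈ SigmaE d E) (ha : reV k ≠ 0)
    (hb : imV k ≠ 0) (x : RV d) {e : RV d} (he : ‖e‖ = 1) :
    ‖regInt (‖reV k‖ ^ 2)⁻¹ x k‖ ≤ ‖reV k‖ ^ (d - 2) *
      (‖normInt 0 e (normParam e (‖reV k‖ • x) (((‖reV k‖⁻¹ : ℝ) : ℂ) • k))‖ +
        ‖normInt 0 (-e) (normParam (-e) (‖reV k‖ • x) (((‖reV k‖⁻¹ : ℝ) : ℂ) • k))‖) := by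
  have hρ : 0 < ‖reV k‖ := norm_pos_iff.2 ha
  set k' : CV d := ((‖reV k‖⁻¹ : ℝ) : ℂ) • k with hk'
  have h3 : ‖reV k'‖ = 1 := by
    rw [hk', reV_ofReal_smul, norm_smul, norm_inv, norm_norm, inv_mul_cancel₀ hρ.ne']
  have hb' : imV k' ≠ 0 := by
    rw [hk', imV_ofReal_smul]
    exact smul_ne_zero (inv_ne_zero hρ.ne') hb
  have hort : inner ℝ (reV k') (imV k') = 0 := by
    rw [hk', reV_ofReal_smul, imV_ofReal_smul, inner_smul_left, inner_smul_right,
      inner_of_mem_SigmaE hk, mul_zero, mul_zero]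
  have ha' : reV k' ≠ 0 := norm_ne_zero_iff.1 (by rw [h3]; exact one_ne_zero)
  have key : ∀ n₀ : RV d, ‖n₀‖ = 1 → n₀ + ‖imV k'‖⁻¹ • imV k' ≠ 0 →
      ‖regInt 1 (‖reV k‖ • x) k'‖ = ‖normInt 0 n₀ (normParam n₀ (‖reV k‖ • x) k')‖ := by
    intro n₀ hn₀ hm
    rw [← smoothInt_zero, smoothInt_eq_normInt 0 _ hort ha' hb' hn₀ hm, h3, norm_mul, norm_mul,
      norm_planeWave_toC, one_pow, Complex.ofReal_one, norm_one, one_mul, one_mul]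
  rw [regInt_scale hρ, norm_mul, Complex.norm_real, Real.norm_of_nonneg (by positivity),
    div_eq_mul_inv, ← pow_sub₀ _ hρ.ne' hd]
  gcongr
  by_cases hm : e + ‖imV k'‖⁻¹ • imV k' = 0
  · rw [key (-e) (by rwa [norm_neg]) fun hm' => ?_]
    · exact le_add_of_nonneg_left (norm_nonneg _)
    · have : (2 : ℝ) • e = 0 := by
        have := sub_eq_zero.2 (hm.trans hm'.symm)
        rw [add_sub_add_right_eq_sub, sub_neg_eq_add] at this
        rwa [two_smul]
      rw [(smul_eq_zero.1 this).resolve_left two_ne_zero, norm_zero] at he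
      exact zero_ne_one he
  · rw [key e he hm]
    exact le_add_of_nonneg_right (norm_nonneg _)

theorem norm_planeWave_neg (k : CV d) (x : RV d) :
    ‖planeWave (-k) x‖ = Real.exp (inner ℝ (imV k) x) := by
  rw [planeWave_neg, planeWave, cdot_toC, Complex.norm_exp]
  simp

theorem tendsto_planeWave_mul_heatTail (hd : d = 2 ∨ d = 3) (E : ℝ) {x : RV d} (hx : x ≠ 0) :
    Tendsto (fun k : CV d => planeWave (-k) x *
      heatTail d (‖reV k‖ ^ 2)⁻¹ (cdot k k) ‖x‖) (largeIm d E) (𝓝 0) := by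
  have hr : 0 < ‖x‖ := norm_pos_iff.2 hx
  obtain ⟨C, hC, hbound⟩ := norm_heatFun_le (d := d) (by omega) hr
  have hlim : Tendsto (fun ρ : ℝ => C * Real.exp |E| *
      Real.exp ((2 * ‖x‖ - ‖x‖ ^ 2 / 8 * ρ) * ρ)) atTop (𝓝 0) := by
    have h1 : Tendsto (fun ρ : ℝ => 2 * ‖x‖ - ‖x‖ ^ 2 / 8 * ρ) atTop atBot := by
      simp only [sub_eq_add_neg]
      exact tendsto_atBot_add_const_left _ _ (tendsto_neg_atTop_atBot.comp
        (tendsto_id.const_mul_atTop (by positivity)))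
    have := (Real.tendsto_exp_atBot.comp (h1.atBot_mul_atTop₀ tendsto_id)).const_mul
      (C * Real.exp |E|)
    rwa [mul_zero] at this
  refine squeeze_zero_norm' ?_ (hlim.comp (tendsto_norm_reV E))
  filter_upwards [largeIm_mem E, (tendsto_norm_reV E).eventually_ge_atTop 1,
    (tendsto_imV_div_reV E).eventually_lt_const one_lt_two] with k hk hρ hβ
  have hρ0 : 0 < ‖reV k‖ := by linarith
  rw [div_lt_iff₀ hρ0] at hβ
  have hE : cdot k k = (E : ℂ) := hk
  have hT : 0 < (‖reV k‖ ^ 2)⁻¹ := by positivity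
  have hT1 : (‖reV k‖ ^ 2)⁻¹ ≤ 1 := inv_le_one_of_one_le₀ (one_le_pow₀ hρ)
  have h1 : ‖heatTail d (‖reV k‖ ^ 2)⁻¹ (cdot k k) ‖x‖‖ ≤
      (C * Real.exp |E| * Real.exp (-(‖x‖ ^ 2 / 8 * ‖reV k‖ ^ 2))) * |(‖reV k‖ ^ 2)⁻¹ - 0| := by
    refine intervalIntegral.norm_integral_le_of_norm_le_const fun ε hε => ?_
    rw [Set.uIoc_of_le hT.le] at hε
    obtain ⟨hε0, hε1⟩ := hε
    refine (hbound _ ε hε0).trans ?_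
    rw [hE, Complex.ofReal_re]
    gcongr
    · calc ε * E ≤ ε * |E| := by gcongr; exact le_abs_self E
        _ ≤ 1 * |E| := by gcongr; exact hε1.trans hT1
        _ = |E| := one_mul _
    · rw [le_div_iff₀ (by positivity)]
      have : ‖reV k‖ ^ 2 * ε ≤ 1 := by
        have := mul_le_mul_of_nonneg_left hε1 (sq_nonneg ‖reV k‖)
        rwa [mul_inv_cancel₀ (by positivity)] at this
      nlinarith [sq_nonneg ‖x‖]
  rw [sub_zero, abs_of_pos hT] at h1
  have h2 : ‖planeWave (-k) x‖ ≤ Real.exp (2 * ‖x‖ * ‖reV k‖) := by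
    rw [norm_planeWave_neg]
    gcongr
    refine (real_inner_le_norm _ _).trans ?_
    nlinarith
  rw [norm_mul, Function.comp]
  calc _ ≤ Real.exp (2 * ‖x‖ * ‖reV k‖) *
        (C * Real.exp |E| * Real.exp (-(‖x‖ ^ 2 / 8 * ‖reV k‖ ^ 2)) * 1) := by
        gcongr
        exact h1.trans (by gcongr)
    _ = _ := by
        rw [mul_one, mul_left_comm, ← Real.exp_add]
        ring_nf

theorem tendsto_green_div (hd : d = 2 ∨ d = 3) (E : ℝ) {x : RV d} (hx : x ≠ 0) :
    Tendsto (fun k : CV d => green x k * (((‖reV k‖ ^ (d - 2))⁻¹ : ℝ) : ℂ))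
      (largeIm d E) (𝓝 0) := by
  have hd2 : 2 ≤ d := by omega
  obtain ⟨e, he, -⟩ := exists_unit_smul hd2 x
  have he0 : e ≠ 0 := norm_ne_zero_iff.1 (by rw [he]; exact one_ne_zero)
  have h := (((tendsto_normInt_normParam hd2 E he0 hx).norm.add
    (tendsto_normInt_normParam hd2 E (neg_ne_zero.2 he0) hx).norm).add
    (tendsto_planeWave_mul_heatTail hd E hx).norm).const_mul ‖(1 / (2 * (Real.pi : ℂ)) ^ d)‖
  simp only [norm_zero, add_zero, mul_zero] at h
  refine squeeze_zero_norm' ?_ h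
  filter_upwards [largeIm_mem E, (tendsto_norm_reV E).eventually_ge_atTop 1,
    (tendsto_norm_imV E).eventually_gt_atTop 0] with k hk hρ hβ
  have hρ0 : 0 < ‖reV k‖ := by linarith
  have h1 := norm_regInt_le hd2 hk (norm_pos_iff.1 hρ0) (norm_pos_iff.1 hβ) x he
  have h2 : 1 ≤ ‖reV k‖ ^ (d - 2) := one_le_pow₀ hρ
  rw [green_eq hd (norm_pos_iff.1 hβ) hx (T := (‖reV k‖ ^ 2)⁻¹) (by positivity), norm_mul,
    Complex.norm_real, Real.norm_of_nonneg (by positivity), norm_mul, norm_neg, mul_assoc]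
  gcongr
  rw [← div_eq_mul_inv, div_le_iff₀ (by positivity)]
  refine (norm_add_le _ _).trans ?_
  rw [add_mul, mul_comm (_ + _) (‖reV k‖ ^ (d - 2))]
  exact add_le_add h1 (le_mul_of_one_le_right (norm_nonneg _) h2)

theorem tendsto_inv_diagTerm (hd : d = 2 ∨ d = 3) (E : ℝ) :
    Tendsto (fun k : CV d => (diagTerm k)⁻¹) (largeIm d E) (𝓝 0) ∧
      (∀ᶠ k : CV d in largeIm d E, diagTerm k ≠ 0) ∧
      ∃ c : ℂ, Tendsto (fun k : CV d => ((‖reV k‖ ^ (d - 2) : ℝ) : ℂ) * (diagTerm k)⁻¹)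
        (largeIm d E) (𝓝 c) := by
  have hρ := tendsto_norm_reV (d := d) E
  have hβ := tendsto_norm_imV (d := d) E
  have main : ∀ u : CV d → ℝ, Tendsto u (largeIm d E) atTop → (∀ k : CV d, diagTerm k = (u k : ℂ)) →
      Tendsto (fun k : CV d => (diagTerm k)⁻¹) (largeIm d E) (𝓝 0) ∧
      ∀ᶠ k : CV d in largeIm d E, diagTerm k ≠ 0 := fun u hu he => by
    simp only [he, ← Complex.ofReal_inv]
    refine ⟨?_, (hu.eventually_gt_atTop 0).mono fun k hk => by exact_mod_cast hk.ne'⟩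
    exact (Complex.continuous_ofReal.tendsto' 0 0 (by simp)).comp hu.inv_tendsto_atTop
  rcases hd with rfl | rfl
  · obtain ⟨h1, h2⟩ := main (fun k => Real.log (‖reV k‖ + ‖imV k‖) / (2 * Real.pi))
      ((Real.tendsto_log_atTop.comp (hρ.atTop_add_atTop hβ)).atTop_div_const (by positivity))
      fun k => by simp [diagTerm]
    exact ⟨h1, h2, 0, by simpa using h1⟩
  · obtain ⟨h1, h2⟩ := main (fun k => ‖imV k‖ / (4 * Real.pi)) (hβ.atTop_div_const (by positivity))
      fun k => by simp [diagTerm]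
    refine ⟨h1, h2, ((1⁻¹ * (4 * Real.pi) : ℝ) : ℂ), ?_⟩
    refine ((Complex.continuous_ofReal.tendsto _).comp
      (((tendsto_imV_div_reV E).inv₀ one_ne_zero).mul_const (4 * Real.pi))).congr fun k => ?_
    simp [diagTerm]
    ring

theorem tendsto_green_mul_inv_diagTerm (hd : d = 2 ∨ d = 3) (E : ℝ) {x : RV d} (hx : x ≠ 0) :
    Tendsto (fun k : CV d => (diagTerm k)⁻¹ * green x k) (largeIm d E) (𝓝 0) := by
  obtain ⟨-, -, c, hc⟩ := tendsto_inv_diagTerm hd E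
  have h := (tendsto_green_div hd E hx).mul hc
  rw [zero_mul] at h
  refine h.congr' ?_
  filter_upwards [(tendsto_norm_reV E).eventually_gt_atTop 0] with k hk
  have : (((‖reV k‖ ^ (d - 2))⁻¹ : ℝ) : ℂ) * ((‖reV k‖ ^ (d - 2) : ℝ) : ℂ) = 1 := by
    rw [← Complex.ofReal_mul, inv_mul_cancel₀ (by positivity), Complex.ofReal_one]
  linear_combination (green x k * (diagTerm k)⁻¹) * this

theorem matA_det_ne_zero_and_tendsto_mu (hd : d = 2 ∨ d = 3) {z : Fin n → RV d}
    (hz : Function.Injective z) (α : Fin n → ℝ) (E : ℝ) :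
    (∀ᶠ k in largeIm d E, (matA z α k).det ≠ 0) ∧
      ∀ x : RV d, (∀ j, x ≠ z j) → Tendsto (mu z α x) (largeIm d E) (𝓝 1) := by
  obtain ⟨ht, hne, -⟩ := tendsto_inv_diagTerm (d := d) hd E
  let r : CV d → Fin n → ℂ := fun k m => if α m = 0 then 1 else (diagTerm k)⁻¹
  let B : CV d → Matrix (Fin n) (Fin n) ℂ := fun k => Matrix.diagonal (r k) * matA z α k
  let D : Fin n → ℂ := fun m => if α m = 0 then 1 else -(α m : ℂ)
  have hD : (Matrix.diagonal D).det ≠ 0 := by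
    rw [Matrix.det_diagonal]
    refine Finset.prod_ne_zero_iff.2 fun m _ => ?_
    simp only [D]
    split_ifs with h
    · exact one_ne_zero
    · exact neg_ne_zero.2 (by exact_mod_cast h)
  have hB : Tendsto B (largeIm d E) (𝓝 (Matrix.diagonal D)) := by
    refine tendsto_pi_nhds.2 fun m => tendsto_pi_nhds.2 fun j => ?_
    simp only [B, Matrix.diagonal_mul, matA, pointMatrix, Matrix.of_apply, r, D]
    by_cases hm : α m = 0
    · simp only [hm, if_true, Matrix.diagonal_apply]
      simp [tendsto_const_nhds]
    · by_cases hmj : m = j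
      · subst hmj
        simp only [hm, if_false, if_true, Matrix.diagonal_apply_eq]
        have := ht.sub_const (α m : ℂ)
        rw [zero_sub] at this
        refine this.congr' ?_
        filter_upwards [hne] with k hk
        field_simp
      · simp only [hm, if_false, hmj, Matrix.diagonal_apply_ne _ hmj]
        have := (tendsto_green_mul_inv_diagTerm hd E
          (sub_ne_zero.2 fun e => hmj (hz e))).const_mul (-(α m : ℂ))
        rw [mul_zero] at this
        exact this.congr fun k => by ring
  have hdet : ∀ᶠ k in largeIm d E, (matA z α k).det ≠ 0 := by
    have h := (continuous_id.matrix_det.tendsto (Matrix.diagonal D)).comp hB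
    filter_upwards [h.eventually_ne hD] with k hk h0
    refine hk ?_
    simp only [Function.comp, id, B, Matrix.det_mul, h0, mul_zero]
  refine ⟨hdet, fun x hx => ?_⟩
  have hinv : Tendsto (fun k => (B k)⁻¹) (largeIm d E) (𝓝 (Matrix.diagonal D)⁻¹) :=
    (continuousAt_matrix_inv _ (by
      rw [show (Ring.inverse : ℂ → ℂ) = fun w => w⁻¹ from Ring.inverse_eq_inv']
      exact continuousAt_inv₀ hD)).tendsto.comp hB
  have hc : ∀ᶠ k in largeIm d E, ∀ j, coeff z α k j =
      (B k)⁻¹.mulVec (fun m => (α m : ℂ)) j * (diagTerm k)⁻¹ := by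
    filter_upwards [hdet, hne] with k hk hk0 j
    have hr : (Matrix.diagonal (r k)).det ≠ 0 := by
      rw [Matrix.det_diagonal]
      refine Finset.prod_ne_zero_iff.2 fun m _ => ?_
      simp only [r]
      split_ifs
      · exact one_ne_zero
      · exact inv_ne_zero hk0
    have h1 : coeff z α k = (B k)⁻¹.mulVec ((Matrix.diagonal (r k)).mulVec fun m => (α m : ℂ)) := by
      rw [Matrix.mul_inv_rev, Matrix.mulVec_mulVec, Matrix.mul_assoc, Matrix.nonsing_inv_mul _
        (isUnit_iff_ne_zero.2 hr), Matrix.mul_one]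
      rfl
    have h2 : ((Matrix.diagonal (r k)).mulVec fun m => (α m : ℂ)) =
        (diagTerm k)⁻¹ • fun m => (α m : ℂ) := by
      ext m
      rw [Matrix.mulVec_diagonal, Pi.smul_apply, smul_eq_mul]
      simp only [r]
      split_ifs with h <;> simp [h]
    rw [h1, h2, Matrix.mulVec_smul, Pi.smul_apply, smul_eq_mul, mul_comm]
  have hsum : Tendsto (fun k => 1 + ∑ j, (B k)⁻¹.mulVec (fun m => (α m : ℂ)) j *
      ((diagTerm k)⁻¹ * green (x - z j) k)) (largeIm d E) (𝓝 (1 + ∑ _j : Fin n, 0)) := by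
    refine (tendsto_finsetSum _ fun j _ => ?_).const_add 1
    have h1 : Tendsto (fun k => (B k)⁻¹.mulVec (fun m => (α m : ℂ)) j) (largeIm d E)
        (𝓝 ((Matrix.diagonal D)⁻¹.mulVec (fun m => (α m : ℂ)) j)) :=
      ((continuous_apply j).comp (continuous_id.matrix_mulVec continuous_const)).continuousAt.tendsto.comp hinv
    have := h1.mul (tendsto_green_mul_inv_diagTerm hd E (sub_ne_zero.2 (hx j)))
    rwa [mul_zero] at this
  rw [Finset.sum_const_zero, add_zero] at hsum
  refine hsum.congr' ?_
  filter_upwards [hc] with k hk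
  simp only [mu, hk, mul_assoc]

end

end Faddeev

end

theorem proposition3p1 {d n : ℕ} (hd : d = 2 ∨ d = 3) (z : Fin n → RV d)
    (hz : Function.Injective z) (α : Fin n → ℝ) :
    -- the Green functions and the classical linear system are well defined
    (∀ (E : ℝ) (k : CV d) (x : RV d), k ∈ SigmaE d E → imV k ≠ 0 → x ≠ 0 →
      GreenConverges x k) ∧
    (∀ γ k x : RV d, ‖γ‖ = 1 → k ≠ 0 → inner ℝ k γ = 0 → x ≠ 0 →
      Tendsto (fun ε : ℝ => green x (shiftIm k γ ε)) (𝓝[>] 0) (𝓝 (greenGamma γ x k))) ∧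
    (∀ k x : RV d, k ≠ 0 → x ≠ 0 →
      (∀ ε : ℝ, 0 < ε → GreenConverges x (shiftIm k k ε)) ∧
      Tendsto (fun ε : ℝ => green x (shiftIm k k ε)) (𝓝[>] 0) (𝓝 (greenPlus x k))) ∧
    (∀ k : RV d, k ≠ 0 → (matAPlus z α k).det ≠ 0) ∧
    -- the equation for `∂̄ψ` and `∂̄μ` on `Σ_E`
    (∀ (E : ℝ) (k : CV d) (x : RV d), k ∈ SigmaE d E → imV k ≠ 0 → (d = 2 → reV k ≠ 0) →
      (matA z α k).det ≠ 0 → (∀ j, x ≠ z j) →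
      HasDbarWithinAt (psi z α x)
        (fun j => -2 * (Real.pi : ℂ) * intDeltaFaddeev k fun ξ =>
          (ξ j : ℂ) * HData z α k (-ξ) * psi z α x (k + toC ξ))
        (SigmaE d E) (tangentSigma k) k ∧
      HasDbarWithinAt (mu z α x)
        (fun j => -2 * (Real.pi : ℂ) * intDeltaFaddeev k fun ξ =>
          (ξ j : ℂ) * HData z α k (-ξ) * planeWave (toC ξ) x * mu z α x (k + toC ξ))
        (SigmaE d E) (tangentSigma k) k) ∧
    -- the equation for `∂̄H` on `Ω_{E,p}`
    (∀ (E : ℝ) (p : RV d) (k : CV d), k ∈ OmegaE E p → imV k ≠ 0 → (d = 2 → reV k ≠ 0) →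
      (matA z α k).det ≠ 0 →
      HasDbarWithinAt (fun k' => HData z α k' p)
        (fun j => -2 * (Real.pi : ℂ) * intDeltaFaddeev k fun ξ =>
          (ξ j : ℂ) * HData z α k (-ξ) * HData z α (k + toC ξ) (p + ξ))
        (OmegaE E p) (tangentOmega p k) k) ∧
    -- the relations between `ψ_γ`, `h_γ` and `ψ⁺`, `f`
    (∀ γ k : RV d, ‖γ‖ = 1 → k ≠ 0 → inner ℝ k γ = 0 → (matAGamma z α γ k).det ≠ 0 →
      (∀ x : RV d, (∀ j, x ≠ z j) →
        psiGamma z α γ x k = psiPlus z α x k +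
          2 * (Real.pi : ℂ) * Complex.I * intDeltaSphere ‖k‖ fun ξ =>
            hGamma z α γ k ξ * heaviside (inner ℝ (ξ - k) γ) * psiPlus z α x ξ) ∧
      (∀ l : RV d, ‖l‖ = ‖k‖ →
        hGamma z α γ k l = fAmp z α k l +
          2 * (Real.pi : ℂ) * Complex.I * intDeltaSphere ‖k‖ fun ξ =>
            hGamma z α γ k ξ * heaviside (inner ℝ (ξ - k) γ) * fAmp z α ξ l)) ∧
    -- large `|Im k|`
    (∀ E : ℝ,
      (∀ᶠ k in comap (fun k : CV d => ‖imV k‖) atTop ⊓ 𝓟 (SigmaE d E),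
        (matA z α k).det ≠ 0) ∧
      ∀ x : RV d, (∀ j, x ≠ z j) →
        Tendsto (mu z α x) (comap (fun k : CV d => ‖imV k‖) atTop ⊓ 𝓟 (SigmaE d E)) (𝓝 1)) := by
  refine ⟨fun E k x hk hb hx => greenConverges hd hb hx,
    fun γ k x hγ hk hkγ hx => greenGamma_tendsto hd hγ hk hkγ hx,
    fun k x hk hx => greenPlus_tendsto hd hk hx,
    fun k hk => (matAPlus_inv_mulVec hd hz α hk 0).1,
    fun E k x hk hb ha hdet hx => ⟨psi_dbar hd hz α hk hb ha hdet hx, mu_dbar hd hz α hk hb ha hdet hx⟩,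
    fun E p k hk hb ha hdet => HData_dbar hd hz α hk hb ha hdet,
    fun γ k hγ hk hkγ hdet => ⟨fun x hx => psiGamma_eq hd hz α hγ hk hkγ hdet hx,
      fun l _ => hGamma_eq hd hz α hγ hk hkγ hdet l⟩,
    fun E => matA_det_ne_zero_and_tendsto_mu hd hz α E⟩
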